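/- **Setting.** Let $k$ be a field. An *$\mathfrak{sl}_2$-categorification* consists of a $k$-linear abelian category $\mathcal A$ in which all objects have finite length and $\operatorname{End}(S)=k$ for every simple object $S$; a pair $(E,F)$ of exact $k$-linear endofunctors of $\mathcal A$ with a fixed adjunction with unit $\eta:\mathrm{Id}\to FE$ and counit $\varepsilon:EF\to\mathrm{Id}$ ($E$ left adjoint to $F$), such that $F$ is also isomorphic to a left adjoint of $E$, such that $e=[E]$ and $f=[F]$ define an action of $\mathfrak{sl}_2$ on $\mathbf Q\otimes K_0(\mathcal A)$ that is a direct sum of finite-dimensional representations, and such that the classes of simple objects are weight vectors; elements $q\in k^\times$, $a\in k$ with $a\neq 0$ if $q\ne 1$; and $X\in\operatorname{End}(E)$, $T\in\operatorname{End}(E^2)$ with $(1_ET)(T1_E)(1_ET)=(T1_E)(1_ET)(T1_E)$, $(T+1)(T-q)=0$, $T(1_EX)T=qX1_E$ if $q\ne1$ and $T(1_EX)T=X1_E-T$ if $q=1$, and $X-a$ locally nilpotent (nilpotent on $EM$ for each object $M$). A *morphism of $\mathfrak{sl}_2$-categorifications* $\mathcal A'\to\mathcal A$ is a $k$-linear functor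 $R:\mathcal A'\to\mathcal A$ with isomorphisms of functors $\zeta_+:RE'\to ER$ and $\zeta_-:RF'\to FR$ such that $\zeta_-=(FR\varepsilon')\circ(F\zeta_+^{-1}F')\circ(\eta RF')$, $a'=a$, $q'=q$, $(XR)\circ\zeta_+=\zeta_+\circ(RX')$ and $(TR)\circ(E\zeta_+)\circ(\zeta_+E')=(E\zeta_+)\circ(\zeta_+E')\circ(RT')$. Let $H_n=H_n(q)$ be the affine Hecke algebra, with generators $T_1,\dots,T_{n-1},X_1^{\pm1},\dots,X_n^{\pm1}$ and the relations $(T_i+1)(T_i-q)=0$, braid relations, $X_iX_j=X_jX_i$, $X_iT_j=T_jX_i$ for $i\neq j,j+1$, and $T_iX_iT_i=qX_{i+1}$, if $q\ne1$; and the degenerate affine Hecke algebra, with generators $T_i$, $X_j$, the same relations except that the $X_j$ are not inverted and that the last relation is replaced by $X_{i+1}T_i=T_iX_i+1$, if $q=1$. Let $\mathfrak n_n$ be the ideal of the symmetric polynomials in the $X_j$ (Laurent polynomials if $q\ne1$) formed by those vanishing at $(a,\dots,a)$, let $\bar H_n=H_n/H_n\mathfrak n_n$ and let $B_i$, for $0\le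 i\le n$, be the subalgebra of $\bar H_n$ generated by the images of $T_1,\dots,T_{i-1}$, $X_1^{(\pm1)},\dots,X_i^{(\pm1)}$. Let $\mathcal A(n)=\bigoplus_{0\le i\le n}B_i\text{-mod}$ (finitely generated modules), with the endofunctors $E=\bigoplus_{i<n}B_{i+1}\otimes_{B_i}-$ and $F=\bigoplus_{i<n}\operatorname{Res}_{B_i}^{B_{i+1}}$, the canonical adjunction $(E,F)$, the endomorphism $X$ of $E$ given by right multiplication by $X_{i+1}$ on $B_{i+1}\otimes_{B_i}M$, the endomorphism $T$ of $E^2$ given by right multiplication by $T_{i+1}$ on $B_{i+2}\otimes_{B_i}M$, and the parameters $q$, $a$. **Theorem.** Let $\mathcal A$ be an $\mathfrak{sl}_2$-categorification, $U$ a simple object of $\mathcal A$ with $FU=0$, and let $n=h_+(U)$ be the largest integer $i$ with $e^i[U]\neq0$. Then $\mathcal A(n)$ (for the parameters $q$, $a$ of $\mathcal A$) is an $\mathfrak{sl}_2$-categorification, and: 1. The rule $T_j\mapsto 1_{E^{i-j-1}}T1_{E^{j-1}}$, $X_j\mapsto 1_{E^{i-j}}X1_{E^{j-1}}$ defines a right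 action of $B_i$ on $E^iU$ for $0\le i\le n$, and the tensor products $E^iU\otimes_{B_i}M$ exist in $\mathcal A$ for all finitely generated $B_i$-modules $M$. 2. For $0\le i<n$, the canonical map $E^iU\otimes_{B_i}B_{i+1}\to FE^{i+1}U$, whose restriction to $E^iU\otimes b$ is $F(b)\circ\eta_{E^iU}$, where $b\in B_{i+1}$ acts on $E^{i+1}U$ from the right, is an isomorphism. 3. Let $R_U=\bigoplus_{0\le i\le n}E^iU\otimes_{B_i}-:\mathcal A(n)\to\mathcal A$. There are an isomorphism $\zeta_+:R_UE\to ER_U$, given by the canonical maps $E^{i+1}U\otimes_{B_{i+1}}(B_{i+1}\otimes_{B_i}M)\to E(E^iU\otimes_{B_i}M)$ (for $m\in M$, the map is $E(-\otimes m)$ on $E^{i+1}U\otimes(1\otimes m)$), and an isomorphism $\zeta_-:R_UF\to FR_U$, given by the maps $E^iU\otimes_{B_i}M\to F(E^{i+1}U\otimes_{B_{i+1}}M)$ for $B_{i+1}$-modules $M$ that come from the isomorphism of part 2 (for $m\in M$, the map is $F(-\otimes m)\circ\eta_{E^iU}$ on $E^iU\otimes m$), such that $(R_U,\zeta_+,\zeta_-)$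 is a morphism of $\mathfrak{sl}_2$-categorifications $\mathcal A(n)\to\mathcal A$. -/

import Mathlib

open CategoryTheory CategoryTheory.Limits TensorProduct

universe w v v' u u'

noncomputable section

namespace SlTwo

section

/-- The parameters `q ∈ kˣ` and `a ∈ k`, with `a ≠ 0` if `q ≠ 1`. -/
structure Param (k : Type u) [Field k] where
  q : k
  a : k
  q_ne_zero : q ≠ 0
  a_ne_zero : q ≠ 1 → a ≠ 0

/-! ### A criterion for finite-dimensionality -/

section Finite

variable {k : Type u} [Field k] {A : Type u'} [Ring A] [Algebra k A]

/-- A subspace that contains `1` and is stable under left multiplication by a set of elements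
contains the subalgebra generated by this set. -/
lemma adjoin_le_of_mul_left (s : Set A)
    (W : Submodule k A) (h1 : 1 ∈ W) (h : ∀ x ∈ s, ∀ w ∈ W, x * w ∈ W) :
    Subalgebra.toSubmodule (Algebra.adjoin k s) ≤ W := by
  intro y hy
  have key : ∀ y ∈ Algebra.adjoin k s, ∀ w ∈ W, y * w ∈ W := by
    intro y hy
    induction hy using Algebra.adjoin_induction with
    | mem x hx => exact h x hx
    | algebraMap r => intro w hw; rw [← Algebra.smul_def]; exact W.smul_mem r hw
    | add x y _ _ hx hy => intro w hw; rw [add_mul]; exact W.add_mem (hx w hw) (hy w hw)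
    | mul x y _ _ hx hy => intro w hw; rw [mul_assoc]; exact hx _ (hy w hw)
  simpa using key y hy 1 h1

variable (k) in
/-- The subalgebra generated by `t 0, …, t (m - 1)`. -/
def initAlg (t : ℕ → A) (m : ℕ) : Subalgebra k A := Algebra.adjoin k (t '' Set.Iio m)

lemma initAlg_mono (t : ℕ → A) {m m' : ℕ} (h : m ≤ m') : initAlg k t m ≤ initAlg k t m' :=
  Algebra.adjoin_mono (Set.image_mono (Set.Iio_subset_Iio h))

lemma mem_initAlg (t : ℕ → A) {j m : ℕ} (h : j < m) : t j ∈ initAlg k t m :=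
  Algebra.subset_adjoin ⟨j, h, rfl⟩

lemma initAlg_zero (t : ℕ → A) : initAlg k t 0 = ⊥ := by simp [initAlg]

lemma initAlg_comm (t : ℕ → A) {m : ℕ} {z : A} (h : ∀ j < m, z * t j = t j * z)
    {y : A} (hy : y ∈ initAlg k t m) : z * y = y * z := by
  unfold initAlg at hy
  induction hy using Algebra.adjoin_induction with
  | mem x hx =>
    obtain ⟨i, hi, rfl⟩ := hx
    exact h i hi
  | algebraMap r => exact (Algebra.commutes r _).symm
  | add x y _ _ hx hy => rw [mul_add, add_mul, hx, hy]
  | mul x y _ _ hx hy => rw [← mul_assoc, hx, mul_assoc, hy, mul_assoc]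

/-- The subspace `S + S t S`. -/
def stepSpace (S : Subalgebra k A) (t : A) : Submodule k A :=
  Subalgebra.toSubmodule S ⊔
    (Subalgebra.toSubmodule S * Submodule.span k {t}) * Subalgebra.toSubmodule S

lemma mem_stepSpace_left {S : Subalgebra k A} {t x : A} (hx : x ∈ S) : x ∈ stepSpace S t :=
  Submodule.mem_sup_left hx

lemma mem_stepSpace_right {S : Subalgebra k A} {t x y : A} (hx : x ∈ S) (hy : y ∈ S) :
    x * t * y ∈ stepSpace S t :=
  Submodule.mem_sup_right (Submodule.mul_mem_mul
    (Submodule.mul_mem_mul hx (Submodule.mem_span_singleton_self _)) hy)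

lemma stepSpace_induction {S : Subalgebra k A} {t : A} {Q : A → Prop}
    (h1 : ∀ x ∈ S, Q x) (h2 : ∀ x ∈ S, ∀ y ∈ S, Q (x * t * y))
    (hadd : ∀ x y, Q x → Q y → Q (x + y)) {x : A} (hx : x ∈ stepSpace S t) : Q x := by
  obtain ⟨y, hy, z, hz, rfl⟩ := Submodule.mem_sup.1 hx
  refine hadd _ _ (h1 y hy) ?_
  refine Submodule.mul_induction_on (C := Q) hz (fun u hu v hv => ?_) hadd
  refine Submodule.mul_induction_on (C := fun u => Q (u * v)) hu (fun u hu t' ht => ?_)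
    (fun a b ha hb => ?_)
  · obtain ⟨c, rfl⟩ := Submodule.mem_span_singleton.1 ht
    rw [mul_smul_comm, ← smul_mul_assoc]
    exact h2 _ (S.smul_mem hu c) _ hv
  · rw [add_mul]; exact hadd _ _ ha hb

lemma stepSpace_mul {S : Subalgebra k A} {t x y : A} (hx : x ∈ stepSpace S t) (hy : y ∈ S) :
    x * y ∈ stepSpace S t := by
  refine stepSpace_induction (Q := fun x => x * y ∈ stepSpace S t) ?_ ?_ ?_ hx
  · exact fun x hx => mem_stepSpace_left (mul_mem hx hy)
  · intro u hu v hv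
    rw [mul_assoc]
    exact mem_stepSpace_right hu (mul_mem hv hy)
  · intro u v hu hv
    rw [add_mul]; exact add_mem hu hv

lemma mul_stepSpace {S : Subalgebra k A} {t x y : A} (hx : x ∈ stepSpace S t) (hy : y ∈ S) :
    y * x ∈ stepSpace S t := by
  refine stepSpace_induction (Q := fun x => y * x ∈ stepSpace S t) ?_ ?_ ?_ hx
  · exact fun x hx => mem_stepSpace_left (mul_mem hy hx)
  · intro u hu v hv
    rw [← mul_assoc, ← mul_assoc]
    exact mem_stepSpace_right (mul_mem hy hu) hv
  · intro u v hu hv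
    rw [mul_add]; exact add_mem hu hv

lemma self_mem_stepSpace (S : Subalgebra k A) (t : A) : t ∈ stepSpace S t := by
  simpa using mem_stepSpace_right (t := t) (one_mem S) (one_mem S)

/-- Elements that satisfy quadratic and braid relations generate a finite-dimensional
subalgebra. -/
lemma initAlg_succ_le (t : ℕ → A) (N : ℕ) (α β : k)
    (hsq : ∀ j < N, t j * t j = α • t j + β • 1)
    (hcomm : ∀ i j, i + 1 < j → j < N → t j * t i = t i * t j)
    (hbraid : ∀ j, j + 1 < N → t j * t (j + 1) * t j = t (j + 1) * t j * t (j + 1))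
    (m : ℕ) (h : m < N) :
    Subalgebra.toSubmodule (initAlg k t (m + 1)) ≤ stepSpace (initAlg k t m) (t m) := by
  -- it is enough that `t S t` lies in the subspace
  have red : ∀ m < N, (∀ x ∈ initAlg k t m, t m * x * t m ∈ stepSpace (initAlg k t m) (t m)) →
      Subalgebra.toSubmodule (initAlg k t (m + 1)) ≤ stepSpace (initAlg k t m) (t m) := by
    intro m hm key
    refine adjoin_le_of_mul_left _ _ (mem_stepSpace_left (one_mem _)) ?_
    rintro _ ⟨j, hj, rfl⟩ w hw
    rcases Nat.lt_succ_iff_lt_or_eq.1 hj with hj | rfl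
    · exact mul_stepSpace hw (mem_initAlg t hj)
    · refine stepSpace_induction (Q := fun w => t j * w ∈ stepSpace (initAlg k t j) (t j))
        ?_ ?_ ?_ hw
      · intro x hx
        simpa using mem_stepSpace_right (t := t j) (one_mem _) hx
      · intro x hx y hy
        rw [← mul_assoc, ← mul_assoc]
        exact stepSpace_mul (key x hx) hy
      · intro x y hx hy
        rw [mul_add]; exact add_mem hx hy
  have hsq' : ∀ m < N, t m * t m ∈ stepSpace (initAlg k t m) (t m) := by
    intro m hm
    rw [hsq m hm]
    exact add_mem (Submodule.smul_mem _ _ (self_mem_stepSpace _ _))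
      (Submodule.smul_mem _ _ (mem_stepSpace_left (one_mem _)))
  induction m with
  | zero =>
    refine red 0 h fun x hx => ?_
    have hx0 := hx
    rw [initAlg_zero] at hx0
    obtain ⟨r, rfl⟩ := Algebra.mem_bot.1 hx0
    rw [← Algebra.commutes, mul_assoc]
    exact mul_stepSpace (hsq' 0 h) hx
  | succ m ih =>
    have h0 : m < N := by omega
    have hc : ∀ y ∈ initAlg k t m, t (m + 1) * y = y * t (m + 1) := fun y hy =>
      initAlg_comm t (fun j hj => hcomm j (m + 1) (by omega) h) hy
    have hmono := initAlg_mono (k := k) t (Nat.le_succ m)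
    refine red (m + 1) h fun x hx => ?_
    refine stepSpace_induction (Q := fun x =>
      t (m + 1) * x * t (m + 1) ∈ stepSpace (initAlg k t (m + 1)) (t (m + 1)))
      ?_ ?_ ?_ (ih h0 hx)
    · intro y hy
      rw [hc y hy, mul_assoc]
      exact mul_stepSpace (hsq' _ h) (hmono hy)
    · intro y hy z hz
      have e : t (m + 1) * (y * t m * z) * t (m + 1) =
          y * (t (m + 1) * t m * t (m + 1)) * z := by
        calc t (m + 1) * (y * t m * z) * t (m + 1)
            = t (m + 1) * y * t m * (z * t (m + 1)) := by simp only [mul_assoc]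
          _ = y * t (m + 1) * t m * (t (m + 1) * z) := by rw [hc y hy, hc z hz]
          _ = _ := by simp only [mul_assoc]
      rw [e, ← hbraid m h]
      refine stepSpace_mul (mul_stepSpace ?_ (hmono hy)) (hmono hz)
      exact mem_stepSpace_right (mem_initAlg t (Nat.lt_succ_self m))
        (mem_initAlg t (Nat.lt_succ_self m))
    · intro y z hy hz
      rw [mul_add, add_mul]; exact add_mem hy hz

lemma initAlg_fg (t : ℕ → A) (N : ℕ) (α β : k)
    (hsq : ∀ j < N, t j * t j = α • t j + β • 1)
    (hcomm : ∀ i j, i + 1 < j → j < N → t j * t i = t i * t j)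
    (hbraid : ∀ j, j + 1 < N → t j * t (j + 1) * t j = t (j + 1) * t j * t (j + 1))
    (m : ℕ) (h : m ≤ N) : (Subalgebra.toSubmodule (initAlg k t m)).FG := by
  induction m with
  | zero =>
    rw [initAlg_zero, Algebra.toSubmodule_bot, Submodule.one_eq_span]
    exact Submodule.fg_span_singleton _
  | succ m ih =>
    have ih := ih (by omega)
    have h1 : (stepSpace (initAlg k t m) (t m)).FG :=
      ih.sup ((ih.mul (Submodule.fg_span_singleton _)).mul ih)
    have h2 := initAlg_succ_le t N α β hsq hcomm hbraid m h
    have : Module.Finite k (stepSpace (initAlg k t m) (t m)) := Module.Finite.of_fg h1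
    have := Submodule.finiteDimensional_of_le h2
    exact (Submodule.fg_iff_finiteDimensional _).2 this

/-- If `P` is generated by elements `x i` that are permuted by `t`, up to terms of lower order,
then `t P ⊆ P + P t`. -/
lemma mul_mem_of_cross (x : ℕ → A) (n : ℕ) (t : A)
    (hx : ∀ i < n, ∃ i' < n, ∃ c d : k, ∃ l < n, t * x i = x i' * t + c • x l + d • 1)
    {y : A} (hy : y ∈ initAlg k x n) :
    t * y ∈ Subalgebra.toSubmodule (initAlg k x n) ⊔
      Subalgebra.toSubmodule (initAlg k x n) * Submodule.span k {t} := by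
  set P := initAlg k x n
  set W := Subalgebra.toSubmodule P ⊔ Subalgebra.toSubmodule P * Submodule.span k {t} with hW
  have hPW : ∀ u ∈ P, ∀ w ∈ W, u * w ∈ W := by
    intro u hu w hw
    obtain ⟨a, ha, b, hb, rfl⟩ := Submodule.mem_sup.1 hw
    rw [mul_add]
    refine add_mem (Submodule.mem_sup_left (mul_mem (S := Subalgebra k A) hu ha)) ?_
    refine Submodule.mem_sup_right ?_
    refine Submodule.mul_induction_on (C := fun b => u * b ∈
      Subalgebra.toSubmodule P * Submodule.span k {t}) hb (fun v hv s hs => ?_)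
      (fun a b ha hb => ?_)
    · rw [← mul_assoc]
      exact Submodule.mul_mem_mul (mul_mem (S := Subalgebra k A) hu hv) hs
    · rw [mul_add]; exact add_mem ha hb
  -- the elements `y` of `P` with `t y ∈ W`
  let V : Submodule k A := Subalgebra.toSubmodule P ⊓ W.comap (LinearMap.mulLeft k t)
  have hle : Subalgebra.toSubmodule P ≤ V := by
    refine adjoin_le_of_mul_left _ _ ⟨one_mem P, ?_⟩ ?_
    · refine Submodule.mem_sup_right ?_
      simpa using Submodule.mul_mem_mul (M := Subalgebra.toSubmodule P) (one_mem P)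
        (Submodule.mem_span_singleton_self (R := k) t)
    · rintro _ ⟨i, hi, rfl⟩ w ⟨hw, hw'⟩
      have hw' : t * w ∈ W := hw'
      refine ⟨mul_mem (S := Subalgebra k A) (mem_initAlg x hi) hw, ?_⟩
      obtain ⟨i', hi', c, d, l, hl, e⟩ := hx i hi
      change t * (x i * w) ∈ W
      rw [← mul_assoc, e, add_mul, add_mul, smul_mul_assoc, smul_mul_assoc, one_mul, mul_assoc]
      refine add_mem (add_mem (hPW _ (mem_initAlg x hi') _ hw') ?_) ?_
      · exact Submodule.smul_mem _ _ (Submodule.mem_sup_left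
          (mul_mem (S := Subalgebra k A) (mem_initAlg x hl) hw))
      · exact Submodule.smul_mem _ _ (Submodule.mem_sup_left hw)
  exact (hle hy).2

/-- A criterion for an algebra with generators `t j`, `x j` to be finite-dimensional. -/
lemma finite_of_relations (n N : ℕ) (t x : ℕ → A) (α β : k)
    (hsq : ∀ j < N, t j * t j = α • t j + β • 1)
    (hcomm : ∀ i j, i + 1 < j → j < N → t j * t i = t i * t j)
    (hbraid : ∀ j, j + 1 < N → t j * t (j + 1) * t j = t (j + 1) * t j * t (j + 1))
    (hx : ∀ j < N, ∀ i < n, ∃ i' < n, ∃ c d : k, ∃ l < n,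
      t j * x i = x i' * t j + c • x l + d • 1)
    (hP : (Subalgebra.toSubmodule (initAlg k x n)).FG)
    (s : Set A) (hs : Algebra.adjoin k s = ⊤)
    (hst : ∀ y ∈ s, y ∈ initAlg k x n ∨ ∃ j < N, y = t j) : Module.Finite k A := by
  have hT := initAlg_fg t N α β hsq hcomm hbraid N le_rfl
  set P := initAlg k x n with hPdef
  set S := initAlg k t N with hSdef
  set W := Subalgebra.toSubmodule P * Subalgebra.toSubmodule S with hW
  have hle : Subalgebra.toSubmodule (Algebra.adjoin k s) ≤ W := by
    have hPW : ∀ u ∈ P, ∀ w ∈ W, u * w ∈ W := by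
      intro u hu w hw
      refine Submodule.mul_induction_on (C := fun w => u * w ∈ W) hw (fun v hv s hs => ?_)
        (fun a b ha hb => ?_)
      · rw [← mul_assoc]
        exact Submodule.mul_mem_mul (mul_mem (S := Subalgebra k A) hu hv) hs
      · rw [mul_add]; exact add_mem ha hb
    refine adjoin_le_of_mul_left _ _ ?_ ?_
    · simpa using Submodule.mul_mem_mul (M := Subalgebra.toSubmodule P)
        (N := Subalgebra.toSubmodule S) (one_mem P) (one_mem S)
    · intro y hy w hw
      rcases hst y hy with hy | ⟨j, hj, rfl⟩
      · exact hPW y hy w hw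
      · refine Submodule.mul_induction_on (C := fun w => t j * w ∈ W) hw (fun v hv s hs => ?_)
          (fun a b ha hb => ?_)
        · have h1 := mul_mem_of_cross (k := k) x n (t j) (hx j hj) hv
          obtain ⟨a, ha, b, hb, hab⟩ := Submodule.mem_sup.1 h1
          rw [← mul_assoc, ← hab, add_mul]
          refine add_mem (Submodule.mul_mem_mul ha hs) ?_
          refine Submodule.mul_induction_on (C := fun b => b * s ∈ W) hb (fun u hu r hr => ?_)
            (fun a b ha hb => ?_)
          · obtain ⟨c, rfl⟩ := Submodule.mem_span_singleton.1 hr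
            rw [mul_assoc]
            exact Submodule.mul_mem_mul hu (mul_mem (S := Subalgebra k A)
              (S.smul_mem (mem_initAlg t hj) c) hs)
          · rw [add_mul]; exact add_mem ha hb
        · rw [mul_add]; exact add_mem ha hb
  rw [hs] at hle
  have htop : W = ⊤ := top_le_iff.1 (by simpa using hle)
  exact ⟨htop ▸ hP.mul hT⟩

end Finite

/-! ### Affine Hecke algebras and their quotients -/

section Hecke

variable {k : Type u} [Field k]

/-- The generators of the (degenerate if `q = 1`) affine Hecke algebra `H_n(q)`.  Indices start
at `0`: `T j` and `X j` are the generators usually written `T_{j+1}` and `X_{j+1}`.  The inverses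
of the `X j` are generators only in the non-degenerate case. -/
inductive HeckeGen (p : Param k) (n : ℕ) : Type u
  | T (j : ℕ) (h : j + 1 < n) : HeckeGen p n
  | X (j : ℕ) (h : j < n) : HeckeGen p n
  | Xinv (j : ℕ) (h : j < n) (hq : p.q ≠ 1) : HeckeGen p n

open HeckeGen in
/-- The defining relations of the (degenerate if `q = 1`) affine Hecke algebra. -/
inductive HeckeRel (p : Param k) (n : ℕ) :
    FreeAlgebra k (HeckeGen p n) → FreeAlgebra k (HeckeGen p n) → Prop
  | quad (j : ℕ) (h : j + 1 < n) :
      HeckeRel p n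
        ((FreeAlgebra.ι k (T j h) + 1) * (FreeAlgebra.ι k (T j h) - algebraMap k _ p.q)) 0
  | comm_T_T (i j : ℕ) (hi : i + 1 < n) (hj : j + 1 < n) (hij : i + 1 < j) :
      HeckeRel p n (FreeAlgebra.ι k (T i hi) * FreeAlgebra.ι k (T j hj))
        (FreeAlgebra.ι k (T j hj) * FreeAlgebra.ι k (T i hi))
  | braid (j : ℕ) (h : j + 1 < n) (h' : j + 1 + 1 < n) :
      HeckeRel p n
        (FreeAlgebra.ι k (T j h) * FreeAlgebra.ι k (T (j + 1) h') * FreeAlgebra.ι k (T j h))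
        (FreeAlgebra.ι k (T (j + 1) h') * FreeAlgebra.ι k (T j h) *
          FreeAlgebra.ι k (T (j + 1) h'))
  | comm_X_X (i j : ℕ) (hi : i < n) (hj : j < n) :
      HeckeRel p n (FreeAlgebra.ι k (X i hi) * FreeAlgebra.ι k (X j hj))
        (FreeAlgebra.ι k (X j hj) * FreeAlgebra.ι k (X i hi))
  | X_Xinv (j : ℕ) (h : j < n) (hq : p.q ≠ 1) :
      HeckeRel p n (FreeAlgebra.ι k (X j h) * FreeAlgebra.ι k (Xinv j h hq)) 1
  | Xinv_X (j : ℕ) (h : j < n) (hq : p.q ≠ 1) :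
      HeckeRel p n (FreeAlgebra.ι k (Xinv j h hq) * FreeAlgebra.ι k (X j h)) 1
  | comm_X_T (i j : ℕ) (hi : i < n) (hj : j + 1 < n) (h : i ≠ j) (h' : i ≠ j + 1) :
      HeckeRel p n (FreeAlgebra.ι k (X i hi) * FreeAlgebra.ι k (T j hj))
        (FreeAlgebra.ι k (T j hj) * FreeAlgebra.ι k (X i hi))
  | T_X_T (j : ℕ) (h : j + 1 < n) (h' : j < n) (hq : p.q ≠ 1) :
      HeckeRel p n
        (FreeAlgebra.ι k (T j h) * FreeAlgebra.ι k (X j h') * FreeAlgebra.ι k (T j h))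
        (p.q • FreeAlgebra.ι k (X (j + 1) h))
  | X_T_degenerate (j : ℕ) (h : j + 1 < n) (h' : j < n) (hq : p.q = 1) :
      HeckeRel p n (FreeAlgebra.ι k (X (j + 1) h) * FreeAlgebra.ι k (T j h))
        (FreeAlgebra.ι k (T j h) * FreeAlgebra.ι k (X j h') + 1)

/-- The affine Hecke algebra `H_n(q)` (the degenerate one if `q = 1`). -/
def AffineHecke (p : Param k) (n : ℕ) : Type u := RingQuot (HeckeRel p n)

namespace AffineHecke

variable (p : Param k) (n : ℕ)

instance : Ring (AffineHecke p n) := inferInstanceAs (Ring (RingQuot (HeckeRel p n)))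

instance : Algebra k (AffineHecke p n) := inferInstanceAs (Algebra k (RingQuot (HeckeRel p n)))

/-- The quotient map from the free algebra. -/
def mk : FreeAlgebra k (HeckeGen p n) →ₐ[k] AffineHecke p n :=
  RingQuot.mkAlgHom k (HeckeRel p n)

lemma mk_surjective : Function.Surjective (mk p n) := RingQuot.mkAlgHom_surjective k _

lemma mk_rel {x y : FreeAlgebra k (HeckeGen p n)} (h : HeckeRel p n x y) : mk p n x = mk p n y :=
  RingQuot.mkAlgHom_rel k h

/-- The image of a generator in `H_n(q)`. -/
def gen (g : HeckeGen p n) : AffineHecke p n :=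
  mk p n (FreeAlgebra.ι k g)

lemma X_comm (i j : Fin n) :
    gen p n (.X i i.2) * gen p n (.X j j.2) = gen p n (.X j j.2) * gen p n (.X i i.2) := by
  have := mk_rel p n (HeckeRel.comm_X_X (p := p) i j i.2 j.2)
  simpa [gen] using this

end AffineHecke

open scoped IsMulCommutative in
/-- Evaluation of commutative polynomials at pairwise commuting elements of an algebra. -/
def commEval {n : ℕ} {A : Type u'} [Ring A] [Algebra k A] (x : Fin n → A)
    (hx : ∀ i j, x i * x j = x j * x i) : MvPolynomial (Fin n) k →ₐ[k] A :=
  have : IsMulCommutative (Algebra.adjoin k (Set.range x)) :=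
    Algebra.isMulCommutative_adjoin k (by rintro _ ⟨i, rfl⟩ _ ⟨j, rfl⟩; exact hx i j)
  (Algebra.adjoin k (Set.range x)).val.comp
    (MvPolynomial.aeval (S₁ := Algebra.adjoin k (Set.range x))
      fun i => ⟨x i, Algebra.subset_adjoin ⟨i, rfl⟩⟩)

open scoped IsMulCommutative in
lemma commEval_X {n : ℕ} {A : Type u'} [Ring A] [Algebra k A] (x : Fin n → A)
    (hx : ∀ i j, x i * x j = x j * x i) (i : Fin n) :
    commEval x hx (MvPolynomial.X (R := k) i) = x i := by
  simp [commEval]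

/-- The relations `f(X_1, …, X_n) = 0` for the symmetric polynomials `f` that vanish at
`(a, …, a)`.  The left-hand sides are central in `H_n(q)`.  If `q ≠ 1`, every symmetric Laurent
polynomial vanishing at `(a, …, a)` is the product of such an `f` with a power of the unit
`X_1 ⋯ X_n`, so that the same ideal is obtained. -/
inductive HBarRel (p : Param k) (n : ℕ) : AffineHecke p n → AffineHecke p n → Prop
  | symm (f : MvPolynomial (Fin n) k) (hf : f.IsSymmetric)
      (h0 : MvPolynomial.eval (fun _ => p.a) f = 0) :
      HBarRel p n
        (commEval (fun i : Fin n => AffineHecke.gen p n (.X i i.2)) (AffineHecke.X_comm p n) f) 0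

/-- The algebra `H̄_n = H_n / H_n 𝔫_n`, where `𝔫_n` is the ideal of the symmetric (Laurent)
polynomials in `X_1, …, X_n` formed by those that vanish at `(a, …, a)`. -/
def HBar (p : Param k) (n : ℕ) : Type u := RingQuot (HBarRel p n)

namespace HBar

variable (p : Param k) (n : ℕ)

instance : Ring (HBar p n) := inferInstanceAs (Ring (RingQuot (HBarRel p n)))

instance : Algebra k (HBar p n) := inferInstanceAs (Algebra k (RingQuot (HBarRel p n)))

/-- The quotient map `H_n → H̄_n`. -/
def mk : AffineHecke p n →ₐ[k] HBar p n := RingQuot.mkAlgHom k (HBarRel p n)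

lemma mk_surjective : Function.Surjective (mk p n) := RingQuot.mkAlgHom_surjective k _

lemma mk_rel {x y : AffineHecke p n} (h : HBarRel p n x y) : mk p n x = mk p n y :=
  RingQuot.mkAlgHom_rel k h

/-- The image in `H̄_n` of a generator of `H_n`. -/
def gen (g : HeckeGen p n) : HBar p n :=
  mk p n (AffineHecke.gen p n g)

/-! #### `H̄_n` is finite-dimensional -/

variable {p n}

lemma rel {x y : FreeAlgebra k (HeckeGen p n)} (h : HeckeRel p n x y) :
    mk p n (AffineHecke.mk p n x) = mk p n (AffineHecke.mk p n y) :=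
  congrArg (mk p n) (AffineHecke.mk_rel p n h)

lemma gen_T_sq (j : ℕ) (h : j + 1 < n) :
    gen p n (.T j h) * gen p n (.T j h) =
      (p.q - 1) • gen p n (.T j h) + p.q • (1 : HBar p n) := by
  have h1 := rel (HeckeRel.quad (p := p) j h)
  simp only [map_mul, map_add, map_sub, map_one, map_zero, AlgHom.commutes] at h1
  change (gen p n (.T j h) + 1) * (gen p n (.T j h) - algebraMap k _ p.q) = 0 at h1
  rw [Algebra.algebraMap_eq_smul_one] at h1
  rw [← sub_eq_zero, ← h1]
  simp only [add_mul, mul_sub, mul_smul_comm, mul_one, one_mul, smul_add, sub_smul, one_smul]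
  abel

lemma gen_comm_T_T (i j : ℕ) (hi : i + 1 < n) (hj : j + 1 < n) (hij : i + 1 < j) :
    gen p n (.T i hi) * gen p n (.T j hj) = gen p n (.T j hj) * gen p n (.T i hi) := by
  simpa [gen, AffineHecke.gen] using rel (HeckeRel.comm_T_T (p := p) i j hi hj hij)

lemma gen_braid (j : ℕ) (h : j + 1 < n) (h' : j + 1 + 1 < n) :
    gen p n (.T j h) * gen p n (.T (j + 1) h') * gen p n (.T j h) =
      gen p n (.T (j + 1) h') * gen p n (.T j h) * gen p n (.T (j + 1) h') := by
  simpa [gen, AffineHecke.gen] using rel (HeckeRel.braid (p := p) j h h')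

lemma gen_X_Xinv (j : ℕ) (h : j < n) (hq : p.q ≠ 1) :
    gen p n (.X j h) * gen p n (.Xinv j h hq) = 1 := by
  simpa [gen, AffineHecke.gen] using rel (HeckeRel.X_Xinv (p := p) j h hq)

lemma gen_Xinv_X (j : ℕ) (h : j < n) (hq : p.q ≠ 1) :
    gen p n (.Xinv j h hq) * gen p n (.X j h) = 1 := by
  simpa [gen, AffineHecke.gen] using rel (HeckeRel.Xinv_X (p := p) j h hq)

lemma gen_comm_X_X (i j : ℕ) (hi : i < n) (hj : j < n) :
    gen p n (.X i hi) * gen p n (.X j hj) = gen p n (.X j hj) * gen p n (.X i hi) := by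
  simpa [gen, AffineHecke.gen] using rel (HeckeRel.comm_X_X (p := p) i j hi hj)

lemma gen_comm_X_T (i j : ℕ) (hi : i < n) (hj : j + 1 < n) (h : i ≠ j) (h' : i ≠ j + 1) :
    gen p n (.X i hi) * gen p n (.T j hj) = gen p n (.T j hj) * gen p n (.X i hi) := by
  simpa [gen, AffineHecke.gen] using rel (HeckeRel.comm_X_T (p := p) i j hi hj h h')

lemma gen_T_X_T (j : ℕ) (h : j + 1 < n) (h' : j < n) (hq : p.q ≠ 1) :
    gen p n (.T j h) * gen p n (.X j h') * gen p n (.T j h) =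
      p.q • gen p n (.X (j + 1) h) := by
  simpa [gen, AffineHecke.gen] using rel (HeckeRel.T_X_T (p := p) j h h' hq)

lemma gen_X_T_degenerate (j : ℕ) (h : j + 1 < n) (h' : j < n) (hq : p.q = 1) :
    gen p n (.X (j + 1) h) * gen p n (.T j h) =
      gen p n (.T j h) * gen p n (.X j h') + 1 := by
  simpa [gen, AffineHecke.gen] using rel (HeckeRel.X_T_degenerate (p := p) j h h' hq)

lemma adjoin_range_gen : Algebra.adjoin k (Set.range (gen p n)) = ⊤ := by
  have h1 : Set.range (gen p n) = ((mk p n).comp (AffineHecke.mk p n)) ''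
      (Set.range (FreeAlgebra.ι k)) := by
    rw [← Set.range_comp]; rfl
  rw [h1, ← AlgHom.map_adjoin, FreeAlgebra.adjoin_range_ι, Algebra.map_top, AlgHom.range_eq_top]
  exact (mk_surjective p n).comp (AffineHecke.mk_surjective p n)

/-- Evaluation of polynomials at the images of the `X_i`. -/
def polyHom (p : Param k) (n : ℕ) : MvPolynomial (Fin n) k →ₐ[k] HBar p n :=
  (mk p n).comp
    (commEval (fun i : Fin n => AffineHecke.gen p n (.X i i.2)) (AffineHecke.X_comm p n))

lemma polyHom_X (i : Fin n) : polyHom p n (MvPolynomial.X i) = gen p n (.X i i.2) := by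
  simp [polyHom, commEval_X, gen]

lemma polyHom_symm (f : MvPolynomial (Fin n) k) (hf : f.IsSymmetric) :
    polyHom p n f = algebraMap k _ (MvPolynomial.eval (fun _ => p.a) f) := by
  have h := mk_rel p n (HBarRel.symm (p := p)
    (f - MvPolynomial.C (MvPolynomial.eval (fun _ => p.a) f))
    (hf.sub (MvPolynomial.IsSymmetric.C _)) (by simp))
  rw [map_zero] at h
  have h2 : polyHom p n (f - MvPolynomial.C (MvPolynomial.eval (fun _ => p.a) f)) = 0 := h
  rw [map_sub, sub_eq_zero] at h2
  rw [h2, ← MvPolynomial.algebraMap_eq, AlgHom.commutes]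

lemma isIntegral_gen_X (i : Fin n) : IsIntegral k (gen p n (.X i i.2)) := by
  have h := MvPolynomial.prod_C_add_X_eq_sum_esymm k (Fin n)
  have h1 := congrArg (Polynomial.map (MvPolynomial.eval fun _ => p.a)) h
  have h2 := congrArg (Polynomial.eval (-MvPolynomial.X i)) h
  rw [Polynomial.eval_prod, Finset.prod_eq_zero (Finset.mem_univ i) (by simp)] at h2
  have h3 := congrArg (polyHom p n) h2
  rw [map_zero, Polynomial.eval_finsetSum, map_sum] at h3
  have h4 : Polynomial.aeval (-gen p n (.X i i.2))
      (∏ _i : Fin n, (Polynomial.X + Polynomial.C p.a)) = 0 := by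
    have h5 : (∏ _i : Fin n, (Polynomial.X + Polynomial.C p.a)) =
        ∑ j ∈ Finset.range (Fintype.card (Fin n) + 1), Polynomial.C
          (MvPolynomial.eval (fun _ => p.a) (MvPolynomial.esymm (Fin n) k j)) *
            Polynomial.X ^ (Fintype.card (Fin n) - j) := by
      simpa [Polynomial.map_prod, Polynomial.map_sum] using h1
    rw [h5, map_sum, h3]
    refine Finset.sum_congr rfl fun j _ => ?_
    simp [polyHom_X, polyHom_symm _ (MvPolynomial.esymm_isSymmetric (Fin n) k j)]
  have h6 : IsIntegral k (-gen p n (.X i i.2)) :=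
    ⟨_, Polynomial.monic_prod_of_monic _ _ fun _ _ => Polynomial.monic_X_add_C _, h4⟩
  simpa using h6.neg

lemma polyHom_range_fg : (Subalgebra.toSubmodule (polyHom p n).range).FG := by
  let I := RingHom.ker (polyHom p n)
  let f : (MvPolynomial (Fin n) k ⧸ I) →ₐ[k] HBar p n := Ideal.kerLiftAlg (polyHom p n)
  have hf : Function.Injective f := Ideal.kerLiftAlg_injective _
  let x : Fin n → MvPolynomial (Fin n) k ⧸ I := fun i => Ideal.Quotient.mkₐ k I (.X i)
  have hfx : ∀ i, f (x i) = gen p n (.X i i.2) := fun i => by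
    rw [← polyHom_X]; exact Ideal.kerLiftAlg_mk _ _
  have hx : ∀ y ∈ Set.range x, IsIntegral k y := by
    rintro _ ⟨i, rfl⟩
    obtain ⟨P, hP, h0⟩ := isIntegral_gen_X (p := p) i
    refine ⟨P, hP, hf ?_⟩
    rw [map_zero, ← h0, ← hfx]
    exact (Polynomial.aeval_algHom_apply f (x i) P).symm
  have h1 := fg_adjoin_of_finite (Set.finite_range x) hx
  have h2 : Algebra.adjoin k (Set.range x) = ⊤ := by
    have : Set.range x = Ideal.Quotient.mkₐ k I '' Set.range MvPolynomial.X := by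
      rw [← Set.range_comp]; rfl
    rw [this, ← AlgHom.map_adjoin, MvPolynomial.adjoin_range_X, Algebra.map_top,
      AlgHom.range_eq_top]
    exact Ideal.Quotient.mkₐ_surjective k I
  rw [h2] at h1
  have h3 := h1.map f.toLinearMap
  convert h3 using 1
  ext y
  simp only [Subalgebra.mem_toSubmodule, AlgHom.mem_range, Submodule.mem_map, Algebra.mem_top,
    true_and, AlgHom.toLinearMap_apply]
  constructor
  · rintro ⟨g, rfl⟩; exact ⟨Ideal.Quotient.mkₐ k I g, Ideal.kerLiftAlg_mk _ _⟩
  · rintro ⟨g, rfl⟩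
    obtain ⟨g, rfl⟩ := Ideal.Quotient.mkₐ_surjective k I g
    exact ⟨g, (Ideal.kerLiftAlg_mk _ _).symm⟩

lemma gen_Xinv_mem (j : ℕ) (h : j < n) (hq : p.q ≠ 1) :
    gen p n (.Xinv j h hq) ∈ (polyHom p n).range := by
  let P := (polyHom p n).range
  have hX : gen p n (.X j h) ∈ P := ⟨.X ⟨j, h⟩, polyHom_X _⟩
  have : Module.Finite k P := Module.Finite.of_fg polyHom_range_fg
  let m : P →ₗ[k] P := LinearMap.mulLeft k (⟨_, hX⟩ : P)
  have hm : Function.Injective m := by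
    intro y z hyz
    have h1 : gen p n (.X j h) * y.1 = gen p n (.X j h) * z.1 := congrArg Subtype.val hyz
    have h2 := congrArg (gen p n (.Xinv j h hq) * ·) h1
    simp only [← mul_assoc, gen_Xinv_X, one_mul] at h2
    exact Subtype.ext h2
  obtain ⟨y, hy⟩ := LinearMap.surjective_of_injective hm 1
  have h1 : gen p n (.X j h) * y.1 = 1 := congrArg Subtype.val hy
  have h2 := congrArg (gen p n (.Xinv j h hq) * ·) h1
  simp only [← mul_assoc, gen_Xinv_X, one_mul, mul_one] at h2
  rw [← h2]; exact y.2

/-- The generators `X_{j+1}`, with junk value `0`. -/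
def xN (p : Param k) (n j : ℕ) : HBar p n := if h : j < n then gen p n (.X j h) else 0

/-- The generators `T_{j+1}`, with junk value `0`. -/
def tN (p : Param k) (n j : ℕ) : HBar p n := if h : j + 1 < n then gen p n (.T j h) else 0

lemma xN_eq {j : ℕ} (h : j < n) : xN p n j = gen p n (.X j h) := dif_pos h

lemma tN_eq {j : ℕ} (h : j + 1 < n) : tN p n j = gen p n (.T j h) := dif_pos h

lemma polyHom_range : (polyHom p n).range = initAlg k (xN p n) n := by
  rw [← Algebra.map_top, ← MvPolynomial.adjoin_range_X, AlgHom.map_adjoin, initAlg]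
  congr 1
  ext y
  simp only [← Set.range_comp, Set.mem_range, Function.comp, Set.mem_image, Set.mem_Iio,
    polyHom_X]
  constructor
  · rintro ⟨i, rfl⟩; exact ⟨i, i.2, xN_eq i.2⟩
  · rintro ⟨i, hi, rfl⟩; exact ⟨⟨i, hi⟩, (xN_eq hi).symm⟩

lemma gen_T_mul_X (j : ℕ) (h : j + 1 < n) (hj : j < n) : ∃ c d : k,
    gen p n (.T j h) * gen p n (.X j hj) =
      gen p n (.X (j + 1) h) * gen p n (.T j h) + c • gen p n (.X (j + 1) h) + d • 1 := by
  by_cases hq : p.q = 1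
  · refine ⟨0, -1, ?_⟩
    rw [gen_X_T_degenerate j h hj hq]
    simp
  · refine ⟨1 - p.q, 0, ?_⟩
    have h1 : gen p n (.T j h) * gen p n (.X j hj) * gen p n (.T j h) * gen p n (.T j h) =
        p.q • gen p n (.X (j + 1) h) * gen p n (.T j h) := by rw [gen_T_X_T j h hj hq]
    rw [mul_assoc, gen_T_sq, mul_add, mul_smul_comm, mul_smul_comm, mul_one,
      gen_T_X_T j h hj hq, smul_mul_assoc, smul_comm, ← smul_add] at h1
    have h2 := smul_right_injective _ p.q_ne_zero h1
    rw [← h2, sub_smul, one_smul, sub_smul, one_smul, zero_smul]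
    abel

lemma gen_T_mul_X_succ (j : ℕ) (h : j + 1 < n) (hj : j < n) : ∃ c d : k,
    gen p n (.T j h) * gen p n (.X (j + 1) h) =
      gen p n (.X j hj) * gen p n (.T j h) + c • gen p n (.X (j + 1) h) + d • 1 := by
  by_cases hq : p.q = 1
  · refine ⟨0, 1, ?_⟩
    set t := gen p n (.T j h) with ht
    have hsq : t * t = 1 := by rw [ht, gen_T_sq, hq]; simp
    have h0 : gen p n (.X (j + 1) h) * t = t * gen p n (.X j hj) + 1 :=
      gen_X_T_degenerate (p := p) j h hj hq
    have h1 : t * gen p n (.X (j + 1) h) * t * t = gen p n (.X j hj) * t + t * t := by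
      rw [mul_assoc t, h0, mul_add, mul_one, ← mul_assoc t t, hsq, one_mul, add_mul, hsq]
    rw [mul_assoc, hsq, mul_one] at h1
    rw [h1]; simp
  · refine ⟨p.q - 1, 0, ?_⟩
    have h1 : gen p n (.T j h) * (gen p n (.T j h) * gen p n (.X j hj) * gen p n (.T j h)) =
        gen p n (.T j h) * (p.q • gen p n (.X (j + 1) h)) := by rw [gen_T_X_T j h hj hq]
    rw [← mul_assoc, ← mul_assoc, gen_T_sq, add_mul, add_mul, smul_mul_assoc,
      smul_mul_assoc, smul_mul_assoc, smul_mul_assoc, one_mul, gen_T_X_T j h hj hq,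
      mul_smul_comm, smul_comm, ← smul_add] at h1
    have h2 := smul_right_injective _ p.q_ne_zero h1
    rw [← h2, zero_smul, add_zero, add_comm]

instance : Module.Finite k (HBar p n) := by
  refine finite_of_relations n (n - 1) (tN p n) (xN p n) (p.q - 1) p.q ?_ ?_ ?_ ?_ ?_
    (Set.range (gen p n)) adjoin_range_gen ?_
  · intro j hj
    rw [tN_eq (by omega)]; exact gen_T_sq _ _
  · intro i j hij hj
    rw [tN_eq (by omega), tN_eq (by omega)]; exact (gen_comm_T_T _ _ _ _ hij).symm
  · intro j hj
    rw [tN_eq (by omega), tN_eq (by omega)]; exact gen_braid _ _ _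
  · intro j hj i hi
    have hj' : j + 1 < n := by omega
    have hj'' : j < n := by omega
    rw [tN_eq hj', xN_eq hi]
    by_cases h1 : i = j
    · subst h1
      obtain ⟨c, d, e⟩ := gen_T_mul_X (p := p) i hj' hi
      exact ⟨i + 1, hj', c, d, i + 1, hj', by rw [xN_eq hj', e]⟩
    · by_cases h2 : i = j + 1
      · subst h2
        obtain ⟨c, d, e⟩ := gen_T_mul_X_succ (p := p) j hj' hj''
        exact ⟨j, hj'', c, d, j + 1, hj', by rw [xN_eq hj', xN_eq hj'', e]⟩
      · exact ⟨i, hi, 0, 0, i, hi, by rw [xN_eq hi, gen_comm_X_T i j hi hj' h1 h2]; simp⟩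
  · rw [← polyHom_range]; exact polyHom_range_fg
  · rintro _ ⟨g, rfl⟩
    cases g with
    | T j h => exact Or.inr ⟨j, by omega, (tN_eq h).symm⟩
    | X j h => exact Or.inl (by rw [← xN_eq h]; exact mem_initAlg _ h)
    | Xinv j h hq => exact Or.inl (by rw [← polyHom_range]; exact gen_Xinv_mem j h hq)

end HBar

end Hecke

end

section

/-! ### The algebras `B_i` -/

section B

variable {k : Type u} [Field k] (p : Param k) (n : ℕ)

/-- The generators of `H_n` that belong to `H_i`. -/
def HeckeGen.IsInitial {p : Param k} {n : ℕ} (i : ℕ) : HeckeGen p n → Prop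
  | .T j _ => j + 1 < i
  | .X j _ => j < i
  | .Xinv j _ _ => j < i

/-- The image `H̄_{i,n}` of `H_i` in `H̄_n`, for `i ≤ n`. -/
def HBarSub (i : ℕ) : Subalgebra k (HBar p n) :=
  Algebra.adjoin k (HBar.gen p n '' {g | g.IsInitial i})

lemma HBarSub_mono {i j : ℕ} (h : i ≤ j) : HBarSub p n i ≤ HBarSub p n j := by
  refine Algebra.adjoin_mono (Set.image_mono ?_)
  rintro (⟨l, hl⟩ | ⟨l, hl⟩ | ⟨l, hl, hq⟩) hg
  · exact lt_of_lt_of_le (show l + 1 < i from hg) h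
  · exact lt_of_lt_of_le (show l < i from hg) h
  · exact lt_of_lt_of_le (show l < i from hg) h

/-- The algebra `B_i`: this is `H̄_{i,n}` if `i ≤ n`, and the zero ring if `i > n` (an element
is a function that gives an element of `H̄_{i,n}` for each proof of `i ≤ n`). -/
def B (i : ℕ) : Type u := PLift (i ≤ n) → HBarSub p n i

namespace B

instance (i : ℕ) : Ring (B p n i) := inferInstanceAs (Ring (PLift (i ≤ n) → HBarSub p n i))

instance (i : ℕ) : Algebra k (B p n i) :=
  inferInstanceAs (Algebra k (PLift (i ≤ n) → HBarSub p n i))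

instance (i : ℕ) : Module.Finite k (B p n i) :=
  inferInstanceAs (Module.Finite k (PLift (i ≤ n) → HBarSub p n i))

instance (i : ℕ) : IsNoetherianRing (B p n i) := IsNoetherianRing.of_finite k _

/-- The inclusion `B_i → B_{i+1}` (the zero map if `i ≥ n`). -/
def incl (i : ℕ) : B p n i →ₐ[k] B p n (i + 1) where
  toFun b h := Subalgebra.inclusion (HBarSub_mono p n (Nat.le_succ i))
    (b ⟨(Nat.le_succ i).trans h.down⟩)
  map_one' := by funext h; exact map_one (Subalgebra.inclusion _)
  map_mul' x y := by funext h; exact map_mul (Subalgebra.inclusion _) _ _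
  map_zero' := by funext h; exact map_zero (Subalgebra.inclusion _)
  map_add' x y := by funext h; exact map_add (Subalgebra.inclusion _) _ _
  commutes' r := by funext h; exact AlgHom.commutes (Subalgebra.inclusion _) r

/-- The image of `X_{i+1}` in `B_{i+1}`. -/
def X (i : ℕ) : B p n (i + 1) := fun h =>
  ⟨HBar.gen p n (.X i h.down), Algebra.subset_adjoin ⟨_, Nat.lt_succ_self i, rfl⟩⟩

/-- The image of `T_{i+1}` in `B_{i+2}`. -/
def T (i : ℕ) : B p n (i + 2) := fun h =>
  ⟨HBar.gen p n (.T i h.down), Algebra.subset_adjoin ⟨_, Nat.lt_succ_self (i + 1), rfl⟩⟩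

variable {p n}

/-- An element of `H̄_n` that commutes with the generators `T_j` and `X_j` of `H_i` commutes with
the image of `H_i`. -/
lemma comm_of_gen {i : ℕ} {z : HBar p n}
    (hT : ∀ j (hj : j + 1 < n), j + 1 < i →
      z * HBar.gen p n (.T j hj) = HBar.gen p n (.T j hj) * z)
    (hX : ∀ j (hj : j < n), j < i → z * HBar.gen p n (.X j hj) = HBar.gen p n (.X j hj) * z)
    {b : HBar p n} (hb : b ∈ HBarSub p n i) : z * b = b * z := by
  unfold HBarSub at hb
  induction hb using Algebra.adjoin_induction with
  | mem x hx =>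
    obtain ⟨g, hg, rfl⟩ := hx
    cases g with
    | T j h => exact hT j h hg
    | X j h => exact hX j h hg
    | Xinv j h hq =>
      have e := hX j h hg
      calc z * HBar.gen p n (.Xinv j h hq)
          = HBar.gen p n (.Xinv j h hq) * HBar.gen p n (.X j h) * z *
              HBar.gen p n (.Xinv j h hq) := by rw [HBar.gen_Xinv_X, one_mul]
        _ = HBar.gen p n (.Xinv j h hq) * z * (HBar.gen p n (.X j h) *
              HBar.gen p n (.Xinv j h hq)) := by rw [mul_assoc _ _ z, ← e]; simp only [mul_assoc]
        _ = _ := by rw [HBar.gen_X_Xinv, mul_one]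
  | algebraMap r => exact (Algebra.commutes r _).symm
  | add x y _ _ hx hy => rw [mul_add, add_mul, hx, hy]
  | mul x y _ _ hx hy => rw [← mul_assoc, hx, mul_assoc, hy, mul_assoc]

lemma ext {i : ℕ} {x y : B p n i} (h : ∀ hi, (x hi : HBar p n) = y hi) : x = y :=
  funext fun hi => Subtype.ext (h hi)

lemma mul_apply {i : ℕ} (x y : B p n i) (h : PLift (i ≤ n)) : (x * y) h = x h * y h := rfl

lemma incl_apply {i : ℕ} (b : B p n i) (h : PLift (i + 1 ≤ n)) :
    (incl p n i b h : HBar p n) = b ⟨(Nat.le_succ i).trans h.down⟩ :=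
  Subalgebra.coe_inclusion (HBarSub_mono p n (Nat.le_succ i)) _

lemma X_apply (i : ℕ) (h : PLift (i + 1 ≤ n)) :
    (X p n i h : HBar p n) = HBar.gen p n (.X i h.down) := rfl

lemma T_apply (i : ℕ) (h : PLift (i + 2 ≤ n)) :
    (T p n i h : HBar p n) = HBar.gen p n (.T i h.down) := rfl

lemma X_comm (i : ℕ) (b : B p n i) : X p n i * incl p n i b = incl p n i b * X p n i := by
  refine ext fun h => ?_
  have hi : i < n := h.down
  rw [mul_apply, mul_apply, Subalgebra.coe_mul, Subalgebra.coe_mul, incl_apply, X_apply]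
  refine comm_of_gen (i := i) ?_ ?_ (b _).2
  · intro j hj hji
    exact HBar.gen_comm_X_T i j hi hj (by omega) (by omega)
  · intro j hj _
    exact HBar.gen_comm_X_X i j hi hj

lemma T_comm (i : ℕ) (b : B p n i) :
    T p n i * incl p n (i + 1) (incl p n i b) = incl p n (i + 1) (incl p n i b) * T p n i := by
  refine ext fun h => ?_
  have hi : i + 1 < n := h.down
  rw [mul_apply, mul_apply, Subalgebra.coe_mul, Subalgebra.coe_mul, incl_apply, incl_apply,
    T_apply]
  refine comm_of_gen (i := i) ?_ ?_ (b _).2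
  · intro j hj hji
    exact (HBar.gen_comm_T_T j i hj hi hji).symm
  · intro j hj hji
    exact (HBar.gen_comm_X_T j i hj hi (by omega) (by omega)).symm

end B

end B

/-! ### Induction and restriction -/

section Ind

variable {R S : Type u} [Ring R] [Ring S] (φ : R →+* S)

/-- The submodule of `S ⊗_ℤ M` generated by the elements `s φ(r) ⊗ m - s ⊗ r m`. -/
def indRel (M : Type u) [AddCommGroup M] [Module R M] : Submodule S (S ⊗[ℤ] M) :=
  Submodule.span S {x | ∃ (s : S) (r : R) (m : M), x = (s * φ r) ⊗ₜ m - s ⊗ₜ (r • m)}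

/-- The induced module `S ⊗_R M`, where `S` is a right `R`-module through `φ : R → S`. -/
def Ind (M : Type u) [AddCommGroup M] [Module R M] : Type u := (S ⊗[ℤ] M) ⧸ indRel φ M

namespace Ind

variable (M : Type u) [AddCommGroup M] [Module R M]

instance : AddCommGroup (Ind φ M) := inferInstanceAs (AddCommGroup (_ ⧸ indRel φ M))

instance : Module S (Ind φ M) := inferInstanceAs (Module S (_ ⧸ indRel φ M))

variable {M}

variable (M) in
/-- The quotient map. -/
def mk : S ⊗[ℤ] M →ₗ[S] Ind φ M := (indRel φ M).mkQ

/-- The element `s ⊗ m` of `S ⊗_R M`. -/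
def tmul (s : S) (m : M) : Ind φ M := mk φ M (s ⊗ₜ m)

lemma smul_tmul (s t : S) (m : M) : s • tmul φ t m = tmul φ (s * t) m := by
  unfold tmul
  rw [← map_smul]; rfl

lemma tmul_add (s : S) (m m' : M) : tmul φ s (m + m') = tmul φ s m + tmul φ s m' := by
  unfold tmul
  rw [TensorProduct.tmul_add, map_add]

lemma tmul_zero (s : S) : tmul φ s (0 : M) = 0 := by
  unfold tmul
  rw [TensorProduct.tmul_zero, map_zero]

lemma tmul_mul (s : S) (r : R) (m : M) : tmul φ (s * φ r) m = tmul φ s (r • m) :=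
  (Submodule.Quotient.eq _).2 (Submodule.subset_span ⟨s, r, m, rfl⟩)

variable {φ}

lemma hom_ext {N : Type u} [AddCommGroup N] [Module S N] {f g : Ind φ M →ₗ[S] N}
    (h : ∀ m, f (tmul φ 1 m) = g (tmul φ 1 m)) : f = g := by
  refine Submodule.linearMap_qext _ (TensorProduct.AlgebraTensorModule.ext fun s m => ?_)
  have h1 : tmul φ s m = s • tmul φ 1 m := by rw [smul_tmul, mul_one]
  change f (tmul φ s m) = g (tmul φ s m)
  rw [h1, map_smul, map_smul, h]

variable (φ) in
/-- The `S`-linear map `S ⊗_R M → N`, `s ⊗ m ↦ s f(m)` defined by a `φ`-semilinear map `f`. -/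
def lift {N : Type u} [AddCommGroup N] [Module S N] (f : M →+ N)
    (hf : ∀ (r : R) (m : M), f (r • m) = φ r • f m) : Ind φ M →ₗ[S] N :=
  (indRel φ M).liftQ
    (TensorProduct.AlgebraTensorModule.lift
      { toFun := fun s => s • f.toIntLinearMap
        map_add' := fun s t => add_smul s t _
        map_smul' := fun s t => mul_smul s t _ })
    (by
      refine Submodule.span_le.2 ?_
      rintro _ ⟨s, r, m, rfl⟩
      simp [hf, mul_smul])

lemma lift_tmul {N : Type u} [AddCommGroup N] [Module S N] (f : M →+ N)
    (hf : ∀ (r : R) (m : M), f (r • m) = φ r • f m) (s : S) (m : M) :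
    lift φ f hf (tmul φ s m) = s • f m := rfl

variable (φ) in
/-- The additive map `m ↦ 1 ⊗ m`. -/
def unit : M →+ Ind φ M where
  toFun m := tmul φ 1 m
  map_zero' := tmul_zero φ 1
  map_add' := tmul_add φ 1

lemma unit_smul (r : R) (m : M) : unit φ (r • m) = φ r • unit φ m := by
  change tmul φ 1 (r • m) = φ r • tmul φ 1 m
  rw [smul_tmul, ← tmul_mul, one_mul, mul_one]

open scoped Classical in
instance [Module.Finite R M] : Module.Finite S (Ind φ M) := by
  obtain ⟨s, hs⟩ := Module.Finite.fg_top (R := R) (M := M)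
  refine ⟨⟨s.image (tmul φ 1), ?_⟩⟩
  rw [Finset.coe_image]
  set W := Submodule.span S (tmul φ 1 '' (s : Set M)) with hW
  have h1 : ∀ m : M, tmul φ 1 m ∈ W := by
    intro m
    have hm : m ∈ Submodule.span R (s : Set M) := by rw [hs]; trivial
    induction hm using Submodule.span_induction with
    | mem x hx => exact Submodule.subset_span ⟨x, hx, rfl⟩
    | zero => rw [tmul_zero]; exact zero_mem _
    | add x y _ _ hx hy => rw [tmul_add]; exact add_mem hx hy
    | smul r x _ hx =>
      rw [← tmul_mul, one_mul]
      have : tmul φ (φ r) x = φ r • tmul φ 1 x := by rw [smul_tmul, mul_one]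
      rw [this]; exact W.smul_mem _ hx
  have h2 : W.mkQ = 0 := hom_ext fun m => by
    simpa using h1 m
  rw [← Submodule.ker_mkQ W, h2, LinearMap.ker_zero]

end Ind

namespace Ind

variable {M N P : Type u} [AddCommGroup M] [Module R M] [AddCommGroup N] [Module R N]
  [AddCommGroup P] [Module R P]

/-- The map `S ⊗_R f`. -/
def map (f : M →ₗ[R] N) : Ind φ M →ₗ[S] Ind φ N :=
  lift φ ((unit φ).comp f.toAddMonoidHom) fun r m => by
    change unit φ (f (r • m)) = φ r • unit φ (f m)
    rw [map_smul, unit_smul]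

lemma map_one_tmul (f : M →ₗ[R] N) (m : M) : map φ f (tmul φ 1 m) = tmul φ 1 (f m) :=
  one_smul S (tmul φ 1 (f m))

lemma map_id : map φ (LinearMap.id : M →ₗ[R] M) = LinearMap.id :=
  hom_ext fun m => map_one_tmul φ _ m

lemma map_comp (f : M →ₗ[R] N) (g : N →ₗ[R] P) : map φ (g ∘ₗ f) = map φ g ∘ₗ map φ f :=
  hom_ext fun m => by
    rw [LinearMap.comp_apply, map_one_tmul, map_one_tmul, map_one_tmul, LinearMap.comp_apply]

end Ind

/-- The induction functor `S ⊗_R -` on finitely generated modules. -/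
def indFunctor : FGModuleCat.{u} R ⥤ FGModuleCat.{u} S where
  obj M := FGModuleCat.of S (Ind φ M)
  map f := FGModuleCat.ofHom (Ind.map φ f.hom.hom)
  map_id M := FGModuleCat.hom_ext (Ind.map_id φ)
  map_comp f g := FGModuleCat.hom_ext (Ind.map_comp φ f.hom.hom g.hom.hom)

end Ind

section Res

variable {k : Type u} [Field k] {R S : Type u} [Ring R] [Ring S] [Algebra k R] [Algebra k S]
  [Module.Finite k S] (φ : R →ₐ[k] S)

/-- The restriction functor along a morphism of finite-dimensional algebras. -/
def resFunctor : FGModuleCat.{u} S ⥤ FGModuleCat.{u} R :=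
  (ModuleCat.isFG R).lift ((ModuleCat.isFG S).ι ⋙ ModuleCat.restrictScalars (φ : R →+* S))
    (fun M => by
      let _ : Module k M := Module.compHom M (algebraMap k S)
      have : IsScalarTower k S M := ⟨fun c s m => by
        change (c • s) • m = algebraMap k S c • (s • m)
        rw [Algebra.smul_def, mul_smul]⟩
      have : Module.Finite k M := Module.Finite.trans S M
      let N := (ModuleCat.restrictScalars (φ : R →+* S)).obj M.obj
      let _ : Module k N := inferInstanceAs (Module k M)
      have : Module.Finite k N := inferInstanceAs (Module.Finite k M)
      have : IsScalarTower k R N := ⟨fun c r m => by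
        change φ (c • r) • (m : M) = algebraMap k S c • (φ r • (m : M))
        rw [map_smul, Algebra.smul_def, mul_smul]⟩
      exact Module.Finite.of_restrictScalars_finite k R N)

end Res

end

section

/-! ### Products of abelian categories -/

section PiAbelian

variable {I : Type w} {C : I → Type u} [∀ i, Category.{v} (C i)] [∀ i, Abelian (C i)]

instance piPreadditive : Preadditive (∀ i, C i) where
  homGroup X Y := inferInstanceAs (AddCommGroup (∀ i, X i ⟶ Y i))
  add_comp _ _ _ _ _ _ := funext fun _ => Preadditive.add_comp _ _ _ _ _ _
  comp_add _ _ _ _ _ _ := funext fun _ => Preadditive.comp_add _ _ _ _ _ _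

lemma pi_zero {X Y : ∀ i, C i} (i : I) : (0 : X ⟶ Y) i = 0 := rfl

lemma pi_comp_eq_zero {X Y Z : ∀ i, C i} {f : X ⟶ Y} {g : Y ⟶ Z} (h : f ≫ g = 0) (i : I) :
    f i ≫ g i = 0 := congrFun h i

lemma pi_mono {X Y : ∀ i, C i} (f : X ⟶ Y) [Mono f] (i : I) : Mono (f i) := by
  let κ : (fun i => kernel (f i)) ⟶ X := fun i => kernel.ι (f i)
  have h : κ ≫ f = 0 := funext fun i => kernel.condition (f i)
  exact Preadditive.mono_of_kernel_zero (congrFun (zero_of_comp_mono f h) i)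

lemma pi_epi {X Y : ∀ i, C i} (f : X ⟶ Y) [Epi f] (i : I) : Epi (f i) := by
  let κ : Y ⟶ (fun i => cokernel (f i)) := fun i => cokernel.π (f i)
  have h : f ≫ κ = 0 := funext fun i => cokernel.condition (f i)
  exact Preadditive.epi_of_cokernel_zero (congrFun (zero_of_epi_comp f h) i)

/-- A componentwise kernel is a kernel. -/
def piKernel {X Y K : ∀ i, C i} (f : X ⟶ Y) (κ : K ⟶ X) (h : κ ≫ f = 0)
    (hκ : ∀ i, IsLimit (KernelFork.ofι (κ i) (pi_comp_eq_zero h i))) :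
    IsLimit (KernelFork.ofι κ h) :=
  KernelFork.IsLimit.ofι _ _
    (fun g hg i => (KernelFork.IsLimit.lift' (hκ i) (g i) (pi_comp_eq_zero hg i)).1)
    (fun g hg => funext fun i =>
      (KernelFork.IsLimit.lift' (hκ i) (g i) (pi_comp_eq_zero hg i)).2)
    (fun _ hg _ hm => funext fun i => Fork.IsLimit.hom_ext (hκ i)
      ((congrFun hm i).trans
        (KernelFork.IsLimit.lift' (hκ i) _ (pi_comp_eq_zero hg i)).2.symm))

/-- A componentwise cokernel is a cokernel. -/
def piCokernel {X Y Q : ∀ i, C i} (f : X ⟶ Y) (κ : Y ⟶ Q) (h : f ≫ κ = 0)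
    (hκ : ∀ i, IsColimit (CokernelCofork.ofπ (κ i) (pi_comp_eq_zero h i))) :
    IsColimit (CokernelCofork.ofπ κ h) :=
  CokernelCofork.IsColimit.ofπ _ _
    (fun g hg i => (CokernelCofork.IsColimit.desc' (hκ i) (g i) (pi_comp_eq_zero hg i)).1)
    (fun g hg => funext fun i =>
      (CokernelCofork.IsColimit.desc' (hκ i) (g i) (pi_comp_eq_zero hg i)).2)
    (fun _ hg _ hm => funext fun i => Cofork.IsColimit.hom_ext (hκ i)
      ((congrFun hm i).trans
        (CokernelCofork.IsColimit.desc' (hκ i) _ (pi_comp_eq_zero hg i)).2.symm))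

instance piAbelian : Abelian (∀ i, C i) where
  normalMonoOfMono {X Y} f _ := by
    have : ∀ i, Mono (f i) := pi_mono f
    exact ⟨{  Z := fun i => cokernel (f i)
              g := fun i => cokernel.π (f i)
              w := funext fun i => cokernel.condition (f i)
              isLimit := piKernel _ _ _ fun i => Abelian.monoIsKernelOfCokernel
                (CokernelCofork.ofπ (cokernel.π (f i)) (cokernel.condition (f i)))
                (cokernelIsCokernel (f i)) }⟩
  normalEpiOfEpi {X Y} f _ := by
    have : ∀ i, Epi (f i) := pi_epi f
    exact ⟨{  W := fun i => kernel (f i)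
              g := fun i => kernel.ι (f i)
              w := funext fun i => kernel.condition (f i)
              isColimit := piCokernel _ _ _ fun i => Abelian.epiIsCokernelOfKernel
                (KernelFork.ofι (kernel.ι (f i)) (kernel.condition (f i)))
                (kernelIsKernel (f i)) }⟩
  has_kernels := ⟨fun {X Y} f => ⟨⟨
    { cone := KernelFork.ofι (f := f) (Z := fun i => kernel (f i)) (fun i => kernel.ι (f i))
        (funext fun i => kernel.condition (f i))
      isLimit := piKernel _ _ _ fun i => kernelIsKernel (f i) }⟩⟩⟩
  has_cokernels := ⟨fun {X Y} f => ⟨⟨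
    { cocone := CokernelCofork.ofπ (f := f) (Z := fun i => cokernel (f i))
        (fun i => cokernel.π (f i)) (funext fun i => cokernel.condition (f i))
      isColimit := piCokernel _ _ _ fun i => cokernelIsCokernel (f i) }⟩⟩⟩
  has_finite_products := ⟨fun n => ⟨fun K => by
    let f : Fin n → ∀ i, C i := fun j => K.obj ⟨j⟩
    have : HasProduct f := ⟨⟨
      { cone := Fan.mk (fun i => ∏ᶜ fun j => f j i) (fun j i => Pi.π (fun j => f j i) j)
        isLimit := Fan.IsLimit.mk _ (fun s i => Pi.lift fun j => s.proj j i)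
          (fun s j => funext fun i => Pi.lift_π _ _)
          (fun s m hm => funext fun i => Pi.hom_ext _ _ fun j =>
            (congrFun (hm j) i).trans
              (Pi.lift_π (fun j => s.proj j i) j).symm) }⟩⟩
    have : HasLimit (Discrete.functor (K.obj ∘ Discrete.mk)) := this
    exact hasLimit_of_iso (Discrete.natIsoFunctor (F := K)).symm⟩⟩

instance piLinear {k : Type u'} [Ring k] [∀ i, Linear k (C i)] : Linear k (∀ i, C i) where
  homModule X Y := inferInstanceAs (Module k (∀ i, X i ⟶ Y i))
  smul_comp _ _ _ _ _ _ := funext fun _ => Linear.smul_comp _ _ _ _ _ _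
  comp_smul _ _ _ _ _ _ := funext fun _ => Linear.comp_smul _ _ _ _ _ _

end PiAbelian

variable {k : Type u} [Field k] (p : Param k) (n : ℕ)

/-- The category `𝒜(n) = ⨁_{0 ≤ i ≤ n} B_i-mod` of families of finitely generated modules `M_i`
over `B_i` (the algebras `B_i` with `i > n` are zero). -/
abbrev MinCat : Type (u + 1) := ∀ i : ℕ, FGModuleCat.{u} (B p n i)

end

section

section IndRes

namespace Ind

variable {R S S' : Type u} [Ring R] [Ring S] [Ring S'] {φ : R →+* S} {ψ : S →+* S'}
  {M N : Type u} [AddCommGroup M] [Module R M] [AddCommGroup N] [Module R N]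

lemma induction_on {Q : Ind φ M → Prop} (x : Ind φ M) (h0 : Q 0)
    (ht : ∀ s m, Q (tmul φ s m)) (ha : ∀ x y, Q x → Q y → Q (x + y)) : Q x := by
  obtain ⟨y, rfl⟩ := (indRel φ M).mkQ_surjective x
  induction y with
  | zero => exact h0
  | tmul s m => exact ht s m
  | add y z hy hz => rw [map_add]; exact ha _ _ hy hz

variable (φ) in
/-- Right multiplication by an element `z` of `S` that commutes with the image of `R`, as an
endomorphism of `S ⊗_R M`. -/
def mulRight (z : S) (hz : ∀ r, z * φ r = φ r * z) : Ind φ M →ₗ[S] Ind φ M :=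
  lift φ ((DistribSMul.toAddMonoidHom (Ind φ M) z).comp (unit φ)) fun r m => by
    change z • unit φ (r • m) = φ r • z • unit φ m
    rw [unit_smul, ← mul_smul, hz, mul_smul]

lemma mulRight_tmul (z : S) (hz : ∀ r, z * φ r = φ r * z) (s : S) (m : M) :
    mulRight φ z hz (tmul φ s m) = tmul φ (s * z) m := by
  change s • z • tmul φ 1 m = _
  rw [smul_tmul, smul_tmul, mul_one]

variable (φ) in
/-- The map `s ⊗ m ↦ ψ(s) f(m)` defined by a `ψφ`-semilinear map `f`. -/
def liftAdd (ψ : S →+* S') {P : Type u} [AddCommGroup P] [Module S' P] (f : M →+ P)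
    (hf : ∀ (r : R) (m : M), f (r • m) = ψ (φ r) • f m) : Ind φ M →+ P :=
  letI : Module S P := Module.compHom P ψ
  (lift φ f hf).toAddMonoidHom

lemma liftAdd_tmul {P : Type u} [AddCommGroup P] [Module S' P] (f : M →+ P)
    (hf : ∀ (r : R) (m : M), f (r • m) = ψ (φ r) • f m) (s : S) (m : M) :
    liftAdd φ ψ f hf (tmul φ s m) = ψ s • f m := rfl

lemma liftAdd_smul {P : Type u} [AddCommGroup P] [Module S' P] (f : M →+ P)
    (hf : ∀ (r : R) (m : M), f (r • m) = ψ (φ r) • f m) (s : S) (x : Ind φ M) :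
    liftAdd φ ψ f hf (s • x) = ψ s • liftAdd φ ψ f hf x :=
  letI : Module S P := Module.compHom P ψ
  map_smul (lift φ f hf) s x

variable (φ ψ) in
/-- Right multiplication by an element `z` of `S'` that commutes with the image of `R`, as an
endomorphism of `S' ⊗_S (S ⊗_R M) = S' ⊗_R M`. -/
def mulRight₂ (z : S') (hz : ∀ r, z * ψ (φ r) = ψ (φ r) * z) :
    Ind ψ (Ind φ M) →ₗ[S'] Ind ψ (Ind φ M) :=
  lift ψ
    (liftAdd φ ψ
      ((DistribSMul.toAddMonoidHom (Ind ψ (Ind φ M)) z).comp ((unit ψ).comp (unit φ)))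
      fun r m => by
        change z • unit ψ (unit φ (r • m)) = ψ (φ r) • z • unit ψ (unit φ m)
        rw [unit_smul, unit_smul, ← mul_smul, hz, mul_smul])
    fun s x => liftAdd_smul _ _ s x

lemma mulRight₂_tmul (z : S') (hz : ∀ r, z * ψ (φ r) = ψ (φ r) * z) (s : S') (t : S) (m : M) :
    mulRight₂ φ ψ z hz (tmul ψ s (tmul φ t m)) = tmul ψ (s * ψ t * z) (tmul φ 1 m) := by
  change s • ψ t • z • tmul ψ 1 (tmul φ 1 m) = _
  rw [smul_tmul, smul_tmul, smul_tmul, mul_one, mul_assoc]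

lemma map_tmul (f : M →ₗ[R] N) (s : S) (m : M) : map φ f (tmul φ s m) = tmul φ s (f m) := by
  have h1 : tmul φ s m = s • tmul φ 1 m := by rw [smul_tmul, mul_one]
  rw [h1, map_smul, map_one_tmul, smul_tmul, mul_one]

lemma hom_ext₂ {P : Type u} [AddCommGroup P] [Module S' P] {f g : Ind ψ (Ind φ M) →ₗ[S'] P}
    (h : ∀ t m, f (tmul ψ 1 (tmul φ t m)) = g (tmul ψ 1 (tmul φ t m))) : f = g := by
  refine hom_ext fun x => ?_
  refine induction_on (Q := fun x => f (tmul ψ 1 x) = g (tmul ψ 1 x)) x ?_ h ?_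
  · rw [tmul_zero, map_zero, map_zero]
  · intro x y hx hy
    rw [tmul_add, map_add, map_add, hx, hy]

lemma map_mulRight (z : S) (hz : ∀ r, z * φ r = φ r * z) (f : M →ₗ[R] N) :
    mulRight φ z hz ∘ₗ map φ f = map φ f ∘ₗ mulRight φ z hz :=
  hom_ext fun m => by
    rw [LinearMap.comp_apply, LinearMap.comp_apply, map_tmul, mulRight_tmul, mulRight_tmul,
      map_tmul]

lemma map_mulRight₂ (z : S') (hz : ∀ r, z * ψ (φ r) = ψ (φ r) * z) (f : M →ₗ[R] N) :
    mulRight₂ φ ψ z hz ∘ₗ map ψ (map φ f) = map ψ (map φ f) ∘ₗ mulRight₂ φ ψ z hz :=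
  hom_ext₂ fun t m => by
    rw [LinearMap.comp_apply, LinearMap.comp_apply, map_tmul, map_tmul, mulRight₂_tmul,
      mulRight₂_tmul, map_tmul, map_tmul]

variable (φ) in
/-- The map `S ⊗_R N → N`, `s ⊗ m ↦ s m`, for an `S`-module `N`. -/
def counit (N : Type u) [AddCommGroup N] [Module S N] [Module R N]
    (h : ∀ (r : R) (m : N), r • m = φ r • m) : Ind φ N →ₗ[S] N :=
  lift φ (AddMonoidHom.id N) h

lemma counit_tmul (N : Type u) [AddCommGroup N] [Module S N] [Module R N]
    (h : ∀ (r : R) (m : N), r • m = φ r • m) (s : S) (m : N) :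
    counit φ N h (tmul φ s m) = s • m := rfl

lemma counit_map {N N' : Type u} [AddCommGroup N] [Module S N] [Module R N]
    (h : ∀ (r : R) (m : N), r • m = φ r • m) [AddCommGroup N'] [Module S N'] [Module R N']
    (h' : ∀ (r : R) (m : N'), r • m = φ r • m) (f : N →ₗ[S] N') (g : N →ₗ[R] N')
    (hg : ∀ m, g m = f m) : counit φ N' h' ∘ₗ map φ g = f ∘ₗ counit φ N h :=
  hom_ext fun m => by
    rw [LinearMap.comp_apply, LinearMap.comp_apply, map_tmul, counit_tmul, counit_tmul, map_smul,
      hg]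

lemma counit_map_unit [Module R (Ind φ M)] (h : ∀ (r : R) (m : Ind φ M), r • m = φ r • m)
    (g : M →ₗ[R] Ind φ M) (hg : ∀ m, g m = tmul φ 1 m) :
    counit φ (Ind φ M) h ∘ₗ map φ g = LinearMap.id :=
  hom_ext fun m => by
    rw [LinearMap.comp_apply, map_tmul, counit_tmul, one_smul, hg, LinearMap.id_apply]

end Ind

variable {k : Type u} [Field k] {R S : Type u} [Ring R] [Ring S] [Algebra k R] [Algebra k S]
  [Module.Finite k S] (φ : R →ₐ[k] S)

/-- The unit `m ↦ 1 ⊗ m` of the adjunction between induction and restriction. -/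
def indUnit (M : FGModuleCat.{u} R) :
    M ⟶ (resFunctor φ).obj ((indFunctor (φ : R →+* S)).obj M) :=
  ObjectProperty.homMk (ModuleCat.ofHom
    (Y := (ModuleCat.restrictScalars (φ : R →+* S)).obj (ModuleCat.of S (Ind (φ : R →+* S) M)))
    { toFun := fun m => Ind.unit (φ : R →+* S) m
      map_add' := fun x y => map_add (Ind.unit (φ : R →+* S)) x y
      map_smul' := fun r m => Ind.unit_smul r m })

/-- The counit `s ⊗ m ↦ s m` of the adjunction between induction and restriction. -/
def indCounit (M : FGModuleCat.{u} S) :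
    (indFunctor (φ : R →+* S)).obj ((resFunctor φ).obj M) ⟶ M :=
  letI : Module R M := Module.compHom M (φ : R →+* S)
  FGModuleCat.ofHom (Ind.counit (φ : R →+* S) M fun _ _ => rfl)

/-- The adjunction between induction and restriction. -/
def indResAdj : indFunctor (φ : R →+* S) ⊣ resFunctor φ where
  unit :=
    { app := indUnit φ
      naturality := fun M N f => by
        ext m
        exact (Ind.map_one_tmul _ f.hom.hom m).symm }
  counit :=
    { app := indCounit φ
      naturality := fun M N f =>
        letI : Module R M := Module.compHom M (φ : R →+* S)
        letI : Module R N := Module.compHom N (φ : R →+* S)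
        FGModuleCat.hom_ext (Ind.counit_map (φ := (φ : R →+* S)) (fun _ _ => rfl) (fun _ _ => rfl)
          f.hom.hom ((resFunctor φ).map f).hom.hom fun _ => rfl) }
  left_triangle_components M :=
    letI : Module R (Ind (φ : R →+* S) M) := Module.compHom _ (φ : R →+* S)
    FGModuleCat.hom_ext (Ind.counit_map_unit (φ := (φ : R →+* S)) (fun _ _ => rfl)
      (indUnit φ M).hom.hom fun _ => rfl)
  right_triangle_components M := by
    ext m
    exact one_smul S (show M.obj from m)

end IndRes

variable {k : Type u} [Field k] (p : Param k) (n : ℕ)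

lemma hom_ext_punit {R : Type u} [Ring R] {M : FGModuleCat.{u} R}
    (f g : FGModuleCat.of R PUnit.{u + 1} ⟶ M) : f = g :=
  FGModuleCat.hom_ext (LinearMap.ext fun _ => (map_zero f.hom.hom).trans (map_zero g.hom.hom).symm)

namespace MinCat

/-- The functor `E = ⨁ Ind_{B_i}^{B_{i+1}}` on `𝒜(n)`. -/
def E : MinCat p n ⥤ MinCat p n where
  obj M
    | 0 => FGModuleCat.of (B p n 0) PUnit.{u + 1}
    | i + 1 => (indFunctor (B.incl p n i : B p n i →+* B p n (i + 1))).obj (M i)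
  map f
    | 0 => 𝟙 _
    | i + 1 => (indFunctor (B.incl p n i : B p n i →+* B p n (i + 1))).map (f i)
  map_id M := funext fun
    | 0 => rfl
    | i + 1 => (indFunctor (B.incl p n i : B p n i →+* B p n (i + 1))).map_id (M i)
  map_comp f g := funext fun
    | 0 => (Category.id_comp _).symm
    | i + 1 => (indFunctor (B.incl p n i : B p n i →+* B p n (i + 1))).map_comp (f i) (g i)

/-- The functor `F = ⨁ Res_{B_i}^{B_{i+1}}` on `𝒜(n)`. -/
def F : MinCat p n ⥤ MinCat p n where
  obj M i := (resFunctor (B.incl p n i)).obj (M (i + 1))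
  map f i := (resFunctor (B.incl p n i)).map (f (i + 1))
  map_id M := funext fun i => (resFunctor (B.incl p n i)).map_id (M (i + 1))
  map_comp f g := funext fun i => (resFunctor (B.incl p n i)).map_comp (f (i + 1)) (g (i + 1))

/-- The adjunction `(E, F)` given by the canonical adjunctions between induction and
restriction. -/
def adj : E p n ⊣ F p n where
  unit :=
    { app := fun M i => (indResAdj (B.incl p n i)).unit.app (M i)
      naturality := fun _ _ f => funext fun i =>
        (indResAdj (B.incl p n i)).unit.naturality (f i) }
  counit :=
    { app := fun M => fun
        | 0 => 0
        | i + 1 => (indResAdj (B.incl p n i)).counit.app (M (i + 1))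
      naturality := fun _ _ f => funext fun
        | 0 => hom_ext_punit _ _
        | i + 1 => (indResAdj (B.incl p n i)).counit.naturality (f (i + 1)) }
  left_triangle_components M := funext fun
    | 0 => hom_ext_punit _ _
    | i + 1 => (indResAdj (B.incl p n i)).left_triangle_components (M i)
  right_triangle_components M := funext fun i =>
    (indResAdj (B.incl p n i)).right_triangle_components (M (i + 1))

/-- The endomorphism `X` of `E`: right multiplication by the image of `X_{i+1}` on
`B_{i+1} ⊗_{B_i} M_i`. -/
def X : E p n ⟶ E p n where
  app M
    | 0 => 𝟙 _
    | i + 1 => FGModuleCat.ofHom (Ind.mulRight (B.incl p n i : B p n i →+* B p n (i + 1))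
        (B.X p n i) (B.X_comm i))
  naturality M N f := funext fun
    | 0 => rfl
    | i + 1 => FGModuleCat.hom_ext (Ind.map_mulRight
        (φ := (B.incl p n i : B p n i →+* B p n (i + 1))) (B.X p n i) (B.X_comm i) (f i).hom.hom)

/-- The endomorphism `T` of `E²`: right multiplication by the image of `T_{i+1}` on
`B_{i+2} ⊗_{B_{i+1}} B_{i+1} ⊗_{B_i} M_i = B_{i+2} ⊗_{B_i} M_i`. -/
def T : E p n ⋙ E p n ⟶ E p n ⋙ E p n where
  app M
    | 0 => 𝟙 _
    | 1 => 𝟙 _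
    | i + 2 => FGModuleCat.ofHom (Ind.mulRight₂ (B.incl p n i : B p n i →+* B p n (i + 1))
        (B.incl p n (i + 1) : B p n (i + 1) →+* B p n (i + 2)) (B.T p n i) (B.T_comm i))
  naturality M N f := funext fun
    | 0 => rfl
    | 1 => (Category.comp_id (((E p n ⋙ E p n).map f) 1)).trans (Category.id_comp _).symm
    | i + 2 => FGModuleCat.hom_ext (Ind.map_mulRight₂
        (φ := (B.incl p n i : B p n i →+* B p n (i + 1)))
        (ψ := (B.incl p n (i + 1) : B p n (i + 1) →+* B p n (i + 2)))
        (B.T p n i) (B.T_comm i) (f i).hom.hom)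

end MinCat

end

section

/-! ### Grothendieck groups -/

section K0

variable (C : Type u) [Category.{v} C] [Abelian C]

/-- The relations `[M] = [M'] + [M'']` given by short exact sequences `0 → M' → M → M'' → 0`. -/
def K0Rel : AddSubgroup (FreeAbelianGroup C) :=
  AddSubgroup.closure {x | ∃ S : ShortComplex C, S.ShortExact ∧
    x = FreeAbelianGroup.of S.X₂ - FreeAbelianGroup.of S.X₁ - FreeAbelianGroup.of S.X₃}

/-- The rational Grothendieck group `ℚ ⊗ K₀(C)` of an abelian category. -/
abbrev K0Q : Type u := ℚ ⊗[ℤ] (FreeAbelianGroup C ⧸ K0Rel C)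

variable {C}

/-- The class `[M]` of an object in `ℚ ⊗ K₀(C)`. -/
def cls (M : C) : K0Q C := 1 ⊗ₜ QuotientAddGroup.mk (FreeAbelianGroup.of M)

end K0

/-! ### `sl₂`-categorifications -/

section Categorification

variable (k : Type u) [Field k] (C : Type u') [Category.{v} C] [Abelian C] [Linear k C]

/-- The data underlying an `sl₂`-categorification: an adjoint pair `(E, F)` of endofunctors,
endomorphisms `X` of `E` and `T` of `E²`, and the parameters `q` and `a`. -/
structure Sl2Data where
  param : Param k
  E : C ⥤ C
  F : C ⥤ C
  adj : E ⊣ F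
  X : E ⟶ E
  T : E ⋙ E ⟶ E ⋙ E

namespace Sl2Data

variable {k C} (D : Sl2Data k C)

/-- The value of `X` at an object. -/
def x (M : C) : D.E.obj M ⟶ D.E.obj M := D.X.app M

/-- The value of `T` at an object. -/
def t (M : C) : D.E.obj (D.E.obj M) ⟶ D.E.obj (D.E.obj M) := D.T.app M

/-- The value of the unit `η : Id → FE` at an object. -/
def η (M : C) : M ⟶ D.F.obj (D.E.obj M) := D.adj.unit.app M

/-- The value of the counit `ε : EF → Id` at an object. -/
def ε (M : C) : D.E.obj (D.F.obj M) ⟶ M := D.adj.counit.app M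

/-- `E` and `F` are exact endofunctors whose classes give a locally finite action of `sl₂` (a
direct sum of finite-dimensional representations) on `ℚ ⊗ K₀`, the classes of simple objects are
weight vectors, and `F` is isomorphic to a left adjoint of `E`.  The category has finite length
and the endomorphism rings of its simple objects are `k`. -/
structure IsWeak : Prop where
  noetherian : ∀ M : C, IsNoetherianObject M
  artinian : ∀ M : C, IsArtinianObject M
  end_simple : ∀ S : C, Simple S → Function.Bijective fun c : k => c • 𝟙 S
  additive_E : D.E.Additive
  additive_F : D.F.Additive
  linear_E : D.E.Linear k
  linear_F : D.F.Linear k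
  left_exact_E : PreservesFiniteLimits D.E
  right_exact_E : PreservesFiniteColimits D.E
  left_exact_F : PreservesFiniteLimits D.F
  right_exact_F : PreservesFiniteColimits D.F
  left_adj : Nonempty (D.F ⊣ D.E)
  sl2_action : ∃ e f h : K0Q C →ₗ[ℚ] K0Q C,
    (∀ M : C, e (cls M) = cls (D.E.obj M)) ∧
    (∀ M : C, f (cls M) = cls (D.F.obj M)) ∧
    e ∘ₗ f - f ∘ₗ e = h ∧
    h ∘ₗ e - e ∘ₗ h = (2 : ℚ) • e ∧
    h ∘ₗ f - f ∘ₗ h = -((2 : ℚ) • f) ∧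
    (∃ S : Set (Submodule ℚ (K0Q C)),
      (∀ W ∈ S, FiniteDimensional ℚ W ∧ W ≤ W.comap e ∧ W ≤ W.comap f) ∧
      sSupIndep S ∧ sSup S = ⊤) ∧
    ∀ S : C, Simple S → ∃ c : ℤ, h (cls S) = (c : ℚ) • cls S

/-- The conditions for an `sl₂`-categorification.  At an object `M`, the endomorphisms `X1_E`,
`1_E X` of `E²` are `X_{E M}`, `E(X_M)`, and the endomorphisms `T1_E`, `1_E T` of `E³` are
`T_{E M}`, `E(T_M)`. -/
structure IsSl2Categorification : Prop extends D.IsWeak where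
  braid : ∀ M : C,
    D.E.map (D.t M) ≫ D.t (D.E.obj M) ≫ D.E.map (D.t M) =
      D.t (D.E.obj M) ≫ D.E.map (D.t M) ≫ D.t (D.E.obj M)
  quad : ∀ M : C, (D.t M + 𝟙 _) ≫ (D.t M - D.param.q • 𝟙 _) = 0
  affine : D.param.q ≠ 1 → ∀ M : C,
    D.t M ≫ D.E.map (D.x M) ≫ D.t M = D.param.q • D.x (D.E.obj M)
  affine_degenerate : D.param.q = 1 → ∀ M : C,
    D.t M ≫ D.E.map (D.x M) ≫ D.t M = D.x (D.E.obj M) - D.t M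
  nilpotent : ∀ M : C, ∃ N : ℕ,
    (End.of (D.x M - D.param.a • 𝟙 _)) ^ N = 0

/-- The conditions for a functor `R` and isomorphisms `ζ₊ : R E' ≅ E R`, `ζ₋ : R F' ≅ F R` to form
a morphism of `sl₂`-categorifications. -/
structure IsMorphism {C' : Type w} [Category.{v'} C'] [Abelian C'] [Linear k C']
    (D' : Sl2Data k C') (D : Sl2Data k C) (R : C' ⥤ C)
    (ζp : D'.E ⋙ R ≅ R ⋙ D.E) (ζm : D'.F ⋙ R ≅ R ⋙ D.F) : Prop where
  param_eq : D'.param = D.param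
  additive : R.Additive
  linear : R.Linear k
  comm_weak : ∀ M : C',
    ζm.hom.app M = D.η (R.obj (D'.F.obj M)) ≫ D.F.map (ζp.inv.app (D'.F.obj M)) ≫
      D.F.map (R.map (D'.ε M))
  comm_X : ∀ M : C', ζp.hom.app M ≫ D.x (R.obj M) = R.map (D'.x M) ≫ ζp.hom.app M
  comm_T : ∀ M : C',
    (ζp.hom.app (D'.E.obj M) ≫ D.E.map (ζp.hom.app M)) ≫ D.t (R.obj M) =
      R.map (D'.t M) ≫ ζp.hom.app (D'.E.obj M) ≫ D.E.map (ζp.hom.app M)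

/-- The object `E^i U`. -/
def iter (U : C) : ℕ → C
  | 0 => U
  | i + 1 => D.E.obj (iter U i)

/-- `h_+(U) = n`: the integer `n` is the largest `i` with `e^i [U] ≠ 0`. -/
def HPlus (U : C) (n : ℕ) : Prop := IsGreatest {i : ℕ | cls (D.iter U i) ≠ 0} n

/-- The algebra morphisms `ρ_i` are the right actions of the algebras `B_i` on the objects
`E^i U` for which `T_j` acts by `1_{E^{i-j-1}} T 1_{E^{j-1}}` and `X_j` acts by
`1_{E^{i-j}} X 1_{E^{j-1}}`. -/
structure IsHeckeAction (U : C) (n : ℕ)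
    (ρ : ∀ i : ℕ, B D.param n i →ₐ[k] (End (D.iter U i))ᵐᵒᵖ) : Prop where
  incl : ∀ (i : ℕ) (b : B D.param n i),
    (ρ (i + 1) (B.incl D.param n i b)).unop = End.of (D.E.map (ρ i b).unop.asHom)
  X : ∀ i : ℕ, (ρ (i + 1) (B.X D.param n i)).unop = End.of (D.x (D.iter U i))
  T : ∀ i : ℕ, (ρ (i + 2) (B.T D.param n i)).unop = End.of (D.t (D.iter U i))

end Sl2Data

end Categorification

variable {k : Type u} [Field k]

/-- The minimal categorification `𝒜(n)`. -/
def minimal (p : Param k) (n : ℕ) : Sl2Data k (MinCat p n) where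
  param := p
  E := MinCat.E p n
  F := MinCat.F p n
  adj := MinCat.adj p n
  X := MinCat.X p n
  T := MinCat.T p n

namespace MinCat

variable {p : Param k} {n : ℕ}

/-- The element `1 ⊗ m` of the component `B_{i+1} ⊗_{B_i} M_i` of `E M`. -/
def oneTmul (M : MinCat p n) (i : ℕ) (m : M i) : ((minimal p n).E.obj M) (i + 1) :=
  Ind.unit (B.incl p n i : B p n i →+* B p n (i + 1)) m

/-- An element of `M_{i+1}` as an element of the component `Res M_{i+1}` of `F M`. -/
def toRes (M : MinCat p n) (i : ℕ) (m : M (i + 1)) : ((minimal p n).F.obj M) i := m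

end MinCat

/-- The `B_i`-module `B_{i+1}`. -/
def B.res (p : Param k) (n i : ℕ) : FGModuleCat.{u} (B p n i) :=
  (resFunctor (B.incl p n i)).obj (FGModuleCat.of (B p n (i + 1)) (B p n (i + 1)))

/-- An element of `B_{i+1}` as an element of the `B_i`-module `B_{i+1}`. -/
def B.toRes {p : Param k} {n i : ℕ} (b : B p n (i + 1)) : B.res p n i := b

/-! ### Tensor products of objects with modules -/

section Tensor

attribute [local instance] Abelian.hasFiniteBiproducts

variable {C : Type u'} [Category.{v} C] [Abelian C] [Linear k C]

/-- The functor `V ⊗_A - : A-mod → C`, for an object `V` with a right action `ρ` of `A`. An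
element `m` of `M` gives the morphism `ι m : V → V ⊗_A M`, `v ↦ v ⊗ m`, and `V ⊗_A M` is the universal object
with such morphisms. -/
structure TensorFunctor {A : Type u} [Ring A] [Algebra k A] {V : C}
    (ρ : A →ₐ[k] (End V)ᵐᵒᵖ) where
  functor : FGModuleCat.{u} A ⥤ C
  ι (M : FGModuleCat.{u} A) : M →+ (V ⟶ functor.obj M)
  ι_smul (M : FGModuleCat.{u} A) (b : A) (m : M) : ι M (b • m) = (ρ b).unop.asHom ≫ ι M m
  ι_map {M N : FGModuleCat.{u} A} (f : M ⟶ N) (m : M) : ι M m ≫ functor.map f = ι N (f m)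
  universal (M : FGModuleCat.{u} A) (Y : C) (g : M →+ (V ⟶ Y))
    (hg : ∀ (b : A) (m : M), g (b • m) = (ρ b).unop.asHom ≫ g m) :
    ∃! h : functor.obj M ⟶ Y, ∀ m : M, ι M m ≫ h = g m

variable {p : Param k} {n : ℕ} {V : ℕ → C}
  {ρ : ∀ i, B p n i →ₐ[k] (End (V i))ᵐᵒᵖ} (G : ∀ i, TensorFunctor (ρ i))

/-- The functor `⨁_{0 ≤ i ≤ n} V_i ⊗_{B_i} -` on `𝒜(n)`. -/
def sumFunctor : MinCat p n ⥤ C where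
  obj M := ⨁ fun i : Fin (n + 1) => (G i).functor.obj (M i)
  map f := biproduct.map fun i : Fin (n + 1) => (G i).functor.map (f i)
  map_id M := by
    refine biproduct.hom_ext' _ _ fun i => ?_
    rw [biproduct.ι_map, Category.comp_id]
    exact (congrArg (· ≫ _) ((G i).functor.map_id (M i))).trans (Category.id_comp _)
  map_comp f g := by
    refine biproduct.hom_ext' _ _ fun i => ?_
    rw [biproduct.ι_map, biproduct.ι_map_assoc, biproduct.ι_map, ← Category.assoc]
    exact congrArg (· ≫ _) ((G i).functor.map_comp (f i) (g i))

/-- The morphism `v ↦ v ⊗ m` from `V_i` to the summand `V_i ⊗_{B_i} M_i`. -/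
def sumι (M : MinCat p n) (i : ℕ) (hi : i ≤ n) (m : M i) : V i ⟶ (sumFunctor G).obj M :=
  (G i).ι (M i) m ≫
    biproduct.ι (fun j : Fin (n + 1) => (G j).functor.obj (M j)) ⟨i, Nat.lt_succ_of_le hi⟩

end Tensor

end

end SlTwo

end

open SlTwo

/-! The proof is a dimension count in which an upper bound from the categorification meets a lower
bound from algebra. As `FU = 0`, the class `[U]` is a lowest weight vector of weight `-n`, so `f^i
e^i [U]` is `[U]` times `prodRank n i`, the product of the numbers `(l + 1)(n - l)` for `l < i`.
Adjunction turns endomorphisms of `E^i U` into morphisms `U → F^i E^i U`, and Schur's lemma bounds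
these by the length: `dim End(E^i U) ≤ prodRank n i`, which is `(n!)²` for `i = n`
(`Sl2Data.IsLowest.finite_end_iter`).

On the algebraic side, `X_j - a` is nilpotent, so `X_{j+1} - q X_j - κ` is invertible, and solving
`T_j = q + (X_{j+1} - q X_j - κ) d_j` for `d_j` reduces both kinds of affine Hecke algebra to the
nil affine Hecke algebra (`IsHecke.isNilHecke`). A nonzero finite-dimensional representation of the
latter has dimension at least `n!`, and a nonzero bimodule at least `(n!)²`
(`IsNilHecke.factorial_le_finrank`, `IsNilHecke.factorial_sq_le_finrank_of_bimodule`). Hence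
`End(E^n U)` is generated by the `X_j` and `T_j` and has no proper nonzero ideals. A symmetric
polynomial that vanishes at `(a, …, a)` acts as a central nilpotent element, so by zero
(`IsHecke.commEval_eq_zero`), and the action factors through `H̄_n`.

Conversely, `B_{m+1}` is generated by `(m + 1)(n - m)` elements as a right `B_m`-module
(`IsNilHecke.nilSub_succ_le_span`). These numbers multiply to `(n!)²`, which is also a lower bound
for `dim H̄_n` once `H̄_n ≠ 0`. So all these bounds are equalities: `dim B_i = prodRank n i`, and
`B_{i+1}` is free over `B_i` on both sides. Comparison of dimensions gives `End(E^n U) ≅ H̄_n` up to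
the opposite. Since `E` is faithful on morphisms to `E^i U` for `i < n`, this descends to `End(E^i
U) ≅ B_i` for all `i ≤ n` (`Sl2Data.IsLowest.exists_heckeAction`).

The canonical map `E^i U ⊗ B_{i+1} → F E^{i+1} U` is then an isomorphism
(`Sl2Data.IsLowest.exists_canonical_iso`): both sides have the class of `(i + 1)(n - i)` copies of
`E^i U`, and a simple subobject of the kernel would yield a nonzero element of `B_{i+1}` that acts
by zero on `E^{i+1} U`. The inverse of `ζ₊` comes from the adjunction `(E, F)`. That of `ζ₋` comes
from the canonical isomorphism and the second adjunction `(F, E)`. The axioms of a morphism are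
checked on elements.

For `𝒜(n)` itself, the main point is that restriction is left adjoint to induction, which follows
from a Frobenius form `B_{i+1} → B_i`. The form is read off from the given category: it is the
counit `F E → Id` of the second adjunction, evaluated at `E^i U`, and it is perfect because of the
canonical isomorphism (`Sl2Data.IsLowest.exists_frobeniusForm`). Exactness follows from
biadjointness. For each `i ≤ n`, simple `B_i`-modules have dimension `i!`, scalar endomorphisms, and
a single isomorphism class, so `ℚ ⊗ K₀` is detected by dimensions of components (`K0Q_min_eq_zero`),
and the relations of `sl₂` become numerical identities. -/

noncomputable section

namespace SlTwo

/-! ### Nil affine Hecke algebras -/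

section NilHecke

/-- The relations of the nil affine Hecke algebra of rank `n`. -/
structure IsNilHecke {A : Type*} [Ring A] (n : ℕ) (x d : ℕ → A) : Prop where
  xx : ∀ i j, i < n → j < n → x i * x j = x j * x i
  dd : ∀ j, j + 1 < n → d j * d j = 0
  dd_comm : ∀ i j, i + 1 < j → j + 1 < n → d i * d j = d j * d i
  braid : ∀ j, j + 2 < n → d j * d (j + 1) * d j = d (j + 1) * d j * d (j + 1)
  xd : ∀ i j, i < n → j + 1 < n → i ≠ j → i ≠ j + 1 → x i * d j = d j * x i
  dx : ∀ j, j + 1 < n → d j * x j = x (j + 1) * d j + 1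
  xd_self : ∀ j, j + 1 < n → x j * d j = d j * x (j + 1) + 1

/-- The product `d_j d_{j+1} ⋯ d_{j+l-1}`. -/
def ascProd {A : Type*} [Ring A] (d : ℕ → A) : ℕ → ℕ → A
  | _, 0 => 1
  | j, l + 1 => d j * ascProd d (j + 1) l

namespace IsNilHecke

section Ring

variable {A : Type*} [Ring A] {n : ℕ} {x d : ℕ → A}

/-- The relations are symmetric under reversal of products, with `dx` and `xd_self` exchanged.
Statements about right modules therefore give statements about left modules, and right
multiplication becomes an action of the same kind. -/
lemma op (h : IsNilHecke n x d) :
    IsNilHecke n (fun j => MulOpposite.op (x j)) (fun j => MulOpposite.op (d j)) where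
  xx i j hi hj := congrArg MulOpposite.op (h.xx j i hj hi)
  dd j hj := congrArg MulOpposite.op (h.dd j hj)
  dd_comm i j hij hj := congrArg MulOpposite.op (h.dd_comm i j hij hj).symm
  braid j hj := by
    have := congrArg MulOpposite.op (h.braid j hj)
    simpa only [mul_assoc, MulOpposite.op_mul] using this
  xd i j hi hj h1 h2 := congrArg MulOpposite.op (h.xd i j hi hj h1 h2).symm
  dx j hj := congrArg MulOpposite.op (h.xd_self j hj)
  xd_self j hj := congrArg MulOpposite.op (h.dx j hj)

lemma map {B F : Type*} [Ring B] [FunLike F A B] [RingHomClass F A B] (f : F)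
    (h : IsNilHecke n x d) : IsNilHecke n (fun j => f (x j)) (fun j => f (d j)) where
  xx i j hi hj := by simp only [← map_mul, h.xx i j hi hj]
  dd j hj := by simp only [← map_mul, h.dd j hj, map_zero]
  dd_comm i j hij hj := by simp only [← map_mul, h.dd_comm i j hij hj]
  braid j hj := by simp only [← map_mul, h.braid j hj]
  xd i j hi hj h1 h2 := by simp only [← map_mul, h.xd i j hi hj h1 h2]
  dx j hj := by simp only [← map_mul, h.dx j hj, map_add, map_one]
  xd_self j hj := by simp only [← map_mul, h.xd_self j hj, map_add, map_one]

lemma mono (h : IsNilHecke n x d) {m : ℕ} (hm : m ≤ n) : IsNilHecke m x d where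
  xx i j hi hj := h.xx i j (by omega) (by omega)
  dd j hj := h.dd j (by omega)
  dd_comm i j hij hj := h.dd_comm i j hij (by omega)
  braid j hj := h.braid j (by omega)
  xd i j hi hj h1 h2 := h.xd i j (by omega) (by omega) h1 h2
  dx j hj := h.dx j (by omega)
  xd_self j hj := h.xd_self j (by omega)

lemma congr (h : IsNilHecke n x d) {x' d' : ℕ → A} (hx : ∀ j < n, x' j = x j)
    (hd : ∀ j, j + 1 < n → d' j = d j) : IsNilHecke n x' d' where
  xx i j hi hj := by rw [hx i hi, hx j hj, h.xx i j hi hj]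
  dd j hj := by rw [hd j hj, h.dd j hj]
  dd_comm i j hij hj := by rw [hd i (by omega), hd j hj, h.dd_comm i j hij hj]
  braid j hj := by rw [hd j (by omega), hd (j + 1) hj, h.braid j hj]
  xd i j hi hj h1 h2 := by rw [hx i hi, hd j hj, h.xd i j hi hj h1 h2]
  dx j hj := by rw [hx j (by omega), hx (j + 1) hj, hd j hj, h.dx j hj]
  xd_self j hj := by rw [hx j (by omega), hx (j + 1) hj, hd j hj, h.xd_self j hj]

lemma d_mul_ascProd_of_lt (h : IsNilHecke n x d) (l : ℕ) :
    ∀ i j, i + 1 < j → j + l < n → d i * ascProd d j l = ascProd d j l * d i := by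
  induction l with
  | zero => intro i j _ _; simp [ascProd]
  | succ l ih =>
    intro i j hij hj
    rw [ascProd, ← mul_assoc, h.dd_comm i j hij (by omega), mul_assoc,
      ih i (j + 1) (by omega) (by omega), mul_assoc]

lemma x_mul_ascProd_of_lt (h : IsNilHecke n x d) (l : ℕ) :
    ∀ i j, i < j → j + l < n → x i * ascProd d j l = ascProd d j l * x i := by
  induction l with
  | zero => intro i j _ _; simp [ascProd]
  | succ l ih =>
    intro i j hij hj
    rw [ascProd, ← mul_assoc, h.xd i j (by omega) (by omega) (by omega) (by omega), mul_assoc,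
      ih i (j + 1) (by omega) (by omega), mul_assoc]

/-- Inside the product, the braid relation turns `d_{i+1} d_i d_{i+1}` into `d_i d_{i+1} d_i`, and
the last `d_i` commutes with the factors of index at least `i + 2`. So `d_{i+1}` crosses the product
and comes out with its index lowered by one. -/
lemma d_succ_mul_ascProd (h : IsNilHecke n x d) (l : ℕ) :
    ∀ i j, j ≤ i → i + 1 < j + l → j + l < n →
      d (i + 1) * ascProd d j l = ascProd d j l * d i := by
  induction l with
  | zero => intro i j _ _ _; omega
  | succ l ih =>
    intro i j hij hi hj
    rcases hij.eq_or_lt with rfl | hij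
    · obtain ⟨l, rfl⟩ : ∃ l', l = l' + 1 := ⟨l - 1, by omega⟩
      rw [ascProd, ascProd]
      calc d (j + 1) * (d j * (d (j + 1) * ascProd d (j + 1 + 1) l))
          = (d (j + 1) * d j * d (j + 1)) * ascProd d (j + 1 + 1) l := by simp only [mul_assoc]
        _ = d j * d (j + 1) * (d j * ascProd d (j + 1 + 1) l) := by
            rw [← h.braid j (by omega)]; simp only [mul_assoc]
        _ = _ := by
            rw [h.d_mul_ascProd_of_lt l j (j + 1 + 1) (by omega) (by omega)]
            simp only [mul_assoc]
    · rw [ascProd, ← mul_assoc, ← h.dd_comm j (i + 1) (by omega) (by omega), mul_assoc,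
        ih i (j + 1) (by omega) (by omega) (by omega), mul_assoc]

end Ring

/-! ### Spanning sets for the chain of subalgebras `S_m` -/

section Spanning

variable {k : Type*} [Field k] {A : Type*} [Ring A] [Algebra k A] {n : ℕ} {x d : ℕ → A}

variable (k x d) in
/-- The subalgebra generated by `x_j` for `j < m` and `d_j` for `j + 1 < m`. -/
def nilSub (m : ℕ) : Subalgebra k A :=
  Algebra.adjoin k (x '' {j | j < m} ∪ d '' {j | j + 1 < m})

lemma x_mem_nilSub {j m : ℕ} (h : j < m) : x j ∈ nilSub k x d m :=
  Algebra.subset_adjoin (Or.inl ⟨j, h, rfl⟩)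

lemma d_mem_nilSub {j m : ℕ} (h : j + 1 < m) : d j ∈ nilSub k x d m :=
  Algebra.subset_adjoin (Or.inr ⟨j, h, rfl⟩)

lemma x_comm_nilSub (h : IsNilHecke n x d) {m : ℕ} (hm : m < n) {s : A}
    (hs : s ∈ nilSub k x d m) : x m * s = s * x m := by
  unfold nilSub at hs
  induction hs using Algebra.adjoin_induction with
  | mem s hs =>
    rcases hs with ⟨j, hj, rfl⟩ | ⟨j, hj, rfl⟩
    · have hj : j < m := hj
      exact h.xx _ _ hm (by omega)
    · have hj : j + 1 < m := hj
      exact h.xd _ _ hm (by omega) (by omega) (by omega)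
  | algebraMap r => exact (Algebra.commutes r _).symm
  | add a b _ _ ha hb => rw [mul_add, add_mul, ha, hb]
  | mul a b _ _ ha hb => rw [← mul_assoc, ha, mul_assoc, hb, mul_assoc]

variable (d) in
/-- The span of the products `d_t ⋯ d_{m-1} y` for `t₀ ≤ t ≤ m` and `y` in `Y`. -/
def ascSpan (m : ℕ) (Y : Submodule k A) (t₀ : ℕ) : Submodule k A :=
  Submodule.span k {z | ∃ t l, t₀ ≤ t ∧ t + l = m ∧ ∃ y ∈ Y, z = ascProd d t l * y}

lemma mem_ascSpan {m : ℕ} {Y : Submodule k A} {t₀ t l : ℕ} (h : t₀ ≤ t) (hm : t + l = m) {y : A}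
    (hy : y ∈ Y) : ascProd d t l * y ∈ ascSpan d m Y t₀ :=
  Submodule.subset_span ⟨t, l, h, hm, y, hy, rfl⟩

lemma ascSpan_anti {m : ℕ} {Y : Submodule k A} {t₀ t₁ : ℕ} (h : t₁ ≤ t₀) :
    ascSpan d m Y t₀ ≤ ascSpan d m Y t₁ := by
  refine Submodule.span_mono ?_
  rintro _ ⟨t, l, ht, hm, y, hy, rfl⟩
  exact ⟨t, l, h.trans ht, hm, y, hy, rfl⟩

lemma mul_mem_of_span {s : Set A} {W : Submodule k A} {a z : A} (h : ∀ y ∈ s, a * y ∈ W)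
    (hz : z ∈ Submodule.span k s) : a * z ∈ W := by
  have : Submodule.span k s ≤ W.comap (LinearMap.mulLeft k a) := Submodule.span_le.2 h
  exact this hz

section

variable {m : ℕ} {Y : Submodule k A} (h : IsNilHecke n x d) (hm : m < n)
  (hY : ∀ s ∈ nilSub k x d m, ∀ y ∈ Y, s * y ∈ Y) (hxY : ∀ y ∈ Y, x m * y ∈ Y)

include h hm hY in
lemma d_mul_mem_ascSpan {t₀ j : ℕ} (hj : j + 1 < t₀) {z : A} (hz : z ∈ ascSpan d m Y t₀) :
    d j * z ∈ ascSpan d m Y t₀ := by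
  refine mul_mem_of_span ?_ hz
  rintro _ ⟨t, l, ht, htl, y, hy, rfl⟩
  rw [← mul_assoc, h.d_mul_ascProd_of_lt l j t (by omega) (by omega), mul_assoc]
  exact mem_ascSpan ht htl (hY _ (d_mem_nilSub (by omega)) _ hy)

-- Moving `x_{i+1}` through the product costs one correction, in which `d_i` is deleted. The factors
-- to the left of the gap commute with those to its right and are absorbed into `Y`, so that only
-- the product starting at `i + 1` remains.
include h hm hY in
lemma x_succ_mul_ascProd_mem (l : ℕ) : ∀ i j, j ≤ i → i + 1 ≤ m → j + l = m → ∀ y ∈ Y,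
    x (i + 1) * (ascProd d j l * y) - ascProd d j l * (x i * y) ∈ ascSpan d m Y (i + 1) := by
  induction l with
  | zero => intro i j h1 h2 h3; omega
  | succ l ih =>
    intro i j hij hi hjl y hy
    rcases hij.eq_or_lt with rfl | hij
    · have e : x (j + 1) * (ascProd d j (l + 1) * y) - ascProd d j (l + 1) * (x j * y) =
          - (ascProd d (j + 1) l * y) := by
        have h1 : x (j + 1) * d j = d j * x j - 1 := by rw [h.dx j (by omega)]; simp
        rw [ascProd, mul_assoc, ← mul_assoc, h1, mul_assoc, sub_mul, one_mul, mul_assoc (d j),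
          ← mul_assoc (x j), h.x_mul_ascProd_of_lt l j (j + 1) (by omega) (by omega)]
        simp only [mul_assoc]; abel
      rw [e]
      exact neg_mem (mem_ascSpan le_rfl (by omega) hy)
    · have e : x (i + 1) * (ascProd d j (l + 1) * y) - ascProd d j (l + 1) * (x i * y) =
          d j * (x (i + 1) * (ascProd d (j + 1) l * y) - ascProd d (j + 1) l * (x i * y)) := by
        rw [ascProd, mul_sub, mul_assoc, ← mul_assoc (x (i + 1)),
          h.xd (i + 1) j (by omega) (by omega) (by omega) (by omega)]
        simp only [mul_assoc]
      rw [e]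
      exact d_mul_mem_ascSpan h hm hY (by omega) (ih i (j + 1) (by omega) hi (by omega) y hy)

-- Here every factor is crossed, so `x_j` arrives as `x_m`, and each crossing leaves a correction
-- with one factor deleted. Whatever stands to the left of the gap is absorbed into `Y`, and shorter
-- products remain.
include h hm hY in
lemma x_mul_ascProd_mem (l : ℕ) : ∀ j, j + (l + 1) = m → ∀ y ∈ Y,
    x j * (ascProd d j (l + 1) * y) - ascProd d j (l + 1) * (x m * y) ∈
      ascSpan d m Y (j + 1) := by
  induction l with
  | zero =>
    intro j hj y hy
    subst hj
    have e : x j * (ascProd d j (0 + 1) * y) - ascProd d j (0 + 1) * (x (j + (0 + 1)) * y) =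
        ascProd d (j + 1) 0 * y := by
      simp only [ascProd, mul_one, one_mul]
      rw [← mul_assoc, h.xd_self j hm, add_mul, mul_assoc]
      simp
    rw [e]
    exact mem_ascSpan (t := j + 1) (l := 0) le_rfl (by omega) hy
  | succ l ih =>
    intro j hj y hy
    have e : x j * (ascProd d j (l + 1 + 1) * y) - ascProd d j (l + 1 + 1) * (x m * y) =
        d j * (x (j + 1) * (ascProd d (j + 1) (l + 1) * y) -
          ascProd d (j + 1) (l + 1) * (x m * y)) + ascProd d (j + 1) (l + 1) * y := by
      rw [ascProd, mul_assoc, ← mul_assoc (x j), h.xd_self j (by omega), add_mul, one_mul, mul_sub]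
      simp only [mul_assoc]; abel
    rw [e]
    refine add_mem (ascSpan_anti (by omega : j + 1 ≤ j + 2) ?_)
      (mem_ascSpan le_rfl (by omega) hy)
    exact d_mul_mem_ascSpan h hm hY (by omega) (ih (j + 1) (by omega) y hy)

include h hm hY hxY in
/-- If `Y` contains `1` and is stable under left multiplication by `S_m` and `x_m`, then
`S_{m+1}` is contained in the sum of the subspaces `d_t ⋯ d_{m-1} Y`. -/
lemma nilSub_succ_le (h1 : 1 ∈ Y) :
    Subalgebra.toSubmodule (nilSub k x d (m + 1)) ≤ ascSpan d m Y 0 := by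
  refine adjoin_le_of_mul_left _ _ ?_ ?_
  · simpa [ascProd] using mem_ascSpan (d := d) (t₀ := 0) (Nat.zero_le m) (Nat.add_zero m) h1
  · intro a ha z hz
    refine mul_mem_of_span ?_ hz
    rintro _ ⟨t, l, ht, htl, y, hy, rfl⟩
    rcases ha with ⟨j, hj, rfl⟩ | ⟨j, hj, rfl⟩
    · have hj : j < m + 1 := hj
      rcases lt_trichotomy j t with hjt | rfl | hjt
      · rw [← mul_assoc, h.x_mul_ascProd_of_lt l j t hjt (by omega), mul_assoc]
        exact mem_ascSpan ht htl (hY _ (x_mem_nilSub (by omega)) _ hy)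
      · cases l with
        | zero =>
          obtain rfl : j = m := by omega
          simpa [ascProd] using mem_ascSpan (d := d) ht htl (hxY _ hy)
        | succ l =>
          have := x_mul_ascProd_mem h hm hY l j htl y hy
          rw [← sub_add_cancel (x j * _) (ascProd d j (l + 1) * (x m * y))]
          exact add_mem (ascSpan_anti (Nat.zero_le _) this)
            (mem_ascSpan ht htl (hxY _ hy))
      · obtain ⟨i, rfl⟩ : ∃ i, j = i + 1 := ⟨j - 1, by omega⟩
        have := x_succ_mul_ascProd_mem h hm hY l i t (by omega) (by omega) htl y hy
        rw [← sub_add_cancel (x (i + 1) * _) (ascProd d t l * (x i * y))]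
        exact add_mem (ascSpan_anti (Nat.zero_le _) this)
          (mem_ascSpan ht htl (hY _ (x_mem_nilSub (by omega)) _ hy))
    -- The element `d_j` commutes with the product if `j + 1 < t`, lengthens it if `j + 1 = t`,
    -- kills it if `j = t`, and slides through as `d_{j-1}` if `j > t`.
    · have hj : j + 1 < m + 1 := hj
      rcases lt_trichotomy j t with hjt | rfl | hjt
      · rcases (Nat.succ_le_of_lt hjt).eq_or_lt with e | hjt'
        · subst e
          have e : d j * (ascProd d (j + 1) l * y) = ascProd d j (l + 1) * y := by
            rw [ascProd, mul_assoc]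
          rw [show j.succ = j + 1 from rfl, e]
          exact mem_ascSpan (Nat.zero_le _) (by omega) hy
        · rw [← mul_assoc, h.d_mul_ascProd_of_lt l j t hjt' (by omega), mul_assoc]
          exact mem_ascSpan ht htl (hY _ (d_mem_nilSub (by omega)) _ hy)
      · obtain ⟨l, rfl⟩ : ∃ l', l = l' + 1 := ⟨l - 1, by omega⟩
        rw [ascProd, mul_assoc, ← mul_assoc, h.dd j (by omega), zero_mul]
        exact zero_mem _
      · obtain ⟨i, rfl⟩ : ∃ i, j = i + 1 := ⟨j - 1, by omega⟩
        rw [← mul_assoc, h.d_succ_mul_ascProd l i t (by omega) (by omega) (by omega), mul_assoc]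
        exact mem_ascSpan ht htl (hY _ (d_mem_nilSub (by omega)) _ hy)

end

/-- If `x_m^N` is a combination of lower powers of `x_m` with coefficients in `S_m`, then
`S_{m+1}` is generated by `(m + 1) N` elements as a right `S_m`-module. -/
lemma nilSub_succ_le_span (h : IsNilHecke n x d) {m : ℕ} (hm : m < n) {N : ℕ} (hN : 0 < N)
    (hpow : x m ^ N ∈ Submodule.span k {z | ∃ c < N, ∃ s ∈ nilSub k x d m, z = x m ^ c * s}) :
    Subalgebra.toSubmodule (nilSub k x d (m + 1)) ≤
      Submodule.span k {z | ∃ i : Fin (m + 1) × Fin N, ∃ s ∈ nilSub k x d m,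
        z = (ascProd d i.1 (m - i.1) * x m ^ (i.2 : ℕ)) * s} := by
  set Y := Submodule.span k {z | ∃ c < N, ∃ s ∈ nilSub k x d m, z = x m ^ c * s} with hYdef
  have hcomm : ∀ (c : ℕ), ∀ s ∈ nilSub k x d m, s * x m ^ c = x m ^ c * s := fun c s hs =>
    (show Commute s (x m) from (x_comm_nilSub h hm hs).symm).pow_right c
  have hYr : ∀ s ∈ nilSub k x d m, ∀ y ∈ Y, y * s ∈ Y := by
    intro s hs y hy
    have : Y ≤ Y.comap (LinearMap.mulRight k s) := by
      refine Submodule.span_le.2 ?_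
      rintro _ ⟨c, hc, s', hs', rfl⟩
      exact Submodule.subset_span ⟨c, hc, s' * s, mul_mem hs' hs, mul_assoc _ _ _⟩
    exact this hy
  -- `Y` is the right `S_m`-module generated by the powers of `x_m` of exponent less than `N`. It is
  -- stable under `S_m` because `x_m` commutes with `S_m`, and under `x_m` because of `hpow`.
  refine (nilSub_succ_le (Y := Y) h hm ?_ ?_ ?_).trans ?_
  · intro s hs y hy
    refine mul_mem_of_span ?_ hy
    rintro _ ⟨c, hc, s', hs', rfl⟩
    rw [← mul_assoc, hcomm c s hs, mul_assoc]
    exact Submodule.subset_span ⟨c, hc, _, mul_mem hs hs', rfl⟩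
  · intro y hy
    refine mul_mem_of_span ?_ hy
    rintro _ ⟨c, hc, s', hs', rfl⟩
    rw [← mul_assoc, ← pow_succ']
    rcases (Nat.succ_le_of_lt hc).eq_or_lt with e | hc'
    · rw [show c + 1 = N from e]
      exact hYr _ hs' _ hpow
    · exact Submodule.subset_span ⟨c + 1, hc', s', hs', rfl⟩
  · exact Submodule.subset_span ⟨0, hN, 1, one_mem _, by simp⟩
  · refine Submodule.span_le.2 ?_
    rintro _ ⟨t, l, _, htl, y, hy, rfl⟩
    refine mul_mem_of_span ?_ hy
    rintro _ ⟨c, hc, s, hs, rfl⟩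
    refine Submodule.subset_span ⟨(⟨t, by omega⟩, ⟨c, hc⟩), s, hs, ?_⟩
    have : m - t = l := by omega
    simp only [this, mul_assoc]

end Spanning

/-! ### Lower bounds for the dimensions of representations -/

section LowerBound

variable {k : Type*} [Field k] {V : Type*} [AddCommGroup V] [Module k V] {n : ℕ}
  {x d : ℕ → Module.End k V}

/-- The subspace of the vectors that are killed by `d_j` for `j + 1 < m`. -/
def killed (d : ℕ → Module.End k V) (m : ℕ) : Submodule k V where
  carrier := {v | ∀ j, j + 1 < m → d j v = 0}
  add_mem' {a b} ha hb j hj := by rw [map_add, ha j hj, hb j hj, add_zero]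
  zero_mem' j _ := map_zero _
  smul_mem' c v hv j hj := by rw [map_smul, hv j hj, smul_zero]

lemma restrict (h : IsNilHecke n x d) (W : Submodule k V) (hx : ∀ j, ∀ v ∈ W, x j v ∈ W)
    (hd : ∀ j, ∀ v ∈ W, d j v ∈ W) :
    IsNilHecke n (fun j => (x j).restrict (hx j)) (fun j => (d j).restrict (hd j)) where
  xx i j hi hj := LinearMap.ext fun v => Subtype.ext (LinearMap.congr_fun (h.xx i j hi hj) v.1)
  dd j hj := LinearMap.ext fun v => Subtype.ext (LinearMap.congr_fun (h.dd j hj) v.1)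
  dd_comm i j hij hj := LinearMap.ext fun v =>
    Subtype.ext (LinearMap.congr_fun (h.dd_comm i j hij hj) v.1)
  braid j hj := LinearMap.ext fun v => Subtype.ext (LinearMap.congr_fun (h.braid j hj) v.1)
  xd i j hi hj h1 h2 := LinearMap.ext fun v =>
    Subtype.ext (LinearMap.congr_fun (h.xd i j hi hj h1 h2) v.1)
  dx j hj := LinearMap.ext fun v => Subtype.ext (LinearMap.congr_fun (h.dx j hj) v.1)
  xd_self j hj := LinearMap.ext fun v =>
    Subtype.ext (LinearMap.congr_fun (h.xd_self j hj) v.1)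

lemma x_mem_killed (h : IsNilHecke n x d) {m : ℕ} (hm : m < n) {v : V} (hv : v ∈ killed d m) :
    x m v ∈ killed d m := fun j hj => by
  have := LinearMap.congr_fun (h.xd m j hm (by omega) (by omega) (by omega)) v
  rw [Module.End.mul_apply, Module.End.mul_apply, hv j hj, map_zero] at this
  exact this.symm

lemma x_pow_mem_killed (h : IsNilHecke n x d) {m : ℕ} (hm : m < n) (c : ℕ) {v : V}
    (hv : v ∈ killed d m) : (x m ^ c) v ∈ killed d m := by
  induction c with
  | zero => simpa using hv
  | succ c ih =>
    rw [pow_succ', Module.End.mul_apply]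
    exact h.x_mem_killed hm ih

/-- The relation `x_j d_j = d_j x_{j+1} + 1` is applied at each factor. All corrections but the
first vanish: in the later ones, a factor to the left of the gap can be moved onto `w`, which it
kills. -/
lemma x_ascProd_apply (h : IsNilHecke n x d) (l : ℕ) : ∀ j, j + l + 1 < n → ∀ w : V,
    (∀ i, j ≤ i → i < j + l → d i w = 0) →
    x j (ascProd d j (l + 1) w) = ascProd d j (l + 1) (x (j + l + 1) w) + ascProd d (j + 1) l w := by
  induction l with
  | zero =>
    intro j hj w _
    simpa [ascProd] using LinearMap.congr_fun (h.xd_self j hj) w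
  | succ l ih =>
    intro j hj w hw
    have h1 := ih (j + 1) (by omega) w fun i hi hi' => hw i (by omega) (by omega)
    have h2 := LinearMap.congr_fun (h.d_mul_ascProd_of_lt l j (j + 2) (by omega) (by omega)) w
    have h3 := LinearMap.congr_fun (h.xd_self j (by omega)) (ascProd d (j + 1) (l + 1) w)
    simp only [Module.End.mul_apply, LinearMap.add_apply, Module.End.one_apply] at h2 h3
    rw [hw j le_rfl (by omega), map_zero] at h2
    rw [ascProd, Module.End.mul_apply, h3, h1, map_add, h2, add_zero, Module.End.mul_apply]
    rw [show j + 1 + l + 1 = j + (l + 1) + 1 by omega]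

lemma ascProd_apply_x (h : IsNilHecke n x d) {m j l : ℕ} (hm : m < n) (hjl : j + (l + 1) = m)
    {w : V} (hw : w ∈ killed d m) :
    ascProd d j (l + 1) (x m w) = x j (ascProd d j (l + 1) w) - ascProd d (j + 1) l w := by
  have := h.x_ascProd_apply l j (by omega) w fun i hi hi' => hw i (by omega)
  rw [this, show j + l + 1 = m by omega, add_sub_cancel_right]

/-- The product acts like an iterated divided difference: on `x_m^c v`, with `v` killed by the
`d_j`, it lowers the degree `c` of the polynomial in front of `v` by `l`. The result is zero if `c <
l` and a sign times `v` if `c = l`. -/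
lemma ascProd_apply_pow (h : IsNilHecke n x d) {m : ℕ} (hm : m < n) {v : V}
    (hv : v ∈ killed d (m + 1)) (c : ℕ) : ∀ j l, j + l = m →
      (c < l → ascProd d j l ((x m ^ c) v) = 0) ∧
      (c = l → ascProd d j l ((x m ^ c) v) = (-1 : k) ^ l • v) := by
  induction c with
  | zero =>
    have h0 : ∀ l j, j + l = m → 0 < l → ascProd d j l v = 0 := by
      intro l
      induction l with
      | zero => intro j _ h; omega
      | succ l ih =>
        intro j hj _
        rcases Nat.eq_zero_or_pos l with rfl | hl
        · simpa [ascProd] using hv j (by omega)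
        · rw [ascProd, Module.End.mul_apply, ih (j + 1) (by omega) hl, map_zero]
    intro j l hjl
    refine ⟨fun hl => by simpa using h0 l j hjl hl, ?_⟩
    rintro rfl
    simp [ascProd]
  | succ c ih =>
    have hv' : v ∈ killed d m := fun j hj => hv j (by omega)
    intro j l hjl
    cases l with
    | zero => exact ⟨fun h => by omega, fun h => by omega⟩
    | succ l =>
      have e : ascProd d j (l + 1) ((x m ^ (c + 1)) v) =
          x j (ascProd d j (l + 1) ((x m ^ c) v)) - ascProd d (j + 1) l ((x m ^ c) v) := by
        rw [pow_succ', Module.End.mul_apply]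
        exact h.ascProd_apply_x hm hjl (h.x_pow_mem_killed hm c hv')
      constructor
      · intro hc
        rw [e, (ih j (l + 1) hjl).1 (by omega), (ih (j + 1) l (by omega)).1 (by omega)]
        simp
      · intro hc
        rw [e, (ih j (l + 1) hjl).1 (by omega), (ih (j + 1) l (by omega)).2 (by omega)]
        rw [map_zero, zero_sub, pow_succ, mul_neg_one, neg_smul]

/-- The map `(v_c) ↦ ∑ x_m^c v_c` over `c ≤ m` embeds `m + 1` copies of the smaller space in the
larger one. The product `d_0 ⋯ d_{m-1}` isolates the coefficient of `x_m^m` up to sign, so the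
coefficients can be recovered starting with the highest. -/
lemma finrank_killed_succ [FiniteDimensional k V] (h : IsNilHecke n x d) {m : ℕ} (hm : m < n) :
    (m + 1) * Module.finrank k (killed d (m + 1)) ≤ Module.finrank k (killed d m) := by
  have hle : killed d (m + 1) ≤ killed d m := fun v hv j hj => hv j (by omega)
  let f : (Fin (m + 1) → killed d (m + 1)) →ₗ[k] killed d m :=
    LinearMap.codRestrict (killed d m)
      (∑ c : Fin (m + 1), (x m ^ (c : ℕ)) ∘ₗ (killed d (m + 1)).subtype ∘ₗ LinearMap.proj c)
      (fun v => by
        rw [LinearMap.sum_apply]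
        exact sum_mem fun c _ => h.x_pow_mem_killed hm c (hle (v c).2))
  have hf : ∀ v, (f v : V) = ∑ c : Fin (m + 1), (x m ^ (c : ℕ)) (v c : V) := fun v => by
    simp [f]
  have hinj : Function.Injective f := by
    rw [injective_iff_map_eq_zero]
    intro v hv
    have hv0 : ∑ c : Fin (m + 1), (x m ^ (c : ℕ)) (v c : V) = 0 := by rw [← hf, hv]; rfl
    -- With `c + b = m`, multiplication by `x_m^b` shifts `v_c` to the top power. Terms with smaller
    -- index are killed by `d_0 ⋯ d_{m-1}`, and those with larger index are already known to vanish.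
    have key : ∀ b c : ℕ, ∀ hc : c < m + 1, c + b = m → v ⟨c, hc⟩ = 0 := by
      intro b
      induction b using Nat.strong_induction_on with
      | _ b ih =>
        intro c hc hcb
        have h1 := congrArg (fun w => ascProd d 0 m ((x m ^ b) w)) hv0
        simp only [map_sum, map_zero] at h1
        rw [Finset.sum_eq_single ⟨c, hc⟩] at h1
        · rw [← Module.End.mul_apply (x m ^ b), ← pow_add, show b + c = m by omega,
            (h.ascProd_apply_pow hm (v ⟨c, hc⟩).2 m 0 m (by omega)).2 rfl] at h1
          have h2 : IsUnit ((-1 : k) ^ m) := (isUnit_one.neg).pow m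
          exact Subtype.ext ((smul_eq_zero_iff_right h2.ne_zero).1 h1)
        · intro c' _ hcc
          rcases lt_or_gt_of_ne (fun e => hcc (Fin.ext e) : (c' : ℕ) ≠ c) with hlt | hgt
          · rw [← Module.End.mul_apply (x m ^ b), ← pow_add,
              (h.ascProd_apply_pow hm (v c').2 (b + c') 0 m (by omega)).1 (by omega)]
          · have := ih (m - c') (by omega) c' c'.2 (by omega)
            rw [show v c' = 0 from this]
            simp
        · intro hc'; exact absurd (Finset.mem_univ _) hc'
    funext c
    exact key (m - c) c c.2 (by omega)
  have := LinearMap.finrank_le_finrank_of_injective hinj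
  rwa [Module.finrank_pi_fintype, Finset.sum_const, Finset.card_univ, Fintype.card_fin,
    smul_eq_mul] at this

/-- If `w` is killed by `d_0, …, d_{m-2}`, then `d_0 ⋯ d_{m-1} w` is killed by all `d_j` with `j <
m`. If these vectors vanish for all `w = x_m^c v`, the commutation rule with `x_m` strips the
factors of the product one at a time from the left, until `v = 0`. -/
lemma killed_succ_ne_bot (h : IsNilHecke n x d) {m : ℕ} (hm : m < n) (hne : killed d m ≠ ⊥) :
    killed d (m + 1) ≠ ⊥ := by
  obtain ⟨v, hv, hv0⟩ := Submodule.exists_mem_ne_zero_of_ne_bot hne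
  intro hbot
  have h0 : ∀ c, ascProd d 0 m ((x m ^ c) v) = 0 := by
    intro c
    have hw := h.x_pow_mem_killed hm c hv
    set w := (x m ^ c) v
    have : ascProd d 0 m w ∈ killed d (m + 1) := by
      intro j hj
      cases j with
      | zero =>
        obtain ⟨m, rfl⟩ : ∃ m', m = m' + 1 := ⟨m - 1, by omega⟩
        rw [ascProd, ← Module.End.mul_apply, ← mul_assoc, h.dd 0 (by omega), zero_mul]; rfl
      | succ j =>
        rw [← Module.End.mul_apply, h.d_succ_mul_ascProd m j 0 (by omega) (by omega) (by omega),
          Module.End.mul_apply, hw j (by omega), map_zero]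
    rw [hbot] at this
    exact this
  have h1 : ∀ j l, j + l = m → ∀ c, ascProd d j l ((x m ^ c) v) = 0 := by
    intro j
    induction j with
    | zero => intro l hl c; obtain rfl : l = m := by omega
              exact h0 c
    | succ j ih =>
      intro l hl c
      have e := h.ascProd_apply_x hm (j := j) (l := l) (by omega) (h.x_pow_mem_killed hm c hv)
      rw [← Module.End.mul_apply (x m), ← pow_succ', ih (l + 1) (by omega),
        ih (l + 1) (by omega), map_zero, zero_sub] at e
      exact neg_eq_zero.1 e.symm
  have := h1 m 0 (by omega) 0
  exact hv0 (by simpa [ascProd] using this)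

lemma killed_ne_bot [Nontrivial V] (h : IsNilHecke n x d) : killed d n ≠ ⊥ := by
  have : ∀ m ≤ n, killed d m ≠ ⊥ := by
    intro m
    induction m with
    | zero =>
      intro _ h0
      obtain ⟨v, hv⟩ := exists_ne (0 : V)
      have : v ∈ killed d 0 := fun j hj => by omega
      rw [h0] at this
      exact hv this
    | succ m ih => intro hm; exact h.killed_succ_ne_bot (by omega) (ih (by omega))
  exact this n le_rfl

lemma factorial_mul_finrank_killed_le [FiniteDimensional k V] (h : IsNilHecke n x d) :
    n.factorial * Module.finrank k (killed d n) ≤ Module.finrank k V := by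
  have : ∀ m ≤ n, m.factorial * Module.finrank k (killed d m) ≤ Module.finrank k V := by
    intro m
    induction m with
    | zero => intro _; simpa using Submodule.finrank_le (killed d 0)
    | succ m ih =>
      intro hm
      refine le_trans ?_ (ih (by omega))
      rw [Nat.factorial_succ, mul_comm (m + 1), mul_assoc]
      exact Nat.mul_le_mul_left _ (h.finrank_killed_succ (by omega))
  exact this n le_rfl

lemma factorial_le_finrank [FiniteDimensional k V] [Nontrivial V] (h : IsNilHecke n x d) :
    n.factorial ≤ Module.finrank k V := by
  refine le_trans ?_ h.factorial_mul_finrank_killed_le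
  have : 0 < Module.finrank k (killed d n) := by
    rw [Nat.pos_iff_ne_zero, Ne, Submodule.finrank_eq_zero]
    exact h.killed_ne_bot
  exact Nat.le_mul_of_pos_right _ this

/-- A nonzero space with two commuting actions has dimension at least `(n!)²`. -/
lemma factorial_sq_le_finrank [FiniteDimensional k V] [Nontrivial V] (h : IsNilHecke n x d)
    {x' d' : ℕ → Module.End k V} (h' : IsNilHecke n x' d')
    (hx : ∀ i j, d i * x' j = x' j * d i) (hd : ∀ i j, d i * d' j = d' j * d i) :
    n.factorial * n.factorial ≤ Module.finrank k V := by
  refine le_trans ?_ h.factorial_mul_finrank_killed_le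
  refine Nat.mul_le_mul_left _ ?_
  -- The second action commutes with the `d_j` and so preserves the killed subspace, which therefore
  -- has dimension at least `n!` itself.
  have : Nontrivial (killed d n) := Submodule.nontrivial_iff_ne_bot.2 h.killed_ne_bot
  refine (h'.restrict (killed d n) ?_ ?_).factorial_le_finrank
  · intro j v hv i hi
    rw [← Module.End.mul_apply, hx, Module.End.mul_apply, hv i hi, map_zero]
  · intro j v hv i hi
    rw [← Module.End.mul_apply, hd, Module.End.mul_apply, hv i hi, map_zero]

end LowerBound

/-! ### Subspaces stable under left and right multiplication -/

section Ideal

variable {k : Type*} [Field k] {A : Type*} [Ring A] [Algebra k A] [FiniteDimensional k A] {n : ℕ}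
  {x d : ℕ → A}

/-- A nonzero subspace of an algebra that is stable under left and right multiplication by the
generators has dimension at least `(n!)²`. -/
lemma factorial_sq_le_finrank_ideal (h : IsNilHecke n x d) (I : Submodule k A) (hI : I ≠ ⊥)
    (hxl : ∀ j, ∀ y ∈ I, x j * y ∈ I) (hdl : ∀ j, ∀ y ∈ I, d j * y ∈ I)
    (hxr : ∀ j, ∀ y ∈ I, y * x j ∈ I) (hdr : ∀ j, ∀ y ∈ I, y * d j ∈ I) :
    n.factorial * n.factorial ≤ Module.finrank k I := by
  have : Nontrivial I := Submodule.nontrivial_iff_ne_bot.2 hI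
  refine ((h.map (Algebra.lmul k A)).restrict I hxl hdl).factorial_sq_le_finrank
    ((h.op.map (Algebra.lsmul k k A)).restrict I hxr hdr) ?_ ?_
  · exact fun i j => LinearMap.ext fun y => Subtype.ext (mul_assoc (d i) y.1 (x j)).symm
  · exact fun i j => LinearMap.ext fun y => Subtype.ext (mul_assoc (d i) y.1 (d j)).symm

end Ideal

end IsNilHecke

end NilHecke

end SlTwo

namespace SlTwo

/-! ### From affine Hecke algebras to nil affine Hecke algebras -/

section HeckeToNil

lemma mul_inv_comm_of_comm {A : Type*} [Ring A] {a y z : A} (h1 : y * z = 1) (h2 : z * y = 1)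
    (h : a * y = y * a) : a * z = z * a := by
  calc a * z = z * y * a * z := by rw [h2, one_mul]
    _ = z * (a * y) * z := by rw [h, mul_assoc z y a]
    _ = z * a * (y * z) := by simp only [mul_assoc]
    _ = z * a := by rw [h1, mul_one]

lemma isUnit_smul_one_add {k : Type*} [Field k] {A : Type*} [Ring A] [Algebra k A] {y : A}
    (hy : IsNilpotent y) {c : k} (hc : c ≠ 0) : IsUnit (y + c • (1 : A)) := by
  have hu : IsUnit (c • (1 : A)) := by
    rw [← Algebra.algebraMap_eq_smul_one]; exact (isUnit_iff_ne_zero.2 hc).map _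
  exact hy.isUnit_add_right_of_commute hu ((Commute.one_right y).smul_right c)

/-- A nonzero scalar plus a nilpotent element of `S` is already invertible in `S`, and inverses are
unique. In this way the inverses of the `X_j` and of the elements `X_{j+1} - q X_j - κ` stay inside
subalgebras generated by the `X_j` and `T_j`. -/
lemma mem_of_mul_eq_one {k : Type*} [Field k] {A : Type*} [Ring A] [Algebra k A]
    (S : Subalgebra k A) {y z : A} (hyS : y ∈ S) (hy : IsNilpotent y) {c : k} (hc : c ≠ 0)
    (hz : (y + c • (1 : A)) * z = 1) : z ∈ S := by
  have hn : IsNilpotent (⟨y, hyS⟩ : S) := by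
    obtain ⟨N, hN⟩ := hy
    exact ⟨N, Subtype.ext hN⟩
  obtain ⟨w, hw⟩ := (isUnit_smul_one_add hn hc).exists_left_inv
  have hw' : (w : A) * (y + c • (1 : A)) = 1 := congrArg Subtype.val hw
  have : z = w := by
    calc z = (w : A) * (y + c • (1 : A)) * z := by rw [hw', one_mul]
      _ = w := by rw [mul_assoc, hz, mul_one]
  rw [this]; exact w.2

variable {k : Type u} [Field k]

/-- The relations of the (degenerate if `q = 1`) affine Hecke algebra, with `X_j - a`
nilpotent. -/
structure IsHecke {A : Type*} [Ring A] [Algebra k A] (p : Param k) (n : ℕ) (X T : ℕ → A) :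
    Prop where
  XX : ∀ i j, i < n → j < n → X i * X j = X j * X i
  quad : ∀ j, j + 1 < n → T j * T j = (p.q - 1) • T j + p.q • (1 : A)
  TT : ∀ i j, i + 1 < j → j + 1 < n → T i * T j = T j * T i
  braid : ∀ j, j + 2 < n → T j * T (j + 1) * T j = T (j + 1) * T j * T (j + 1)
  XT : ∀ i j, i < n → j + 1 < n → i ≠ j → i ≠ j + 1 → X i * T j = T j * X i
  affine : p.q ≠ 1 → ∀ j, j + 1 < n → T j * X j * T j = p.q • X (j + 1)
  affine_degenerate : p.q = 1 → ∀ j, j + 1 < n → X (j + 1) * T j = T j * X j + 1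
  nilpotent : ∀ j, j < n → IsNilpotent (X j - p.a • (1 : A))

/-- `1` in the degenerate case and `0` otherwise. -/
def Param.kappa (p : Param k) : k := open scoped Classical in if p.q = 1 then 1 else 0

/-- The constant term of `X_{j+1} - q X_j - κ` at `X = (a, a)`. -/
def Param.kappaZero (p : Param k) : k := (1 - p.q) * p.a - p.kappa

/-- The value is `-1` for `q = 1` and `(1 - q) a` otherwise; the second case needs `a ≠ 0`. -/
lemma Param.kappaZero_ne_zero (p : Param k) : p.kappaZero ≠ 0 := by
  unfold Param.kappaZero Param.kappa
  by_cases h : p.q = 1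
  · simp [h]
  · simp [h, p.a_ne_zero h, sub_eq_zero, Ne.symm h]

namespace IsHecke

variable {A : Type*} [Ring A] [Algebra k A] {p : Param k} {n : ℕ} {X T : ℕ → A}

lemma map {A' : Type*} [Ring A'] [Algebra k A'] (f : A →ₐ[k] A') (h : IsHecke p n X T) :
    IsHecke p n (fun j => f (X j)) (fun j => f (T j)) where
  XX i j hi hj := by simp only [← map_mul, h.XX i j hi hj]
  quad j hj := by simp only [← map_mul, h.quad j hj, map_add, map_smul, map_one]
  TT i j hij hj := by simp only [← map_mul, h.TT i j hij hj]
  braid j hj := by simp only [← map_mul, h.braid j hj]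
  XT i j hi hj h1 h2 := by simp only [← map_mul, h.XT i j hi hj h1 h2]
  affine hq j hj := by simp only [← map_mul, h.affine hq j hj, map_smul]
  affine_degenerate hq j hj := by
    simp only [← map_mul, h.affine_degenerate hq j hj, map_add, map_one]
  nilpotent j hj := by
    simpa only [map_sub, map_smul, map_one] using (h.nilpotent j hj).map f

/-- The constant `κ` makes the crossing relation uniform in `q`. For `q ≠ 1` it results from `T_j
X_j T_j = q X_{j+1}` by multiplication with `T_j` on the right, the quadratic relation, and
cancellation of `q`. -/
lemma T_mul_X (h : IsHecke p n X T) {j : ℕ} (hj : j + 1 < n) :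
    T j * X j = X (j + 1) * T j + (1 - p.q) • X (j + 1) - p.kappa • (1 : A) := by
  unfold Param.kappa
  by_cases hq : p.q = 1
  · rw [h.affine_degenerate hq j hj]; simp [hq]
  · have h1 := congrArg (· * T j) (h.affine hq j hj)
    rw [mul_assoc, h.quad j hj, mul_add, mul_smul_comm, mul_smul_comm, mul_one,
      h.affine hq j hj, smul_mul_assoc, smul_comm, ← smul_add] at h1
    have h2 := smul_right_injective _ p.q_ne_zero h1
    simp only [hq, if_false]
    rw [← h2]; module

lemma T_mul_X_succ (h : IsHecke p n X T) {j : ℕ} (hj : j + 1 < n) :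
    T j * X (j + 1) = X j * T j + (p.q - 1) • X (j + 1) + p.kappa • (1 : A) := by
  unfold Param.kappa
  by_cases hq : p.q = 1
  · have hsq : T j * T j = 1 := by rw [h.quad j hj, hq]; simp
    have h1 : T j * (X (j + 1) * T j) * T j = X j * T j + T j * T j := by
      rw [h.affine_degenerate hq j hj, mul_add, mul_one, ← mul_assoc, hsq, one_mul, add_mul, hsq]
    rw [mul_assoc, mul_assoc, hsq, mul_one] at h1
    rw [h1]; simp [hq]
  · have h1 := congrArg (T j * ·) (h.affine hq j hj)
    rw [← mul_assoc, ← mul_assoc, h.quad j hj, add_mul, add_mul, smul_mul_assoc, smul_mul_assoc,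
      smul_mul_assoc, smul_mul_assoc, one_mul, h.affine hq j hj, mul_smul_comm, smul_comm,
      ← smul_add] at h1
    have h2 := smul_right_injective _ p.q_ne_zero h1
    simp only [hq, if_false]
    rw [← h2]; module

/-- The element `X_{j+1} - q X_j - κ`. -/
def factor (p : Param k) (X : ℕ → A) (j : ℕ) : A := X (j + 1) - p.q • X j - p.kappa • (1 : A)

/-- The divided difference elements `d_j`, defined by `T_j = q + (X_{j+1} - q X_j - κ) d_j`. -/
def divDiff (p : Param k) (X T : ℕ → A) (j : ℕ) : A :=
  Ring.inverse (factor p X j) * (T j - p.q • (1 : A))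

lemma isNilpotent_comb (h : IsHecke p n X T) {i j : ℕ} (hi : i < n) (hj : j < n) (c : k) :
    IsNilpotent ((X i - p.a • (1 : A)) - c • (X j - p.a • (1 : A))) := by
  refine Commute.isNilpotent_sub ?_ (h.nilpotent i hi) ((h.nilpotent j hj).smul c)
  refine Commute.smul_right ?_ c
  exact ((show Commute (X i) (X j) from h.XX i j hi hj).sub_right
    ((Commute.one_right _).smul_right _)).sub_left
    (((Commute.one_left _).smul_left _))

/-- The element is a nonzero scalar plus the nilpotent element `(X_i - a) - q (X_j - a)`. -/
lemma isUnit_comb (h : IsHecke p n X T) {i j : ℕ} (hi : i < n) (hj : j < n) :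
    IsUnit (X i - p.q • X j - p.kappa • (1 : A)) := by
  have := isUnit_smul_one_add (h.isNilpotent_comb hi hj p.q) p.kappaZero_ne_zero
  convert this using 1
  unfold Param.kappaZero
  module

lemma isUnit_factor (h : IsHecke p n X T) {j : ℕ} (hj : j + 1 < n) : IsUnit (factor p X j) :=
  h.isUnit_comb hj (by omega)

lemma factor_mul_divDiff (h : IsHecke p n X T) {j : ℕ} (hj : j + 1 < n) :
    factor p X j * divDiff p X T j = T j - p.q • (1 : A) := by
  rw [divDiff, ← mul_assoc, Ring.mul_inverse_cancel _ (h.isUnit_factor hj), one_mul]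

lemma T_eq (h : IsHecke p n X T) {j : ℕ} (hj : j + 1 < n) :
    T j = factor p X j * divDiff p X T j + p.q • (1 : A) := by
  rw [h.factor_mul_divDiff hj, sub_add_cancel]

lemma comm_inverse {a y : A} (hy : IsUnit y) (h : a * y = y * a) :
    a * Ring.inverse y = Ring.inverse y * a :=
  mul_inv_comm_of_comm (Ring.mul_inverse_cancel _ hy) (Ring.inverse_mul_cancel _ hy) h

lemma X_comm_factor (h : IsHecke p n X T) {i j : ℕ} (hi : i < n) (hj : j + 1 < n) :
    X i * factor p X j = factor p X j * X i := by
  simp only [factor, mul_sub, sub_mul, mul_smul_comm, smul_mul_assoc, mul_one, one_mul,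
    h.XX i (j + 1) hi hj, h.XX i j hi (by omega)]

lemma divDiff_X (h : IsHecke p n X T) {j : ℕ} (hj : j + 1 < n) :
    divDiff p X T j * X j = X (j + 1) * divDiff p X T j + 1 := by
  have h1 : (T j - p.q • (1 : A)) * X j = X (j + 1) * (T j - p.q • (1 : A)) + factor p X j := by
    rw [sub_mul, h.T_mul_X hj, factor, mul_sub, smul_mul_assoc, mul_smul_comm, one_mul, mul_one]
    module
  rw [divDiff, mul_assoc, h1, mul_add, Ring.inverse_mul_cancel _ (h.isUnit_factor hj),
    ← mul_assoc, ← comm_inverse (h.isUnit_factor hj) (h.X_comm_factor hj hj), mul_assoc]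

lemma X_divDiff (h : IsHecke p n X T) {j : ℕ} (hj : j + 1 < n) :
    X j * divDiff p X T j = divDiff p X T j * X (j + 1) + 1 := by
  have h1 : X j * (T j - p.q • (1 : A)) = (T j - p.q • (1 : A)) * X (j + 1) + factor p X j := by
    rw [sub_mul, h.T_mul_X_succ hj, factor, mul_sub, smul_mul_assoc, mul_smul_comm, one_mul,
      mul_one]
    module
  have hj' : j < n := by omega
  rw [divDiff, ← mul_assoc, comm_inverse (h.isUnit_factor hj) (h.X_comm_factor hj' hj), mul_assoc,
    h1, mul_add, Ring.inverse_mul_cancel _ (h.isUnit_factor hj), mul_assoc]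

lemma divDiff_X_succ (h : IsHecke p n X T) {j : ℕ} (hj : j + 1 < n) :
    divDiff p X T j * X (j + 1) = X j * divDiff p X T j - 1 := by
  rw [h.X_divDiff hj, add_sub_cancel_right]

lemma sub_q_sq (h : IsHecke p n X T) {j : ℕ} (hj : j + 1 < n) :
    (T j - p.q • (1 : A)) * (T j - p.q • (1 : A)) =
      -((1 + p.q) • (T j - p.q • (1 : A))) := by
  simp only [mul_sub, sub_mul, h.quad j hj, mul_smul_comm, smul_mul_assoc, mul_one, one_mul]
  module

/-- Let `u = X_{j+1} - q X_j - κ`, and let `u'` be obtained by exchanging the two variables, so that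
`d u = u' d - (1 + q)`. Substituting `T_j - q = u d` in the quadratic relation leaves `u u' d² = 0`,
and both factors are units. -/
lemma divDiff_sq (h : IsHecke p n X T) {j : ℕ} (hj : j + 1 < n) :
    divDiff p X T j * divDiff p X T j = 0 := by
  set d := divDiff p X T j with hd
  set u := factor p X j with hu
  set u' := X j - p.q • X (j + 1) - p.kappa • (1 : A) with hu'
  have h1 : d * u = u' * d - (1 + p.q) • (1 : A) := by
    simp only [hu, factor, hu', mul_sub, sub_mul, mul_smul_comm, smul_mul_assoc, mul_one, one_mul]
    rw [h.divDiff_X_succ hj, h.divDiff_X hj]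
    module
  have h2 := h.sub_q_sq hj
  rw [← h.factor_mul_divDiff hj, ← hu, ← hd] at h2
  have h3 : u * d * (u * d) = u * u' * (d * d) - (1 + p.q) • (u * d) := by
    rw [mul_assoc, ← mul_assoc d, h1]
    simp only [mul_sub, sub_mul, mul_smul_comm, smul_mul_assoc, one_mul, mul_assoc]
  have h4 : u * u' * (d * d) = 0 := by
    have := h3.symm.trans h2
    rw [sub_eq_add_neg] at this
    exact add_eq_right.1 this
  exact (((h.isUnit_factor hj).mul (h.isUnit_comb (by omega) hj)).mul_right_eq_zero).1 h4

lemma factor_comm_factor (h : IsHecke p n X T) {i j : ℕ} (hi : i + 1 < n) (hj : j + 1 < n) :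
    factor p X i * factor p X j = factor p X j * factor p X i := by
  rw [factor, sub_mul, sub_mul, mul_sub, mul_sub]
  simp only [smul_mul_assoc, mul_smul_comm, one_mul, mul_one, h.X_comm_factor hi hj,
    h.X_comm_factor (show i < n by omega) hj]

lemma X_comm_divDiff (h : IsHecke p n X T) {i j : ℕ} (hi : i < n) (hj : j + 1 < n) (h1 : i ≠ j)
    (h2 : i ≠ j + 1) : X i * divDiff p X T j = divDiff p X T j * X i := by
  rw [divDiff, ← mul_assoc, comm_inverse (h.isUnit_factor hj) (h.X_comm_factor hi hj), mul_assoc,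
    mul_assoc, mul_sub, h.XT i j hi hj h1 h2, sub_mul]
  simp

lemma divDiff_comm (h : IsHecke p n X T) {i j : ℕ} (hij : i + 1 < j) (hj : j + 1 < n) :
    divDiff p X T i * divDiff p X T j = divDiff p X T j * divDiff p X T i := by
  have hi : i + 1 < n := by omega
  have e1 : divDiff p X T i * factor p X j = factor p X j * divDiff p X T i := by
    simp only [factor, mul_sub, sub_mul, smul_mul_assoc, mul_smul_comm, one_mul, mul_one,
      h.X_comm_divDiff hj hi (by omega) (by omega),
      h.X_comm_divDiff (show j < n by omega) hi (by omega) (by omega)]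
  have e2 : T j * factor p X i = factor p X i * T j := by
    simp only [factor, mul_sub, sub_mul, smul_mul_assoc, mul_smul_comm, one_mul, mul_one,
      h.XT (i + 1) j (by omega) hj (by omega) (by omega),
      h.XT i j (by omega) hj (by omega) (by omega)]
  have e3 : T j * divDiff p X T i = divDiff p X T i * T j := by
    rw [divDiff, ← mul_assoc, comm_inverse (h.isUnit_factor hi) e2, mul_assoc, mul_assoc, mul_sub,
      ← h.TT i j hij hj, sub_mul]
    simp
  conv_lhs => rw [divDiff.eq_1 p X T j]
  rw [← mul_assoc, comm_inverse (h.isUnit_factor hj) e1, divDiff.eq_1 p X T j, mul_assoc,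
    mul_assoc, mul_sub, ← e3, sub_mul]
  simp

/-- In terms of `t_j = T_j - q`, the braid relation says that `t_1 t_2 t_1 - q t_1` is symmetric in
the two indices. Writing `t_j = u_j d_j` and moving all factors in the `X`'s to the left turns this
expression into `u_1 u_3 u_2 d_1 d_2 d_1`, where `u_3` belongs to the outer pair of variables. The
product of the `u`'s is the same unit on both sides and can be cancelled. -/
lemma divDiff_braid (h : IsHecke p n X T) {j : ℕ} (hj : j + 2 < n) :
    divDiff p X T j * divDiff p X T (j + 1) * divDiff p X T j =
      divDiff p X T (j + 1) * divDiff p X T j * divDiff p X T (j + 1) := by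
  have hj1 : j + 1 < n := by omega
  have hj2 : j + 1 + 1 < n := by omega
  have hj0 : j < n := by omega
  have ht1 := h.factor_mul_divDiff hj1
  have ht2 := h.factor_mul_divDiff hj2
  have hs1 := h.sub_q_sq hj1
  have hs2 := h.sub_q_sq hj2
  have hb := h.braid j hj
  have c1 : divDiff p X T j * factor p X (j + 1) =
      (X (j + 2) - p.q • X j - p.kappa • (1 : A)) * divDiff p X T j + p.q • (1 : A) := by
    simp only [factor, mul_sub, sub_mul, smul_mul_assoc, mul_smul_comm, one_mul, mul_one]
    rw [h.divDiff_X_succ hj1, h.X_comm_divDiff (i := j + 1 + 1) hj2 hj1 (by omega) (by omega)]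
    module
  have c2 : divDiff p X T (j + 1) * factor p X j =
      (X (j + 2) - p.q • X j - p.kappa • (1 : A)) * divDiff p X T (j + 1) + (1 : A) := by
    simp only [factor, mul_sub, sub_mul, smul_mul_assoc, mul_smul_comm, one_mul, mul_one]
    rw [h.divDiff_X hj2, h.X_comm_divDiff (i := j) hj0 hj2 (by omega) (by omega)]
    module
  have c3 : divDiff p X T j * (X (j + 2) - p.q • X j - p.kappa • (1 : A)) =
      factor p X (j + 1) * divDiff p X T j - p.q • (1 : A) := by
    simp only [factor, mul_sub, sub_mul, smul_mul_assoc, mul_smul_comm, one_mul, mul_one]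
    rw [h.divDiff_X hj1, h.X_comm_divDiff (i := j + 2) hj2 hj1 (by omega) (by omega)]
    module
  have c4 : divDiff p X T (j + 1) * (X (j + 2) - p.q • X j - p.kappa • (1 : A)) =
      factor p X j * divDiff p X T (j + 1) - (1 : A) := by
    simp only [factor, mul_sub, sub_mul, smul_mul_assoc, mul_smul_comm, one_mul, mul_one]
    rw [h.divDiff_X_succ hj2, h.X_comm_divDiff (i := j) hj0 hj2 (by omega) (by omega)]
    module
  have hu3 : IsUnit (X (j + 2) - p.q • X j - p.kappa • (1 : A)) := h.isUnit_comb hj (by omega)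
  have hu1 := h.isUnit_factor hj1
  have hu2 := h.isUnit_factor hj2
  have hc12 := h.factor_comm_factor hj1 hj2
  have hc3 : ∀ i, i + 1 < n → (X (j + 2) - p.q • X j - p.kappa • (1 : A)) * factor p X i =
      factor p X i * (X (j + 2) - p.q • X j - p.kappa • (1 : A)) := fun i hi => by
    simp only [sub_mul, mul_sub, smul_mul_assoc, mul_smul_comm, one_mul, mul_one,
      h.X_comm_factor hj hi, h.X_comm_factor hj0 hi]
  have hd1 := h.divDiff_sq hj1
  have hd2 := h.divDiff_sq hj2
  have hc31 := hc3 j hj1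
  have hc32 := hc3 (j + 1) hj2
  clear hc3
  -- From here on only the crossing rules `c1` to `c4`, `d_i² = 0` and the commutation of the `u`'s
  -- are used, so everything else is made opaque.
  generalize (X (j + 2) - p.q • X j - p.kappa • (1 : A)) = u3 at *
  generalize divDiff p X T j = d1 at *
  generalize divDiff p X T (j + 1) = d2 at *
  generalize factor p X j = u1 at *
  generalize factor p X (j + 1) = u2 at *
  have e1 : u1 * d1 * (u2 * d2) * (u1 * d1) = u1 * u3 * u2 * (d1 * d2 * d1) + p.q • (u1 * d1) := by
    calc u1 * d1 * (u2 * d2) * (u1 * d1) = u1 * (d1 * u2) * (d2 * u1) * d1 := by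
          simp only [mul_assoc]
      _ = u1 * u3 * (d1 * u3) * d2 * d1 + u1 * u3 * (d1 * d1) + p.q • (u1 * u3 * d2 * d1)
            + p.q • (u1 * d1) := by
          rw [c1, c2]
          simp only [mul_add, add_mul, mul_smul_comm, smul_mul_assoc, mul_one, mul_assoc]
          module
      _ = _ := by
          rw [c3, hd1]
          simp only [mul_sub, sub_mul, mul_smul_comm, smul_mul_assoc, mul_one, mul_assoc,
            mul_zero]
          module
  have e2 : u2 * d2 * (u1 * d1) * (u2 * d2) = u1 * u3 * u2 * (d2 * d1 * d2) + p.q • (u2 * d2) := by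
    calc u2 * d2 * (u1 * d1) * (u2 * d2) = u2 * (d2 * u1) * (d1 * u2) * d2 := by
          simp only [mul_assoc]
      _ = u2 * u3 * (d2 * u3) * d1 * d2 + p.q • (u2 * u3 * (d2 * d2)) + u2 * u3 * d1 * d2
            + p.q • (u2 * d2) := by
          rw [c1, c2]
          simp only [mul_add, add_mul, mul_smul_comm, smul_mul_assoc, mul_one, mul_assoc]
          module
      _ = u2 * u3 * u1 * (d2 * d1 * d2) + p.q • (u2 * d2) := by
          rw [c4, hd2]
          simp only [mul_sub, sub_mul, mul_one, mul_assoc,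
            mul_zero]
          module
      _ = _ := by
          have : u2 * u3 * u1 = u1 * u3 * u2 := by
            rw [mul_assoc, hc31, ← mul_assoc, ← hc12, mul_assoc, ← hc32, ← mul_assoc]
          rw [this]
  have e3 : u1 * d1 * (u2 * d2) * (u1 * d1) - p.q • (u1 * d1) =
      u2 * d2 * (u1 * d1) * (u2 * d2) - p.q • (u2 * d2) := by
    have h1 : T j = u1 * d1 + p.q • (1 : A) := by rw [ht1]; simp
    have h2 : T (j + 1) = u2 * d2 + p.q • (1 : A) := by rw [ht2]; simp
    rw [← ht1] at hs1
    rw [← ht2] at hs2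
    rw [h1, h2] at hb
    generalize u1 * d1 = t1 at *
    generalize u2 * d2 = t2 at *
    simp only [mul_add, add_mul, mul_smul_comm, smul_mul_assoc, mul_one, one_mul, hs1, hs2] at hb
    have hb' := sub_eq_zero.2 hb
    rw [← sub_eq_zero, ← hb']
    module
  rw [e1, e2, add_sub_cancel_right, add_sub_cancel_right] at e3
  exact ((hu1.mul hu3).mul hu2).mul_left_cancel e3

lemma isNilHecke (h : IsHecke p n X T) : IsNilHecke n X (divDiff p X T) where
  xx := h.XX
  dd _ hj := h.divDiff_sq hj
  dd_comm _ _ hij hj := h.divDiff_comm hij hj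
  braid _ hj := h.divDiff_braid hj
  xd _ _ hi hj h1 h2 := h.X_comm_divDiff hi hj h1 h2
  dx _ hj := h.divDiff_X hj
  xd_self _ hj := h.X_divDiff hj

end IsHecke

/-- Apart from commutation relations, the `x_j` enter only through expressions that do not change
under a common scalar shift. The shift by `a` makes them nilpotent. -/
lemma IsNilHecke.shift {A : Type*} [Ring A] [Algebra k A] {n : ℕ} {x d : ℕ → A}
    (h : IsNilHecke n x d) (c : k) : IsNilHecke n (fun j => x j - c • (1 : A)) d where
  xx i j hi hj := by
    simp only [mul_sub, sub_mul, h.xx i j hi hj, smul_mul_assoc, mul_smul_comm, mul_one, one_mul]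
    module
  dd := h.dd
  dd_comm := h.dd_comm
  braid := h.braid
  xd i j hi hj h1 h2 := by
    simp only [mul_sub, sub_mul, h.xd i j hi hj h1 h2, smul_mul_assoc, mul_smul_comm, mul_one,
      one_mul]
  dx j hj := by
    simp only [mul_sub, sub_mul, h.dx j hj, smul_mul_assoc, mul_smul_comm, mul_one, one_mul]
    module
  xd_self j hj := by
    simp only [mul_sub, sub_mul, h.xd_self j hj, smul_mul_assoc, mul_smul_comm, mul_one, one_mul]
    module

namespace IsHecke

variable {A : Type*} [Ring A] [Algebra k A] {p : Param k} {n : ℕ} {X T : ℕ → A}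

/-- The elements `X_j - a` and `d_j` satisfy the nil affine Hecke relations. -/
lemma isNilHecke_shift (h : IsHecke p n X T) :
    IsNilHecke n (fun j => X j - p.a • (1 : A)) (divDiff p X T) := h.isNilHecke.shift p.a

/-- The only point is that the inverse of `X_{j+1} - q X_j - κ` lies in `S`; this holds because the
element is a nonzero scalar plus a nilpotent element of `S`. -/
lemma divDiff_mem (h : IsHecke p n X T) (S : Subalgebra k A) {j : ℕ} (hj : j + 1 < n)
    (h0 : X j ∈ S) (h1 : X (j + 1) ∈ S) (hT : T j ∈ S) : divDiff p X T j ∈ S := by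
  have hx : ∀ i, X i ∈ S → X i - p.a • (1 : A) ∈ S := fun i hi =>
    sub_mem hi (S.smul_mem (one_mem S) _)
  refine mul_mem ?_ (sub_mem hT (S.smul_mem (one_mem S) _))
  refine mem_of_mul_eq_one S (sub_mem (hx _ h1) (S.smul_mem (hx _ h0) p.q))
    (h.isNilpotent_comb hj (by omega) p.q) p.kappaZero_ne_zero ?_
  refine Eq.trans ?_ (Ring.mul_inverse_cancel _ (h.isUnit_factor hj))
  congr 1
  rw [factor, Param.kappaZero]
  module

/-- The subalgebra generated by the `X_j - a` and the `d_j` is generated by the `X_j` and `T_j`. -/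
lemma nilSub_le_iff (h : IsHecke p n X T) {m : ℕ} (hm : m ≤ n) (S : Subalgebra k A) :
    IsNilHecke.nilSub k (fun j => X j - p.a • (1 : A)) (divDiff p X T) m ≤ S ↔
      (∀ j < m, X j ∈ S) ∧ ∀ j, j + 1 < m → T j ∈ S := by
  constructor
  · intro hle
    have hX : ∀ j < m, X j ∈ S := fun j hj => by
      have := hle (IsNilHecke.x_mem_nilSub (k := k) (x := fun j => X j - p.a • (1 : A))
        (d := divDiff p X T) hj)
      rw [← sub_add_cancel (X j) (p.a • (1 : A))]
      exact add_mem this (S.smul_mem (one_mem S) _)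
    refine ⟨hX, fun j hj => ?_⟩
    rw [h.T_eq (show j + 1 < n by omega)]
    refine add_mem (mul_mem ?_ (hle (IsNilHecke.d_mem_nilSub hj))) (S.smul_mem (one_mem S) _)
    exact sub_mem (sub_mem (hX _ hj) (S.smul_mem (hX j (by omega)) _)) (S.smul_mem (one_mem S) _)
  · rintro ⟨hX, hT⟩
    refine Algebra.adjoin_le ?_
    rintro _ (⟨j, hj, rfl⟩ | ⟨j, hj, rfl⟩)
    · exact sub_mem (hX j hj) (S.smul_mem (one_mem S) _)
    · have hj : j + 1 < m := hj
      exact h.divDiff_mem S (by omega) (hX _ (by omega)) (hX _ hj) (hT _ hj)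

end IsHecke

/-- Commutation of `d_j` with polynomials in the `x_i`. -/
lemma IsNilHecke.d_mul_poly {A : Type*} [Ring A] [Algebra k A] {n : ℕ} {x d : ℕ → A}
    (h : IsNilHecke n x d) (ev : MvPolynomial (Fin n) k →ₐ[k] A)
    (hev : ∀ i : Fin n, ev (MvPolynomial.X i) = x i) {j : ℕ} (hj : j + 1 < n)
    (f : MvPolynomial (Fin n) k) :
    ∃ g, (MvPolynomial.X ⟨j, by omega⟩ - MvPolynomial.X ⟨j + 1, hj⟩) * g =
        f - MvPolynomial.rename (Equiv.swap (⟨j, by omega⟩ : Fin n) ⟨j + 1, hj⟩) f ∧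
      d j * ev f =
        ev (MvPolynomial.rename (Equiv.swap (⟨j, by omega⟩ : Fin n) ⟨j + 1, hj⟩) f) * d j +
          ev g := by
  induction f using MvPolynomial.induction_on with
  | C c =>
    refine ⟨0, by simp, ?_⟩
    rw [MvPolynomial.rename_C, ← MvPolynomial.algebraMap_eq, AlgHom.commutes, map_zero, add_zero,
      Algebra.commutes]
  | add f g hf hg =>
    obtain ⟨f', h1, h2⟩ := hf
    obtain ⟨g', h3, h4⟩ := hg
    refine ⟨f' + g', ?_, ?_⟩
    · rw [mul_add, h1, h3, map_add]; ring
    · rw [map_add, map_add, map_add, map_add, mul_add, add_mul, h2, h4]; abel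
  | mul_X f i hf =>
    obtain ⟨g, h1, h2⟩ := hf
    set s := Equiv.swap (⟨j, by omega⟩ : Fin n) ⟨j + 1, hj⟩ with hs
    have hj0 : j < n := by omega
    obtain ⟨δ, h3, h4⟩ : ∃ δ : k,
        (MvPolynomial.X ⟨j, hj0⟩ - MvPolynomial.X ⟨j + 1, hj⟩ : MvPolynomial (Fin n) k) *
          MvPolynomial.C δ = MvPolynomial.X i - MvPolynomial.X (s i) ∧
        d j * x i = x (s i) * d j + δ • (1 : A) := by
      by_cases hi : i = ⟨j, hj0⟩
      · refine ⟨1, ?_, ?_⟩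
        · rw [hi, hs, Equiv.swap_apply_left]; simp
        · rw [hi, hs, Equiv.swap_apply_left, one_smul]; exact h.dx j hj
      · by_cases hi' : i = ⟨j + 1, hj⟩
        · refine ⟨-1, ?_, ?_⟩
          · rw [hi', hs, Equiv.swap_apply_right]; simp
          · rw [hi', hs, Equiv.swap_apply_right, neg_smul, one_smul]
            have := h.xd_self j hj
            exact (eq_sub_of_add_eq this.symm).trans (sub_eq_add_neg _ _)
        · refine ⟨0, ?_, ?_⟩
          · rw [hs, Equiv.swap_apply_of_ne_of_ne hi hi']; simp
          · rw [hs, Equiv.swap_apply_of_ne_of_ne hi hi', zero_smul, add_zero]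
            exact (h.xd i j i.2 hj (fun e => hi (Fin.ext e)) (fun e => hi' (Fin.ext e))).symm
    refine ⟨MvPolynomial.rename s f * MvPolynomial.C δ + g * MvPolynomial.X i, ?_, ?_⟩
    · rw [map_mul, MvPolynomial.rename_X]
      linear_combination (MvPolynomial.rename s f) * h3 + MvPolynomial.X i * h1
    · rw [map_mul, hev, ← mul_assoc, h2, add_mul, mul_assoc, h4, map_mul, MvPolynomial.rename_X,
        map_mul, map_add, map_mul, map_mul, hev, hev, ← MvPolynomial.algebraMap_eq,
        AlgHom.commutes, Algebra.algebraMap_eq_smul_one, mul_add, mul_assoc, add_assoc]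

/-- For symmetric `f`, the divided difference `g` satisfies `(X_j - X_{j+1}) g = 0`, and the
polynomial ring is a domain. -/
lemma IsNilHecke.d_comm_symm {A : Type*} [Ring A] [Algebra k A] {n : ℕ} {x d : ℕ → A}
    (h : IsNilHecke n x d) (ev : MvPolynomial (Fin n) k →ₐ[k] A)
    (hev : ∀ i : Fin n, ev (MvPolynomial.X i) = x i) {j : ℕ} (hj : j + 1 < n)
    {f : MvPolynomial (Fin n) k} (hf : f.IsSymmetric) : d j * ev f = ev f * d j := by
  obtain ⟨g, h1, h2⟩ := h.d_mul_poly ev hev hj f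
  rw [hf, sub_self] at h1
  have hne : (MvPolynomial.X ⟨j, by omega⟩ - MvPolynomial.X ⟨j + 1, hj⟩ :
      MvPolynomial (Fin n) k) ≠ 0 := by
    rw [sub_ne_zero]
    intro e
    have := MvPolynomial.X_injective e
    simp at this
  rw [hf, (mul_eq_zero.1 h1).resolve_left hne, map_zero, add_zero] at h2
  exact h2

end HeckeToNil

end SlTwo

namespace SlTwo

/-! ### Dimensions of the algebras `B_i` -/

section Dimension

/-- The product of the factors with index at least `m` is the quotient of `X^n` by a monic
polynomial with coefficients in `k[y_0, …, y_{m-1}]`, so its coefficients lie there too. It is monic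
of degree `n - m` and has `y_m` as a root. -/
lemma pow_mem_span_of_prod_eq {k : Type*} [Field k] {R : Type*} [CommRing R] [Nontrivial R]
    [Algebra k R] {n : ℕ} {y : ℕ → R}
    (h : ∏ i ∈ Finset.range n, (Polynomial.X - Polynomial.C (y i)) = Polynomial.X ^ n)
    {m : ℕ} (hm : m < n) :
    y m ^ (n - m) ∈ Submodule.span k
      {z | ∃ c < n - m, ∃ s ∈ Algebra.adjoin k (y '' Set.Iio m), z = y m ^ c * s} := by
  set P : ℕ → Polynomial R := fun m => ∏ i ∈ Finset.Ico m n, (Polynomial.X - Polynomial.C (y i))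
    with hP
  have hcoeff : ∀ m ≤ n, ∀ c, (P m).coeff c ∈ Algebra.adjoin k (y '' Set.Iio m) := by
    intro m
    induction m with
    | zero =>
      intro _ c
      simp only [hP, ← Finset.range_eq_Ico, h, Polynomial.coeff_X_pow]
      split_ifs
      · exact one_mem _
      · exact zero_mem _
    | succ m ih =>
      intro hm
      have hstep : P m = (Polynomial.X - Polynomial.C (y m)) * P (m + 1) :=
        Finset.prod_eq_prod_Ico_succ_bot (by omega) _
      have hmono : Algebra.adjoin k (y '' Set.Iio m) ≤ Algebra.adjoin k (y '' Set.Iio (m + 1)) :=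
        Algebra.adjoin_mono (Set.image_mono (Set.Iio_subset_Iio (Nat.le_succ m)))
      have hy : y m ∈ Algebra.adjoin k (y '' Set.Iio (m + 1)) :=
        Algebra.subset_adjoin ⟨m, Nat.lt_succ_self m, rfl⟩
      -- Synthetic division by `X - y_m`: the coefficients are found from the top degree downwards,
      -- starting above the degree, where they vanish.
      have key : ∀ e c, (P (m + 1)).natDegree < c + e →
          (P (m + 1)).coeff c ∈ Algebra.adjoin k (y '' Set.Iio (m + 1)) := by
        intro e
        induction e with
        | zero =>
          intro c hc
          rw [Polynomial.coeff_eq_zero_of_natDegree_lt (n := c) hc]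
          exact zero_mem _
        | succ e ihe =>
          intro c hc
          have h1 := congrArg (fun Q => Polynomial.coeff Q (c + 1)) hstep
          simp only [sub_mul, Polynomial.coeff_sub, Polynomial.coeff_X_mul,
            Polynomial.coeff_C_mul] at h1
          have h2 : (P (m + 1)).coeff c = (P m).coeff (c + 1) + y m * (P (m + 1)).coeff (c + 1) := by
            rw [h1]; ring
          rw [h2]
          exact add_mem (hmono (ih (by omega) _)) (mul_mem hy (ihe (c + 1) (by omega)))
      exact fun c => key ((P (m + 1)).natDegree + 1) c (by omega)
  have hmonic : (P m).Monic :=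
    Polynomial.monic_prod_of_monic _ _ fun i _ => Polynomial.monic_X_sub_C _
  have hdeg : (P m).natDegree = n - m := by
    rw [hP, Polynomial.natDegree_prod_of_monic _ _ fun i _ => Polynomial.monic_X_sub_C _]
    simp
  have h0 : (P m).eval (y m) = 0 := by
    rw [hP, Polynomial.eval_prod]
    exact Finset.prod_eq_zero (Finset.mem_Ico.2 ⟨le_rfl, hm⟩) (by simp)
  rw [Polynomial.eval_eq_sum_range, hdeg, Finset.sum_range_succ, ← hdeg, hmonic.coeff_natDegree,
    one_mul, hdeg] at h0
  rw [← neg_eq_of_add_eq_zero_right h0]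
  refine neg_mem (sum_mem fun c hc => Submodule.subset_span ⟨c, Finset.mem_range.1 hc, _,
    hcoeff m hm.le c, mul_comm _ _⟩)

/-! ### A generating family of the right size is a basis -/

section FinrankSpan

variable {k : Type*} [Field k] {A : Type*} [Ring A] [Algebra k A] {ι : Type*} [Fintype ι]

/-- The map `(c_i) ↦ ∑ b_i c_i`. -/
def rightComb (S : Subalgebra k A) (b : ι → A) : (ι → S) →ₗ[k] A :=
  ∑ i, (LinearMap.mulLeft k (b i)) ∘ₗ S.val.toLinearMap ∘ₗ LinearMap.proj i

lemma rightComb_apply (S : Subalgebra k A) (b : ι → A) (c : ι → S) :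
    rightComb S b c = ∑ i, b i * (c i : A) := by
  simp [rightComb]

lemma rightComb_single [DecidableEq ι] (S : Subalgebra k A) (b : ι → A) (i : ι) (s : S) :
    rightComb S b (Pi.single i s) = b i * (s : A) := by
  rw [rightComb_apply, Finset.sum_eq_single i]
  · simp
  · intro j _ hj; simp [hj]
  · intro h; exact absurd (Finset.mem_univ _) h

lemma span_le_range_rightComb (S : Subalgebra k A) (b : ι → A) :
    Submodule.span k {z | ∃ i : ι, ∃ s ∈ S, z = b i * s} ≤ LinearMap.range (rightComb S b) := by
  classical
  refine Submodule.span_le.2 ?_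
  rintro _ ⟨i, s, hs, rfl⟩
  exact ⟨Pi.single i ⟨s, hs⟩, rightComb_single S b i ⟨s, hs⟩⟩

variable [FiniteDimensional k A]

lemma finrank_le_of_le_span {S S' : Subalgebra k A} {b : ι → A}
    (h : Subalgebra.toSubmodule S' ≤ Submodule.span k {z | ∃ i : ι, ∃ s ∈ S, z = b i * s}) :
    Module.finrank k S' ≤ Fintype.card ι * Module.finrank k S := by
  have h1 := Submodule.finrank_mono (h.trans (span_le_range_rightComb S b))
  refine h1.trans ((LinearMap.finrank_range_le _).trans ?_)
  rw [Module.finrank_pi_fintype, Finset.sum_const, Finset.card_univ, smul_eq_mul]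

/-- The source `S^ι` of the spanning map has the dimension of `S'`, so the map is forced to be
injective with image exactly `S'`. -/
lemma existsUnique_of_le_span {S S' : Subalgebra k A} {b : ι → A}
    (h : Subalgebra.toSubmodule S' ≤ Submodule.span k {z | ∃ i : ι, ∃ s ∈ S, z = b i * s})
    (hr : Module.finrank k S' = Fintype.card ι * Module.finrank k S) :
    (∀ i, b i ∈ S') ∧ ∀ y ∈ S', ∃! c : ι → S, ∑ i, b i * (c i : A) = y := by
  classical
  have h0 : Module.finrank k (ι → S) = Module.finrank k S' := by
    rw [Module.finrank_pi_fintype, Finset.sum_const, Finset.card_univ, smul_eq_mul, hr]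
  have h1 := h.trans (span_le_range_rightComb S b)
  have h2 : Subalgebra.toSubmodule S' = LinearMap.range (rightComb S b) := by
    refine Submodule.eq_of_le_of_finrank_le h1 ?_
    refine (LinearMap.finrank_range_le _).trans ?_
    rw [h0]; rfl
  have h3 : Function.Injective (rightComb S b) := by
    rw [← LinearMap.ker_eq_bot, ← Submodule.finrank_eq_zero (R := k)]
    have h4 := LinearMap.finrank_range_add_finrank_ker (rightComb S b)
    rw [← h2, h0] at h4
    exact Nat.add_eq_left.1 h4
  constructor
  · intro i
    have : b i ∈ LinearMap.range (rightComb S b) :=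
      ⟨Pi.single i 1, by rw [rightComb_single]; simp⟩
    rw [← h2] at this
    exact this
  · intro y hy
    have hy' : y ∈ Subalgebra.toSubmodule S' := hy
    rw [h2] at hy'
    obtain ⟨c, hc⟩ := hy'
    refine ⟨c, (rightComb_apply S b c).symm.trans hc, fun c' hc' => h3 ?_⟩
    rw [rightComb_apply, hc, ← hc']

end FinrankSpan

/-- The product of the numbers `(l + 1)(n - l)` for `l < m`. -/
def prodRank (n m : ℕ) : ℕ := ∏ l ∈ Finset.range m, (l + 1) * (n - l)

lemma prodRank_succ (n m : ℕ) : prodRank n (m + 1) = prodRank n m * ((m + 1) * (n - m)) :=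
  Finset.prod_range_succ _ _

/-- Both `l + 1` and `n - l` run through `1, …, n`. -/
lemma prodRank_self (n : ℕ) : prodRank n n = n.factorial * n.factorial := by
  rw [prodRank, Finset.prod_mul_distrib, Finset.prod_range_add_one_eq_factorial,
    ← Finset.prod_range_reflect]
  conv_lhs => rw [← Finset.prod_range_add_one_eq_factorial n]
  rw [← Finset.prod_range_add_one_eq_factorial n]
  congr 1
  refine Finset.prod_congr rfl fun j hj => ?_
  have := Finset.mem_range.1 hj
  omega

namespace IsNilHecke

variable {k : Type*} [Field k] {A : Type*} [Ring A] [Algebra k A] {n : ℕ} {x d : ℕ → A}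

lemma nilSub_op (m : ℕ) : nilSub k (fun j => MulOpposite.op (x j)) (fun j => MulOpposite.op (d j)) m
    = (nilSub k x d m).op := by
  rw [nilSub, nilSub, Subalgebra.op_adjoin]
  congr 1
  ext y
  simp only [Set.mem_union, Set.mem_image, Set.mem_preimage]
  constructor
  · rintro (⟨j, hj, rfl⟩ | ⟨j, hj, rfl⟩)
    · exact Or.inl ⟨j, hj, rfl⟩
    · exact Or.inr ⟨j, hj, rfl⟩
  · rintro (⟨j, hj, e⟩ | ⟨j, hj, e⟩)
    · exact Or.inl ⟨j, hj, by rw [e]; rfl⟩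
    · exact Or.inr ⟨j, hj, by rw [e]; rfl⟩

lemma nilSub_zero : nilSub k x d 0 = ⊥ := by simp [nilSub]

/-- `S_{m+1}` is generated by `(m + 1) (n - m)` elements as a right `S_m`-module, for all `m`. -/
def IsSpanned (k : Type*) [Field k] {A : Type*} [Ring A] [Algebra k A] (n : ℕ) (x d : ℕ → A) :
    Prop :=
  ∀ m < n, x m ^ (n - m) ∈
    Submodule.span k {z | ∃ c < n - m, ∃ s ∈ nilSub k x d m, z = x m ^ c * s}

/-- Since `x_m` commutes with `S_m`, the coefficients may be written on either side of its powers.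
-/
lemma IsSpanned.op (hs : IsSpanned k n x d) (h : IsNilHecke n x d) :
    IsSpanned k n (fun j => MulOpposite.op (x j)) (fun j => MulOpposite.op (d j)) := by
  intro m hm
  have h1 : Submodule.span k {z | ∃ c < n - m, ∃ s ∈ nilSub k x d m, z = x m ^ c * s} ≤
      (Submodule.span k {z | ∃ c < n - m, ∃ s ∈ nilSub k (fun j => MulOpposite.op (x j))
        (fun j => MulOpposite.op (d j)) m, z = MulOpposite.op (x m) ^ c * s}).comap
        (MulOpposite.opLinearEquiv k : A ≃ₗ[k] Aᵐᵒᵖ).toLinearMap := by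
    refine Submodule.span_le.2 ?_
    rintro _ ⟨c, hc, s, hs, rfl⟩
    refine Submodule.subset_span ⟨c, hc, MulOpposite.op s, ?_, ?_⟩
    · rw [nilSub_op]; exact hs
    · have : s * x m ^ c = x m ^ c * s :=
        (show Commute s (x m) from (x_comm_nilSub h hm hs).symm).pow_right c
      change MulOpposite.op (x m ^ c * s) = _
      rw [← this, MulOpposite.op_mul, MulOpposite.op_pow]
  have h2 := h1 (hs m hm)
  exact h2

variable [FiniteDimensional k A]

lemma finrank_nilSub_succ (h : IsNilHecke n x d) (hs : IsSpanned k n x d) {m : ℕ} (hm : m < n) :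
    Module.finrank k (nilSub k x d (m + 1)) ≤
      ((m + 1) * (n - m)) * Module.finrank k (nilSub k x d m) := by
  have := finrank_le_of_le_span (nilSub_succ_le_span h hm (by omega) (hs m hm))
  simpa using this

lemma factorial_sq_le_finrank_of_bimodule (h : IsNilHecke n x d) (I : Submodule k A) (hI : I ≠ ⊥)
    (hxl : ∀ j < n, ∀ y ∈ I, x j * y ∈ I) (hdl : ∀ j, j + 1 < n → ∀ y ∈ I, d j * y ∈ I)
    (hxr : ∀ j < n, ∀ y ∈ I, y * x j ∈ I) (hdr : ∀ j, j + 1 < n → ∀ y ∈ I, y * d j ∈ I) :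
    n.factorial * n.factorial ≤ Module.finrank k I := by
  classical
  have h' : IsNilHecke n (fun j => if j < n then x j else 0)
      (fun j => if j + 1 < n then d j else 0) :=
    h.congr (fun j hj => if_pos hj) (fun j hj => if_pos hj)
  refine h'.factorial_sq_le_finrank_ideal I hI ?_ ?_ ?_ ?_
  · intro j y hy
    by_cases hj : j < n
    · simpa [hj] using hxl j hj y hy
    · simp [hj]
  · intro j y hy
    by_cases hj : j + 1 < n
    · simpa [hj] using hdl j hj y hy
    · simp [hj]
  · intro j y hy
    by_cases hj : j < n
    · simpa [hj] using hxr j hj y hy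
    · simp [hj]
  · intro j y hy
    by_cases hj : j + 1 < n
    · simpa [hj] using hdr j hj y hy
    · simp [hj]

variable [Nontrivial A]

/-- Each step of the chain multiplies the dimension by at most `(m + 1)(n - m)`. These numbers
multiply to `(n!)²`, which is a lower bound for the dimension of `A`, as `A ≠ 0` is a bimodule over
itself. Hence no step can fall short. -/
lemma finrank_nilSub (h : IsNilHecke n x d) (hs : IsSpanned k n x d)
    (htop : nilSub k x d n = ⊤) {m : ℕ} (hm : m ≤ n) :
    Module.finrank k (nilSub k x d m) = prodRank n m := by
  have h0 : Module.finrank k (nilSub k x d 0) = 1 := by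
    rw [nilSub_zero]; exact Subalgebra.finrank_bot
  have hle : ∀ m ≤ n, Module.finrank k (nilSub k x d m) ≤ prodRank n m := by
    intro m
    induction m with
    | zero => intro _; rw [h0]; simp [prodRank]
    | succ m ih =>
      intro hm
      refine (h.finrank_nilSub_succ hs (by omega)).trans ?_
      rw [prodRank_succ, mul_comm]
      exact Nat.mul_le_mul_right _ (ih (by omega))
  have hge : prodRank n n ≤ Module.finrank k (nilSub k x d n) := by
    rw [htop, prodRank_self]
    have : (⊤ : Submodule k A) ≠ ⊥ := top_ne_bot
    have := h.factorial_sq_le_finrank_of_bimodule ⊤ this (fun _ _ _ _ => trivial)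
      (fun _ _ _ _ => trivial) (fun _ _ _ _ => trivial) (fun _ _ _ _ => trivial)
    rw [finrank_top] at this
    rwa [(Subalgebra.topEquiv (R := k) (A := A)).toLinearEquiv.finrank_eq]
  have hup : ∀ e m, m + e = n → prodRank n m ≤ Module.finrank k (nilSub k x d m) := by
    intro e
    induction e with
    | zero => intro m hm; obtain rfl : m = n := by omega
              exact hge
    | succ e ih =>
      intro m hm
      have h1 := (ih (m + 1) (by omega)).trans (h.finrank_nilSub_succ hs (by omega))
      rw [prodRank_succ, mul_comm] at h1
      exact Nat.le_of_mul_le_mul_left h1 (Nat.mul_pos (by omega) (by omega))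
  exact le_antisymm (hle m hm) (hup (n - m) m (by omega))

lemma exists_right_basis (h : IsNilHecke n x d) (hs : IsSpanned k n x d)
    (htop : nilSub k x d n = ⊤) {m : ℕ} (hm : m < n) :
    ∃ b : Fin (m + 1) × Fin (n - m) → A, (∀ i, b i ∈ nilSub k x d (m + 1)) ∧
      ∀ y ∈ nilSub k x d (m + 1), ∃! c : Fin (m + 1) × Fin (n - m) → nilSub k x d m,
        ∑ i, b i * (c i : A) = y := by
  refine ⟨_, existsUnique_of_le_span (nilSub_succ_le_span h hm (by omega) (hs m hm)) ?_⟩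
  rw [h.finrank_nilSub hs htop hm, h.finrank_nilSub hs htop hm.le, prodRank_succ, mul_comm]
  simp

/-- This is the right-hand statement for the opposite algebra. -/
lemma exists_left_basis (h : IsNilHecke n x d) (hs : IsSpanned k n x d)
    (htop : nilSub k x d n = ⊤) {m : ℕ} (hm : m < n) :
    ∃ b : Fin (m + 1) × Fin (n - m) → A, (∀ i, b i ∈ nilSub k x d (m + 1)) ∧
      ∀ y ∈ nilSub k x d (m + 1), ∃! c : Fin (m + 1) × Fin (n - m) → nilSub k x d m,
        ∑ i, (c i : A) * b i = y := by
  have : FiniteDimensional k Aᵐᵒᵖ := Module.Finite.equiv (MulOpposite.opLinearEquiv k)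
  obtain ⟨b, hb, hu⟩ := h.op.exists_right_basis (hs.op h)
    (by rw [nilSub_op, htop]; exact Subalgebra.op_top) hm
  simp only [nilSub_op] at hb hu
  refine ⟨fun i => (b i).unop, hb, fun y hy => ?_⟩
  obtain ⟨c, hc, hcu⟩ := hu (MulOpposite.op y) hy
  refine ⟨fun i => ⟨(c i).1.unop, (SetLike.ext_iff.1 (nilSub_op m) _).1 (c i).2⟩, ?_, ?_⟩
  · have := congrArg MulOpposite.unop hc
    simpa using this
  · intro c' hc'
    have := hcu (fun i => ⟨MulOpposite.op (c' i).1, (SetLike.ext_iff.1 (nilSub_op m) _).2 (c' i).2⟩) (by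
      apply MulOpposite.unop_injective
      simpa using hc')
    funext i
    rw [← this]; rfl

end IsNilHecke

/-! ### Symmetric polynomials act by scalars on small modules -/

namespace IsHecke

variable {k : Type u} [Field k] {A : Type*} [Ring A] [Algebra k A] {p : Param k} {n : ℕ}
  {X T : ℕ → A}

/-- Modulo the commuting nilpotent elements `X_j - a`, every polynomial equals its value at `(a, …,
a)`. -/
lemma isNilpotent_eval (h : IsHecke p n X T)
    (hX : ∀ i j : Fin n, X i * X j = X j * X i)
    {f : MvPolynomial (Fin n) k} (hf : MvPolynomial.eval (fun _ => p.a) f = 0) :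
    IsNilpotent (commEval (fun i : Fin n => X i) hX f) := by
  have key : ∀ g : MvPolynomial (Fin n) k,
      Commute (commEval (fun i : Fin n => X i) hX f) (commEval (fun i : Fin n => X i) hX g) ∧
      IsNilpotent (commEval (fun i : Fin n => X i) hX g -
        (MvPolynomial.eval (fun _ => p.a) g) • (1 : A)) := by
    intro g
    have hc : ∀ f g : MvPolynomial (Fin n) k, Commute (commEval (fun i : Fin n => X i) hX f)
        (commEval (fun i : Fin n => X i) hX g) := fun f g => by
      rw [Commute, SemiconjBy, ← map_mul, ← map_mul, mul_comm]
    refine ⟨hc f g, ?_⟩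
    have hc' : ∀ f g : MvPolynomial (Fin n) k, ∀ c c' : k,
        Commute (commEval (fun i : Fin n => X i) hX f - c • (1 : A))
        (commEval (fun i : Fin n => X i) hX g - c' • (1 : A)) := fun f g c c' =>
      ((hc f g).sub_right ((Commute.one_right _).smul_right _)).sub_left
        ((Commute.one_left _).smul_left _)
    induction g using MvPolynomial.induction_on with
    | C c =>
      rw [← MvPolynomial.algebraMap_eq, AlgHom.commutes, MvPolynomial.algebraMap_eq,
        MvPolynomial.eval_C, Algebra.algebraMap_eq_smul_one, sub_self]
      exact IsNilpotent.zero
    | add f g hf hg =>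
      have := (hc' f g _ _).isNilpotent_add hf hg
      convert this using 1
      rw [map_add, map_add]; module
    | mul_X f i hf =>
      have hi := h.nilpotent i i.2
      rw [← commEval_X (k := k) (fun i : Fin n => X i) hX i] at hi
      have h1 := (hc' f (MvPolynomial.X i) _ _).isNilpotent_mul_right hf
        (y := commEval (fun i : Fin n => X i) hX (MvPolynomial.X i) - 0 • (1 : A))
      have h2 := (hi.smul (MvPolynomial.eval (fun _ => p.a) f))
      rw [zero_smul, sub_zero] at h1
      have h3 := Commute.isNilpotent_add (?_ : Commute _ _) h1 h2
      · convert h3 using 1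
        rw [map_mul, map_mul, MvPolynomial.eval_X, sub_mul, smul_mul_assoc, one_mul]
        module
      · have := (hc' f (MvPolynomial.X i) (MvPolynomial.eval (fun _ => p.a) f) p.a).mul_left
          (b := commEval (fun i : Fin n => X i) hX (MvPolynomial.X i)) (by
            have := hc' (MvPolynomial.X i) (MvPolynomial.X i) 0 p.a
            rwa [zero_smul, sub_zero] at this)
        exact this.smul_right _
  have := (key f).2
  rwa [hf, zero_smul, sub_zero] at this

variable [FiniteDimensional k A]

/-- A nonzero subspace that is stable on both sides already has dimension at least `(n!)²`. An
algebra of at most this dimension has no room for proper nonzero ideals, nor for proper subalgebras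
that contain the generators. -/
lemma eq_top_of_bimodule (h : IsHecke p n X T)
    (hdim : Module.finrank k A ≤ n.factorial * n.factorial)
    (I : Submodule k A) (hI : I ≠ ⊥) (S : Subalgebra k A) (hX : ∀ j < n, X j ∈ S)
    (hT : ∀ j, j + 1 < n → T j ∈ S) (hl : ∀ s ∈ S, ∀ y ∈ I, s * y ∈ I)
    (hr : ∀ s ∈ S, ∀ y ∈ I, y * s ∈ I) : I = ⊤ := by
  have hS := (h.nilSub_le_iff le_rfl S).2 ⟨hX, hT⟩
  have hx : ∀ j < n, X j - p.a • (1 : A) ∈ S := fun j hj => hS (IsNilHecke.x_mem_nilSub hj)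
  have hd : ∀ j, j + 1 < n → divDiff p X T j ∈ S := fun j hj =>
    hS (IsNilHecke.d_mem_nilSub hj)
  have := h.isNilHecke_shift.factorial_sq_le_finrank_of_bimodule I hI
    (fun j hj => hl _ (hx j hj)) (fun j hj => hl _ (hd j hj))
    (fun j hj => hr _ (hx j hj)) (fun j hj => hr _ (hd j hj))
  exact Submodule.eq_top_of_finrank_eq (le_antisymm (Submodule.finrank_le I) (hdim.trans this))

variable [Nontrivial A]

lemma eq_top_of_subalgebra (h : IsHecke p n X T)
    (hdim : Module.finrank k A ≤ n.factorial * n.factorial)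
    (S : Subalgebra k A) (hX : ∀ j < n, X j ∈ S) (hT : ∀ j, j + 1 < n → T j ∈ S) : S = ⊤ := by
  rw [← Algebra.toSubmodule_eq_top]
  refine h.eq_top_of_bimodule hdim _ ?_ S hX hT (fun s hs y hy => mul_mem (S := Subalgebra k A) hs hy)
    (fun s hs y hy => mul_mem (S := Subalgebra k A) hy hs)
  intro e
  have : (1 : A) ∈ Subalgebra.toSubmodule S := one_mem S
  rw [e] at this
  exact one_ne_zero this

/-- If the dimension of `A` is at most `(n!)²`, then symmetric polynomials that vanish at
`(a, …, a)` act by zero. -/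
lemma commEval_eq_zero (h : IsHecke p n X T)
    (hdim : Module.finrank k A ≤ n.factorial * n.factorial)
    (hX : ∀ i j : Fin n, X i * X j = X j * X i)
    {f : MvPolynomial (Fin n) k} (hfs : f.IsSymmetric)
    (hf : MvPolynomial.eval (fun _ => p.a) f = 0) :
    commEval (fun i : Fin n => X i) hX f = 0 := by
  set y := commEval (fun i : Fin n => X i) hX f with hy
  have hnil : IsNilpotent y := h.isNilpotent_eval hX hf
  have hcX : ∀ j < n, X j * y = y * X j := fun j hj => by
    rw [hy, ← commEval_X (k := k) (fun i : Fin n => X i) hX ⟨j, hj⟩, ← map_mul, ← map_mul,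
      mul_comm]
  have hcd : ∀ j, j + 1 < n → divDiff p X T j * y = y * divDiff p X T j := fun j hj =>
    h.isNilHecke.d_comm_symm _ (commEval_X (fun i : Fin n => X i) hX) hj hfs
  -- The element `y` commutes with the `X_j`, and with the `d_j` because `f` is symmetric, hence
  -- with the `T_j`. Its centralizer contains the generators and is therefore everything.
  have hc : Subalgebra.centralizer k {y} = ⊤ := by
    refine h.eq_top_of_subalgebra hdim _ ?_ ?_
    · intro j hj
      rw [Subalgebra.mem_centralizer_iff]
      rintro _ rfl
      exact (hcX j hj).symm
    · intro j hj
      have h1 : ∀ i < n, X i ∈ Subalgebra.centralizer k {y} := fun i hi => by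
        rw [Subalgebra.mem_centralizer_iff]
        rintro _ rfl
        exact (hcX i hi).symm
      rw [h.T_eq hj]
      refine add_mem (mul_mem (sub_mem (sub_mem (h1 _ hj) (Subalgebra.smul_mem _ (h1 _ (by omega)) _))
        (Subalgebra.smul_mem _ (one_mem _) _)) ?_) (Subalgebra.smul_mem _ (one_mem _) _)
      rw [Subalgebra.mem_centralizer_iff]
      rintro _ rfl
      exact (hcd j hj).symm
  have hcomm : ∀ z, y * z = z * y := fun z => by
    have : z ∈ Subalgebra.centralizer k {y} := by rw [hc]; trivial
    exact Subalgebra.mem_centralizer_iff (R := k) |>.1 this y rfl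
  by_contra hne
  -- If the central element `y` were nonzero, the ideal it generates would be everything, and `y`
  -- would be invertible as well as nilpotent.
  have := h.eq_top_of_bimodule hdim (LinearMap.range (LinearMap.mulLeft k y)) (by
    intro e
    rw [LinearMap.range_eq_bot] at e
    have := LinearMap.congr_fun e 1
    simp only [LinearMap.mulLeft_apply, mul_one, LinearMap.zero_apply] at this
    exact hne this) ⊤ (fun _ _ => trivial) (fun _ _ => trivial)
    (by rintro s _ _ ⟨z, rfl⟩; exact ⟨s * z, by
          simp only [LinearMap.mulLeft_apply]; rw [← mul_assoc, hcomm, mul_assoc]⟩)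
    (by rintro s _ _ ⟨z, rfl⟩; exact ⟨z * s, by simp only [LinearMap.mulLeft_apply, mul_assoc]⟩)
  have h1 : (1 : A) ∈ LinearMap.range (LinearMap.mulLeft k y) := by rw [this]; trivial
  obtain ⟨z, hz⟩ := h1
  have hz : y * z = 1 := hz
  have hu : IsUnit y := ⟨⟨y, z, hz, (hcomm z).symm.trans hz⟩, rfl⟩
  exact not_isUnit_zero (M₀ := A) (by
    obtain ⟨N, hN⟩ := hnil
    rw [← hN]; exact hu.pow N)

end IsHecke

end Dimension

end SlTwo

namespace SlTwo

/-! ### The structure of `H̄_n` and its subalgebras `B_i` -/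

section HBarStructure

variable {k : Type u} [Field k] (p : Param k) (n : ℕ)

namespace HBar

/-- The commutative algebra generated by the `X_i`. -/
abbrev PolyQuot : Type u := MvPolynomial (Fin n) k ⧸ RingHom.ker (polyHom p n)

/-- The embedding of the commutative algebra generated by the `X_i`. -/
def polyQuotHom : PolyQuot p n →ₐ[k] HBar p n := Ideal.kerLiftAlg (polyHom p n)

/-- The elements `X_j - a`. -/
def polyVar (j : ℕ) : PolyQuot p n :=
  if h : j < n then Ideal.Quotient.mkₐ k _ (MvPolynomial.X ⟨j, h⟩) - algebraMap k _ p.a else 0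

/-- The elements `X_j - a` of `H̄_n`. -/
def nilX (j : ℕ) : HBar p n := xN p n j - p.a • (1 : HBar p n)

variable {p n}

lemma polyQuotHom_injective : Function.Injective (polyQuotHom p n) :=
  Ideal.kerLiftAlg_injective _

lemma polyQuotHom_mk (f : MvPolynomial (Fin n) k) :
    polyQuotHom p n (Ideal.Quotient.mkₐ k _ f) = polyHom p n f := Ideal.kerLiftAlg_mk _ _

lemma polyQuotHom_polyVar {j : ℕ} (h : j < n) : polyQuotHom p n (polyVar p n j) = nilX p n j := by
  rw [polyVar, dif_pos h, map_sub, polyQuotHom_mk, polyHom_X, AlgHom.commutes, nilX, xN_eq h,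
    Algebra.algebraMap_eq_smul_one]

/-- In `H̄_n` the elementary symmetric polynomials in the `X_i` take their values at `(a, …, a)`, so
`∏ (t + X_i) = (t + a)^n`. The substitution `t = -(X + a)` and the removal of the sign `(-1)^n` give
the shifted form. -/
lemma prod_X_sub_polyVar :
    ∏ i ∈ Finset.range n, (Polynomial.X - Polynomial.C (polyVar p n i)) = Polynomial.X ^ n := by
  have h := MvPolynomial.prod_C_add_X_eq_sum_esymm k (Fin n)
  set φ : MvPolynomial (Fin n) k →+* PolyQuot p n :=
    (Ideal.Quotient.mkₐ k (RingHom.ker (polyHom p n))).toRingHom with hφ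
  set ψ : MvPolynomial (Fin n) k →+* PolyQuot p n :=
    (algebraMap k (PolyQuot p n)).comp (MvPolynomial.eval fun _ => p.a) with hψ
  have hsymm : ∀ j, φ (MvPolynomial.esymm (Fin n) k j) = ψ (MvPolynomial.esymm (Fin n) k j) := by
    intro j
    apply polyQuotHom_injective
    change polyQuotHom p n (Ideal.Quotient.mkₐ k _ _) = _
    rw [polyQuotHom_mk, polyHom_symm _ (MvPolynomial.esymm_isSymmetric (Fin n) k j), hψ,
      RingHom.comp_apply, AlgHom.commutes]
  have h1 := congrArg (Polynomial.map φ) h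
  have h2 := congrArg (Polynomial.map ψ) h
  simp only [Polynomial.map_prod, Polynomial.map_sum, Polynomial.map_add, Polynomial.map_mul,
    Polynomial.map_X, Polynomial.map_C, Polynomial.map_pow, hsymm] at h1 h2
  have h3 := h1.trans h2.symm
  have h4 := congrArg (fun Q => Polynomial.comp Q
    (-(Polynomial.X + Polynomial.C (algebraMap k (PolyQuot p n) p.a)))) h3
  simp only [Polynomial.prod_comp, Polynomial.add_comp, Polynomial.X_comp,
    Polynomial.C_comp] at h4
  have h5 : ∀ i : Fin n, -(Polynomial.X + Polynomial.C (algebraMap k (PolyQuot p n) p.a)) +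
      Polynomial.C (φ (MvPolynomial.X i)) =
      -1 * (Polynomial.X - Polynomial.C (polyVar p n i)) := by
    intro i
    have : polyVar p n i = φ (MvPolynomial.X i) - algebraMap k _ p.a := by
      rw [polyVar, dif_pos i.2]; rfl
    rw [this, Polynomial.C_sub]; ring
  have h6 : ∀ i : Fin n, -(Polynomial.X + Polynomial.C (algebraMap k (PolyQuot p n) p.a)) +
      Polynomial.C (ψ (MvPolynomial.X i)) = -1 * Polynomial.X := by
    intro i
    have : ψ (MvPolynomial.X i) = algebraMap k _ p.a := by simp [hψ]
    rw [this]; ring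
  simp only [h5, h6, Finset.prod_mul_distrib, Finset.prod_const, Finset.card_univ,
    Fintype.card_fin] at h4
  have h7 : IsUnit ((-1 : Polynomial (PolyQuot p n)) ^ n) := (isUnit_one.neg).pow n
  rw [Finset.prod_range]
  exact h7.mul_left_cancel h4

lemma nilX_pow {j : ℕ} (h : j < n) : nilX p n j ^ n = 0 := by
  have h1 := congrArg (Polynomial.eval (polyVar p n j)) (prod_X_sub_polyVar (p := p) (n := n))
  rw [Polynomial.eval_prod, Finset.prod_eq_zero (Finset.mem_range.2 h) (by simp),
    Polynomial.eval_pow, Polynomial.eval_X] at h1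
  rw [← polyQuotHom_polyVar h, ← map_pow, ← h1, map_zero]

variable (p n) in
lemma isHecke : IsHecke p n (xN p n) (tN p n) where
  XX i j hi hj := by rw [xN_eq hi, xN_eq hj, gen_comm_X_X]
  quad j hj := by rw [tN_eq hj, gen_T_sq]
  TT i j hij hj := by rw [tN_eq hj, tN_eq (by omega), gen_comm_T_T _ _ _ _ hij]
  braid j hj := by rw [tN_eq (by omega), tN_eq hj]; exact gen_braid _ _ _
  XT i j hi hj h1 h2 := by rw [tN_eq hj, xN_eq hi, gen_comm_X_T _ _ _ _ h1 h2]
  affine hq j hj := by rw [tN_eq hj, xN_eq hj, xN_eq (by omega), gen_T_X_T _ _ _ hq]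
  affine_degenerate hq j hj := by
    rw [tN_eq hj, xN_eq hj, xN_eq (by omega), gen_X_T_degenerate _ _ _ hq]
  nilpotent j hj := ⟨n, nilX_pow hj⟩

variable (p n) in
/-- The divided difference elements of `H̄_n`. -/
def nilD (j : ℕ) : HBar p n := IsHecke.divDiff p (xN p n) (tN p n) j

variable (p n) in
lemma isNilHecke : IsNilHecke n (nilX p n) (nilD p n) := (isHecke p n).isNilHecke_shift

/-- In the presence of the `X_j`, the `T_j` and `d_j` can be exchanged for each other. The inverses
of the `X_j`, present for `q ≠ 1`, are redundant because `X_j` is a nonzero scalar plus a nilpotent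
element. -/
lemma HBarSub_eq {i : ℕ} (hi : i ≤ n) :
    HBarSub p n i = IsNilHecke.nilSub k (nilX p n) (nilD p n) i := by
  refine le_antisymm (Algebra.adjoin_le ?_) (((isHecke p n).nilSub_le_iff hi _).2 ⟨?_, ?_⟩)
  · have h := ((isHecke p n).nilSub_le_iff hi
      (IsNilHecke.nilSub k (nilX p n) (nilD p n) i)).1 le_rfl
    rintro _ ⟨g, hg, rfl⟩
    cases g with
    | T j hj => have := h.2 j hg; rwa [tN_eq hj] at this
    | X j hj => have := h.1 j hg; rwa [xN_eq hj] at this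
    | Xinv j hj hq =>
      refine mem_of_mul_eq_one _ (IsNilHecke.x_mem_nilSub (x := nilX p n) (show j < i from hg))
        ⟨n, nilX_pow hj⟩ (p.a_ne_zero hq) ?_
      rw [nilX, sub_add_cancel, xN_eq hj, gen_X_Xinv]
  · intro j hj
    rw [xN_eq (by omega : j < n)]
    exact Algebra.subset_adjoin ⟨_, hj, rfl⟩
  · intro j hj
    rw [tN_eq (by omega : j + 1 < n)]
    exact Algebra.subset_adjoin ⟨_, hj, rfl⟩

variable (p n) in
lemma HBarSub_self : HBarSub p n n = ⊤ := by
  rw [← adjoin_range_gen (p := p) (n := n), HBarSub]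
  congr 1
  ext y
  constructor
  · rintro ⟨g, _, rfl⟩; exact ⟨g, rfl⟩
  · rintro ⟨g, rfl⟩
    refine ⟨g, ?_, rfl⟩
    cases g with
    | T j hj => exact hj
    | X j hj => exact hj
    | Xinv j hj hq => exact hj

variable (p n) in
lemma nilSub_self : IsNilHecke.nilSub k (nilX p n) (nilD p n) n = ⊤ := by
  rw [← HBarSub_eq le_rfl, HBarSub_self]

-- The relation `∏ (X - x_i) = X^n` holds in the commutative algebra generated by the `X_i`. It
-- expresses `x_m^{n-m}` through lower powers with coefficients in `k[x_0, …, x_{m-1}]`, and this is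
-- transported along the embedding in `H̄_n`.
variable (p n) in
lemma isSpanned [Nontrivial (HBar p n)] : IsNilHecke.IsSpanned k n (nilX p n) (nilD p n) := by
  intro m hm
  have : Nontrivial (PolyQuot p n) := ⟨1, 0, fun e => by
    have := congrArg (polyQuotHom p n) e
    rw [map_one, map_zero] at this
    exact one_ne_zero this⟩
  have h1 := pow_mem_span_of_prod_eq (k := k) (prod_X_sub_polyVar (p := p) (n := n)) hm
  have h2 : Submodule.span k {z | ∃ c < n - m,
      ∃ s ∈ Algebra.adjoin k (polyVar p n '' Set.Iio m), z = polyVar p n m ^ c * s} ≤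
      (Submodule.span k {z | ∃ c < n - m, ∃ s ∈ IsNilHecke.nilSub k (nilX p n) (nilD p n) m,
        z = nilX p n m ^ c * s}).comap (polyQuotHom p n).toLinearMap := by
    refine Submodule.span_le.2 ?_
    rintro _ ⟨c, hc, s, hs, rfl⟩
    refine Submodule.subset_span ⟨c, hc, polyQuotHom p n s, ?_, ?_⟩
    · have : Algebra.adjoin k (polyVar p n '' Set.Iio m) ≤
          (IsNilHecke.nilSub k (nilX p n) (nilD p n) m).comap (polyQuotHom p n) := by
        refine Algebra.adjoin_le ?_
        rintro _ ⟨j, hj, rfl⟩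
        have hj : j < m := hj
        change polyQuotHom p n _ ∈ IsNilHecke.nilSub k (nilX p n) (nilD p n) m
        rw [polyQuotHom_polyVar (by omega)]
        exact IsNilHecke.x_mem_nilSub hj
      exact this hs
    · rw [← polyQuotHom_polyVar hm, ← map_pow, ← map_mul]; rfl
  have h3 := Submodule.mem_comap.1 (h2 h1)
  rw [AlgHom.toLinearMap_apply, map_pow, polyQuotHom_polyVar hm] at h3
  exact h3

end HBar

namespace B

variable {p n}

/-- The embedding of `B_i` into `H̄_n`, for `i ≤ n`. -/
def valHom {i : ℕ} (hi : i ≤ n) : B p n i →ₐ[k] HBar p n where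
  toFun b := (b ⟨hi⟩ : HBar p n)
  map_one' := rfl
  map_mul' _ _ := rfl
  map_zero' := rfl
  map_add' _ _ := rfl
  commutes' _ := rfl

lemma valHom_apply {i : ℕ} (hi : i ≤ n) (b : B p n i) : valHom hi b = (b ⟨hi⟩ : HBar p n) := rfl

lemma valHom_injective {i : ℕ} (hi : i ≤ n) :
    Function.Injective (valHom hi : B p n i →ₐ[k] HBar p n) := fun _ _ h => ext fun _ => h

lemma valHom_mem {i : ℕ} (hi : i ≤ n) (b : B p n i) : valHom hi b ∈ HBarSub p n i := (b ⟨hi⟩).2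

/-- An element of `H̄_{i,n}` as an element of `B_i`. -/
def mkOfMem {i : ℕ} {y : HBar p n} (hy : y ∈ HBarSub p n i) : B p n i := fun _ => ⟨y, hy⟩

lemma valHom_mkOfMem {i : ℕ} (hi : i ≤ n) {y : HBar p n} (hy : y ∈ HBarSub p n i) :
    valHom hi (mkOfMem hy) = y := rfl

lemma mkOfMem_valHom {i : ℕ} (hi : i ≤ n) (b : B p n i) : mkOfMem (valHom_mem hi b) = b :=
  valHom_injective hi rfl

lemma valHom_incl {i : ℕ} (hi : i + 1 ≤ n) (b : B p n i) :
    valHom hi (incl p n i b) = valHom ((Nat.le_succ i).trans hi) b := by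
  rw [valHom_apply, valHom_apply, incl_apply]

lemma valHom_X {i : ℕ} (hi : i + 1 ≤ n) : valHom hi (X p n i) = HBar.xN p n i :=
  (HBar.xN_eq hi).symm

lemma valHom_T {i : ℕ} (hi : i + 2 ≤ n) : valHom hi (T p n i) = HBar.tN p n i :=
  (HBar.tN_eq hi).symm

lemma subsingleton {i : ℕ} (hi : n < i) : Subsingleton (B p n i) :=
  ⟨fun _ _ => ext fun h => absurd h.down (by omega)⟩

/-- `B_i` as a subalgebra of `H̄_n`. -/
def linearEquiv {i : ℕ} (hi : i ≤ n) : B p n i ≃ₗ[k] HBarSub p n i where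
  toFun b := b ⟨hi⟩
  invFun y := fun _ => y
  left_inv _ := rfl
  right_inv _ := rfl
  map_add' _ _ := rfl
  map_smul' _ _ := rfl

variable [Nontrivial (HBar p n)]

lemma finrank_eq {i : ℕ} (hi : i ≤ n) : Module.finrank k (B p n i) = prodRank n i := by
  rw [(linearEquiv hi).finrank_eq, HBar.HBarSub_eq hi]
  exact (HBar.isNilHecke p n).finrank_nilSub (HBar.isSpanned p n) (HBar.nilSub_self p n) hi

/-- `B_{i+1}` is free as a left `B_i`-module. -/
lemma exists_left_basis {i : ℕ} (hi : i < n) :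
    ∃ b : Fin (i + 1) × Fin (n - i) → B p n (i + 1),
      ∀ y : B p n (i + 1), ∃! c : Fin (i + 1) × Fin (n - i) → B p n i,
        ∑ j, incl p n i (c j) * b j = y := by
  obtain ⟨b, hb, hu⟩ := (HBar.isNilHecke p n).exists_left_basis (HBar.isSpanned p n)
    (HBar.nilSub_self p n) hi
  rw [← HBar.HBarSub_eq hi] at hb
  refine ⟨fun j => mkOfMem (hb j), fun y => ?_⟩
  obtain ⟨c, hc, hcu⟩ := hu (valHom hi y) (by rw [← HBar.HBarSub_eq hi]; exact valHom_mem hi y)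
  have hmem : ∀ z : IsNilHecke.nilSub k (HBar.nilX p n) (HBar.nilD p n) i,
      (z : HBar p n) ∈ HBarSub p n i := fun z => by rw [HBar.HBarSub_eq hi.le]; exact z.2
  refine ⟨fun j => mkOfMem (hmem (c j)), ?_, fun c' hc' => ?_⟩
  · apply valHom_injective hi
    rw [map_sum, ← hc]
    exact Finset.sum_congr rfl fun j _ => by
      rw [map_mul, valHom_incl, valHom_mkOfMem, valHom_mkOfMem]
  · have := hcu (fun j => ⟨valHom hi.le (c' j), by
      rw [← HBar.HBarSub_eq hi.le]; exact valHom_mem hi.le (c' j)⟩) (by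
        have h1 := congrArg (valHom hi) hc'
        rw [map_sum] at h1
        simpa only [map_mul, valHom_incl, valHom_mkOfMem] using h1)
    funext j
    apply valHom_injective hi.le
    rw [valHom_mkOfMem]
    exact congrArg Subtype.val (congrFun this j)

/-- `B_{i+1}` is free as a right `B_i`-module. -/
lemma exists_right_basis {i : ℕ} (hi : i < n) :
    ∃ b : Fin (i + 1) × Fin (n - i) → B p n (i + 1),
      ∀ y : B p n (i + 1), ∃! c : Fin (i + 1) × Fin (n - i) → B p n i,
        ∑ j, b j * incl p n i (c j) = y := by
  obtain ⟨b, hb, hu⟩ := (HBar.isNilHecke p n).exists_right_basis (HBar.isSpanned p n)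
    (HBar.nilSub_self p n) hi
  rw [← HBar.HBarSub_eq hi] at hb
  refine ⟨fun j => mkOfMem (hb j), fun y => ?_⟩
  obtain ⟨c, hc, hcu⟩ := hu (valHom hi y) (by rw [← HBar.HBarSub_eq hi]; exact valHom_mem hi y)
  have hmem : ∀ z : IsNilHecke.nilSub k (HBar.nilX p n) (HBar.nilD p n) i,
      (z : HBar p n) ∈ HBarSub p n i := fun z => by rw [HBar.HBarSub_eq hi.le]; exact z.2
  refine ⟨fun j => mkOfMem (hmem (c j)), ?_, fun c' hc' => ?_⟩
  · apply valHom_injective hi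
    rw [map_sum, ← hc]
    exact Finset.sum_congr rfl fun j _ => by
      rw [map_mul, valHom_incl, valHom_mkOfMem, valHom_mkOfMem]
  · have := hcu (fun j => ⟨valHom hi.le (c' j), by
      rw [← HBar.HBarSub_eq hi.le]; exact valHom_mem hi.le (c' j)⟩) (by
        have h1 := congrArg (valHom hi) hc'
        rw [map_sum] at h1
        simpa only [map_mul, valHom_incl, valHom_mkOfMem] using h1)
    funext j
    apply valHom_injective hi.le
    rw [valHom_mkOfMem]
    exact congrArg Subtype.val (congrFun this j)

end B

end HBarStructure

/-! ### Modules over finite-dimensional quotients of nil affine Hecke algebras -/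

section NilModules

variable {k : Type u} [Field k] {A : Type*} [Ring A] [Algebra k A] {m : ℕ} {x d : ℕ → A}
  {N : Type*} [AddCommGroup N] [Module k N] [Module A N] [IsScalarTower k A N]

namespace IsNilHecke

/-- A nonzero vector that is killed by the `x_j`. -/
lemma exists_eigenvector [Nontrivial N] (h : IsNilHecke m x d)
    (hx : ∀ j < m, IsNilpotent (x j)) : ∃ v : N, v ≠ 0 ∧ ∀ j < m, x j • v = 0 := by
  have : ∀ l ≤ m, ∃ v : N, v ≠ 0 ∧ ∀ j < l, x j • v = 0 := by
    intro l
    induction l with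
    | zero =>
      intro _
      obtain ⟨v, hv⟩ := exists_ne (0 : N)
      exact ⟨v, hv, fun j hj => by omega⟩
    | succ l ih =>
      intro hl
      obtain ⟨v, hv, hv0⟩ := ih (by omega)
      classical
      have hex : ∃ c, x l ^ c • v = 0 := by
        obtain ⟨c, hc⟩ := hx l (by omega)
        exact ⟨c, by rw [hc, zero_smul]⟩
      set c := Nat.find hex with hc
      have hc0 : c ≠ 0 := fun e => by
        have := Nat.find_spec hex
        rw [← hc, e, pow_zero, one_smul] at this
        exact hv this
      refine ⟨x l ^ (c - 1) • v, fun e => Nat.find_min hex (by omega : c - 1 < c) e, ?_⟩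
      intro j hj
      rcases Nat.lt_succ_iff_lt_or_eq.1 hj with hj | rfl
      · have : x j * x l ^ (c - 1) = x l ^ (c - 1) * x j :=
          (show Commute (x j) (x l) from h.xx j l (by omega) (by omega)).pow_right _
        rw [smul_smul, this, mul_smul, hv0 j hj, smul_zero]
      · rw [smul_smul, ← pow_succ', show c - 1 + 1 = c by omega]
        exact Nat.find_spec hex
  exact this m le_rfl

lemma lsmul (h : IsNilHecke m x d) : IsNilHecke m (fun j => Algebra.lsmul k k N (x j))
    (fun j => Algebra.lsmul k k N (d j)) := h.map (Algebra.lsmul k k N)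

variable (k) in
lemma range_toSpanSingleton_eq_top [IsSimpleModule A N] {v : N} (hv : v ≠ 0) :
    LinearMap.range ((LinearMap.toSpanSingleton A N v).restrictScalars k) = ⊤ := by
  have := IsSimpleModule.toSpanSingleton_surjective A hv
  exact LinearMap.range_eq_top.2 this

variable [FiniteDimensional k N]

/-- With `K = S_l v`, the space of all `a` with `a v ∈ K` is stable under `S_l`, and under `x_l`
because `x_l` kills `K`. So `S_{l+1} v` is contained in the sum of the `l + 1` spaces `d_t ⋯ d_{l-1}
K`, and the bound grows by the factor `l + 1`. -/
lemma finrank_nilSub_smul_le (h : IsNilHecke m x d) {v : N} (hv : ∀ j < m, x j • v = 0)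
    {l : ℕ} (hl : l ≤ m) :
    Module.finrank k ((Subalgebra.toSubmodule (nilSub k x d l)).map
      ((LinearMap.toSpanSingleton A N v).restrictScalars k)) ≤ l.factorial := by
  induction l with
  | zero =>
    rw [nilSub_zero, Algebra.toSubmodule_bot, Submodule.one_eq_span, Submodule.map_span,
      Set.image_singleton]
    exact (finrank_span_le_card _).trans (by simp)
  | succ l ih =>
    set K := (Subalgebra.toSubmodule (nilSub k x d l)).map
      ((LinearMap.toSpanSingleton A N v).restrictScalars k) with hK
    set Y : Submodule k A := K.comap ((LinearMap.toSpanSingleton A N v).restrictScalars k)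
    have hKx : ∀ w ∈ K, x l • w = 0 := by
      rintro _ ⟨s, hs, rfl⟩
      change x l • s • v = 0
      rw [smul_smul, x_comm_nilSub h (by omega) hs, mul_smul, hv l (by omega), smul_zero]
    have h1 := nilSub_succ_le (k := k) (Y := Y) h (show l < m by omega) (by
        rintro s hs y ⟨s', hs', e⟩
        refine ⟨s * s', mul_mem (S := Subalgebra k A) hs hs', ?_⟩
        change (s * s') • v = (s * y) • v
        rw [mul_smul, mul_smul]
        exact congrArg (s • ·) e) (by
        intro y hy
        change (x l * y) • v ∈ K
        have := hKx _ hy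
        rw [mul_smul, show x l • y • v = 0 from this]
        exact zero_mem _) ⟨1, one_mem (nilSub k x d l), rfl⟩
    let g : (Fin (l + 1) → K) →ₗ[k] N :=
      ∑ t : Fin (l + 1), (Algebra.lsmul k k N (ascProd d t (l - t))) ∘ₗ K.subtype ∘ₗ
        LinearMap.proj t
    have h2 : (Subalgebra.toSubmodule (nilSub k x d (l + 1))).map
        ((LinearMap.toSpanSingleton A N v).restrictScalars k) ≤ LinearMap.range g := by
      refine (Submodule.map_mono h1).trans ?_
      rw [ascSpan, Submodule.map_span, Submodule.span_le]
      rintro _ ⟨_, ⟨t, l', _, htl, y, hy, rfl⟩, rfl⟩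
      classical
      refine ⟨Pi.single ⟨t, by omega⟩ ⟨y • v, hy⟩, ?_⟩
      obtain rfl : l' = l - t := by omega
      simp only [g, LinearMap.sum_apply]
      rw [Finset.sum_eq_single ⟨t, by omega⟩]
      · simp [mul_smul]
      · intro j _ hj; simp [hj]
      · intro hh; exact absurd (Finset.mem_univ _) hh
    refine (Submodule.finrank_mono h2).trans ((LinearMap.finrank_range_le g).trans ?_)
    rw [Module.finrank_pi_fintype, Finset.sum_const, Finset.card_univ, Fintype.card_fin,
      smul_eq_mul, Nat.factorial_succ]
    exact Nat.mul_le_mul_left _ (ih (by omega))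

lemma finrank_range_toSpanSingleton_le (h : IsNilHecke m x d) (htop : nilSub k x d m = ⊤) {v : N}
    (hv : ∀ j < m, x j • v = 0) :
    Module.finrank k (LinearMap.range ((LinearMap.toSpanSingleton A N v).restrictScalars k)) ≤
      m.factorial := by
  have := h.finrank_nilSub_smul_le hv (k := k) le_rfl
  rwa [htop, Algebra.top_toSubmodule, Submodule.map_top] at this

/-- Simple modules have dimension `m!`. -/
lemma finrank_simple [IsSimpleModule A N] (h : IsNilHecke m x d) (htop : nilSub k x d m = ⊤)
    (hx : ∀ j < m, IsNilpotent (x j)) : Module.finrank k N = m.factorial := by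
  have := IsSimpleModule.nontrivial A N
  refine le_antisymm ?_ (h.lsmul (k := k) (N := N)).factorial_le_finrank
  -- A simple module is generated by any nonzero vector, in particular by one that is killed by the
  -- `x_j`; this bounds the dimension from above.
  obtain ⟨v, hv, hv0⟩ := h.exists_eigenvector (N := N) hx
  have := h.finrank_range_toSpanSingleton_le htop hv0
  rwa [range_toSpanSingleton_eq_top k hv, finrank_top] at this

/-- The endomorphisms of a simple module are scalars. -/
lemma end_simple [IsSimpleModule A N] (h : IsNilHecke m x d) (htop : nilSub k x d m = ⊤)
    (hx : ∀ j < m, IsNilpotent (x j)) (φ : N →ₗ[A] N) : ∃ c : k, ∀ w, φ w = c • w := by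
  have := IsSimpleModule.nontrivial A N
  have h1 := (h.lsmul (k := k) (N := N)).factorial_mul_finrank_killed_le
  rw [h.finrank_simple (N := N) htop hx] at h1
  -- The dimension `m!` of the module is at least `m!` times that of the killed subspace, which is
  -- therefore a line. Endomorphisms preserve this line, and it generates the module.
  have h2 : Module.finrank k (killed (fun j => Algebra.lsmul k k N (d j)) m) ≤ 1 := by
    exact Nat.le_of_mul_le_mul_left (by simpa using h1) (Nat.factorial_pos m)
  obtain ⟨w, hw, hw0⟩ := Submodule.exists_mem_ne_zero_of_ne_bot
    (h.lsmul (k := k) (N := N)).killed_ne_bot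
  have hφ : φ w ∈ killed (fun j => Algebra.lsmul k k N (d j)) m := by
    intro j hj
    change d j • φ w = 0
    rw [← map_smul]
    exact (congrArg φ (hw j hj)).trans (map_zero φ)
  obtain ⟨⟨w', hw'⟩, hspan⟩ := finrank_le_one_iff.1 h2
  obtain ⟨c1, hc1⟩ := hspan ⟨w, hw⟩
  obtain ⟨c2, hc2⟩ := hspan ⟨φ w, hφ⟩
  have hc1 : c1 • w' = w := congrArg Subtype.val hc1
  have hc2 : c2 • w' = φ w := congrArg Subtype.val hc2
  have hc10 : c1 ≠ 0 := fun e => hw0 (by rw [← hc1, e, zero_smul])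
  refine ⟨c2 * c1⁻¹, fun z => ?_⟩
  obtain ⟨b, rfl⟩ := IsSimpleModule.toSpanSingleton_surjective A hw0 z
  change φ (b • w) = _ • b • w
  rw [map_smul, smul_comm _ b w, ← hc2]
  congr 1
  rw [← hc1, smul_smul, mul_assoc, inv_mul_cancel₀ hc10, mul_one]

/-- Two simple modules are isomorphic. -/
lemma nonempty_linearEquiv_simple [IsSimpleModule A N] {N' : Type*} [AddCommGroup N'] [Module k N']
    [Module A N'] [IsScalarTower k A N'] [FiniteDimensional k N'] [IsSimpleModule A N']
    (h : IsNilHecke m x d) (htop : nilSub k x d m = ⊤) (hx : ∀ j < m, IsNilpotent (x j)) :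
    Nonempty (N ≃ₗ[A] N') := by
  have := IsSimpleModule.nontrivial A N
  have := IsSimpleModule.nontrivial A N'
  obtain ⟨v, hv, hv0⟩ := h.exists_eigenvector (N := N) hx
  obtain ⟨v', hv', hv0'⟩ := h.exists_eigenvector (N := N') hx
  -- The submodule generated by `(v, v')` has dimension at most `m!` and projects onto both factors,
  -- so it is the graph of an isomorphism.
  let W : Submodule A (N × N') := LinearMap.range (LinearMap.toSpanSingleton A (N × N') (v, v'))
  have hW : Module.finrank k W ≤ m.factorial :=
    h.finrank_range_toSpanSingleton_le (N := N × N') (v := (v, v')) htop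
      (fun j hj => Prod.ext (hv0 j hj) (hv0' j hj))
  have hfin : FiniteDimensional k W :=
    inferInstanceAs (FiniteDimensional k (W.restrictScalars k))
  let f : W →ₗ[A] N := LinearMap.fst A N N' ∘ₗ W.subtype
  let f' : W →ₗ[A] N' := LinearMap.snd A N N' ∘ₗ W.subtype
  have hf : Function.Surjective f := fun z => by
    obtain ⟨b, rfl⟩ := IsSimpleModule.toSpanSingleton_surjective A hv z
    exact ⟨⟨_, b, rfl⟩, rfl⟩
  have hf' : Function.Surjective f' := fun z => by
    obtain ⟨b, rfl⟩ := IsSimpleModule.toSpanSingleton_surjective A hv' z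
    exact ⟨⟨_, b, rfl⟩, rfl⟩
  have e1 : Module.finrank k W = Module.finrank k N := by
    rw [h.finrank_simple (N := N) htop hx]
    refine le_antisymm hW ?_
    rw [← h.finrank_simple (N := N) htop hx]
    exact LinearMap.finrank_le_finrank_of_surjective (f := f.restrictScalars k) hf
  have e2 : Module.finrank k W = Module.finrank k N' := by
    rw [e1, h.finrank_simple (N := N) htop hx, h.finrank_simple (N := N') htop hx]
  have hi : Function.Injective f := (LinearMap.injective_iff_surjective_of_finrank_eq_finrank
    (f := f.restrictScalars k) e1).2 hf
  have hi' : Function.Injective f' := (LinearMap.injective_iff_surjective_of_finrank_eq_finrank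
    (f := f'.restrictScalars k) e2).2 hf'
  exact ⟨(LinearEquiv.ofBijective f ⟨hi, hf⟩).symm.trans (LinearEquiv.ofBijective f' ⟨hi', hf'⟩)⟩

end IsNilHecke

end NilModules

/-! ### The nil affine Hecke generators of `B_i` -/

section BNil

variable {k : Type u} [Field k] (p : Param k) (n : ℕ)

namespace B

/-- The elements `X_j - a` of `B_i`, for `j < i`. -/
def nilX (i j : ℕ) : B p n i := fun h =>
  ⟨if j < i then HBar.nilX p n j else 0, by
    split_ifs with hj
    · rw [HBar.HBarSub_eq h.down]; exact IsNilHecke.x_mem_nilSub hj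
    · exact zero_mem _⟩

/-- The divided difference elements of `B_i`. -/
def nilD (i j : ℕ) : B p n i := fun h =>
  ⟨if j + 1 < i then HBar.nilD p n j else 0, by
    split_ifs with hj
    · rw [HBar.HBarSub_eq h.down]; exact IsNilHecke.d_mem_nilSub hj
    · exact zero_mem _⟩

variable {p n}

lemma valHom_nilX {i j : ℕ} (hi : i ≤ n) (hj : j < i) :
    valHom hi (nilX p n i j) = HBar.nilX p n j := if_pos hj

lemma valHom_nilD {i j : ℕ} (hi : i ≤ n) (hj : j + 1 < i) :
    valHom hi (nilD p n i j) = HBar.nilD p n j := if_pos hj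

lemma nilX_pow {i j : ℕ} (hi : i ≤ n) (hj : j < i) : IsNilpotent (nilX p n i j) :=
  ⟨n, valHom_injective hi (by
    rw [map_pow, valHom_nilX hi hj, HBar.nilX_pow (by omega), map_zero])⟩

lemma isNilHecke {i : ℕ} (hi : i ≤ n) : IsNilHecke i (nilX p n i) (nilD p n i) := by
  have h : IsNilHecke i (fun j => valHom hi (nilX p n i j)) (fun j => valHom hi (nilD p n i j)) :=
    ((HBar.isNilHecke p n).mono hi).congr (fun j hj => valHom_nilX hi hj)
      (fun j hj => valHom_nilD hi hj)
  have hinj := valHom_injective (p := p) hi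
  exact {
    xx := fun i j hi hj => hinj (by simpa only [map_mul] using h.xx i j hi hj)
    dd := fun j hj => hinj (by simpa only [map_mul, map_zero] using h.dd j hj)
    dd_comm := fun i j hij hj => hinj (by simpa only [map_mul] using h.dd_comm i j hij hj)
    braid := fun j hj => hinj (by simpa only [map_mul] using h.braid j hj)
    xd := fun i j hi hj h1 h2 => hinj (by simpa only [map_mul] using h.xd i j hi hj h1 h2)
    dx := fun j hj => hinj (by simpa only [map_mul, map_add, map_one] using h.dx j hj)
    xd_self := fun j hj => hinj (by simpa only [map_mul, map_add, map_one] using h.xd_self j hj) }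

lemma nilSub_eq_top {i : ℕ} (hi : i ≤ n) :
    IsNilHecke.nilSub k (nilX p n i) (nilD p n i) i = ⊤ := by
  have h1 : (IsNilHecke.nilSub k (nilX p n i) (nilD p n i) i).map (valHom hi) =
      HBarSub p n i := by
    rw [HBar.HBarSub_eq hi, IsNilHecke.nilSub, AlgHom.map_adjoin, IsNilHecke.nilSub]
    congr 1
    rw [Set.image_union, Set.image_image, Set.image_image]
    congr 1
    · exact Set.image_congr fun j hj => valHom_nilX hi hj
    · exact Set.image_congr fun j hj => valHom_nilD hi hj
  rw [eq_top_iff]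
  intro b _
  have h2 := valHom_mem hi b
  rw [← h1] at h2
  obtain ⟨b', hb', e⟩ := h2
  rwa [← valHom_injective hi e]

end B

end BNil

end SlTwo

namespace SlTwo

/-! ### Objects of finite length -/

section FiniteLength

variable {C : Type u} [Category.{v} C] [Abelian C]

/-- The sequence `0 → A → M → Q → 0` is exact. -/
structure IsSES {A M Q : C} (f : A ⟶ M) (g : M ⟶ Q) : Prop where
  zero : f ≫ g = 0
  shortExact : (ShortComplex.mk f g zero).ShortExact

namespace IsSES

variable {A M Q : C} {f : A ⟶ M} {g : M ⟶ Q}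

lemma mono (h : IsSES f g) : Mono f := h.shortExact.mono_f

lemma epi (h : IsSES f g) : Epi g := h.shortExact.epi_g

lemma lift (h : IsSES f g) {Z : C} (y : Z ⟶ M) (hy : y ≫ g = 0) : ∃ w : Z ⟶ A, w ≫ f = y := by
  obtain ⟨w, hw⟩ := KernelFork.IsLimit.lift' h.shortExact.fIsKernel y hy
  exact ⟨w, hw⟩

lemma desc (h : IsSES f g) {Z : C} (y : M ⟶ Z) (hy : f ≫ y = 0) : ∃ w : Q ⟶ Z, g ≫ w = y := by
  obtain ⟨w, hw⟩ := CokernelCofork.IsColimit.desc' h.shortExact.gIsCokernel y hy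
  exact ⟨w, hw⟩

lemma of_refinements [Mono f] [Epi g] (zero : f ≫ g = 0)
    (h : ∀ ⦃Z : C⦄ (y : Z ⟶ M), y ≫ g = 0 → ∃ (Z' : C) (π : Z' ⟶ Z) (_ : Epi π) (w : Z' ⟶ A),
      π ≫ y = w ≫ f) : IsSES f g :=
  ⟨zero, ShortComplex.ShortExact.mk' ((ShortComplex.exact_iff_exact_up_to_refinements _).2 h)
    ‹_› ‹_›⟩

lemma cokernel (f : A ⟶ M) [Mono f] : IsSES f (cokernel.π f) :=
  ⟨cokernel.condition f, ⟨ShortComplex.exact_cokernel f⟩⟩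

lemma kernel (g : M ⟶ Q) [Epi g] : IsSES (kernel.ι g) g :=
  ⟨kernel.condition g, ⟨ShortComplex.exact_kernel g⟩⟩

lemma of_isZero {A M : C} (hA : IsZero A) (g : M ⟶ Q) [IsIso g] : IsSES (0 : A ⟶ M) g := by
  have : Mono (0 : A ⟶ M) := ⟨fun _ _ _ => hA.eq_of_tgt _ _⟩
  refine of_refinements zero_comp fun Z y hy => ⟨Z, 𝟙 Z, inferInstance, 0, ?_⟩
  rw [zero_comp, Category.id_comp]
  exact (cancel_mono g).1 (hy.trans zero_comp.symm)

lemma isIso_of_isZero (h : IsSES f g) (hA : IsZero A) : IsIso g := by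
  have := h.epi
  have : Mono g := Preadditive.mono_of_cancel_zero g fun y hy => by
    obtain ⟨w, rfl⟩ := h.lift y hy
    rw [hA.eq_of_tgt w 0, zero_comp]
  exact isIso_of_mono_of_epi g

lemma comp_iso (h : IsSES f g) {M' : C} (e : M ≅ M') : IsSES (f ≫ e.hom) (e.inv ≫ g) := by
  have := h.mono
  have := h.epi
  refine of_refinements (by simp [h.zero]) fun Z y hy => ?_
  obtain ⟨w, hw⟩ := h.lift (y ≫ e.inv) (by simpa using hy)
  exact ⟨Z, 𝟙 Z, inferInstance, w, by rw [← Category.assoc, hw]; simp⟩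

/-- The third isomorphism theorem. -/
lemma third {M' Q' M'' : C} {a : A ⟶ M'} {p : M' ⟶ Q'} {i : M' ⟶ M} {s : M ⟶ M''}
    (h : IsSES a p) (h' : IsSES i s) :
    ∃ (Q : C) (π : M ⟶ Q) (u : Q' ⟶ Q) (v : Q ⟶ M''), IsSES (a ≫ i) π ∧ IsSES u v := by
  have := h.mono
  have := h'.mono
  have := h.epi
  have := h'.epi
  have hπ := cokernel (a ≫ i)
  have := hπ.epi
  obtain ⟨u, hu⟩ := h.desc (i ≫ cokernel.π (a ≫ i)) (by
      rw [← Category.assoc]; exact hπ.zero)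
  obtain ⟨v, hv⟩ := hπ.desc s (by rw [Category.assoc, h'.zero, comp_zero])
  have hum : Mono u := Preadditive.mono_of_cancel_zero u fun {Z} z hz => by
    obtain ⟨Z', π, _, y, hy⟩ := surjective_up_to_refinements_of_epi p z
    obtain ⟨w, hw⟩ := hπ.lift (y ≫ i) (by
      rw [Category.assoc, ← hu, ← Category.assoc, ← hy, Category.assoc, hz, comp_zero])
    rw [← Category.assoc] at hw
    rw [← cancel_epi π, hy, ← (cancel_mono i).1 hw, Category.assoc, h.zero, comp_zero, comp_zero]
  have hve : Epi v := epi_of_epi_fac hv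
  refine ⟨_, cokernel.π (a ≫ i), u, v, hπ, of_refinements ?_ fun Z z hz => ?_⟩
  · rw [← cancel_epi p, ← Category.assoc, hu, Category.assoc, hv, h'.zero, comp_zero]
  · obtain ⟨Z', π, hπe, y, hy⟩ := surjective_up_to_refinements_of_epi (cokernel.π (a ≫ i)) z
    obtain ⟨w, hw⟩ := h'.lift y (by
      rw [← hv, ← Category.assoc, ← hy, Category.assoc, hz, comp_zero])
    exact ⟨Z', π, hπe, w ≫ p, by rw [hy, ← hw, Category.assoc, Category.assoc, hu]⟩

/-- Two disjoint subobjects. -/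
lemma exchange {A' Q' : C} {f' : A' ⟶ M} {g' : M ⟶ Q'} (h : IsSES f g) (h' : IsSES f' g')
    [Mono (f ≫ g')] [Mono (f' ≫ g)] :
    ∃ (R : C) (π : Q' ⟶ R) (π' : Q ⟶ R), IsSES (f ≫ g') π ∧ IsSES (f' ≫ g) π' := by
  have := h.epi
  have := h'.epi
  have hπ := cokernel (f ≫ g')
  have := hπ.epi
  obtain ⟨v, hv⟩ := h.desc (g' ≫ cokernel.π (f ≫ g')) (by
    rw [← Category.assoc]; exact hπ.zero)
  have : Epi (g' ≫ cokernel.π (f ≫ g')) := epi_comp _ _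
  have hve : Epi v := epi_of_epi_fac hv
  refine ⟨_, _, v, hπ, of_refinements ?_ fun Z z hz => ?_⟩
  · rw [Category.assoc, hv, ← Category.assoc, h'.zero, zero_comp]
  · obtain ⟨Z', π, hπe, y, hy⟩ := surjective_up_to_refinements_of_epi g z
    obtain ⟨w, hw⟩ := hπ.lift (y ≫ g') (by
      rw [Category.assoc, ← hv, ← Category.assoc, ← hy, Category.assoc, hz, comp_zero])
    obtain ⟨w', hw'⟩ := h'.lift (y - w ≫ f) (by
      rw [Preadditive.sub_comp, Category.assoc, hw, sub_self])
    refine ⟨Z', π, hπe, w', ?_⟩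
    rw [hy, ← Category.assoc, hw', Preadditive.sub_comp, Category.assoc, h.zero, comp_zero,
      sub_zero]

end IsSES

variable (C) in
/-- All objects have finite length. -/
class FiniteLength : Prop where
  noetherian : ∀ M : C, IsNoetherianObject M
  artinian : ∀ M : C, IsArtinianObject M

lemma exists_simple_mono [FiniteLength C] {M : C} (h : ¬ IsZero M) :
    ∃ (A : C) (_ : Simple A) (f : A ⟶ M), Mono f := by
  have := FiniteLength.artinian M
  exact ⟨_, inferInstance, simpleSubobjectArrow h, inferInstance⟩

/-- If passing from `Q` to `R` does not enlarge the kernel on `M`, nothing nonzero in `Q` dies in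
`R`. This gives the strict increase in the Noetherian induction below. -/
lemma comp_eq_zero_of_kernelSubobject_eq {M Q R : C} (p : M ⟶ Q) [Epi p] {A : C} (f : A ⟶ Q)
    (g : Q ⟶ R) (hfg : f ≫ g = 0) (h : kernelSubobject (p ≫ g) ≤ kernelSubobject p) : f = 0 := by
  obtain ⟨Z, π, _, y, hy⟩ := surjective_up_to_refinements_of_epi p f
  have h1 : (kernelSubobject (p ≫ g)).Factors y := (kernelSubobject_factors_iff _ _).2 (by
    rw [← Category.assoc, ← hy, Category.assoc, hfg, comp_zero])
  have h2 := (kernelSubobject_factors_iff _ _).1 (Subobject.factors_of_le _ h h1)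
  rw [← cancel_epi π, hy, h2, comp_zero]

/-- Induction on the length of an object. -/
theorem finite_length_induction [FiniteLength C] {P : C → Prop}
    (h0 : ∀ M, IsZero M → P M)
    (h : ∀ M : C, ¬ IsZero M →
      (∀ {A Q : C} (f : A ⟶ M) (g : M ⟶ Q), Simple A → IsSES f g → P Q) → P M) (M : C) : P M := by
  have := FiniteLength.noetherian M
  -- The induction runs over the kernels of the quotients `M → Q`, by the ascending chain condition
  -- for subobjects of `M`.
  have key : ∀ (K : Subobject M) (Q : C) (p : M ⟶ Q), Epi p → kernelSubobject p = K → P Q := by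
    intro K
    induction K using WellFoundedGT.induction with
    | ind K ih =>
      intro Q p hp hK
      by_cases hQ : IsZero Q
      · exact h0 Q hQ
      · refine h Q hQ fun {A R} f g hA hfg => ?_
        have := hfg.epi
        have := hfg.mono
        refine ih (kernelSubobject (p ≫ g)) ?_ R (p ≫ g) (epi_comp _ _) rfl
        rw [← hK]
        refine lt_of_le_of_ne (kernelSubobject_comp_le _ _) fun e => ?_
        have hf := comp_eq_zero_of_kernelSubobject_eq p f g hfg.zero e.ge
        exact Simple.not_isZero A ((IsZero.iff_id_eq_zero A).2 (by
          rw [← cancel_mono f, hf, comp_zero, comp_zero]))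
  exact key _ M (𝟙 M) inferInstance rfl

/-- The object `M` has length `l`, where the simple subquotients are counted with weights `w`. -/
inductive HasLen (w : C → ℚ) : C → ℚ → Prop
  | zero {M : C} (h : IsZero M) : HasLen w M 0
  | cons {A M Q : C} {f : A ⟶ M} {g : M ⟶ Q} {l : ℚ} (hA : Simple A) (h : IsSES f g)
      (hQ : HasLen w Q l) : HasLen w M (w A + l)

lemma mono_of_simple {A M : C} [Simple A] (f : A ⟶ M) (h : f ≠ 0) : Mono f :=
  Preadditive.mono_of_kernel_zero (kernel_zero_of_nonzero_from_simple h)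

namespace HasLen

variable {w : C → ℚ}

lemma of_iso {M N : C} {l : ℚ} (h : HasLen w M l) (e : M ≅ N) : HasLen w N l := by
  cases h with
  | zero h => exact .zero (h.of_iso e.symm)
  | cons hA h hQ => exact .cons hA (h.comp_iso e) hQ

lemma eq_zero {M : C} {l : ℚ} (h : HasLen w M l) (hM : IsZero M) : l = 0 := by
  cases h with
  | zero h => rfl
  | @cons A _ _ f _ _ hA h hQ =>
    have := h.mono
    exact absurd (hM.of_mono f) (Simple.not_isZero A)

lemma exists_len [FiniteLength C] (w : C → ℚ) (M : C) : ∃ l, HasLen w M l := by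
  induction M using finite_length_induction with
  | h0 M h => exact ⟨0, .zero h⟩
  | h M hM ih =>
    obtain ⟨A, hA, f, hf⟩ := exists_simple_mono hM
    obtain ⟨l, hl⟩ := ih f (cokernel.π f) hA (IsSES.cokernel f)
    exact ⟨_, .cons hA (IsSES.cokernel f) hl⟩

/-- The Jordan–Hölder theorem. -/
theorem unique [FiniteLength C] (hw : ∀ {A A' : C}, Simple A → (A ≅ A') → w A = w A') (M : C) :
    ∀ {l l' : ℚ}, HasLen w M l → HasLen w M l' → l = l' := by
  induction M using finite_length_induction with
  | h0 M h => exact fun h1 h2 => (h1.eq_zero h).trans (h2.eq_zero h).symm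
  | h M hM ih =>
    intro l l' h1 h2
    cases h1 with
    | zero h => exact absurd h hM
    | @cons A _ Q f g l hA h hQ =>
      cases h2 with
      | zero h => exact absurd h hM
      | @cons A' _ Q' f' g' l' hA' h' hQ' =>
        have := h.mono
        have := h'.mono
        have := h.epi
        have := h'.epi
        -- Either the two simple subobjects coincide and the quotients are isomorphic, or they are
        -- disjoint and both quotients map onto a common `R`, through which the two lengths are
        -- compared.
        by_cases hz : f ≫ g' = 0
        · obtain ⟨i, hi⟩ := h'.lift f hz
          have hi0 : i ≠ 0 := fun e => Simple.not_isZero A ((IsZero.iff_id_eq_zero A).2 (by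
            rw [← cancel_mono f, ← hi, e]; simp))
          have : IsIso i := isIso_of_hom_simple hi0
          obtain ⟨j, hj⟩ := h.desc g' hz
          obtain ⟨j', hj'⟩ := h'.desc g (by
            rw [← cancel_epi i, ← Category.assoc, hi, h.zero, comp_zero])
          have e : Q ≅ Q' := ⟨j, j', by
            rw [← cancel_epi g, ← Category.assoc, hj, hj', Category.comp_id], by
            rw [← cancel_epi g', ← Category.assoc, hj', hj, Category.comp_id]⟩
          rw [hw hA (asIso i), ih f g hA h hQ (hQ'.of_iso e.symm)]
        · have : Mono (f ≫ g') := mono_of_simple _ hz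
          have hz' : f' ≫ g ≠ 0 := fun e => hz (by
            obtain ⟨i, hi⟩ := h.lift f' e
            have hi0 : i ≠ 0 := fun e => Simple.not_isZero A' ((IsZero.iff_id_eq_zero A').2 (by
              rw [← cancel_mono f', ← hi, e]; simp))
            have : IsIso i := isIso_of_hom_simple hi0
            rw [← cancel_epi i, ← Category.assoc, hi, h'.zero, comp_zero])
          have : Mono (f' ≫ g) := mono_of_simple _ hz'
          obtain ⟨R, π, π', hπ, hπ'⟩ := h.exchange h'
          obtain ⟨r, hr⟩ := exists_len w R
          rw [ih f g hA h hQ (.cons hA' hπ' hr), ih f' g' hA' h' hQ' (.cons hA hπ hr)]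
          ring

/-- A filtration of `M'` is continued by one of `M''`. Simple subobjects of `M'` are divided out one
at a time, and the third isomorphism theorem provides the new exact sequence. -/
lemma add {M' M M'' : C} {i : M' ⟶ M} {s : M ⟶ M''} {l' l'' : ℚ} (h' : HasLen w M' l')
    (h : IsSES i s) (h'' : HasLen w M'' l'') : HasLen w M (l' + l'') := by
  induction h' generalizing M M'' with
  | zero hz =>
    have := h.isIso_of_isZero hz
    rw [zero_add]
    exact h''.of_iso (asIso s).symm
  | cons hA hses _ ih =>
    obtain ⟨Q, π, u, v, h1, h2⟩ := hses.third h
    rw [add_assoc]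
    exact .cons hA h1 (ih h2 h'')

end HasLen

end FiniteLength

/-! ### Functionals on Grothendieck groups -/

section K0

variable {C : Type u} [Category.{v} C] [Abelian C]

lemma cls_eq_add {A M Q : C} {f : A ⟶ M} {g : M ⟶ Q} (h : IsSES f g) :
    cls M = cls A + cls Q := by
  unfold cls
  rw [← TensorProduct.tmul_add, ← QuotientAddGroup.mk_add]
  congr 1
  rw [eq_comm, QuotientAddGroup.eq]
  refine AddSubgroup.subset_closure ⟨_, h.shortExact, ?_⟩
  abel

lemma cls_of_isZero {M : C} (h : IsZero M) : cls M = 0 := by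
  have h1 := cls_eq_add (IsSES.of_isZero h (𝟙 M))
  simpa using h1

lemma cls_eq_of_iso {M N : C} (e : M ≅ N) : cls M = cls N := by
  have h1 := cls_eq_add (IsSES.of_isZero (isZero_zero C) e.hom)
  rwa [cls_of_isZero (isZero_zero C), zero_add] at h1

/-- The linear map on `ℚ ⊗ K₀` defined by an additive function. -/
def K0Q.lift {V : Type*} [AddCommGroup V] [Module ℚ V] (d : C → V)
    (hd : ∀ {A M Q : C} {f : A ⟶ M} {g : M ⟶ Q}, IsSES f g → d M = d A + d Q) :
    K0Q C →ₗ[ℚ] V :=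
  (QuotientAddGroup.lift (K0Rel C) (FreeAbelianGroup.lift d) (by
    refine (AddSubgroup.closure_le _).2 ?_
    rintro _ ⟨S, hS, rfl⟩
    have h1 : IsSES S.f S.g := ⟨S.zero, hS⟩
    change FreeAbelianGroup.lift d _ = 0
    rw [map_sub, map_sub, FreeAbelianGroup.lift_apply_of, FreeAbelianGroup.lift_apply_of,
      FreeAbelianGroup.lift_apply_of, hd h1]
    abel)).toIntLinearMap.liftBaseChange ℚ

lemma K0Q.lift_cls {V : Type*} [AddCommGroup V] [Module ℚ V] (d : C → V)
    (hd : ∀ {A M Q : C} {f : A ⟶ M} {g : M ⟶ Q}, IsSES f g → d M = d A + d Q) (M : C) :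
    K0Q.lift d hd (cls M) = d M := by
  unfold K0Q.lift cls
  rw [LinearMap.liftBaseChange_tmul, one_smul]
  exact FreeAbelianGroup.lift_apply_of _ _

variable (C) in
lemma K0Q.span_cls : Submodule.span ℚ (Set.range (cls : C → K0Q C)) = ⊤ := by
  rw [eq_top_iff]
  rintro x -
  induction x using TensorProduct.induction_on with
  | zero => exact zero_mem _
  | add x y hx hy => exact add_mem hx hy
  | tmul r y =>
    induction y using QuotientAddGroup.induction_on with
    | H y =>
    have : r ⊗ₜ[ℤ] (y : FreeAbelianGroup C ⧸ K0Rel C) =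
        r • ((1 : ℚ) ⊗ₜ[ℤ] (y : FreeAbelianGroup C ⧸ K0Rel C)) := by
      rw [TensorProduct.smul_tmul', smul_eq_mul, mul_one]
    rw [this]
    clear this
    refine Submodule.smul_mem _ _ ?_
    induction y using FreeAbelianGroup.induction_on with
    | zero => rw [QuotientAddGroup.mk_zero, TensorProduct.tmul_zero]; exact zero_mem _
    | of M => exact Submodule.subset_span ⟨M, rfl⟩
    | neg M h => rw [QuotientAddGroup.mk_neg, TensorProduct.tmul_neg]; exact neg_mem h
    | add x y hx hy =>
      rw [QuotientAddGroup.mk_add, TensorProduct.tmul_add]; exact add_mem hx hy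

lemma K0Q.hom_ext {V : Type*} [AddCommGroup V] [Module ℚ V] {f g : K0Q C →ₗ[ℚ] V}
    (h : ∀ M : C, f (cls M) = g (cls M)) : f = g :=
  LinearMap.ext_on_range (K0Q.span_cls C) h


lemma HasLen.nonneg {w : C → ℚ} (hw : ∀ A, 0 ≤ w A) {M : C} {l : ℚ} (h : HasLen w M l) :
    0 ≤ l := by
  induction h with
  | zero => rfl
  | cons _ _ _ h => exact add_nonneg (hw _) h

variable [FiniteLength C]

/-- The functional on `ℚ ⊗ K₀` with given values on simple objects. -/
theorem exists_weight (w : C → ℚ) (hw : ∀ {A A' : C}, Simple A → (A ≅ A') → w A = w A') :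
    ∃ μ : K0Q C →ₗ[ℚ] ℚ, (∀ M, HasLen w M (μ (cls M))) ∧ ∀ A, Simple A → μ (cls A) = w A := by
  choose d hd using HasLen.exists_len (C := C) w
  refine ⟨K0Q.lift d fun h => HasLen.unique hw _ (hd _) ((hd _).add h (hd _)), fun M => ?_,
    fun A hA => ?_⟩
  · rw [K0Q.lift_cls]; exact hd M
  · rw [K0Q.lift_cls]
    have h1 : HasLen w A (w A + 0) :=
      .cons hA (IsSES.cokernel (𝟙 A)) (.zero (isZero_cokernel_of_epi (𝟙 A)))
    rw [HasLen.unique hw A (hd A) h1, add_zero]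

open scoped Classical in
/-- The multiplicity of a simple object in a composition series. -/
theorem exists_multiplicity (S : C) :
    ∃ μ : K0Q C →ₗ[ℚ] ℚ, (∀ M, 0 ≤ μ (cls M)) ∧
      (∀ A, Simple A → μ (cls A) = if Nonempty (A ≅ S) then 1 else 0) := by
  obtain ⟨μ, hμ, hμ'⟩ := exists_weight (C := C) (fun A => if Nonempty (A ≅ S) then 1 else 0)
    fun {A A'} _ e => by
      have : Nonempty (A ≅ S) ↔ Nonempty (A' ≅ S) :=
        ⟨fun ⟨f⟩ => ⟨e.symm ≪≫ f⟩, fun ⟨f⟩ => ⟨e ≪≫ f⟩⟩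
      simp [this]
  refine ⟨μ, fun M => (hμ M).nonneg fun A => ?_, hμ'⟩
  split_ifs <;> simp

/-- If a multiple of the class of a simple object `U` is the class of `N`, then all simple
subobjects of `N` are isomorphic to `U`. -/
lemma nonempty_iso_of_cls_eq {U N S : C} (hU : Simple U) (hS : Simple S) (f : S ⟶ N) [Mono f]
    {c : ℚ} (h : cls N = c • cls U) : Nonempty (S ≅ U) := by
  classical
  obtain ⟨μ, h0, h1⟩ := exists_multiplicity S
  have h2 := cls_eq_add (IsSES.cokernel f)
  have h3 := congrArg μ h2
  rw [h, map_smul, map_add, h1 U hU, h1 S hS, if_pos (c := Nonempty (S ≅ S)) ⟨Iso.refl S⟩] at h3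
  have h4 := h0 (cokernel f)
  by_contra hne
  rw [if_neg fun ⟨e⟩ => hne ⟨e.symm⟩, smul_zero] at h3
  linarith

variable (C) in
/-- The length as a functional on `ℚ ⊗ K₀`. -/
theorem exists_length : ∃ μ : K0Q C →ₗ[ℚ] ℚ,
    (∀ M, HasLen (fun _ => 1) M (μ (cls M))) ∧ (∀ A, Simple A → μ (cls A) = 1) ∧
    ∀ M, ¬ IsZero M → 0 < μ (cls M) := by
  obtain ⟨μ, hμ, hμ'⟩ := exists_weight (C := C) (fun _ => 1) fun _ _ => rfl
  refine ⟨μ, hμ, hμ', fun M hM => ?_⟩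
  obtain ⟨A, hA, f, hf⟩ := exists_simple_mono hM
  rw [cls_eq_add (IsSES.cokernel f), map_add, hμ' A hA]
  have := (hμ (cokernel f)).nonneg fun _ => zero_le_one
  linarith

/-- Length is a functional on `ℚ ⊗ K₀` that is positive on nonzero objects. -/
lemma isZero_of_cls_eq_zero {M : C} (h : cls M = 0) : IsZero M := by
  obtain ⟨μ, -, -, hμ⟩ := exists_length C
  by_contra hM
  have := hμ M hM
  rw [h, map_zero] at this
  exact lt_irrefl _ this

/-- A monomorphism between objects of the same class is an isomorphism. -/
lemma isIso_of_mono_of_cls_eq {M N : C} (f : M ⟶ N) [Mono f] (h : cls M = cls N) : IsIso f := by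
  have h1 := cls_eq_add (IsSES.cokernel f)
  rw [h, left_eq_add] at h1
  have h2 := isZero_of_cls_eq_zero h1
  have : Epi f := Preadditive.epi_of_cokernel_zero (h2.eq_of_tgt _ _)
  exact isIso_of_mono_of_epi f

/-- By finite length, a nonzero kernel contains a simple subobject. -/
lemma mono_of_simple_sub {M N : C} (f : M ⟶ N)
    (h : ∀ (S : C) (_ : Simple S) (g : S ⟶ M), Mono g → g ≫ f ≠ 0) : Mono f := by
  refine Preadditive.mono_of_kernel_zero ?_
  by_contra hne
  have : ¬ IsZero (kernel f) := fun hz => hne (hz.eq_of_src _ _)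
  obtain ⟨S, hS, g, hg⟩ := exists_simple_mono this
  exact h S hS (g ≫ kernel.ι f) (mono_comp _ _) (by simp)

end K0

/-! ### Morphisms from simple objects -/

section HomSimple

variable {k : Type u'} [Field k] {C : Type u} [Category.{v} C] [Abelian C] [Linear k C]

variable (k) in
lemma finite_hom_of_simple {U A : C} [Simple U] [Simple A]
    (hU : Function.Bijective fun c : k => c • 𝟙 U) :
    Module.Finite k (U ⟶ A) ∧ Module.finrank k (U ⟶ A) ≤ 1 := by
  by_cases h : ∃ f : U ⟶ A, f ≠ 0
  · obtain ⟨f, hf⟩ := h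
    have : IsIso f := isIso_of_hom_simple hf
    have h1 : ∀ g : U ⟶ A, ∃ c : k, c • f = g := fun g => by
      obtain ⟨c, hc⟩ := hU.2 (g ≫ inv f)
      refine ⟨c, ?_⟩
      have hc : c • 𝟙 U = g ≫ inv f := hc
      rw [← Category.id_comp f, ← Linear.smul_comp, hc, Category.assoc, IsIso.inv_hom_id,
        Category.comp_id]
    refine ⟨⟨⟨{f}, ?_⟩⟩, finrank_le_one f h1⟩
    rw [eq_top_iff]
    rintro g -
    obtain ⟨c, rfl⟩ := h1 g
    exact Submodule.smul_mem _ _ (Submodule.subset_span (by simp))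
  · push Not at h
    have : Subsingleton (U ⟶ A) := ⟨fun f g => (h f).trans (h g).symm⟩
    exact ⟨inferInstance, by rw [Module.finrank_zero_of_subsingleton]; exact zero_le_one⟩

variable (k) in
/-- The dimension of a space of morphisms out of a simple object is at most the length. -/
lemma finite_hom {U M : C} [Simple U] (hU : Function.Bijective fun c : k => c • 𝟙 U) {l : ℚ}
    (h : HasLen (fun _ => 1) M l) :
    Module.Finite k (U ⟶ M) ∧ (Module.finrank k (U ⟶ M) : ℚ) ≤ l := by
  induction h with
  | @zero M hM =>
    have : Subsingleton (U ⟶ M) := ⟨fun f g => hM.eq_of_tgt _ _⟩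
    exact ⟨inferInstance, by rw [Module.finrank_zero_of_subsingleton]; simp⟩
  | @cons A M Q f g l hA h hQ ih =>
    obtain ⟨h1, h2⟩ := finite_hom_of_simple k (A := A) hU
    obtain ⟨h3, h4⟩ := ih
    -- Only left exactness of `Hom(U, -)` is used, so the simple subobject `A` adds at most one to
    -- the dimension.
    have hle : LinearMap.ker (Linear.rightComp k U g) ≤ LinearMap.range (Linear.rightComp k U f) :=
      fun y hy => by
        obtain ⟨w, hw⟩ := h.lift y hy
        exact ⟨w, hw⟩
    have h5 : Module.Finite k (LinearMap.ker (Linear.rightComp k U g)) :=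
      Submodule.finiteDimensional_of_le hle
    have h6 : Module.Finite k (LinearMap.range (Linear.rightComp k U g)) := inferInstance
    have h7 : Module.Finite k (U ⟶ M) := by
      have := Module.Finite.equiv (LinearMap.quotKerEquivRange (Linear.rightComp k U g)).symm
      exact Module.Finite.of_submodule_quotient (LinearMap.ker (Linear.rightComp k U g))
    refine ⟨h7, ?_⟩
    have h8 := LinearMap.finrank_range_add_finrank_ker (Linear.rightComp k U g)
    have h9 := Submodule.finrank_mono hle
    have h10 := LinearMap.finrank_range_le (Linear.rightComp k U f)
    have h11 := Submodule.finrank_le (LinearMap.range (Linear.rightComp k U g))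
    have h12 : Module.finrank k (U ⟶ M) ≤ 1 + Module.finrank k (U ⟶ Q) := by omega
    have h13 : (Module.finrank k (U ⟶ M) : ℚ) ≤ 1 + Module.finrank k (U ⟶ Q) := by
      exact_mod_cast h12
    linarith

end HomSimple

end SlTwo

namespace SlTwo

/-! ### Lowest weight vectors -/

section Weights

variable {V : Type*} [AddCommGroup V] [Module ℚ V]

/-- The commutation relations of `sl₂`. -/
structure IsSlTwo (e f h : V →ₗ[ℚ] V) : Prop where
  ef (v : V) : e (f v) = f (e v) + h v
  he (v : V) : h (e v) = e (h v) + (2 : ℚ) • e v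
  hf (v : V) : h (f v) = f (h v) - (2 : ℚ) • f v

namespace IsSlTwo

variable {e f h : V →ₗ[ℚ] V} (H : IsSlTwo e f h)

include H

lemma h_pow_e {v : V} {c : ℚ} (hv : h v = c • v) (i : ℕ) :
    h ((e ^ i) v) = (c + 2 * i) • (e ^ i) v := by
  induction i with
  | zero => simpa using hv
  | succ i ih =>
    rw [pow_succ', Module.End.mul_apply, H.he, ih, map_smul, ← add_smul]
    congr 1
    push_cast; ring

lemma h_pow_f {v : V} {c : ℚ} (hv : h v = c • v) (i : ℕ) :
    h ((f ^ i) v) = (c - 2 * i) • (f ^ i) v := by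
  induction i with
  | zero => simpa using hv
  | succ i ih =>
    rw [pow_succ', Module.End.mul_apply, H.hf, ih, map_smul, ← sub_smul]
    congr 1
    push_cast; ring

/-- The coefficient is minus the sum of the weights `c, c + 2, …, c + 2 i` along the string. For `c
= -n` it equals `(i + 1)(n - i)`, which is also the rank of `B_{i+1}` over `B_i`. -/
lemma f_pow_e {v : V} {c : ℚ} (hv : h v = c • v) (hf : f v = 0) (i : ℕ) :
    f ((e ^ (i + 1)) v) = ((i + 1) * (-c - i) : ℚ) • (e ^ i) v := by
  induction i with
  | zero =>
    have := H.ef v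
    rw [hf, map_zero] at this
    rw [zero_add, pow_one, pow_zero, Module.End.one_apply, eq_neg_of_add_eq_zero_left this.symm, hv,
      ← neg_smul]
    congr 1; simp
  | succ i ih =>
    have := H.ef ((e ^ (i + 1)) v)
    rw [ih, map_smul, H.h_pow_e hv, ← Module.End.mul_apply, ← pow_succ'] at this
    rw [pow_succ' e (i + 1), Module.End.mul_apply, ← sub_eq_of_eq_add this, ← sub_smul]
    congr 1
    push_cast; ring

/-- The weight of a lowest weight vector. -/
lemma weight_eq {v : V} {c : ℚ} (hv : h v = c • v) (hf : f v = 0) {n : ℕ}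
    (hn : (e ^ n) v ≠ 0) (hn' : (e ^ (n + 1)) v = 0) : c = -n := by
  have h1 := H.f_pow_e hv hf n
  rw [hn', map_zero] at h1
  rcases smul_eq_zero.1 h1.symm with h2 | h2
  · rcases mul_eq_zero.1 h2 with h3 | h3
    · have : (0 : ℚ) < n + 1 := by positivity
      linarith
    · linarith
  · exact absurd h2 hn

lemma pow_f_e (N : ℕ) {v : V} {c : ℚ} (hv : h v = c • v) :
    (f ^ (N + 1)) (e v) = e ((f ^ (N + 1)) v) - ((N + 1) * (c - N) : ℚ) • (f ^ N) v := by
  induction N with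
  | zero => rw [zero_add, pow_one, H.ef, hv]; simp
  | succ N ih =>
    rw [pow_succ' f (N + 1), Module.End.mul_apply, Module.End.mul_apply, ih, map_sub, map_smul,
      ← Module.End.mul_apply f (f ^ N), ← pow_succ', H.ef, H.h_pow_f hv]
    push_cast
    module

/-- A vector of weight `2 i - n` with `f^{i+1} v = 0 ≠ f^i v` is not killed by `e^{n-i}`. -/
lemma e_pow_ne_zero {n i : ℕ} (hi : i ≤ n) {v : V} (hv : h v = (2 * i - n : ℚ) • v)
    (h0 : (f ^ (i + 1)) v = 0) (h1 : (f ^ i) v ≠ 0) (M : ℕ) (hM : M ≤ n - i) :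
    (e ^ M) v ≠ 0 := by
  -- Going back from `e^M v` with `f^{i+M}` gives a multiple of `f^i v`. The step from `M` to `M +
  -- 1` contributes the factor `(i + M + 1)(n - i - M)`, which is nonzero as long as `M < n - i`.
  have key : ∀ M ≤ n - i, ∃ g : ℚ, g ≠ 0 ∧ (f ^ (i + M)) ((e ^ M) v) = g • (f ^ i) v := by
    intro M
    induction M with
    | zero => exact fun _ => ⟨1, one_ne_zero, by simp⟩
    | succ M ih =>
      intro hM
      obtain ⟨g, hg, hgv⟩ := ih (by omega)
      have hMn : (M : ℚ) + 1 + i ≤ n := by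
        have : M + 1 + i ≤ n := by omega
        exact_mod_cast this
      have hw := H.h_pow_e hv M
      have h2 := H.pow_f_e (i + M) hw
      refine ⟨-(((i + M : ℕ) + 1) * ((2 * i - n + 2 * M) - (i + M : ℕ))) * g,
        mul_ne_zero (neg_ne_zero.2 (mul_ne_zero (by positivity) ?_)) hg, ?_⟩
      · push_cast; intro h; linarith
      · rw [show i + (M + 1) = i + M + 1 from rfl, pow_succ' e, Module.End.mul_apply, h2,
          pow_succ' f (i + M), Module.End.mul_apply, hgv, map_smul, ← Module.End.mul_apply f,
          ← pow_succ', h0, smul_zero, map_zero, smul_smul]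
        module
  obtain ⟨g, hg, hgv⟩ := key M hM
  intro h
  rw [h, map_zero] at hgv
  exact smul_ne_zero hg h1 hgv.symm

end IsSlTwo

end Weights

/-! ### The classes of the objects `E^i U` -/

section Classes

variable {k : Type u} [Field k] {C : Type u'} [Category.{v} C] [Abelian C] [Linear k C]

/-- The dimension of morphism spaces and adjunctions. -/
def adjLinearEquiv {L R : C ⥤ C} (adj : L ⊣ R) [R.Additive] [R.Linear k] (M N : C) :
    (L.obj M ⟶ N) ≃ₗ[k] (M ⟶ R.obj N) where
  toFun f := adj.unit.app M ≫ R.map f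
  invFun g := (adj.homEquiv M N).symm g
  left_inv f := by
    change (adj.homEquiv M N).symm (adj.unit.app M ≫ R.map f) = f
    rw [← Adjunction.homEquiv_unit, Equiv.symm_apply_apply]
  right_inv g := by
    change adj.unit.app M ≫ R.map ((adj.homEquiv M N).symm g) = g
    exact (adj.homEquiv_unit M N _).symm.trans (Equiv.apply_symm_apply _ g)
  map_add' f g := by rw [R.map_add, Preadditive.comp_add]
  map_smul' c f := by rw [R.map_smul, Linear.comp_smul]; rfl

namespace Sl2Data

variable (D : Sl2Data k C)

/-- The linear maps `e` and `f` are the classes of `E` and `F`, and classes of simple objects are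
weight vectors. -/
structure IsAction (e f h : K0Q C →ₗ[ℚ] K0Q C) : Prop where
  cls_E (M : C) : cls (D.E.obj M) = e (cls M)
  cls_F (M : C) : cls (D.F.obj M) = f (cls M)
  isSlTwo : IsSlTwo e f h
  weight (S : C) : Simple S → ∃ c : ℚ, h (cls S) = c • cls S

variable {D}

lemma IsWeak.exists_isAction (hD : D.IsWeak) : ∃ e f h, D.IsAction e f h := by
  obtain ⟨e, f, h, he, hf, h1, h2, h3, -, hw⟩ := hD.sl2_action
  refine ⟨e, f, h, fun M => (he M).symm, fun M => (hf M).symm, ⟨fun v => ?_, fun v => ?_,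
    fun v => ?_⟩, fun S hS => ?_⟩
  · have := LinearMap.congr_fun h1 v
    rw [← this]; simp
  · have := LinearMap.congr_fun h2 v
    rw [LinearMap.smul_apply] at this
    rw [← this]; simp
  · have := LinearMap.congr_fun h3 v
    rw [LinearMap.neg_apply, LinearMap.smul_apply] at this
    rw [sub_eq_add_neg, ← this]; simp
  · obtain ⟨c, hc⟩ := hw S hS
    exact ⟨c, hc⟩

lemma IsWeak.finiteLength (hD : D.IsWeak) : FiniteLength C := ⟨hD.noetherian, hD.artinian⟩

variable (D) in
/-- A simple object `U` with `F U = 0` and `h_+(U) = n`. -/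
structure IsLowest (U : C) (n : ℕ) : Prop extends D.IsWeak where
  simple : Simple U
  isZero : IsZero (D.F.obj U)
  hPlus : D.HPlus U n

namespace IsLowest

variable {U : C} {n : ℕ} (hU : D.IsLowest U n)

include hU

lemma cls_iter {e f h} (hA : D.IsAction e f h) (i : ℕ) : cls (D.iter U i) = (e ^ i) (cls U) := by
  induction i with
  | zero => rfl
  | succ i ih =>
    rw [pow_succ', Module.End.mul_apply, ← ih]
    exact hA.cls_E _

lemma weight {e f h} (hA : D.IsAction e f h) : h (cls U) = (-n : ℚ) • cls U := by
  obtain ⟨c, hc⟩ := hA.weight U hU.simple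
  have h1 : (e ^ n) (cls U) ≠ 0 := by
    rw [← hU.cls_iter hA]; exact hU.hPlus.1
  have h2 : (e ^ (n + 1)) (cls U) = 0 := by
    rw [← hU.cls_iter hA]
    by_contra hne
    have := hU.hPlus.2 hne
    omega
  have h3 : f (cls U) = 0 := by rw [← hA.cls_F, cls_of_isZero hU.isZero]
  rw [hc, hA.isSlTwo.weight_eq hc h3 h1 h2]

lemma f_cls {e f h} (hA : D.IsAction e f h) : f (cls U) = 0 := by
  rw [← hA.cls_F, cls_of_isZero hU.isZero]

lemma f_cls_iter {e f h} (hA : D.IsAction e f h) (i : ℕ) :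
    f (cls (D.iter U (i + 1))) = ((i + 1) * (n - i) : ℚ) • cls (D.iter U i) := by
  rw [hU.cls_iter hA, hU.cls_iter hA, hA.isSlTwo.f_pow_e (hU.weight hA) (hU.f_cls hA), neg_neg]

/-- Iterating `f e^{i+1} [U] = (i + 1)(n - i) e^i [U]` produces the same product as the chain of
ranks of the algebras `B_i`. This coincidence drives the whole argument. -/
lemma f_pow_cls_iter {e f h} (hA : D.IsAction e f h) {i : ℕ} (hi : i ≤ n) :
    (f ^ i) (cls (D.iter U i)) = (prodRank n i : ℚ) • cls U := by
  induction i with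
  | zero => simp [prodRank, iter]
  | succ i ih =>
    rw [pow_succ, Module.End.mul_apply, hU.f_cls_iter hA, map_smul, ih (by omega), smul_smul,
      prodRank_succ]
    congr 1
    push_cast [Nat.cast_sub (by omega : i ≤ n)]
    ring

lemma iter_isZero {i : ℕ} (hi : n < i) : IsZero (D.iter U i) := by
  have := hU.finiteLength
  refine isZero_of_cls_eq_zero ?_
  by_contra hne
  have := hU.hPlus.2 hne
  omega

lemma iter_not_isZero {i : ℕ} (hi : i ≤ n) : ¬ IsZero (D.iter U i) := fun hz => by
  have := hU.additive_E
  have h1 : ∀ j, IsZero (D.iter U (i + j)) := fun j => by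
    induction j with
    | zero => exact hz
    | succ j ih => exact D.E.map_isZero ih
  have := h1 (n - i)
  rw [show i + (n - i) = n by omega] at this
  exact hU.hPlus.1 (cls_of_isZero this)

/-- By adjunction `Hom(E^i U, N) = Hom(U, F^i N)`, and the dimension of a space of morphisms out of
the simple object `U` is at most the length of the target. -/
lemma finite_hom_iter {e f h} (hA : D.IsAction e f h) {μ : K0Q C →ₗ[ℚ] ℚ}
    (hμ : ∀ M, HasLen (fun _ => 1) M (μ (cls M))) (i : ℕ) (N : C) :
    Module.Finite k (D.iter U i ⟶ N) ∧
      (Module.finrank k (D.iter U i ⟶ N) : ℚ) ≤ μ ((f ^ i) (cls N)) := by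
  have := hU.additive_F
  have := hU.linear_F
  have := hU.simple
  induction i generalizing N with
  | zero => exact finite_hom k (hU.end_simple U hU.simple) (hμ N)
  | succ i ih =>
    have h1 := ih (D.F.obj N)
    rw [hA.cls_F, ← Module.End.mul_apply, ← pow_succ] at h1
    have := h1.1
    have e := adjLinearEquiv (k := k) D.adj (D.iter U i) N
    exact ⟨Module.Finite.equiv e.symm, le_of_eq_of_le (congrArg _ e.finrank_eq) h1.2⟩

-- The object `F^i E^i U` has the class of `prodRank n i` copies of `U`, hence this length.
variable (k) in
lemma finite_end_iter {i : ℕ} (hi : i ≤ n) : Module.Finite k (D.iter U i ⟶ D.iter U i) ∧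
    Module.finrank k (D.iter U i ⟶ D.iter U i) ≤ prodRank n i := by
  have := hU.finiteLength
  obtain ⟨e, f, h, hA⟩ := hU.exists_isAction
  obtain ⟨μ, hμ, hμ1, -⟩ := exists_length C
  have h1 := hU.finite_hom_iter hA hμ i (D.iter U i)
  rw [hU.f_pow_cls_iter hA hi, map_smul, hμ1 U hU.simple, smul_eq_mul, mul_one] at h1
  exact ⟨h1.1, by exact_mod_cast h1.2⟩

/-- If `f^i [M]` is a nonzero multiple of `[U]`, there are nonzero morphisms from `E^i U`
to `M`. -/
lemma exists_hom_of_cls {e f h} (hA : D.IsAction e f h) (i : ℕ) {M : C} {c : ℚ}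
    (h1 : (f ^ i) (cls M) = c • cls U) (h2 : (f ^ i) (cls M) ≠ 0) :
    ∃ g : D.iter U i ⟶ M, g ≠ 0 := by
  have := hU.finiteLength
  have := hU.additive_F
  have := hU.linear_F
  induction i generalizing M with
  | zero =>
    have hM : ¬ IsZero M := fun hz => h2 (cls_of_isZero hz)
    obtain ⟨A, hAs, g, hg⟩ := exists_simple_mono hM
    obtain ⟨ι⟩ := nonempty_iso_of_cls_eq hU.simple hAs g h1
    refine ⟨ι.inv ≫ g, fun h0 => Simple.not_isZero A ((IsZero.iff_id_eq_zero A).2 ?_)⟩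
    rw [← cancel_mono g, ← cancel_epi ι.inv, Category.id_comp, zero_comp, comp_zero]
    exact h0
  | succ i ih =>
    rw [pow_succ, Module.End.mul_apply, ← hA.cls_F] at h1 h2
    obtain ⟨g, hg⟩ := ih h1 h2
    exact ⟨(adjLinearEquiv (k := k) D.adj _ _).symm g, (LinearEquiv.map_ne_zero_iff _).2 hg⟩

/-- If there are nonzero morphisms from `M` to `E^i U`, then `F^i M ≠ 0`. -/
lemma f_pow_cls_ne_zero {e f h} (hA : D.IsAction e f h) (i : ℕ) {M : C} {g : M ⟶ D.iter U i}
    (hg : g ≠ 0) : (f ^ i) (cls M) ≠ 0 := by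
  have := hU.finiteLength
  have := hU.additive_E
  have := hU.linear_E
  induction i generalizing M with
  | zero =>
    exact fun h0 => hg ((isZero_of_cls_eq_zero h0).eq_of_src _ _)
  | succ i ih =>
    -- The second adjunction enters here: `Hom(M, E N) = Hom(F M, N)`.
    obtain ⟨adj⟩ := hU.left_adj
    rw [pow_succ, Module.End.mul_apply, ← hA.cls_F]
    exact ih (g := (adjLinearEquiv (k := k) adj _ _).symm g) ((LinearEquiv.map_ne_zero_iff _).2 hg)

end IsLowest

lemma IsWeak.exists_mono_cls (hD : D.IsWeak) {e f h} (hA : D.IsAction e f h) (i : ℕ) {M N : C}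
    (g : M ⟶ N) [Mono g] : ∃ (M' N' : C) (g' : M' ⟶ N'), Mono g' ∧ cls M' = (f ^ i) (cls M) ∧
      cls N' = (f ^ i) (cls N) := by
  have := hD.left_exact_F
  induction i with
  | zero => exact ⟨M, N, g, ‹_›, rfl, rfl⟩
  | succ i ih =>
    obtain ⟨M', N', g', hg, h1, h2⟩ := ih
    refine ⟨_, _, D.F.map g', inferInstance, ?_, ?_⟩
    · rw [hA.cls_F, h1, pow_succ', Module.End.mul_apply]
    · rw [hA.cls_F, h2, pow_succ', Module.End.mul_apply]

end Sl2Data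

/-- The class of a subobject of an object whose class is a multiple of `[U]`. -/
lemma cls_eq_smul_of_mono [FiniteLength C] {U M N : C} (hU : Simple U) (g : M ⟶ N) [Mono g]
    {c : ℚ} (h : cls N = c • cls U) : ∃ c' : ℚ, cls M = c' • cls U := by
  classical
  -- The hypothesis says that no simple object other than `U` occurs in `M`. Its formulation with
  -- additive nonnegative functionals passes to quotients without effort.
  have key : ∀ M : C, (∀ (S : C) (μ : K0Q C →ₗ[ℚ] ℚ), ¬ Nonempty (S ≅ U) →
      (∀ M, 0 ≤ μ (cls M)) → (∀ A, Simple A → μ (cls A) = if Nonempty (A ≅ S) then 1 else 0) →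
      μ (cls M) = 0) → ∃ c' : ℚ, cls M = c' • cls U := by
    intro M
    induction M using finite_length_induction with
    | h0 M hM => exact fun _ => ⟨0, by rw [cls_of_isZero hM, zero_smul]⟩
    | h M hM ih =>
      intro hμ
      obtain ⟨A, hA, f, hf⟩ := exists_simple_mono hM
      have h1 := cls_eq_add (IsSES.cokernel f)
      obtain ⟨c', hc'⟩ := ih f (cokernel.π f) hA (IsSES.cokernel f) fun S μ hS h2 h3 => by
        have h4 := hμ S μ hS h2 h3
        rw [h1, map_add] at h4
        linarith [h2 A, h2 (cokernel f)]
      obtain ⟨e⟩ : Nonempty (A ≅ U) := by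
        by_contra hne
        obtain ⟨μ, h2, h3⟩ := exists_multiplicity A
        have h4 := hμ A μ hne h2 h3
        rw [h1, map_add, h3 A hA, if_pos ⟨Iso.refl A⟩] at h4
        linarith [h2 (cokernel f)]
      exact ⟨1 + c', by rw [h1, hc', cls_eq_of_iso e, add_smul, one_smul]⟩
  refine key M fun S μ hS h2 h3 => ?_
  have h4 := congrArg μ (cls_eq_add (IsSES.cokernel g))
  rw [h, map_smul, map_add, h3 U hU, if_neg fun ⟨e⟩ => hS ⟨e.symm⟩, smul_zero] at h4
  linarith [h2 M, h2 (cokernel g)]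

namespace Sl2Data.IsLowest

variable {D : Sl2Data k C} {U : C} {n : ℕ} (hU : D.IsLowest U n)

include hU

/-- By exactness `F^i S` is a subobject of `F^i E^i U`, whose composition factors are all isomorphic
to `U`. -/
lemma exists_f_pow_cls {e f h} (hA : D.IsAction e f h) {i : ℕ} (hi : i ≤ n) {S : C}
    (g : S ⟶ D.iter U i) [Mono g] : ∃ c : ℚ, (f ^ i) (cls S) = c • cls U := by
  have := hU.finiteLength
  obtain ⟨M', N', g', hg, h1, h2⟩ := hU.exists_mono_cls hA i g
  rw [hU.f_pow_cls_iter hA hi] at h2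
  rw [← h1]
  exact cls_eq_smul_of_mono hU.simple g' h2

/-- There are nonzero morphisms from `E^i U` to the subobjects of `E^i U`. -/
lemma exists_hom_of_mono {i : ℕ} (hi : i ≤ n) {S : C} (g : S ⟶ D.iter U i) [Mono g]
    (hg : g ≠ 0) : ∃ g' : D.iter U i ⟶ S, g' ≠ 0 := by
  obtain ⟨e, f, h, hA⟩ := hU.exists_isAction
  obtain ⟨c, hc⟩ := hU.exists_f_pow_cls hA hi g
  exact hU.exists_hom_of_cls hA i hc (hU.f_pow_cls_ne_zero hA i hg)

/-- The functor `E` does not kill simple subobjects of `E^i U`, for `i < n`. -/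
lemma not_isZero_E_of_mono {i : ℕ} (hi : i < n) {S : C} [Simple S] (g : S ⟶ D.iter U i)
    [Mono g] (hg : g ≠ 0) : ¬ IsZero (D.E.obj S) := by
  obtain ⟨e, f, h, hA⟩ := hU.exists_isAction
  obtain ⟨c, hc⟩ := hU.exists_f_pow_cls hA hi.le g
  have hne := hU.f_pow_cls_ne_zero hA i hg
  obtain ⟨w, hw⟩ := hA.weight S ‹_›
  have h1 := hA.isSlTwo.h_pow_f hw i
  have h2 : h ((f ^ i) (cls S)) = (-n : ℚ) • (f ^ i) (cls S) := by
    rw [hc, map_smul, hU.weight hA, smul_comm]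
  -- The class `[S]` has some weight `w`, and `f^i [S]` is a nonzero multiple of `[U]`, of weight
  -- `-n`. So `w = 2 i - n`, and then `e [S] ≠ 0` for `i < n`.
  have h3 : w - 2 * i = -n := smul_left_injective ℚ hne (h1.symm.trans h2)
  have h4 := hA.isSlTwo.e_pow_ne_zero hi.le (v := cls S) (by rw [hw]; congr 1; linarith)
    (by rw [pow_succ', Module.End.mul_apply, hc, map_smul, hU.f_cls hA, smul_zero]) hne 1 (by omega)
  rw [pow_one, ← hA.cls_E] at h4
  exact fun hz => h4 (cls_of_isZero hz)

/-- The functor `E` is faithful on morphisms to `E^i U`, for `i < n`. -/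
lemma eq_zero_of_map_eq_zero {i : ℕ} (hi : i < n) {M : C} {g : M ⟶ D.iter U i}
    (hg : D.E.map g = 0) : g = 0 := by
  have := hU.finiteLength
  have := hU.additive_E
  have := hU.left_exact_E
  have := hU.right_exact_E
  by_contra hne
  have h1 : ¬ IsZero (image g) := fun hz => hne (by
    rw [← image.fac g, hz.eq_of_tgt (factorThruImage g) 0, zero_comp])
  obtain ⟨S, hS, ι, hι⟩ := exists_simple_mono h1
  -- By exactness `E` kills the image of `g`, hence a simple subobject of it, which is also a
  -- subobject of `E^i U`.
  have h2 : IsZero (D.E.obj (image g)) := by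
    rw [IsZero.iff_id_eq_zero, ← cancel_mono (D.E.map (image.ι g)),
      ← cancel_epi (D.E.map (factorThruImage g)), Category.id_comp, ← D.E.map_comp, image.fac, hg]
    simp
  have h3 : IsZero (D.E.obj S) := h2.of_mono (D.E.map ι)
  refine hU.not_isZero_E_of_mono hi (ι ≫ image.ι g) (fun h0 => Simple.not_isZero S ?_) h3
  rw [IsZero.iff_id_eq_zero, ← cancel_mono (ι ≫ image.ι g), h0, comp_zero, comp_zero]

end Sl2Data.IsLowest

end Classes

end SlTwo

namespace SlTwo

/-! ### Representations of `H̄_n` -/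

section Lift

variable {k : Type u} [Field k] {A : Type*} [Ring A] [Algebra k A] {p : Param k} {n : ℕ}
  {X T : ℕ → A}

namespace IsHecke

lemma isUnit_X (h : IsHecke p n X T) (hq : p.q ≠ 1) {j : ℕ} (hj : j < n) : IsUnit (X j) := by
  have := isUnit_smul_one_add (h.nilpotent j hj) (p.a_ne_zero hq)
  convert this using 1
  abel

/-- The images of the generators of the affine Hecke algebra. -/
def genImage (p : Param k) (n : ℕ) (X T : ℕ → A) : HeckeGen p n → A
  | .T j _ => T j
  | .X j _ => X j
  | .Xinv j _ _ => Ring.inverse (X j)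

lemma lift_rel (h : IsHecke p n X T) {x y : FreeAlgebra k (HeckeGen p n)}
    (hxy : HeckeRel p n x y) :
    FreeAlgebra.lift k (genImage p n X T) x = FreeAlgebra.lift k (genImage p n X T) y := by
  cases hxy with
  | quad j hj =>
    simp only [map_mul, map_add, map_sub, map_smul, map_one, FreeAlgebra.lift_ι_apply,
      genImage, map_zero, add_mul, mul_sub, h.quad j hj, one_mul, Algebra.algebraMap_eq_smul_one,
      mul_smul_comm, mul_one]
    module
  | comm_T_T i j hi hj hij =>
    simp only [map_mul, FreeAlgebra.lift_ι_apply, genImage, h.TT i j hij hj]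
  | braid j hj hj' =>
    simp only [map_mul, FreeAlgebra.lift_ι_apply, genImage, h.braid j hj']
  | comm_X_X i j hi hj =>
    simp only [map_mul, FreeAlgebra.lift_ι_apply, genImage, h.XX i j hi hj]
  | X_Xinv j hj hq =>
    simp only [map_mul, map_one, FreeAlgebra.lift_ι_apply, genImage]
    exact Ring.mul_inverse_cancel _ (h.isUnit_X hq hj)
  | Xinv_X j hj hq =>
    simp only [map_mul, map_one, FreeAlgebra.lift_ι_apply, genImage]
    exact Ring.inverse_mul_cancel _ (h.isUnit_X hq hj)
  | comm_X_T i j hi hj h1 h2 =>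
    simp only [map_mul, FreeAlgebra.lift_ι_apply, genImage, h.XT i j hi hj h1 h2]
  | T_X_T j hj hj' hq =>
    simp only [map_mul, map_smul, FreeAlgebra.lift_ι_apply, genImage, h.affine hq j hj]
  | X_T_degenerate j hj hj' hq =>
    simp only [map_mul, map_add, map_one, FreeAlgebra.lift_ι_apply, genImage,
      h.affine_degenerate hq j hj]

/-- The representation of the affine Hecke algebra. -/
def liftAffine (h : IsHecke p n X T) : AffineHecke p n →ₐ[k] A :=
  RingQuot.liftAlgHom k ⟨FreeAlgebra.lift k (genImage p n X T), fun _ _ hxy => h.lift_rel hxy⟩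

lemma liftAffine_gen (h : IsHecke p n X T) (g : HeckeGen p n) :
    h.liftAffine (AffineHecke.gen p n g) = genImage p n X T g :=
  (RingQuot.liftAlgHom_mkAlgHom_apply k _ _ _).trans (FreeAlgebra.lift_ι_apply _ _)

lemma map_commEval {A' : Type*} [Ring A'] [Algebra k A'] (φ : A →ₐ[k] A') (x : Fin n → A)
    (hx : ∀ i j, x i * x j = x j * x i) (x' : Fin n → A') (hx' : ∀ i j, x' i * x' j = x' j * x' i)
    (e : ∀ i, φ (x i) = x' i) (f : MvPolynomial (Fin n) k) :
    φ (commEval x hx f) = commEval x' hx' f := by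
  have : φ.comp (commEval x hx) = commEval x' hx' := MvPolynomial.algHom_ext fun i => by
    rw [AlgHom.comp_apply, commEval_X, commEval_X, e]
  exact DFunLike.congr_fun this f

/-- The representation of `H̄_n` given by operators that satisfy the relations of the affine Hecke
algebra and are killed by symmetric polynomials. -/
theorem exists_lift (h : IsHecke p n X T) (hX : ∀ i j : Fin n, X i * X j = X j * X i)
    (hsymm : ∀ f : MvPolynomial (Fin n) k, f.IsSymmetric →
      MvPolynomial.eval (fun _ => p.a) f = 0 → commEval (fun i : Fin n => X i) hX f = 0) :
    ∃ Φ : HBar p n →ₐ[k] A, (∀ j < n, Φ (HBar.xN p n j) = X j) ∧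
      ∀ j, j + 1 < n → Φ (HBar.tN p n j) = T j := by
  have hrel : ∀ ⦃x y : AffineHecke p n⦄, HBarRel p n x y → h.liftAffine x = h.liftAffine y := by
    rintro _ _ ⟨f, hf, h0⟩
    rw [map_zero, map_commEval h.liftAffine _ _ (fun i : Fin n => X i) hX, hsymm f hf h0]
    exact fun i => h.liftAffine_gen _
  let Φ : HBar p n →ₐ[k] A := RingQuot.liftAlgHom k ⟨h.liftAffine, hrel⟩
  have hΦ : ∀ g, Φ (HBar.gen p n g) = genImage p n X T g := fun g =>
    (RingQuot.liftAlgHom_mkAlgHom_apply k _ _ _).trans (h.liftAffine_gen g)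
  refine ⟨Φ, fun j hj => ?_, fun j hj => ?_⟩
  · rw [HBar.xN_eq hj, hΦ]; rfl
  · rw [HBar.tN_eq hj, hΦ]; rfl

end IsHecke

end Lift

/-! ### The generators of the algebras `B_i` -/

section Generators

variable {k : Type u} [Field k] (p : Param k) (n : ℕ)

namespace B

/-- The element `X_j` of `B_i`. -/
def gX (i j : ℕ) : B p n i := fun h =>
  ⟨if j < i then HBar.xN p n j else 0, by
    split_ifs with hj
    · exact (((HBar.isHecke p n).nilSub_le_iff h.down _).1 (HBar.HBarSub_eq h.down).ge).1 j hj
    · exact zero_mem _⟩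

/-- The element `T_j` of `B_i`. -/
def gT (i j : ℕ) : B p n i := fun h =>
  ⟨if j + 1 < i then HBar.tN p n j else 0, by
    split_ifs with hj
    · exact (((HBar.isHecke p n).nilSub_le_iff h.down _).1 (HBar.HBarSub_eq h.down).ge).2 j hj
    · exact zero_mem _⟩

variable {p n}

lemma valHom_gX {i j : ℕ} (hi : i ≤ n) (hj : j < i) :
    valHom hi (gX p n i j) = HBar.xN p n j := if_pos hj

lemma valHom_gT {i j : ℕ} (hi : i ≤ n) (hj : j + 1 < i) :
    valHom hi (gT p n i j) = HBar.tN p n j := if_pos hj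

lemma incl_gX {i j : ℕ} (hi : i + 1 ≤ n) (hj : j < i) :
    incl p n i (gX p n i j) = gX p n (i + 1) j := by
  apply valHom_injective hi
  rw [valHom_incl, valHom_gX _ hj, valHom_gX _ (by omega)]

lemma incl_gT {i j : ℕ} (hi : i + 1 ≤ n) (hj : j + 1 < i) :
    incl p n i (gT p n i j) = gT p n (i + 1) j := by
  apply valHom_injective hi
  rw [valHom_incl, valHom_gT _ hj, valHom_gT _ (by omega)]

lemma X_eq_gX {i : ℕ} (hi : i + 1 ≤ n) : X p n i = gX p n (i + 1) i := by
  apply valHom_injective hi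
  rw [valHom_X, valHom_gX _ (by omega)]

lemma T_eq_gT {i : ℕ} (hi : i + 2 ≤ n) : T p n i = gT p n (i + 2) i := by
  apply valHom_injective hi
  rw [valHom_T, valHom_gT _ (by omega)]

/-- `B_i` is generated by the elements `X_j` and `T_j`. -/
lemma eq_top_of_mem {i : ℕ} (hi : i ≤ n) {S : Subalgebra k (B p n i)}
    (hX : ∀ j < i, gX p n i j ∈ S) (hT : ∀ j, j + 1 < i → gT p n i j ∈ S) : S = ⊤ := by
  have h1 : HBarSub p n i ≤ S.map (valHom hi) := by
    rw [HBar.HBarSub_eq hi]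
    refine ((HBar.isHecke p n).nilSub_le_iff hi _).2 ⟨fun j hj => ?_, fun j hj => ?_⟩
    · exact ⟨_, hX j hj, valHom_gX hi hj⟩
    · exact ⟨_, hT j hj, valHom_gT hi hj⟩
  rw [eq_top_iff]
  intro b _
  obtain ⟨b', hb', e⟩ := h1 (valHom_mem hi b)
  rwa [← valHom_injective hi e]

lemma algHom_ext {A : Type*} [Ring A] [Algebra k A] {i : ℕ} (hi : i ≤ n)
    {f g : B p n i →ₐ[k] A} (hX : ∀ j < i, f (gX p n i j) = g (gX p n i j))
    (hT : ∀ j, j + 1 < i → f (gT p n i j) = g (gT p n i j)) : f = g := by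
  have h1 : AlgHom.equalizer f g = ⊤ := eq_top_of_mem hi hX hT
  exact AlgHom.ext fun b => by
    have : b ∈ AlgHom.equalizer f g := by rw [h1]; trivial
    exact this

end B

end Generators

/-! ### The action of `B_i` on `E^i U` -/

section Action

variable {k : Type u} [Field k] {C : Type u'} [Category.{v} C] [Abelian C] [Linear k C]

/-- The action of a functor on endomorphisms. -/
def mapEndOp (F : C ⥤ C) [F.Additive] [F.Linear k] (M : C) :
    (End M)ᵐᵒᵖ →ₐ[k] (End (F.obj M))ᵐᵒᵖ where
  toFun b := MulOpposite.op (End.of (F.map b.unop.asHom))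
  map_one' := congrArg MulOpposite.op (F.map_id M)
  map_mul' a b := congrArg MulOpposite.op (F.map_comp a.unop.asHom b.unop.asHom)
  map_zero' := congrArg MulOpposite.op (F.map_zero M M)
  map_add' _ _ := congrArg MulOpposite.op (F.map_add)
  commutes' r := congrArg MulOpposite.op (by
    change F.map (r • 𝟙 M) = r • 𝟙 (F.obj M)
    rw [F.map_smul, F.map_id])

namespace Sl2Data

variable (D : Sl2Data k C) (U : C)

/-- The action of `E` on the endomorphisms of `E^i U`. -/
def stepHom [D.E.Additive] [D.E.Linear k] (i : ℕ) :
    (End (D.iter U i))ᵐᵒᵖ →ₐ[k] (End (D.iter U (i + 1)))ᵐᵒᵖ := mapEndOp D.E (D.iter U i)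

/-- The endomorphisms `X_j` of `E^i U`. -/
def heckeX [D.E.Additive] [D.E.Linear k] : ∀ i, ℕ → (End (D.iter U i))ᵐᵒᵖ
  | 0, _ => 0
  | i + 1, j => if j = i then MulOpposite.op (End.of (D.x (D.iter U i)))
      else D.stepHom U i (heckeX i j)

/-- The endomorphisms `T_j` of `E^i U`. -/
def heckeT [D.E.Additive] [D.E.Linear k] : ∀ i, ℕ → (End (D.iter U i))ᵐᵒᵖ
  | 0, _ => 0
  | 1, _ => 0
  | i + 2, j => if j = i then MulOpposite.op (End.of (D.t (D.iter U i)))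
      else D.stepHom U (i + 1) (heckeT (i + 1) j)

variable {D U} [D.E.Additive] [D.E.Linear k]

lemma heckeX_self (i : ℕ) :
    D.heckeX U (i + 1) i = MulOpposite.op (End.of (D.x (D.iter U i))) := if_pos rfl

lemma heckeX_succ {i j : ℕ} (h : j < i) :
    D.heckeX U (i + 1) j = D.stepHom U i (D.heckeX U i j) := if_neg h.ne

lemma heckeT_self (i : ℕ) :
    D.heckeT U (i + 2) i = MulOpposite.op (End.of (D.t (D.iter U i))) := if_pos rfl

lemma heckeT_succ {i j : ℕ} (h : j + 1 < i) :
    D.heckeT U (i + 1) j = D.stepHom U i (D.heckeT U i j) := by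
  obtain ⟨i, rfl⟩ : ∃ i', i = i' + 1 := ⟨i - 1, by omega⟩
  exact if_neg (by omega)

lemma x_comm (M : C) (b : (End M)ᵐᵒᵖ) :
    MulOpposite.op (End.of (D.x M)) * mapEndOp (k := k) D.E M b =
      mapEndOp (k := k) D.E M b * MulOpposite.op (End.of (D.x M)) :=
  congrArg MulOpposite.op (D.X.naturality b.unop.asHom).symm

lemma t_comm (M : C) (b : (End M)ᵐᵒᵖ) :
    MulOpposite.op (End.of (D.t M)) *
        mapEndOp (k := k) D.E (D.E.obj M) (mapEndOp (k := k) D.E M b) =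
      mapEndOp (k := k) D.E (D.E.obj M) (mapEndOp (k := k) D.E M b) *
        MulOpposite.op (End.of (D.t M)) :=
  congrArg MulOpposite.op (D.T.naturality b.unop.asHom).symm

/-- In the step from `E^i U` to `E^{i+1} U`, the old operators are transported by the functor `E`
and keep their relations. The new operators commute with the distant old ones by naturality. The
relations between neighbours are the axioms, read in the opposite endomorphism ring. -/
lemma isHecke (hD : D.IsSl2Categorification) (i : ℕ) :
    IsHecke D.param i (D.heckeX U i) (D.heckeT U i) := by
  have quad : ∀ M : C, D.t M ≫ D.t M = (D.param.q - 1) • D.t M + D.param.q • 𝟙 _ := by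
    intro M
    have h1 := hD.quad M
    simp only [Preadditive.add_comp, Preadditive.comp_sub, Linear.comp_smul, Category.comp_id,
      Category.id_comp] at h1
    rw [← sub_eq_zero, ← h1]
    module
  induction i with
  | zero => exact ⟨fun i j hi => by omega, fun j hj => by omega, fun i j hij hj => by omega,
      fun j hj => by omega, fun i j hi => by omega, fun _ j hj => by omega,
      fun _ j hj => by omega, fun j hj => by omega⟩
  | succ i ih =>
    have h := ih.map (D.stepHom U i)
    have hXX : ∀ j < i, D.heckeX U (i + 1) i * D.heckeX U (i + 1) j =
        D.heckeX U (i + 1) j * D.heckeX U (i + 1) i := fun j hj => by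
      rw [heckeX_self, heckeX_succ hj]; exact x_comm _ _
    have hXT : ∀ j, j + 1 < i → D.heckeX U (i + 1) i * D.heckeT U (i + 1) j =
        D.heckeT U (i + 1) j * D.heckeX U (i + 1) i := fun j hj => by
      rw [heckeX_self, heckeT_succ hj]; exact x_comm _ _
    refine ⟨?_, ?_, ?_, ?_, ?_, ?_, ?_, ?_⟩
    · intro a b ha hb
      rcases Nat.lt_succ_iff_lt_or_eq.1 ha with ha | rfl
      · rcases Nat.lt_succ_iff_lt_or_eq.1 hb with hb | rfl
        · rw [heckeX_succ ha, heckeX_succ hb]; exact h.XX a b ha hb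
        · exact (hXX a ha).symm
      · rcases Nat.lt_succ_iff_lt_or_eq.1 hb with hb | rfl
        · exact hXX b hb
        · rfl
    · intro j hj
      rcases Nat.lt_succ_iff_lt_or_eq.1 hj with hj | rfl
      · rw [heckeT_succ hj]; exact h.quad j hj
      · rw [heckeT_self]; exact congrArg MulOpposite.op (quad _)
    · intro a b hab hb
      rcases Nat.lt_succ_iff_lt_or_eq.1 hb with hb | rfl
      · rw [heckeT_succ (by omega), heckeT_succ hb]; exact h.TT a b hab hb
      · rw [heckeT_self, heckeT_succ (by omega), heckeT_succ (by omega)]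
        exact (t_comm _ _).symm
    · intro j hj
      rcases Nat.lt_succ_iff_lt_or_eq.1 hj with hj | rfl
      · rw [heckeT_succ (by omega), heckeT_succ (by omega)]; exact h.braid j hj
      · rw [heckeT_self, heckeT_succ (by omega), heckeT_self]
        refine congrArg MulOpposite.op ?_
        have := hD.braid (D.iter U j)
        rw [← Category.assoc, ← Category.assoc] at this
        exact this
    · intro a b ha hb h1 h2
      rcases Nat.lt_succ_iff_lt_or_eq.1 hb with hb | rfl
      · rcases Nat.lt_succ_iff_lt_or_eq.1 ha with ha | rfl
        · rw [heckeX_succ ha, heckeT_succ hb]; exact h.XT a b ha hb h1 h2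
        · exact hXT b hb
      · rw [heckeT_self, heckeX_succ (by omega), heckeX_succ (by omega)]
        exact (t_comm _ _).symm
    · intro hq j hj
      rcases Nat.lt_succ_iff_lt_or_eq.1 hj with hj | rfl
      · rw [heckeT_succ hj, heckeX_succ (by omega), heckeX_succ hj]; exact h.affine hq j hj
      · rw [heckeT_self, heckeX_succ (by omega), heckeX_self, heckeX_self]
        refine congrArg MulOpposite.op ?_
        have := hD.affine hq (D.iter U j)
        rw [← Category.assoc] at this
        exact this
    · intro hq j hj
      rcases Nat.lt_succ_iff_lt_or_eq.1 hj with hj | rfl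
      · rw [heckeT_succ hj, heckeX_succ hj, heckeX_succ (by omega)]
        exact h.affine_degenerate hq j hj
      · rw [heckeT_self, heckeX_self, heckeX_succ (by omega), heckeX_self]
        refine congrArg MulOpposite.op ?_
        -- The axiom `T (1_E X) T = X 1_E - T` takes the form of the Hecke relation after
        -- multiplication by `T`, because `T² = 1` for `q = 1`.
        have h1 := hD.affine_degenerate hq (D.iter U j)
        have h2 := quad (D.iter U j)
        rw [hq] at h2
        simp only [sub_self, zero_smul, one_smul, zero_add] at h2
        have h3 := congrArg (· ≫ D.t (D.iter U j)) h1
        simp only [Category.assoc, h2, Category.comp_id, Preadditive.sub_comp] at h3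
        exact sub_eq_iff_eq_add.1 h3.symm
    · intro j hj
      rcases Nat.lt_succ_iff_lt_or_eq.1 hj with hj | rfl
      · rw [heckeX_succ hj]; exact h.nilpotent j hj
      · rw [heckeX_self]
        obtain ⟨N, hN⟩ := hD.nilpotent (D.iter U j)
        exact ⟨N, (MulOpposite.op_pow _ _).symm.trans (congrArg MulOpposite.op hN)⟩

namespace IsLowest

variable {n : ℕ} (hU : D.IsLowest U n) (hD : D.IsSl2Categorification)

include hU

lemma stepHom_injective {i : ℕ} (hi : i < n) :
    Function.Injective (D.stepHom U i) := by
  rw [injective_iff_map_eq_zero]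
  intro b hb
  have h1 : D.E.map b.unop.asHom = 0 := congrArg MulOpposite.unop hb
  exact congrArg MulOpposite.op (hU.eq_zero_of_map_eq_zero hi h1)

omit [D.E.Additive] [D.E.Linear k] in
variable (k) in
lemma finite_end {i : ℕ} (hi : i ≤ n) : Module.Finite k (End (D.iter U i))ᵐᵒᵖ ∧
    Module.finrank k (End (D.iter U i))ᵐᵒᵖ ≤ prodRank n i := by
  obtain ⟨h1, h2⟩ := hU.finite_end_iter k hi
  have e := MulOpposite.opLinearEquiv k (M := End (D.iter U i))
  have : Module.Finite k (End (D.iter U i)) := h1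
  exact ⟨Module.Finite.equiv e, by rw [← e.finrank_eq]; exact h2⟩

omit [D.E.Additive] [D.E.Linear k] in
lemma nontrivial_end {i : ℕ} (hi : i ≤ n) : Nontrivial (End (D.iter U i))ᵐᵒᵖ := by
  refine ⟨1, 0, fun e => hU.iter_not_isZero hi ?_⟩
  rw [IsZero.iff_id_eq_zero]
  exact congrArg MulOpposite.unop e

include hD

/-- The bound `(n!)²` for the dimension of `End(E^n U)` forces symmetric polynomials to act by
scalars, so the action of `H_n` factors through `H̄_n`. Its image contains the generators and is
therefore everything. Since both dimensions are `(n!)²`, the map is also injective. -/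
lemma exists_repr_top : ∃ Φ : HBar D.param n →ₐ[k] (End (D.iter U n))ᵐᵒᵖ,
    Function.Injective Φ ∧ (∀ j < n, Φ (HBar.xN D.param n j) = D.heckeX U n j) ∧
      ∀ j, j + 1 < n → Φ (HBar.tN D.param n j) = D.heckeT U n j := by
  obtain ⟨hfin, hdim⟩ := hU.finite_end k le_rfl
  have := hU.nontrivial_end le_rfl
  rw [prodRank_self] at hdim
  have h := isHecke (U := U) hD n
  have hX : ∀ i j : Fin n, D.heckeX U n i * D.heckeX U n j = D.heckeX U n j * D.heckeX U n i :=
    fun i j => h.XX i j i.2 j.2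
  obtain ⟨Φ, hΦX, hΦT⟩ := h.exists_lift hX fun f hf h0 => h.commEval_eq_zero hdim hX hf h0
  refine ⟨Φ, ?_, hΦX, hΦT⟩
  have hrange : Φ.range = ⊤ := h.eq_top_of_subalgebra hdim Φ.range
    (fun j hj => ⟨_, hΦX j hj⟩) (fun j hj => ⟨_, hΦT j hj⟩)
  have hsurj : Function.Surjective Φ := AlgHom.range_eq_top Φ |>.1 hrange
  have : Nontrivial (HBar D.param n) := ⟨1, 0, fun e => by
    have := congrArg Φ e
    rw [map_one, map_zero] at this
    exact one_ne_zero this⟩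
  have e1 : Module.finrank k (HBar D.param n) = n.factorial * n.factorial := by
    have h1 := (HBar.isNilHecke D.param n).finrank_nilSub (HBar.isSpanned D.param n)
      (HBar.nilSub_self D.param n) le_rfl
    rw [HBar.nilSub_self, prodRank_self] at h1
    rw [← h1]
    exact (Subalgebra.topEquiv (R := k) (A := HBar D.param n)).toLinearEquiv.finrank_eq.symm
  have e2 : n.factorial * n.factorial ≤ Module.finrank k (End (D.iter U n))ᵐᵒᵖ :=
    (h.isNilHecke.factorial_sq_le_finrank_of_bimodule ⊤ top_ne_bot (fun _ _ _ _ => trivial)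
      (fun _ _ _ _ => trivial) (fun _ _ _ _ => trivial) (fun _ _ _ _ => trivial)).trans
      (Submodule.finrank_le _)
  exact (LinearMap.injective_iff_surjective_of_finrank_eq_finrank (f := Φ.toLinearMap)
    (e1.trans (le_antisymm e2 hdim))).2 hsurj

/-- That `H̄_n ≠ 0`, on which all rank computations depend, follows from its action on the nonzero
object `E^n U`, without a basis theorem for affine Hecke algebras. -/
lemma nontrivial_hBar : Nontrivial (HBar D.param n) := by
  obtain ⟨Φ, -, -, -⟩ := hU.exists_repr_top hD
  have := hU.nontrivial_end le_rfl
  exact ⟨1, 0, fun e => by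
    have := congrArg Φ e
    rw [map_one, map_zero] at this
    exact one_ne_zero this⟩

/-- Descending induction. The generators of `B_i`, acting on `E^{i+1} U` through `B_{i+1}`, lie in
the image of `End(E^i U)` under `E`. As `E` is injective on this ring for `i < n`, the action
descends. This avoids a presentation of `B_i`, which is only given as a subalgebra of `H̄_n`. -/
lemma exists_repr {i : ℕ} (hi : i ≤ n) : ∃ ρ : B D.param n i →ₐ[k] (End (D.iter U i))ᵐᵒᵖ,
    Function.Injective ρ ∧ (∀ j < i, ρ (B.gX D.param n i j) = D.heckeX U i j) ∧
      ∀ j, j + 1 < i → ρ (B.gT D.param n i j) = D.heckeT U i j := by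
  induction hi using Nat.decreasingInduction with
  | self =>
    obtain ⟨Φ, h1, h2, h3⟩ := hU.exists_repr_top hD
    refine ⟨Φ.comp (B.valHom le_rfl), h1.comp (B.valHom_injective le_rfl), fun j hj => ?_,
      fun j hj => ?_⟩
    · rw [AlgHom.comp_apply, B.valHom_gX le_rfl hj, h2 j hj]
    · rw [AlgHom.comp_apply, B.valHom_gT le_rfl hj, h3 j hj]
  | of_succ i hi ih =>
    obtain ⟨ρ, h1, h2, h3⟩ := ih
    have hinj := hU.stepHom_injective hi
    have hinc : Function.Injective (B.incl D.param n i) := fun b b' e => by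
      apply B.valHom_injective hi.le
      rw [← B.valHom_incl hi, e, B.valHom_incl hi]
    have hX : ∀ j < i, ρ (B.incl D.param n i (B.gX D.param n i j)) =
        D.stepHom U i (D.heckeX U i j) := fun j hj => by
      rw [B.incl_gX hi hj, h2 j (by omega), heckeX_succ hj]
    have hT : ∀ j, j + 1 < i → ρ (B.incl D.param n i (B.gT D.param n i j)) =
        D.stepHom U i (D.heckeT U i j) := fun j hj => by
      rw [B.incl_gT hi hj, h3 j (by omega), heckeT_succ hj]
    have hS : (D.stepHom U i).range.comap (ρ.comp (B.incl D.param n i)) = ⊤ :=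
      B.eq_top_of_mem hi.le (fun j hj => ⟨_, (hX j hj).symm⟩) (fun j hj => ⟨_, (hT j hj).symm⟩)
    have hr : ∀ b, (ρ.comp (B.incl D.param n i)) b ∈
        (D.stepHom U i).range := fun b => by
      have : b ∈ (D.stepHom U i).range.comap
        (ρ.comp (B.incl D.param n i)) := by rw [hS]; trivial
      exact this
    let e := AlgEquiv.ofInjective (D.stepHom U i) hinj
    have he : ∀ y, D.stepHom U i (e.symm y) = y := fun y =>
      congrArg Subtype.val (e.apply_symm_apply y)
    refine ⟨e.symm.toAlgHom.comp ((ρ.comp (B.incl D.param n i)).codRestrict _ hr), ?_, ?_, ?_⟩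
    · intro b b' hb
      have h4 := congrArg Subtype.val (e.symm.injective hb)
      exact hinc (h1 h4)
    · intro j hj
      apply hinj
      exact (he _).trans (hX j hj)
    · intro j hj
      apply hinj
      exact (he _).trans (hT j hj)

/-- The right actions of the algebras `B_i` on the objects `E^i U`. -/
theorem exists_heckeAction :
    ∃ ρ : ∀ i : ℕ, B D.param n i →ₐ[k] (End (D.iter U i))ᵐᵒᵖ, D.IsHeckeAction U n ρ ∧
      ∀ i ≤ n, Function.Bijective (ρ i) := by
  have hnt := hU.nontrivial_hBar hD
  -- In degrees above `n` both `B_i` and `E^i U` are zero, so the zero map is the action there.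
  have htriv : ∀ i, n < i → Subsingleton (End (D.iter U i))ᵐᵒᵖ := fun i hi =>
    ⟨fun a b => congrArg MulOpposite.op ((hU.iter_isZero hi).eq_of_src _ _)⟩
  have hex : ∀ i : ℕ, ∃ ρ : B D.param n i →ₐ[k] (End (D.iter U i))ᵐᵒᵖ, i ≤ n →
      Function.Injective ρ ∧ (∀ j < i, ρ (B.gX D.param n i j) = D.heckeX U i j) ∧
      ∀ j, j + 1 < i → ρ (B.gT D.param n i j) = D.heckeT U i j := fun i => by
    by_cases hi : i ≤ n
    · obtain ⟨ρ, hρ⟩ := hU.exists_repr hD hi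
      exact ⟨ρ, fun _ => hρ⟩
    · have := htriv i (by omega)
      exact ⟨{  toFun := fun _ => 0
                map_one' := Subsingleton.elim _ _
                map_mul' := fun _ _ => Subsingleton.elim _ _
                map_zero' := rfl
                map_add' := fun _ _ => Subsingleton.elim _ _
                commutes' := fun _ => Subsingleton.elim _ _ }, fun h => absurd h hi⟩
  choose ρ hρ using hex
  refine ⟨ρ, ⟨fun i b => ?_, fun i => ?_, fun i => ?_⟩, fun i hi => ?_⟩
  · by_cases hi : i + 1 ≤ n
    · obtain ⟨-, h2, h3⟩ := hρ (i + 1) hi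
      obtain ⟨-, h2', h3'⟩ := hρ i (by omega)
      have : (ρ (i + 1)).comp (B.incl D.param n i) =
          (D.stepHom U i).comp (ρ i) :=
        B.algHom_ext (by omega)
          (fun j hj => by
            rw [AlgHom.comp_apply, AlgHom.comp_apply, B.incl_gX hi hj, h2 j (by omega),
              h2' j hj, heckeX_succ hj])
          (fun j hj => by
            rw [AlgHom.comp_apply, AlgHom.comp_apply, B.incl_gT hi hj, h3 j (by omega),
              h3' j hj, heckeT_succ hj])
      exact congrArg MulOpposite.unop (DFunLike.congr_fun this b)
    · exact (hU.iter_isZero (i := i + 1) (by omega)).eq_of_src _ _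
  · by_cases hi : i + 1 ≤ n
    · rw [B.X_eq_gX hi, (hρ (i + 1) hi).2.1 i (by omega), heckeX_self]; rfl
    · exact (hU.iter_isZero (i := i + 1) (by omega)).eq_of_src _ _
  · by_cases hi : i + 2 ≤ n
    · rw [B.T_eq_gT hi, (hρ (i + 2) hi).2.2 i (by omega), heckeT_self]; rfl
    · exact (hU.iter_isZero (i := i + 2) (by omega)).eq_of_src _ _
  · obtain ⟨hfin, hdim⟩ := hU.finite_end k hi
    have h1 := LinearMap.finrank_le_finrank_of_injective (f := (ρ i).toLinearMap) (hρ i hi).1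
    rw [B.finrank_eq hi] at h1
    refine ⟨(hρ i hi).1, (LinearMap.injective_iff_surjective_of_finrank_eq_finrank
      (f := (ρ i).toLinearMap) ?_).1 (hρ i hi).1⟩
    rw [B.finrank_eq hi]
    exact le_antisymm h1 hdim

end IsLowest

end Sl2Data

end Action

end SlTwo

namespace SlTwo

/-! ### Tensor products of objects with modules -/

section TensorExists

attribute [local instance] Abelian.hasFiniteBiproducts

variable {k : Type u} [Field k] {C : Type u'} [Category.{v} C] [Abelian C] [Linear k C]
  {A : Type u} [Ring A] [Algebra k A] {V : C} (ρ : A →ₐ[k] (End V)ᵐᵒᵖ)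

/-- The `A`-module structure on spaces of morphisms out of an object with a right action. -/
abbrev homModule (Y : C) : Module A (V ⟶ Y) where
  smul b g := (ρ b).unop.asHom ≫ g
  one_smul g := by
    change (ρ 1).unop.asHom ≫ g = g
    rw [map_one]; exact Category.id_comp g
  mul_smul b b' g := by
    change (ρ (b * b')).unop.asHom ≫ g = (ρ b).unop.asHom ≫ (ρ b').unop.asHom ≫ g
    rw [map_mul]; exact Category.assoc _ _ _
  smul_zero b := comp_zero
  smul_add b g g' := Preadditive.comp_add _ _ _ _ _ _
  add_smul b b' g := by
    change (ρ (b + b')).unop.asHom ≫ g = (ρ b).unop.asHom ≫ g + (ρ b').unop.asHom ≫ g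
    rw [map_add]; exact Preadditive.add_comp _ _ _ _ _ _
  zero_smul g := by
    change (ρ 0).unop.asHom ≫ g = 0
    rw [map_zero]; exact zero_comp

/-- There is a finite presentation `A^t → A^s → M` because `A` is Noetherian, and `V ⊗_A M` is the
cokernel of the corresponding morphism `V^t → V^s`. Its universal property is that of a cokernel,
since linear maps out of `A^s` are determined by the values on the basis. -/
lemma exists_tensor [IsNoetherianRing A] (M : Type u) [AddCommGroup M] [Module A M]
    [Module.Finite A M] :
    ∃ (T : C) (ι : M →+ (V ⟶ T)), (∀ b m, ι (b • m) = (ρ b).unop.asHom ≫ ι m) ∧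
      ∀ (Y : C) (g : M →+ (V ⟶ Y)), (∀ b m, g (b • m) = (ρ b).unop.asHom ≫ g m) →
        ∃! h : T ⟶ Y, ∀ m, ι m ≫ h = g m := by
  let inst : ∀ Y : C, Module A (V ⟶ Y) := homModule ρ
  have hsmul : ∀ (Y : C) (b : A) (g : V ⟶ Y), b • g = (ρ b).unop.asHom ≫ g := fun _ _ _ => rfl
  let comp : ∀ {Y Y' : C}, (Y ⟶ Y') → ((V ⟶ Y) →ₗ[A] (V ⟶ Y')) := fun h =>
    { toFun := fun g => g ≫ h
      map_add' := fun g g' => Preadditive.add_comp _ _ _ _ _ _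
      map_smul' := fun b g => Category.assoc _ _ _ }
  obtain ⟨s, e, he⟩ := Module.Finite.exists_fin' A M
  obtain ⟨t, r, hr⟩ := Submodule.fg_iff_exists_fin_generating_family.1
    (IsNoetherian.noetherian (LinearMap.ker e))
  let Φ : (Fin s → A) →ₗ[A] (V ⟶ ⨁ fun _ : Fin s => V) :=
    Fintype.linearCombination A (biproduct.ι fun _ : Fin s => V)
  let d : (⨁ fun _ : Fin t => V) ⟶ ⨁ fun _ : Fin s => V := biproduct.desc fun j => Φ (r j)
  let π := cokernel.π d
  let Ψ : (Fin s → A) →ₗ[A] (V ⟶ cokernel d) := comp π ∘ₗ Φ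
  have hker : LinearMap.ker e ≤ LinearMap.ker Ψ := by
    rw [← hr]
    refine Submodule.span_le.2 ?_
    rintro _ ⟨j, rfl⟩
    change Φ (r j) ≫ π = 0
    have : biproduct.ι (fun _ : Fin t => V) j ≫ d = Φ (r j) := biproduct.ι_desc _ _
    rw [← this, Category.assoc, cokernel.condition, comp_zero]
  let q := LinearMap.quotKerEquivOfSurjective e he
  let ι : M →ₗ[A] (V ⟶ cokernel d) := (LinearMap.ker e).liftQ Ψ hker ∘ₗ q.symm.toLinearMap
  have hι : ∀ c, ι (e c) = Ψ c := fun c => by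
    have : q.symm (e c) = Submodule.Quotient.mk c := by
      rw [LinearEquiv.symm_apply_eq]; rfl
    change (LinearMap.ker e).liftQ Ψ hker (q.symm (e c)) = Ψ c
    rw [this]; rfl
  have hΦ : ∀ {Y : C} (h : (⨁ fun _ : Fin s => V) ⟶ Y) (G : (Fin s → A) →ₗ[A] (V ⟶ Y)),
      (∀ i, biproduct.ι (fun _ : Fin s => V) i ≫ h = G (Pi.single i 1)) →
        comp h ∘ₗ Φ = G := by
    intro Y h G hG
    refine LinearMap.pi_ext' fun i => LinearMap.ext_ring ?_
    rw [LinearMap.comp_apply, LinearMap.comp_apply, LinearMap.comp_apply, LinearMap.coe_single,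
      ← hG i]
    change Fintype.linearCombination A _ (Pi.single i 1) ≫ h = _
    rw [Fintype.linearCombination_apply_single, one_smul]
  refine ⟨cokernel d, ι.toAddMonoidHom, fun b m => ι.map_smul b m, fun Y g hg => ?_⟩
  let gl : M →ₗ[A] (V ⟶ Y) := { toFun := g, map_add' := map_add g, map_smul' := hg }
  let h₀ : (⨁ fun _ : Fin s => V) ⟶ Y := biproduct.desc fun i => gl (e (Pi.single i 1))
  have h1 : comp h₀ ∘ₗ Φ = gl ∘ₗ e := hΦ h₀ (gl ∘ₗ e) fun i => biproduct.ι_desc _ _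
  have h2 : d ≫ h₀ = 0 := by
    refine biproduct.hom_ext' _ _ fun j => ?_
    have h3 : biproduct.ι (fun _ : Fin t => V) j ≫ d = Φ (r j) := biproduct.ι_desc _ _
    rw [← Category.assoc, h3, comp_zero]
    have h4 : e (r j) = 0 := by
      have : r j ∈ LinearMap.ker e := by rw [← hr]; exact Submodule.subset_span ⟨j, rfl⟩
      exact this
    have h5 := LinearMap.congr_fun h1 (r j)
    rw [LinearMap.comp_apply, LinearMap.comp_apply, h4, map_zero] at h5
    exact h5
  refine ⟨cokernel.desc d h₀ h2, fun m => ?_, fun h' hh' => ?_⟩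
  · obtain ⟨c, rfl⟩ := he m
    change ι (e c) ≫ _ = gl (e c)
    rw [hι]
    change (Φ c ≫ π) ≫ _ = _
    rw [Category.assoc, cokernel.π_desc]
    exact LinearMap.congr_fun h1 c
  · rw [← cancel_epi (cokernel.π d), cokernel.π_desc]
    refine biproduct.hom_ext' _ _ fun i => ?_
    have h6 : Φ (Pi.single i 1) = biproduct.ι (fun _ : Fin s => V) i := by
      change Fintype.linearCombination A _ (Pi.single i 1) = _
      rw [Fintype.linearCombination_apply_single, one_smul]
    have h7 := hh' (e (Pi.single i 1))
    change ι (e _) ≫ h' = gl _ at h7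
    rw [hι] at h7
    change (Φ _ ≫ π) ≫ h' = _ at h7
    rw [h6, Category.assoc] at h7
    rw [h7, biproduct.ι_desc]

/-- The functor `V ⊗_A -` exists. -/
theorem exists_tensorFunctor [IsNoetherianRing A] : Nonempty (TensorFunctor ρ) := by
  have hex := fun M : FGModuleCat.{u} A => exists_tensor ρ M
  choose T ι hsmul huniv using hex
  have hmap : ∀ {M N : FGModuleCat.{u} A} (f : M ⟶ N), ∃! h : T M ⟶ T N,
      ∀ m, ι M m ≫ h = ι N (f m) := fun {M N} f =>
    huniv M (T N) ((ι N).comp (f.hom.hom : M →ₗ[A] N).toAddMonoidHom) fun b m => by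
      change ι N (f.hom.hom (b • m)) = _ ≫ ι N (f.hom.hom m)
      rw [map_smul, hsmul]
  choose φ hφ hφu using fun {M N : FGModuleCat.{u} A} (f : M ⟶ N) => (hmap f)
  refine ⟨{ functor := { obj := T, map := fun f => φ f, map_id := fun M => ?_,
                          map_comp := fun {M N P} f g => ?_ }
            ι := ι, ι_smul := hsmul, ι_map := fun f m => hφ f m, universal := huniv }⟩
  · exact (hφu (𝟙 M) _ fun m => Category.comp_id _).symm
  · refine (hφu (f ≫ g) _ fun m => ?_).symm
    rw [← Category.assoc, hφ f m, hφ g]; rfl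

end TensorExists

namespace TensorFunctor

variable {k : Type u} [Field k] {C : Type u'} [Category.{v} C] [Abelian C] [Linear k C]
  {A : Type u} [Ring A] [Algebra k A] {V : C} {ρ : A →ₐ[k] (End V)ᵐᵒᵖ} (G : TensorFunctor ρ)

lemma hom_ext {M : FGModuleCat.{u} A} {Y : C} {h h' : G.functor.obj M ⟶ Y}
    (e : ∀ m, G.ι M m ≫ h = G.ι M m ≫ h') : h = h' :=
  (G.universal M Y
    { toFun := fun m => G.ι M m ≫ h'
      map_zero' := by rw [map_zero, zero_comp]
      map_add' := fun x y => by rw [map_add, Preadditive.add_comp] }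
    fun b m => by
      change G.ι M (b • m) ≫ h' = _ ≫ G.ι M m ≫ h'
      rw [G.ι_smul, Category.assoc]).unique e fun _ => rfl

end TensorFunctor

/-! ### Morphisms out of the direct sums `⨁ V_i ⊗ M_i` -/

section SumFunctor

attribute [local instance] Abelian.hasFiniteBiproducts

variable {k : Type u} [Field k] {C : Type u'} [Category.{v} C] [Abelian C] [Linear k C]
  {p : Param k} {n : ℕ} {V : ℕ → C}
  {ρ : ∀ i, B p n i →ₐ[k] (End (V i))ᵐᵒᵖ} (G : ∀ i, TensorFunctor (ρ i))

/-- The inclusion of a summand. -/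
def sumIncl (M : MinCat p n) (i : ℕ) (hi : i ≤ n) :
    (G i).functor.obj (M i) ⟶ (sumFunctor G).obj M :=
  biproduct.ι (fun j : Fin (n + 1) => (G j).functor.obj (M j)) ⟨i, Nat.lt_succ_of_le hi⟩

lemma sumι_eq (M : MinCat p n) (i : ℕ) (hi : i ≤ n) (m : M i) :
    sumι G M i hi m = (G i).ι (M i) m ≫ sumIncl G M i hi := rfl

lemma sumIncl_map {M N : MinCat p n} (f : M ⟶ N) (i : ℕ) (hi : i ≤ n) :
    sumIncl G M i hi ≫ (sumFunctor G).map f = (G i).functor.map (f i) ≫ sumIncl G N i hi :=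
  biproduct.ι_map (f := fun j : Fin (n + 1) => (G j).functor.obj (M j))
    (g := fun j : Fin (n + 1) => (G j).functor.obj (N j))
    (fun j : Fin (n + 1) => (G j).functor.map (f j)) ⟨i, Nat.lt_succ_of_le hi⟩

lemma sumι_map {M N : MinCat p n} (f : M ⟶ N) (i : ℕ) (hi : i ≤ n) (m : M i) :
    sumι G M i hi m ≫ (sumFunctor G).map f = sumι G N i hi (f i m) := by
  rw [sumι_eq, Category.assoc, sumIncl_map, ← Category.assoc, (G i).ι_map, sumι_eq]

lemma sumι_smul (M : MinCat p n) (i : ℕ) (hi : i ≤ n) (b : B p n i) (m : M i) :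
    sumι G M i hi (b • m) = (ρ i b).unop.asHom ≫ sumι G M i hi m := by
  rw [sumι_eq, (G i).ι_smul, Category.assoc, sumι_eq]

lemma sumι_add (M : MinCat p n) (i : ℕ) (hi : i ≤ n) (m m' : M i) :
    sumι G M i hi (m + m') = sumι G M i hi m + sumι G M i hi m' := by
  rw [sumι_eq, map_add, Preadditive.add_comp]; rfl

lemma sumι_zero (M : MinCat p n) (i : ℕ) (hi : i ≤ n) : sumι G M i hi 0 = 0 := by
  rw [sumι_eq, map_zero, zero_comp]

variable {G} in
lemma sum_hom_ext {M : MinCat p n} {Y : C} {h h' : (sumFunctor G).obj M ⟶ Y}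
    (e : ∀ i hi m, sumι G M i hi m ≫ h = sumι G M i hi m ≫ h') : h = h' := by
  refine biproduct.hom_ext' _ _ fun i => (G i).hom_ext fun m => ?_
  have := e i (Nat.le_of_lt_succ i.2) m
  rw [sumι_eq, Category.assoc, Category.assoc] at this
  exact this

lemma exists_sum_desc (M : MinCat p n) (Y : C) (g : ∀ i, i ≤ n → M i → (V i ⟶ Y))
    (hadd : ∀ i hi m m', g i hi (m + m') = g i hi m + g i hi m')
    (hsmul : ∀ i hi b m, g i hi (b • m) = (ρ i b).unop.asHom ≫ g i hi m) :
    ∃ h : (sumFunctor G).obj M ⟶ Y, ∀ i hi m, sumι G M i hi m ≫ h = g i hi m := by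
  have hex : ∀ i : Fin (n + 1), ∃ h : (G i).functor.obj (M i) ⟶ Y, ∀ m, (G i).ι (M i) m ≫ h =
      g i (Nat.le_of_lt_succ i.2) m := fun i =>
    ((G i).universal (M i) Y (AddMonoidHom.mk' (g i (Nat.le_of_lt_succ i.2)) (hadd i _))
      (hsmul i _)).exists
  choose h hh using hex
  let H : (sumFunctor G).obj M ⟶ Y := biproduct.desc h
  refine ⟨H, fun i hi m => ?_⟩
  have h1 : sumIncl G M i hi ≫ H = h ⟨i, Nat.lt_succ_of_le hi⟩ :=
    biproduct.ι_desc _ _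
  rw [sumι_eq, Category.assoc, h1]
  exact hh ⟨i, Nat.lt_succ_of_le hi⟩ m

instance sumFunctor_additive : (sumFunctor G).Additive where
  map_add {M N f g} := sum_hom_ext fun i hi m => by
    rw [Preadditive.comp_add, sumι_map, sumι_map, sumι_map, ← sumι_add]; rfl

lemma algebraMap_unop_comp {A : Type*} [Ring A] [Algebra k A] {V Y : C}
    (ρ : A →ₐ[k] (End V)ᵐᵒᵖ) (c : k) (g : V ⟶ Y) :
    (ρ (algebraMap k A c)).unop.asHom ≫ g = c • g := by
  rw [AlgHom.commutes]
  change (c • 𝟙 V) ≫ g = c • g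
  rw [Linear.smul_comp, Category.id_comp]

instance sumFunctor_linear : (sumFunctor G).Linear k where
  map_smul {M N} f c := sum_hom_ext fun i hi m => by
    rw [Linear.comp_smul, sumι_map, sumι_map, ← algebraMap_unop_comp (ρ i), ← sumι_smul]
    rfl

end SumFunctor

end SlTwo

namespace SlTwo

/-! ### The isomorphism `E^i U ⊗ B_{i+1} ≅ F E^{i+1} U` -/

section FreeTensor

variable {C : Type u'} [Category.{v} C] [Abelian C]

/-- The class of a direct sum of copies of `V`. -/
lemma cls_eq_of_sum {V : C} (r : ℕ) {N : C} (p : Fin r → (N ⟶ V)) (i : Fin r → (V ⟶ N))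
    (hip : ∀ a b, i a ≫ p b = if a = b then 𝟙 V else 0) (hpi : ∑ a, p a ≫ i a = 𝟙 N) :
    cls N = (r : ℚ) • cls V := by
  induction r generalizing N with
  | zero =>
    rw [cls_of_isZero ((IsZero.iff_id_eq_zero N).2 (by rw [← hpi]; simp))]
    simp
  | succ r ih =>
    have h0 : i 0 ≫ p 0 = 𝟙 V := by rw [hip, if_pos rfl]
    have : IsSplitEpi (p 0) := ⟨⟨⟨i 0, h0⟩⟩⟩
    have h1 := ih (N := kernel (p 0)) (fun a => kernel.ι (p 0) ≫ p a.succ)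
      (fun a => kernel.lift (p 0) (i a.succ) (by rw [hip, if_neg (Fin.succ_ne_zero a)]))
      (fun a b => by
        rw [kernel.lift_ι_assoc, hip]
        simp only [Fin.succ_inj])
      (by
        rw [← cancel_mono (kernel.ι (p 0)), Preadditive.sum_comp, Category.id_comp]
        have h2 := congrArg (kernel.ι (p 0) ≫ ·) hpi
        rw [Fin.sum_univ_succ] at h2
        simp only [Preadditive.comp_add, kernel.condition_assoc, zero_comp, zero_add,
          Category.comp_id, Preadditive.comp_sum] at h2
        simpa using h2)
    rw [cls_eq_add (IsSES.kernel (p 0)), h1]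
    push_cast
    module

variable {k : Type u} [Field k] [Linear k C]
  {A : Type u} [Ring A] [Algebra k A] {V : C} {ρ : A →ₐ[k] (End V)ᵐᵒᵖ} (G : TensorFunctor ρ)

/-- The projections of `V ⊗_A M` to `V` for a free module `M`. -/
lemma TensorFunctor.exists_coord {J : Type*} [Fintype J] [DecidableEq J] (M : FGModuleCat.{u} A)
    (b : J → M) (h : ∀ y : M, ∃! c : J → A, ∑ j, c j • b j = y) :
    ∃ γ : J → (G.functor.obj M ⟶ V),
      (∀ i j, G.ι M (b i) ≫ γ j = if i = j then 𝟙 V else 0) ∧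
      ∑ j, γ j ≫ G.ι M (b j) = 𝟙 _ := by
  choose c hc hcu using h
  have hadd : ∀ y z, c (y + z) = c y + c z := fun y z => (hcu _ _ (by
    have h1 := hc y
    have h2 := hc z
    simp only at h1 h2
    simp only [Pi.add_apply, add_smul, Finset.sum_add_distrib, h1, h2])).symm
  have hsmul : ∀ (r : A) y, c (r • y) = r • c y := fun r y => (hcu _ _ (by
    have h1 := hc y
    simp only at h1
    simp only [Pi.smul_apply, smul_eq_mul, mul_smul, ← Finset.smul_sum, h1])).symm
  have hself : ∀ i j, c (b i) j = if i = j then 1 else 0 := fun i j => by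
    rw [← hcu (b i) (fun j => if i = j then 1 else 0) (by simp)]
  have hex : ∀ j, ∃ γ : G.functor.obj M ⟶ V, ∀ y, G.ι M y ≫ γ = (ρ (c y j)).unop.asHom :=
    fun j => (G.universal M V (AddMonoidHom.mk' (fun y => (ρ (c y j)).unop.asHom) fun y z => by
      rw [hadd, Pi.add_apply, map_add]; rfl) fun r y => by
        change (ρ (c (r • y) j)).unop.asHom = (ρ r).unop.asHom ≫ (ρ (c y j)).unop.asHom
        rw [hsmul, Pi.smul_apply, smul_eq_mul, map_mul]; rfl).exists
  choose γ hγ using hex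
  refine ⟨γ, fun i j => ?_, G.hom_ext fun y => ?_⟩
  · rw [hγ, hself]
    split_ifs
    · rw [map_one]; rfl
    · rw [map_zero]; rfl
  · rw [Preadditive.comp_sum, Category.comp_id]
    have h1 := hc y
    simp only at h1
    conv_rhs => rw [← h1, map_sum]
    refine Finset.sum_congr rfl fun j _ => ?_
    rw [← Category.assoc, hγ, G.ι_smul]

end FreeTensor

section Iso

variable {k : Type u} [Field k] {C : Type u'} [Category.{v} C] [Abelian C] [Linear k C]

namespace Sl2Data

variable {D : Sl2Data k C} {U : C} {n : ℕ}
  {ρ : ∀ i : ℕ, B D.param n i →ₐ[k] (End (D.iter U i))ᵐᵒᵖ}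

lemma IsHeckeAction.asHom_mul (_ : D.IsHeckeAction U n ρ) (i : ℕ) (b b' : B D.param n i) :
    (ρ i (b * b')).unop.asHom = (ρ i b).unop.asHom ≫ (ρ i b').unop.asHom := by
  rw [map_mul]; rfl

lemma IsHeckeAction.asHom_add (_ : D.IsHeckeAction U n ρ) (i : ℕ) (b b' : B D.param n i) :
    (ρ i (b + b')).unop.asHom = (ρ i b).unop.asHom + (ρ i b').unop.asHom := by
  rw [map_add]; rfl

lemma IsHeckeAction.asHom_one (_ : D.IsHeckeAction U n ρ) (i : ℕ) :
    (ρ i 1).unop.asHom = 𝟙 _ := by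
  rw [map_one]; rfl

lemma IsHeckeAction.asHom_incl (hρ : D.IsHeckeAction U n ρ) (i : ℕ) (b : B D.param n i) :
    (ρ (i + 1) (B.incl D.param n i b)).unop.asHom = D.E.map (ρ i b).unop.asHom :=
  congrArg End.asHom (hρ.incl i b)

omit [Abelian C] [Linear k C] in
lemma η_naturality {M N : C} (f : M ⟶ N) : f ≫ D.η N = D.η M ≫ D.F.map (D.E.map f) :=
  D.adj.unit.naturality f

omit [Abelian C] [Linear k C] in
lemma η_comp {M N Y : C} (f : M ⟶ N) (g : D.E.obj N ⟶ Y) :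
    D.η M ≫ D.F.map (D.E.map f ≫ g) = f ≫ D.η N ≫ D.F.map g := by
  rw [D.F.map_comp, ← Category.assoc, ← η_naturality, Category.assoc]

omit [Abelian C] [Linear k C] in
lemma η_map_comp {M Y Z : C} (g : D.E.obj M ⟶ Y) (h : Y ⟶ Z) :
    D.η M ≫ D.F.map (g ≫ h) = (D.η M ≫ D.F.map g) ≫ D.F.map h := by
  rw [D.F.map_comp, Category.assoc]

omit [Abelian C] [Linear k C] in
lemma η_map_id (M : C) : D.η M ≫ D.F.map (𝟙 (D.E.obj M)) = D.η M := by
  rw [D.F.map_id, Category.comp_id]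

omit [Linear k C] in
lemma η_map_add [D.F.Additive] {M Y : C} (g g' : D.E.obj M ⟶ Y) :
    D.η M ≫ D.F.map (g + g') = D.η M ≫ D.F.map g + D.η M ≫ D.F.map g' := by
  rw [D.F.map_add, Preadditive.comp_add]

/-- The canonical map `E^i U ⊗ B_{i+1} → F E^{i+1} U`. -/
lemma IsHeckeAction.exists_canonical [D.F.Additive] (hρ : D.IsHeckeAction U n ρ)
    (G : ∀ i, TensorFunctor (ρ i)) (i : ℕ) :
    ∃ φ : (G i).functor.obj (B.res D.param n i) ⟶ D.F.obj (D.iter U (i + 1)),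
      ∀ b : B D.param n (i + 1), (G i).ι (B.res D.param n i) b.toRes ≫ φ =
        D.η (D.iter U i) ≫ D.F.map (ρ (i + 1) b).unop.asHom := by
  let g : B D.param n (i + 1) → (D.iter U i ⟶ D.F.obj (D.iter U (i + 1))) := fun b =>
    D.η (D.iter U i) ≫ D.F.map (ρ (i + 1) b).unop.asHom
  have hadd : ∀ b b', g (b + b') = g b + g b' := fun b b' => by
    change D.η (D.iter U i) ≫ D.F.map (ρ (i + 1) (b + b')).unop.asHom = _
    rw [hρ.asHom_add]
    exact η_map_add _ _
  have hsmul : ∀ (b : B D.param n i) (y : B D.param n (i + 1)),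
      g (B.incl D.param n i b * y) = (ρ i b).unop.asHom ≫ g y := fun b y => by
    change D.η (D.iter U i) ≫ D.F.map (ρ (i + 1) (B.incl D.param n i b * y)).unop.asHom =
      (ρ i b).unop.asHom ≫ D.η (D.iter U i) ≫ D.F.map (ρ (i + 1) y).unop.asHom
    rw [hρ.asHom_mul, hρ.asHom_incl]
    exact η_comp _ _
  obtain ⟨φ, hφ, -⟩ := (G i).universal (B.res D.param n i) (D.F.obj (D.iter U (i + 1)))
    (AddMonoidHom.mk' g hadd) hsmul
  exact ⟨φ, hφ⟩

/-- The canonical map `E^i U ⊗ B_{i+1} → F E^{i+1} U` is an isomorphism. -/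
theorem IsLowest.exists_canonical_iso (hU : D.IsLowest U n) (hD : D.IsSl2Categorification)
    (hρ : D.IsHeckeAction U n ρ) (hb : ∀ i ≤ n, Function.Bijective (ρ i))
    (G : ∀ i, TensorFunctor (ρ i)) {i : ℕ} (hi : i < n) :
    ∃ φ : (G i).functor.obj (B.res D.param n i) ≅ D.F.obj (D.iter U (i + 1)),
      ∀ b : B D.param n (i + 1), (G i).ι (B.res D.param n i) b.toRes ≫ φ.hom =
        D.η (D.iter U i) ≫ D.F.map (ρ (i + 1) b).unop.asHom := by
  have := hU.additive_E
  have := hU.linear_E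
  have := hU.additive_F
  have := hU.linear_F
  have := hU.finiteLength
  have := hU.nontrivial_hBar hD
  obtain ⟨φ, hφ⟩ := hρ.exists_canonical G i
  obtain ⟨β, hβ⟩ := B.exists_left_basis (p := D.param) hi
  obtain ⟨γ, hγ, hsum⟩ := (G i).exists_coord (B.res D.param n i) (fun j => B.toRes (β j)) hβ
  -- A simple subobject `S` of the kernel maps nontrivially to one of the summands `E^i U`, hence
  -- embeds there and receives a nonzero morphism from `E^i U`. The composite `E^i U → S → E^i U ⊗
  -- B_{i+1}` is given by an element `b` of `B_{i+1}`, because all endomorphisms of `E^i U` come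
  -- from `B_i`. The map `φ` sends it to the adjoint of the action of `b`, which vanishes only for
  -- `b = 0`.
  have hmono : Mono φ := by
    refine mono_of_simple_sub φ fun S hS g hg h0 => ?_
    have hne : ∃ j, g ≫ γ j ≠ 0 := by
      by_contra! hall
      have : g = 0 := by
        rw [← Category.comp_id g, ← hsum, Preadditive.comp_sum]
        exact Finset.sum_eq_zero fun j _ => by rw [← Category.assoc, hall j, zero_comp]
      refine Simple.not_isZero S ((IsZero.iff_id_eq_zero S).2 ?_)
      rw [← cancel_mono g, this, comp_zero, comp_zero]
    obtain ⟨j, hj⟩ := hne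
    have := mono_of_simple _ hj
    obtain ⟨g', hg'⟩ := hU.exists_hom_of_mono hi.le (g ≫ γ j) hj
    have hex : ∀ j, ∃ c, ρ i c = MulOpposite.op (End.of (g' ≫ g ≫ γ j)) := fun j =>
      (hb i hi.le).2 _
    choose c hc using hex
    have h1 : g' ≫ g = (G i).ι (B.res D.param n i) (∑ j, c j • B.toRes (β j)) := by
      rw [map_sum, ← Category.comp_id (g' ≫ g), ← hsum, Preadditive.comp_sum]
      refine Finset.sum_congr rfl fun j _ => ?_
      rw [(G i).ι_smul, hc j]
      change (g' ≫ g) ≫ γ j ≫ _ = (g' ≫ g ≫ γ j) ≫ _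
      simp only [Category.assoc]
    obtain ⟨b, hbb⟩ : ∃ b : B D.param n (i + 1), B.toRes b = ∑ j, c j • B.toRes (β j) := ⟨_, rfl⟩
    rw [← hbb] at h1
    have h2 : D.η (D.iter U i) ≫ D.F.map (ρ (i + 1) b).unop.asHom = 0 := by
      rw [← hφ, ← h1, Category.assoc, h0, comp_zero]
    have h3 : (ρ (i + 1) b).unop.asHom = 0 :=
      (adjLinearEquiv (k := k) D.adj _ _).map_eq_zero_iff.1 h2
    have h4 : b = 0 := (hb (i + 1) hi).1 (by
      rw [map_zero]; exact congrArg MulOpposite.op h3)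
    refine hg' ((cancel_mono g).1 ?_)
    rw [h1, h4, zero_comp]
    exact map_zero ((G i).ι (B.res D.param n i))
  obtain ⟨e, f, h, hA⟩ := hU.exists_isAction
  -- Since `B_{i+1}` is free over `B_i`, the left-hand side is the class of `(i + 1)(n - i)` copies
  -- of `E^i U`, which is also `f e^{i+1} [U]`.
  have hcls : cls ((G i).functor.obj (B.res D.param n i)) = cls (D.F.obj (D.iter U (i + 1))) := by
    rw [hA.cls_F, hU.f_cls_iter hA]
    let q := Fintype.equivFin (Fin (i + 1) × Fin (n - i))
    rw [cls_eq_of_sum (V := D.iter U i) _ (fun a => γ (q.symm a))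
      (fun a => (G i).ι (B.res D.param n i) (B.toRes (β (q.symm a)))) (fun a b => by
        simp only [hγ, EmbeddingLike.apply_eq_iff_eq])
      (by rw [← hsum]; exact q.symm.sum_comp (fun j => γ j ≫
        (G i).ι (B.res D.param n i) (B.toRes (β j))))]
    congr 1
    rw [Fintype.card_prod, Fintype.card_fin, Fintype.card_fin]
    push_cast [Nat.cast_sub hi.le]
    ring
  have := isIso_of_mono_of_cls_eq φ hcls
  exact ⟨asIso φ, hφ⟩

end Sl2Data

end Iso

end SlTwo

namespace SlTwo

/-! ### The morphism of categorifications defined by `U` -/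

/-- The target will be a space of morphisms in the given category, so its universe must be
independent of that of the rings. -/
lemma Ind.exists_lift {R S : Type u} [Ring R] [Ring S] (φ : R →+* S) {M : Type u} [AddCommGroup M]
    [Module R M] {N : Type*} [AddCommGroup N] [Module S N] (f : M →+ N)
    (hf : ∀ (r : R) (m : M), f (r • m) = φ r • f m) :
    ∃ g : Ind φ M →ₗ[S] N, ∀ s m, g (Ind.tmul φ s m) = s • f m :=
  ⟨(indRel φ M).liftQ
    (TensorProduct.AlgebraTensorModule.lift
      { toFun := fun s => s • f.toIntLinearMap
        map_add' := fun s t => add_smul s t _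
        map_smul' := fun s t => mul_smul s t _ })
    (by
      refine Submodule.span_le.2 ?_
      rintro _ ⟨s, r, m, rfl⟩
      simp [hf, mul_smul]), fun _ _ => rfl⟩

/-! ### Testing morphisms on the elements `1 ⊗ m` -/

section SumInd

attribute [local instance] Abelian.hasFiniteBiproducts

variable {k : Type u} [Field k] {C : Type u'} [Category.{v} C] [Abelian C] [Linear k C]
  {p : Param k} {n : ℕ} {V : ℕ → C}
  {ρ : ∀ i, B p n i →ₐ[k] (End (V i))ᵐᵒᵖ} {G : ∀ i, TensorFunctor (ρ i)}

lemma oneTmul_smul (M : MinCat p n) (i : ℕ) (b : B p n i) (m : M i) :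
    M.oneTmul i (b • m) = B.incl p n i b • M.oneTmul i m :=
  Ind.unit_smul (φ := (B.incl p n i : B p n i →+* B p n (i + 1))) b m

lemma oneTmul_add (M : MinCat p n) (i : ℕ) (m m' : M i) :
    M.oneTmul i (m + m') = M.oneTmul i m + M.oneTmul i m' :=
  map_add (Ind.unit (B.incl p n i : B p n i →+* B p n (i + 1))) m m'

lemma E_induction {M : MinCat p n} {i : ℕ} {Q : ((minimal p n).E.obj M) (i + 1) → Prop}
    (one : ∀ m, Q (M.oneTmul i m)) (smul : ∀ (b : B p n (i + 1)) x, Q x → Q (b • x))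
    (add : ∀ x y, Q x → Q y → Q (x + y)) (y : ((minimal p n).E.obj M) (i + 1)) : Q y := by
  refine Ind.induction_on (φ := (B.incl p n i : B p n i →+* B p n (i + 1))) (M := M i) y ?_
    (fun s m => ?_) add
  · have := smul 0 _ (one 0)
    rwa [zero_smul] at this
  · have h1 : Ind.tmul (B.incl p n i : B p n i →+* B p n (i + 1)) s m =
        s • Ind.tmul (B.incl p n i : B p n i →+* B p n (i + 1)) 1 m := by
      rw [Ind.smul_tmul, mul_one]
    rw [h1]
    exact smul s _ (one m)

lemma sum_E_hom_ext {M : MinCat p n} {Y : C}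
    {h h' : (sumFunctor G).obj ((minimal p n).E.obj M) ⟶ Y}
    (e : ∀ i (hi : i < n) m, sumι G ((minimal p n).E.obj M) (i + 1) hi (M.oneTmul i m) ≫ h =
      sumι G ((minimal p n).E.obj M) (i + 1) hi (M.oneTmul i m) ≫ h') : h = h' := by
  refine sum_hom_ext fun i hi y => ?_
  cases i with
  | zero =>
    have : y = 0 := Subsingleton.elim (α := PUnit) _ _
    rw [this, sumι_zero, zero_comp, zero_comp]
  | succ i =>
    induction y using E_induction with
    | one m => exact e i hi m
    | smul b x hx => rw [sumι_smul, Category.assoc, Category.assoc, hx]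
    | add x y hx hy => rw [sumι_add, Preadditive.add_comp, Preadditive.add_comp, hx, hy]

lemma E_map_oneTmul {M N : MinCat p n} (f : M ⟶ N) (i : ℕ) (m : M i) :
    (minimal p n).E.map f (i + 1) (M.oneTmul i m) = N.oneTmul i (f i m) :=
  Ind.map_one_tmul (B.incl p n i : B p n i →+* B p n (i + 1)) (f i).hom.hom m

lemma sum_E_E_hom_ext {M : MinCat p n} {Y : C}
    {h h' : (sumFunctor G).obj ((minimal p n).E.obj ((minimal p n).E.obj M)) ⟶ Y}
    (e : ∀ i (hi : i + 1 < n) m,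
      sumι G ((minimal p n).E.obj ((minimal p n).E.obj M)) (i + 2) hi
          (((minimal p n).E.obj M).oneTmul (i + 1) (M.oneTmul i m)) ≫ h =
        sumι G ((minimal p n).E.obj ((minimal p n).E.obj M)) (i + 2) hi
          (((minimal p n).E.obj M).oneTmul (i + 1) (M.oneTmul i m)) ≫ h') : h = h' := by
  refine sum_E_hom_ext fun i hi y => ?_
  cases i with
  | zero =>
    -- The component of degree `0` of `E M` is trivial. Writing `y` as `0 • y` lets its vanishing
    -- pass through `oneTmul`.
    have h1 : y = (0 : B p n 0) • y := Subsingleton.elim (α := PUnit) _ _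
    rw [h1, oneTmul_smul, map_zero, zero_smul, sumι_zero, zero_comp, zero_comp]
  | succ i =>
    induction y using E_induction with
    | one m => exact e i hi m
    | smul b x hx => rw [oneTmul_smul, sumι_smul, Category.assoc, Category.assoc, hx]
    | add x y hx hy =>
      rw [oneTmul_add, sumι_add, Preadditive.add_comp, Preadditive.add_comp, hx, hy]

lemma subsingleton_of_lt (M : MinCat p n) {i : ℕ} (hi : n < i) (m : M i) : m = 0 := by
  have := B.subsingleton (p := p) hi
  have h1 : (1 : B p n i) = 0 := Subsingleton.elim _ _
  rw [← one_smul (B p n i) m, h1, zero_smul]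

end SumInd

/-! ### The isomorphism `ζ₊` -/

section Morphism

lemma comp_comp_eq {C : Type u'} [Category.{v} C] {W X Y Z : C} {f : W ⟶ X} {g : X ⟶ Y}
    {h : W ⟶ Y} {g' : Y ⟶ Z} {w : W ⟶ Z} (e : f ≫ g = h) (e' : h ≫ g' = w) :
    f ≫ g ≫ g' = w := by
  rw [← Category.assoc, e, e']

attribute [local instance] Abelian.hasFiniteBiproducts

variable {k : Type u} [Field k] {C : Type u'} [Category.{v} C] [Abelian C] [Linear k C]

namespace Sl2Data

variable {D : Sl2Data k C} {U : C} {n : ℕ}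
  {ρ : ∀ i : ℕ, B D.param n i →ₐ[k] (End (D.iter U i))ᵐᵒᵖ}
  (G : ∀ i, TensorFunctor (ρ i))

/-- The assignment `m ↦ E(- ⊗ m)` is compatible with `B_i`, because `B_i` acts on `E^{i+1} U`
through the functor `E`; so it extends to `B_{i+1} ⊗ M_i`. -/
lemma IsHeckeAction.exists_E_comp [D.E.Additive] (hρ : D.IsHeckeAction U n ρ)
    (M : MinCat D.param n) :
    ∃ a : (sumFunctor G).obj ((minimal D.param n).E.obj M) ⟶ D.E.obj ((sumFunctor G).obj M),
      ∀ i (hi : i < n) (m : M i),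
        sumι G ((minimal D.param n).E.obj M) (i + 1) hi (M.oneTmul i m) ≫ a =
          D.E.map (sumι G M i hi.le m) := by
  have hex : ∀ i (hi : i + 1 ≤ n),
      ∃ g : ((minimal D.param n).E.obj M) (i + 1) →
        (D.iter U (i + 1) ⟶ D.E.obj ((sumFunctor G).obj M)),
      (∀ x y, g (x + y) = g x + g y) ∧
      (∀ (b : B D.param n (i + 1)) x, g (b • x) = (ρ (i + 1) b).unop.asHom ≫ g x) ∧
      ∀ m, g (M.oneTmul i m) = D.E.map (sumι G M i (Nat.le_of_lt hi) m) := fun i hi => by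
    let _ := homModule (ρ (i + 1)) (D.E.obj ((sumFunctor G).obj M))
    obtain ⟨g, hg⟩ := Ind.exists_lift (B.incl D.param n i : B D.param n i →+* B D.param n (i + 1))
      (M := M i) (N := D.iter U (i + 1) ⟶ D.E.obj ((sumFunctor G).obj M))
      (AddMonoidHom.mk' (fun m => D.E.map (sumι G M i (Nat.le_of_lt hi) m)) fun m m' => by
        rw [sumι_add, D.E.map_add]; rfl) (fun b m => by
        change D.E.map (sumι G M i _ (b • m)) =
          (ρ (i + 1) (B.incl D.param n i b)).unop.asHom ≫ D.E.map (sumι G M i _ m)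
        rw [sumι_smul, D.E.map_comp, hρ.asHom_incl]; rfl)
    exact ⟨g, map_add g, fun b x => map_smul g b x, fun m => (hg 1 m).trans (one_smul _ _)⟩
  choose g hadd hsmul hone using hex
  let g' : ∀ i, i ≤ n → ((minimal D.param n).E.obj M) i →
      (D.iter U i ⟶ D.E.obj ((sumFunctor G).obj M))
    | 0, _, _ => 0
    | i + 1, hi, y => g i hi y
  obtain ⟨a, ha⟩ := exists_sum_desc G ((minimal D.param n).E.obj M) (D.E.obj ((sumFunctor G).obj M))
    g' (fun i hi y y' => by
      cases i with
      | zero => exact (add_zero _).symm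
      | succ i => exact hadd i hi y y') (fun i hi b y => by
      cases i with
      | zero => exact comp_zero.symm
      | succ i => exact hsmul i hi b y)
  exact ⟨a, fun i hi m => (ha (i + 1) hi (M.oneTmul i m)).trans (hone i hi m)⟩

variable {G} in
/-- Morphisms out of `E R_U M` are determined by their restrictions to the objects
`E (E^i U ⊗ m)`. -/
lemma IsLowest.E_sum_hom_ext (hU : D.IsLowest U n) {M : MinCat D.param n} {Y : C}
    {h h' : D.E.obj ((sumFunctor G).obj M) ⟶ Y}
    (e : ∀ i (hi : i < n) (m : M i), D.E.map (sumι G M i hi.le m) ≫ h =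
      D.E.map (sumι G M i hi.le m) ≫ h') : h = h' := by
  apply (D.adj.homEquiv _ _).injective
  refine sum_hom_ext fun i hi m => ?_
  rw [D.adj.homEquiv_unit, D.adj.homEquiv_unit]
  change sumι G M i hi m ≫ D.η _ ≫ _ = sumι G M i hi m ≫ D.η _ ≫ _
  rw [← η_comp, ← η_comp]
  rcases hi.lt_or_eq with hi' | rfl
  · rw [e i hi' m]
  · congr 2
    exact (hU.iter_isZero (Nat.lt_succ_self i)).eq_of_src _ _

/-- A morphism out of `E R_U M` amounts to one from `R_U M` to `F R_U E M`, where the universal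
property of the tensor products applies. In degree `n` there is no component to map to, and the
value `0` is taken. -/
lemma IsHeckeAction.exists_E_comp_inv [D.F.Additive] (hρ : D.IsHeckeAction U n ρ)
    (M : MinCat D.param n) :
    ∃ a : D.E.obj ((sumFunctor G).obj M) ⟶ (sumFunctor G).obj ((minimal D.param n).E.obj M),
      ∀ i (hi : i < n) (m : M i), D.E.map (sumι G M i hi.le m) ≫ a =
        sumι G ((minimal D.param n).E.obj M) (i + 1) hi (M.oneTmul i m) := by
  classical
  obtain ⟨a, ha⟩ := exists_sum_desc G M
    (D.F.obj ((sumFunctor G).obj ((minimal D.param n).E.obj M)))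
    (fun i hi m => if h : i < n then D.η (D.iter U i) ≫ D.F.map
      (sumι G ((minimal D.param n).E.obj M) (i + 1) h (M.oneTmul i m)) else 0)
    (fun i hi m m' => by
      split_ifs with h
      · rw [oneTmul_add, sumι_add]; exact η_map_add _ _
      · rw [add_zero])
    (fun i hi b m => by
      split_ifs with h
      · rw [oneTmul_smul, sumι_smul, hρ.asHom_incl]; exact η_comp _ _
      · rw [comp_zero])
  refine ⟨(D.adj.homEquiv _ _).symm a, fun i hi m => ?_⟩
  apply (D.adj.homEquiv _ _).injective
  rw [D.adj.homEquiv_naturality_left, Equiv.apply_symm_apply, ha i hi.le m, dif_pos hi]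
  exact (D.adj.homEquiv_unit _ _ _).symm

/-- The isomorphism `ζ₊`. -/
theorem IsLowest.exists_zetaPlus (hU : D.IsLowest U n) (hρ : D.IsHeckeAction U n ρ) :
    ∃ ζ : (minimal D.param n).E ⋙ sumFunctor G ≅ sumFunctor G ⋙ D.E,
      ∀ (M : MinCat D.param n) (i : ℕ) (hi : i < n) (m : M i),
        sumι G ((minimal D.param n).E.obj M) (i + 1) hi (M.oneTmul i m) ≫ ζ.hom.app M =
          D.E.map (sumι G M i hi.le m) := by
  have := hU.additive_E
  have := hU.additive_F
  choose a ha using hρ.exists_E_comp G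
  choose a' ha' using hρ.exists_E_comp_inv G
  refine ⟨NatIso.ofComponents (fun M =>
    { hom := a M
      inv := a' M
      hom_inv_id := sum_E_hom_ext fun i hi m => ?_
      inv_hom_id := hU.E_sum_hom_ext fun i hi m => ?_ }) fun {M N} f =>
        sum_E_hom_ext fun i hi m => ?_, ha⟩
  · exact (comp_comp_eq (ha M i hi m) (ha' M i hi m)).trans (Category.comp_id _).symm
  · exact (comp_comp_eq (ha' M i hi m) (ha M i hi m)).trans (Category.comp_id _).symm
  · refine (comp_comp_eq (sumι_map G ((minimal D.param n).E.map f) (i + 1) hi _) ?_).trans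
      (comp_comp_eq (ha M i hi m) ((D.E.map_comp _ _).symm.trans
        (congrArg D.E.map (sumι_map G f i hi.le m)))).symm
    rw [E_map_oneTmul]
    exact ha N i hi _

end Sl2Data

end Morphism

end SlTwo

namespace SlTwo

/-! ### The isomorphism `ζ₋` and the axioms of a morphism -/

section MorphismMinus

attribute [local instance] Abelian.hasFiniteBiproducts

variable {k : Type u} [Field k] {C : Type u'} [Category.{v} C] [Abelian C] [Linear k C]

lemma toRes_smul {p : Param k} {n : ℕ} (M : MinCat p n) (i : ℕ) (b : B p n i) (m : M (i + 1)) :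
    M.toRes i (B.incl p n i b • m) = b • M.toRes i m := rfl

lemma toRes_add {p : Param k} {n : ℕ} (M : MinCat p n) (i : ℕ) (m m' : M (i + 1)) :
    M.toRes i (m + m') = M.toRes i m + M.toRes i m' := rfl

lemma F_map_toRes {p : Param k} {n : ℕ} {M N : MinCat p n} (f : M ⟶ N) (i : ℕ) (m : M (i + 1)) :
    (minimal p n).F.map f i (M.toRes i m) = N.toRes i (f (i + 1) m) := rfl

lemma ε_oneTmul_toRes {p : Param k} {n : ℕ} (M : MinCat p n) (i : ℕ) (m : M (i + 1)) :
    (minimal p n).ε M (i + 1) (((minimal p n).F.obj M).oneTmul i (M.toRes i m)) = m :=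
  one_smul (B p n (i + 1)) m

lemma x_oneTmul {p : Param k} {n : ℕ} (M : MinCat p n) (i : ℕ) (m : M i) :
    (minimal p n).x M (i + 1) (M.oneTmul i m) = B.X p n i • M.oneTmul i m :=
  (Ind.mulRight_tmul (B.X p n i) (B.X_comm i) 1 m).trans (by
    rw [one_mul]
    exact ((Ind.smul_tmul (B.incl p n i : B p n i →+* B p n (i + 1)) (B.X p n i) 1 m).trans
      (by rw [mul_one]; rfl)).symm)

lemma t_oneTmul {p : Param k} {n : ℕ} (M : MinCat p n) (i : ℕ) (m : M i) :
    (minimal p n).t M (i + 2) (((minimal p n).E.obj M).oneTmul (i + 1) (M.oneTmul i m)) =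
      B.T p n i • ((minimal p n).E.obj M).oneTmul (i + 1) (M.oneTmul i m) :=
  (Ind.mulRight₂_tmul (B.T p n i) (B.T_comm i) 1 1 m).trans (by
    rw [map_one, one_mul, one_mul]
    exact ((Ind.smul_tmul (B.incl p n (i + 1) : B p n (i + 1) →+* B p n (i + 2)) (B.T p n i) 1
      _).trans (by rw [mul_one]; rfl)).symm)

namespace Sl2Data

variable {D : Sl2Data k C} {U : C} {n : ℕ}
  {ρ : ∀ i : ℕ, B D.param n i →ₐ[k] (End (D.iter U i))ᵐᵒᵖ}
  (G : ∀ i, TensorFunctor (ρ i))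

/-- The canonical maps `E^i U ⊗ B_{i+1} → F E^{i+1} U` are isomorphisms. -/
def CanonicalIso (G : ∀ i, TensorFunctor (ρ i)) : Prop :=
  ∀ i < n, ∃ φ : (G i).functor.obj (B.res D.param n i) ≅ D.F.obj (D.iter U (i + 1)),
    ∀ b : B D.param n (i + 1), (G i).ι (B.res D.param n i) b.toRes ≫ φ.hom =
      D.η (D.iter U i) ≫ D.F.map (ρ (i + 1) b).unop.asHom

variable {G} (hG : CanonicalIso G)

include hG

lemma CanonicalIso.hom_ext {i : ℕ} (hi : i < n) {Y : C} {h h' : D.F.obj (D.iter U (i + 1)) ⟶ Y}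
    (e : ∀ b : B D.param n (i + 1), (D.η (D.iter U i) ≫ D.F.map (ρ (i + 1) b).unop.asHom) ≫ h =
      (D.η (D.iter U i) ≫ D.F.map (ρ (i + 1) b).unop.asHom) ≫ h') : h = h' := by
  obtain ⟨φ, hφ⟩ := hG i hi
  rw [← cancel_epi φ.hom]
  refine (G i).hom_ext fun b => ?_
  have := e b
  rw [← hφ b, Category.assoc, Category.assoc] at this
  exact this

/-- The morphism `F E^{i+1} U ≅ E^i U ⊗ B_{i+1} → E^i U ⊗ M_{i+1}` given by an element of
`M_{i+1}`. -/
lemma CanonicalIso.exists_elem {i : ℕ} (hi : i < n) (M : MinCat D.param n) (m : M (i + 1)) :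
    ∃ θ : D.F.obj (D.iter U (i + 1)) ⟶ (sumFunctor G).obj ((minimal D.param n).F.obj M),
      ∀ b : B D.param n (i + 1),
        (D.η (D.iter U i) ≫ D.F.map (ρ (i + 1) b).unop.asHom) ≫ θ =
          sumι G ((minimal D.param n).F.obj M) i hi.le (M.toRes i (b • m)) := by
  obtain ⟨φ, hφ⟩ := hG i hi
  let g : B D.param n (i + 1) →
      (D.iter U i ⟶ (sumFunctor G).obj ((minimal D.param n).F.obj M)) := fun b =>
    sumι G ((minimal D.param n).F.obj M) i hi.le (M.toRes i (b • m))
  have hadd : ∀ b b', g (b + b') = g b + g b' := fun b b' => by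
    change sumι G _ i _ (M.toRes i ((b + b') • m)) = _
    rw [add_smul, toRes_add, sumι_add]
  have hsmul : ∀ (b : B D.param n i) (y : B D.param n (i + 1)),
      g (B.incl D.param n i b * y) = (ρ i b).unop.asHom ≫ g y := fun b y => by
    change sumι G _ i _ (M.toRes i ((B.incl D.param n i b * y) • m)) = _
    rw [mul_smul, toRes_smul, sumι_smul]
  obtain ⟨ψ, hψ, -⟩ := (G i).universal (B.res D.param n i) _ (AddMonoidHom.mk' g hadd) hsmul
  refine ⟨φ.inv ≫ ψ, fun b => ?_⟩
  rw [← hφ b, Category.assoc, φ.hom_inv_id_assoc]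
  exact hψ b

/-- By the adjunction with `F` on the left, a morphism out of `F R_U M` amounts to one from `R_U M`
to `E R_U F M`. In degree `i + 1` this is the transpose of the morphism `F E^{i+1} U ≅ E^i U ⊗
B_{i+1} → E^i U ⊗ M_{i+1}` given by an element of `M_{i+1}`. -/
lemma IsHeckeAction.exists_F_comp_inv (hρ : D.IsHeckeAction U n ρ)
    [D.E.Additive] [D.F.Additive] (adj : D.F ⊣ D.E) (M : MinCat D.param n) :
    ∃ a : D.F.obj ((sumFunctor G).obj M) ⟶ (sumFunctor G).obj ((minimal D.param n).F.obj M),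
      ∀ i (hi : i < n) (m : M (i + 1)) (b : B D.param n (i + 1)),
        (D.η (D.iter U i) ≫ D.F.map (ρ (i + 1) b).unop.asHom) ≫
          D.F.map (sumι G M (i + 1) hi m) ≫ a =
            sumι G ((minimal D.param n).F.obj M) i hi.le (M.toRes i (b • m)) := by
  choose θ hθ using fun (i : ℕ) (hi : i < n) => hG.exists_elem hi M
  have hadd : ∀ i hi m m', θ i hi (m + m') = θ i hi m + θ i hi m' := fun i hi m m' =>
    hG.hom_ext hi fun b => by
      rw [Preadditive.comp_add, hθ, hθ, hθ, ← sumι_add, smul_add, toRes_add]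
  have hsmul : ∀ i hi b m, θ i hi (b • m) = D.F.map (ρ (i + 1) b).unop.asHom ≫ θ i hi m :=
    fun i hi b m => hG.hom_ext hi fun b' => by
      have h1 := hθ i hi m (b' * b)
      rw [hρ.asHom_mul] at h1
      rw [hθ, ← mul_smul, ← h1, ← Category.assoc]
      exact congrArg (· ≫ _) (η_map_comp _ _)
  let g' : ∀ j, j ≤ n → M j →
      (D.iter U j ⟶ D.E.obj ((sumFunctor G).obj ((minimal D.param n).F.obj M)))
    | 0, _, _ => 0
    | i + 1, hi, m => adj.homEquiv _ _ (θ i hi m)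
  obtain ⟨a, ha⟩ := exists_sum_desc G M _ g' (fun i hi m m' => by
      cases i with
      | zero => exact (add_zero _).symm
      | succ i =>
        change adj.homEquiv _ _ (θ i hi (m + m')) = adj.homEquiv _ _ _ + adj.homEquiv _ _ _
        rw [hadd, adj.homEquiv_unit, adj.homEquiv_unit, adj.homEquiv_unit, D.E.map_add,
          Preadditive.comp_add])
    (fun i hi b m => by
      cases i with
      | zero => exact comp_zero.symm
      | succ i =>
        change adj.homEquiv _ _ (θ i hi (b • m)) = _ ≫ adj.homEquiv _ _ _
        rw [hsmul, adj.homEquiv_naturality_left])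
  refine ⟨(adj.homEquiv _ _).symm a, fun i hi m b => ?_⟩
  rw [← hθ i hi m b]
  congr 1
  apply (adj.homEquiv _ _).injective
  rw [adj.homEquiv_naturality_left, Equiv.apply_symm_apply]
  exact ha (i + 1) hi m

omit hG in
lemma IsHeckeAction.exists_F_comp [D.F.Additive] (hρ : D.IsHeckeAction U n ρ)
    (M : MinCat D.param n) :
    ∃ a : (sumFunctor G).obj ((minimal D.param n).F.obj M) ⟶ D.F.obj ((sumFunctor G).obj M),
      ∀ i (hi : i < n) (m : M (i + 1)),
        sumι G ((minimal D.param n).F.obj M) i hi.le (M.toRes i m) ≫ a =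
          D.η (D.iter U i) ≫ D.F.map (sumι G M (i + 1) hi m) := by
  classical
  let g : ∀ i, i ≤ n → M (i + 1) → (D.iter U i ⟶ D.F.obj ((sumFunctor G).obj M)) :=
    fun i hi m => if h : i < n then D.η (D.iter U i) ≫ D.F.map (sumι G M (i + 1) h m) else 0
  have hadd : ∀ i hi m m', g i hi (m + m') = g i hi m + g i hi m' := fun i hi m m' => by
    simp only [g]
    split_ifs with h
    · rw [sumι_add]; exact η_map_add _ _
    · rw [add_zero]
  have hsmul : ∀ i hi b m, g i hi (B.incl D.param n i b • m) =
      (ρ i b).unop.asHom ≫ g i hi m := fun i hi b m => by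
    simp only [g]
    split_ifs with h
    · rw [sumι_smul, hρ.asHom_incl]; exact η_comp _ _
    · rw [comp_zero]
  obtain ⟨a, ha⟩ := exists_sum_desc G ((minimal D.param n).F.obj M) _ g hadd hsmul
  exact ⟨a, fun i hi m => (ha i hi.le m).trans (dif_pos hi)⟩

omit hG in
lemma sum_F_hom_ext {M : MinCat D.param n} {Y : C}
    {h h' : (sumFunctor G).obj ((minimal D.param n).F.obj M) ⟶ Y}
    (e : ∀ i (hi : i < n) (m : M (i + 1)),
      sumι G ((minimal D.param n).F.obj M) i hi.le (M.toRes i m) ≫ h =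
        sumι G ((minimal D.param n).F.obj M) i hi.le (M.toRes i m) ≫ h') : h = h' := by
  refine sum_hom_ext fun i hi m => ?_
  rcases hi.lt_or_eq with hi' | rfl
  · exact e i hi' m
  · have : m = 0 := subsingleton_of_lt M (Nat.lt_succ_self _) m
    rw [this, sumι_zero, zero_comp, zero_comp]

-- As `F` is also a left adjoint, morphisms out of `F R_U M` can be tested on the pieces of `R_U M`.
-- The piece of degree `0` does not matter because `F U = 0`.
omit hG in
lemma IsLowest.F_sum_hom_ext (hU : D.IsLowest U n) {M : MinCat D.param n} {Y : C}
    {h h' : D.F.obj ((sumFunctor G).obj M) ⟶ Y}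
    (e : ∀ i (hi : i < n) (m : M (i + 1)), D.F.map (sumι G M (i + 1) hi m) ≫ h =
      D.F.map (sumι G M (i + 1) hi m) ≫ h') : h = h' := by
  obtain ⟨adj⟩ := hU.left_adj
  apply (adj.homEquiv _ _).injective
  refine sum_hom_ext fun i hi m => ?_
  rw [← adj.homEquiv_naturality_left, ← adj.homEquiv_naturality_left]
  cases i with
  | zero =>
    congr 1
    exact hU.isZero.eq_of_src _ _
  | succ i => rw [e i hi m]

/-- The isomorphism `ζ₋`. -/
theorem IsLowest.exists_zetaMinus (hU : D.IsLowest U n) (hρ : D.IsHeckeAction U n ρ) :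
    ∃ ζ : (minimal D.param n).F ⋙ sumFunctor G ≅ sumFunctor G ⋙ D.F,
      ∀ (M : MinCat D.param n) (i : ℕ) (hi : i < n) (m : M (i + 1)),
        sumι G ((minimal D.param n).F.obj M) i hi.le (M.toRes i m) ≫ ζ.hom.app M =
          D.η (D.iter U i) ≫ D.F.map (sumι G M (i + 1) hi m) := by
  have := hU.additive_E
  have := hU.additive_F
  obtain ⟨adj⟩ := hU.left_adj
  choose a ha using hρ.exists_F_comp (G := G)
  choose a' ha' using hρ.exists_F_comp_inv hG adj
  refine ⟨NatIso.ofComponents (fun M =>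
    { hom := a M
      inv := a' M
      hom_inv_id := sum_F_hom_ext fun i hi m => ?_
      inv_hom_id := hU.F_sum_hom_ext fun i hi m => hG.hom_ext hi fun b => ?_ }) fun {M N} f =>
        sum_F_hom_ext fun i hi m => ?_, ha⟩
  · refine (comp_comp_eq (ha M i hi m) ?_).trans (Category.comp_id _).symm
    -- For `b = 1` the test morphism is the unit `η` itself.
    have h1 := ha' M i hi m 1
    rw [one_smul, hρ.asHom_one] at h1
    rw [← h1, Category.assoc]
    exact congrArg (· ≫ _) (η_map_id _).symm
  · have h1 := comp_comp_eq (ha' M i hi m b) (ha M i hi (b • m))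
    refine Eq.trans ?_ (h1.trans ?_)
    · simp only [Category.assoc]
    · rw [sumι_smul]
      exact (η_map_comp _ _).trans (congrArg (_ ≫ ·) (Category.comp_id _).symm)
  · refine (comp_comp_eq (sumι_map G ((minimal D.param n).F.map f) i hi.le _) (ha N i hi _)).trans
      (comp_comp_eq (ha M i hi m) ?_).symm
    rw [F_map_toRes]
    exact (η_map_comp _ _).symm.trans
      (congrArg (fun f => D.η (D.iter U i) ≫ D.F.map f) (sumι_map G f (i + 1) hi m))

omit hG in
/-- The functor `R_U` is a morphism of categorifications. -/
theorem IsHeckeAction.isMorphism (hρ : D.IsHeckeAction U n ρ)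
    (ζp : (minimal D.param n).E ⋙ sumFunctor G ≅ sumFunctor G ⋙ D.E)
    (ζm : (minimal D.param n).F ⋙ sumFunctor G ≅ sumFunctor G ⋙ D.F)
    (hp : ∀ (M : MinCat D.param n) (i : ℕ) (hi : i < n) (m : M i),
      sumι G ((minimal D.param n).E.obj M) (i + 1) hi (M.oneTmul i m) ≫ ζp.hom.app M =
        D.E.map (sumι G M i hi.le m))
    (hm : ∀ (M : MinCat D.param n) (i : ℕ) (hi : i < n) (m : M (i + 1)),
      sumι G ((minimal D.param n).F.obj M) i hi.le (M.toRes i m) ≫ ζm.hom.app M =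
        D.η (D.iter U i) ≫ D.F.map (sumι G M (i + 1) hi m)) :
    (minimal D.param n).IsMorphism D (sumFunctor G) ζp ζm where
  param_eq := rfl
  additive := inferInstance
  linear := inferInstance
  comm_weak M := sum_F_hom_ext fun i hi m => by
    have h1 : D.E.map (sumι G ((minimal D.param n).F.obj M) i hi.le (M.toRes i m)) ≫
        ζp.inv.app ((minimal D.param n).F.obj M) =
          sumι G ((minimal D.param n).E.obj ((minimal D.param n).F.obj M)) (i + 1) hi
            (((minimal D.param n).F.obj M).oneTmul i (M.toRes i m)) :=
      (congrArg (· ≫ _) (hp _ i hi _).symm).trans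
        ((Category.assoc _ _ _).trans ((congrArg (_ ≫ ·) (ζp.hom_inv_id_app _)).trans
          (Category.comp_id _)))
    -- The counit of `𝒜(n)` sends `1 ⊗ m` to `m`, so that both sides become `F(- ⊗ m) ∘ η` on `E^i
    -- U`.
    have h2 := sumι_map G ((minimal D.param n).ε M) (i + 1) hi
      (((minimal D.param n).F.obj M).oneTmul i (M.toRes i m))
    rw [ε_oneTmul_toRes] at h2
    rw [hm, ← D.F.map_comp, ← η_comp, ← Category.assoc]
    exact (congrArg (fun f => D.η (D.iter U i) ≫ D.F.map f)
      ((congrArg (· ≫ _) h1).trans h2)).symm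
  comm_X M := sum_E_hom_ext fun i hi m => by
    refine (comp_comp_eq (hp M i hi m) (D.X.naturality _)).trans
      (comp_comp_eq (sumι_map G ((minimal D.param n).x M) (i + 1) hi _) ?_).symm
    rw [x_oneTmul, sumι_smul, hρ.X, Category.assoc]
    exact congrArg (_ ≫ ·) (hp M i hi m)
  comm_T M := sum_E_E_hom_ext fun i hi m => by
    have h1 : sumι G ((minimal D.param n).E.obj ((minimal D.param n).E.obj M)) (i + 2) hi
        (((minimal D.param n).E.obj M).oneTmul (i + 1) (M.oneTmul i m)) ≫
          ζp.hom.app ((minimal D.param n).E.obj M) ≫ D.E.map (ζp.hom.app M) =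
            D.E.map (D.E.map (sumι G M i (by omega) m)) :=
      comp_comp_eq (hp _ (i + 1) hi _) ((D.E.map_comp _ _).symm.trans
        (congrArg D.E.map (hp M i _ m)))
    refine (comp_comp_eq h1 (D.T.naturality _)).trans
      (comp_comp_eq (sumι_map G ((minimal D.param n).t M) (i + 2) hi _) ?_).symm
    rw [t_oneTmul, sumι_smul, hρ.T, Category.assoc]
    exact congrArg (_ ≫ ·) h1

end Sl2Data

end MorphismMinus

end SlTwo

namespace SlTwo

/-! ### Frobenius extensions -/

section Frobenius

/-- A Frobenius form for a ring extension, with dual bases. -/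
structure FrobeniusForm {R S : Type*} [Ring R] [Ring S] (φ : R →+* S) (J : Type*)
    [Fintype J] where
  form : S →+ R
  dual : J → S
  basis : J → S
  map_left (r : R) (s : S) : form (φ r * s) = r * form s
  map_right (s : S) (r : R) : form (s * φ r) = form s * r
  sum_left (y : S) : ∑ j, φ (form (y * dual j)) * basis j = y
  sum_right (y : S) : ∑ j, dual j * φ (form (basis j * y)) = y

variable {k : Type u} [Field k] {C : Type u'} [Category.{v} C] [Abelian C] [Linear k C]

namespace Sl2Data

variable {D : Sl2Data k C} {U : C} {n : ℕ}
  {ρ : ∀ i : ℕ, B D.param n i →ₐ[k] (End (D.iter U i))ᵐᵒᵖ}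

/-- An endomorphism of `E^{i+1} U` is transposed to `E^i U → F E^{i+1} U` and composed with the
counit `F E → Id` of the second adjunction at `E^i U`. Under the identifications of endomorphism
rings with `B_{i+1}` and `B_i`, this is a `B_i`-bilinear form. It is perfect because of the second
adjunction and the isomorphism of `F E^{i+1} U` with `E^i U ⊗ B_{i+1}`. -/
theorem IsLowest.exists_frobeniusForm (hU : D.IsLowest U n) (hD : D.IsSl2Categorification)
    (hρ : D.IsHeckeAction U n ρ) (hb : ∀ i ≤ n, Function.Bijective (ρ i))
    {i : ℕ} (hi : i < n) :
    Nonempty (FrobeniusForm (B.incl D.param n i : B D.param n i →+* B D.param n (i + 1))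
      (Fin (i + 1) × Fin (n - i))) := by
  have := hU.additive_E
  have := hU.additive_F
  have := hU.linear_E
  have := hU.nontrivial_hBar hD
  obtain ⟨adj⟩ := hU.left_adj
  let G : ∀ i, TensorFunctor (ρ i) := fun i => (exists_tensorFunctor (ρ i)).some
  have hG : CanonicalIso G := fun i hi => hU.exists_canonical_iso hD hρ hb G hi
  let e : ∀ i, i ≤ n → B D.param n i ≃ (D.iter U i ⟶ D.iter U i) := fun i hi =>
    (Equiv.ofBijective (ρ i) (hb i hi)).trans MulOpposite.opEquiv.symm
  let W : B D.param n (i + 1) → (D.iter U i ⟶ D.F.obj (D.iter U (i + 1))) := fun b =>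
    D.η (D.iter U i) ≫ D.F.map (ρ (i + 1) b).unop.asHom
  have hWmul : ∀ b b', W (b * b') = W b ≫ D.F.map (ρ (i + 1) b').unop.asHom := fun b b' => by
    simp only [W]
    rw [hρ.asHom_mul]
    exact η_map_comp _ _
  have hWincl : ∀ b y, W (B.incl D.param n i b * y) = (ρ i b).unop.asHom ≫ W y := fun b y => by
    simp only [W]
    rw [hρ.asHom_mul, hρ.asHom_incl]
    exact η_comp _ _
  have hWadd : ∀ b b', W (b + b') = W b + W b' := fun b b' => by
    simp only [W]
    rw [hρ.asHom_add]
    exact η_map_add _ _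
  let ε : D.F.obj (D.iter U (i + 1)) ⟶ D.iter U i := adj.counit.app (D.iter U i)
  let τ₀ : B D.param n (i + 1) → B D.param n i := fun b => (e i hi.le).symm (W b ≫ ε)
  have hτ₀ : ∀ b, (ρ i (τ₀ b)).unop.asHom = W b ≫ ε := fun b => (e i hi.le).apply_symm_apply _
  have hinj : ∀ {b b'}, (ρ i b).unop.asHom = (ρ i b').unop.asHom → b = b' := fun h =>
    (e i hi.le).injective h
  have hcounit : ∀ b, D.F.map (ρ (i + 1) b).unop.asHom ≫ ε =
      (adj.homEquiv _ _).symm (ρ (i + 1) b).unop.asHom := fun b =>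
    (adj.homEquiv_counit _ _ _).symm
  have hadd : ∀ b b', τ₀ (b + b') = τ₀ b + τ₀ b' := fun b b' => hinj (by
    rw [hρ.asHom_add, hτ₀, hτ₀, hτ₀, hWadd, Preadditive.add_comp])
  have hleft : ∀ b y, τ₀ (B.incl D.param n i b * y) = b * τ₀ y := fun b y => hinj (by
    rw [hρ.asHom_mul, hτ₀, hτ₀, hWincl, Category.assoc])
  have hright : ∀ y b, τ₀ (y * B.incl D.param n i b) = τ₀ y * b := fun y b => hinj (by
    rw [hρ.asHom_mul, hτ₀, hτ₀, hWmul, hρ.asHom_incl]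
    exact (Category.assoc (W y) _ ε).trans ((congrArg (W y ≫ ·) (adj.counit.naturality _)).trans
      (Category.assoc (W y) ε _).symm))
  -- The morphisms `W y` are jointly epimorphic by the canonical isomorphism, and `F(x)` followed by
  -- the counit is the transpose of `x`.
  have hnondeg : ∀ x x', (∀ y, τ₀ (y * x) = τ₀ (y * x')) → x = x' := fun x x' h => by
    apply (e (i + 1) hi).injective
    apply (adj.homEquiv _ _).symm.injective
    refine (hcounit x).symm.trans (Eq.trans ?_ (hcounit x'))
    refine hG.hom_ext hi fun y => ?_
    have h1 := hτ₀ (y * x)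
    rw [h, hτ₀, hWmul, hWmul] at h1
    exact (Category.assoc (W y) _ ε).symm.trans (h1.symm.trans (Category.assoc (W y) _ ε))
  -- A left-linear functional gives a morphism `E^i U ⊗ B_{i+1} → E^i U`, that is, a morphism `F
  -- E^{i+1} U → E^i U`. Its transpose is an endomorphism of `E^{i+1} U`, hence an element `x` of
  -- `B_{i+1}`.
  have hrep : ∀ ℓ : B D.param n (i + 1) → B D.param n i, (∀ y y', ℓ (y + y') = ℓ y + ℓ y') →
      (∀ b y, ℓ (B.incl D.param n i b * y) = b * ℓ y) → ∃ x, ∀ y, ℓ y = τ₀ (y * x) := by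
    intro ℓ hℓ hℓ'
    let g : B D.param n (i + 1) → (D.iter U i ⟶ D.iter U i) := fun y => (ρ i (ℓ y)).unop.asHom
    have hg : ∀ y y', g (y + y') = g y + g y' := fun y y' => by
      simp only [g]
      rw [hℓ, hρ.asHom_add]
    have hg' : ∀ (b : B D.param n i) (y : B D.param n (i + 1)),
        g (B.incl D.param n i b * y) = (ρ i b).unop.asHom ≫ g y := fun b y => by
      simp only [g]
      rw [hℓ', hρ.asHom_mul]
    obtain ⟨ψ, hψ, -⟩ := (G i).universal (B.res D.param n i) _ (AddMonoidHom.mk' g hg) hg'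
    obtain ⟨φ, hφ⟩ := hG i hi
    obtain ⟨x, hx⟩ := (e (i + 1) hi).surjective (adj.homEquiv _ _ (φ.inv ≫ ψ))
    have hx : (ρ (i + 1) x).unop.asHom = adj.homEquiv _ _ (φ.inv ≫ ψ) := hx
    refine ⟨x, fun y => hinj ?_⟩
    rw [hτ₀, hWmul, Category.assoc, hcounit, hx, Equiv.symm_apply_apply]
    have h1 : W y = (G i).ι (B.res D.param n i) y.toRes ≫ φ.hom := (hφ y).symm
    rw [h1, Category.assoc, φ.hom_inv_id_assoc]
    exact (hψ y).symm
  obtain ⟨β, hβ⟩ := B.exists_left_basis (p := D.param) hi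
  choose c hc hcu using hβ
  have hcadd : ∀ y z, c (y + z) = c y + c z := fun y z => (hcu _ _ (by
    have h1 := hc y
    have h2 := hc z
    simp only at h1 h2
    simp only [Pi.add_apply, map_add, add_mul, Finset.sum_add_distrib, h1, h2])).symm
  have hcsmul : ∀ r y, c (B.incl D.param n i r * y) = fun j => r * c y j := fun r y => (hcu _ _ (by
    have h1 := hc y
    simp only at h1
    simp only [map_mul, mul_assoc, ← Finset.mul_sum, h1])).symm
  -- The elements of the dual basis represent the coordinate functionals of the left basis `β`. The
  -- other expansion then follows from nondegeneracy.
  choose z hz using fun j => hrep (fun y => c y j) (fun y y' => by rw [hcadd]; rfl)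
    (fun b y => by rw [hcsmul])
  have hsum : ∀ y, ∑ j, B.incl D.param n i (τ₀ (y * z j)) * β j = y := fun y => by
    have h1 := hc y
    simp only at h1
    simpa only [hz] using h1
  let τ : B D.param n (i + 1) →+ B D.param n i := AddMonoidHom.mk' τ₀ hadd
  refine ⟨⟨τ, z, β, hleft, hright, hsum, fun x => hnondeg _ _ fun y => ?_⟩⟩
  change τ (y * _) = τ (y * x)
  conv_rhs => rw [← hsum y, Finset.sum_mul, map_sum]
  rw [Finset.mul_sum, map_sum]
  refine Finset.sum_congr rfl fun j _ => ?_
  rw [mul_assoc, ← mul_assoc y]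
  exact (hright _ _).trans (hleft _ _).symm

end Sl2Data

end Frobenius

end SlTwo

namespace SlTwo

section FrobeniusAdjunction

/-! ### Maps on induced modules given by semilinear functionals -/

namespace Ind

variable {R S : Type u} [Ring R] [Ring S] {φ : R →+* S} (c : S →+ R)
  (hc : ∀ s r, c (s * φ r) = c s * r) (M : Type u) [AddCommGroup M] [Module R M]

/-- The map `s ⊗ m ↦ c(s) m` on `S ⊗_ℤ M`. -/
def preEval : S ⊗[ℤ] M →+ M :=
  (TensorProduct.lift
    { toFun := fun s => (DistribSMul.toAddMonoidHom M (c s)).toIntLinearMap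
      map_add' := fun s t => by
        ext m
        change c (s + t) • m = c s • m + c t • m
        rw [map_add, add_smul]
      map_smul' := fun z s => by
        ext m
        change c (z • s) • m = z • (c s • m)
        rw [map_zsmul, smul_assoc] } : S ⊗[ℤ] M →ₗ[ℤ] M).toAddMonoidHom

lemma preEval_tmul (s : S) (m : M) : preEval c M (s ⊗ₜ m) = c s • m := rfl

-- The relations span an `S`-submodule, while the evaluation is not `S`-linear. The vanishing is
-- therefore proved for all translates `t • x` at once.
include hc in
lemma preEval_eq_zero {x : S ⊗[ℤ] M} (hx : x ∈ indRel φ M) : preEval c M x = 0 := by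
  suffices h : ∀ t : S, preEval c M (t • x) = 0 by simpa using h 1
  induction hx using Submodule.span_induction with
  | mem x hx =>
    obtain ⟨s, r, m, rfl⟩ := hx
    intro t
    rw [smul_sub, map_sub]
    change preEval c M ((t * (s * φ r)) ⊗ₜ m) - preEval c M ((t * s) ⊗ₜ (r • m)) = 0
    rw [preEval_tmul, preEval_tmul, ← mul_assoc, hc, mul_smul, sub_self]
  | zero => simp
  | add x y _ _ hx hy => intro t; rw [smul_add, map_add, hx, hy, add_zero]
  | smul s x _ hx => intro t; rw [← mul_smul]; exact hx _

/-- The map `s ⊗ m ↦ c(s) m`. -/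
def eval : Ind φ M →+ M :=
  QuotientAddGroup.lift (indRel φ M).toAddSubgroup (preEval c M) fun _ hx =>
    preEval_eq_zero c hc M hx

lemma eval_tmul (s : S) (m : M) : eval c hc M (Ind.tmul φ s m) = c s • m := rfl

end Ind

namespace FrobeniusForm

variable {R S : Type u} [Ring R] [Ring S] {φ : R →+* S} {J : Type*} [Fintype J]
  (τ : FrobeniusForm φ J)

/-- The Frobenius form of a trivial extension. -/
def ofSubsingleton [Subsingleton S] (φ : R →+* S) : FrobeniusForm φ J where
  form := 0
  dual _ := 0
  basis _ := 0
  map_left _ _ := (mul_zero _).symm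
  map_right _ _ := (zero_mul _).symm
  sum_left _ := Subsingleton.elim _ _
  sum_right _ := Subsingleton.elim _ _

section Counit

variable (M : Type u) [AddCommGroup M] [Module R M]

/-- The map `s ⊗ m ↦ τ(s) m`. -/
def counit : Ind φ M →+ M := Ind.eval τ.form τ.map_right M

lemma counit_tmul (s : S) (m : M) : τ.counit M (Ind.tmul φ s m) = τ.form s • m := rfl

lemma counit_smul (r : R) (x : Ind φ M) : τ.counit M (φ r • x) = r • τ.counit M x := by
  induction x using Ind.induction_on with
  | h0 => rw [smul_zero, map_zero, smul_zero]
  | ht s m => rw [Ind.smul_tmul, counit_tmul, counit_tmul, τ.map_left, mul_smul]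
  | ha x y hx hy => rw [smul_add, map_add, map_add, hx, hy, smul_add]

lemma counit_map {M' : Type u} [AddCommGroup M'] [Module R M'] (f : M →ₗ[R] M') (x : Ind φ M) :
    τ.counit M' (Ind.map φ f x) = f (τ.counit M x) := by
  induction x using Ind.induction_on with
  | h0 => simp
  | ht s m => rw [Ind.map_tmul, counit_tmul, counit_tmul, map_smul]
  | ha x y hx hy => rw [map_add, map_add, hx, hy, map_add, map_add]

end Counit

section Unit

variable (N : Type u) [AddCommGroup N] [Module R N] [Module S N]
  (h : ∀ (r : R) (m : N), r • m = φ r • m)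

-- The element `∑ z_j ⊗ b_j` commutes with `S`: expand `b_j y` in the left basis, move the
-- coefficients across the tensor sign, and collect them with the dual basis.
include h in
lemma tmul_dual_smul (y : S) (m : N) :
    ∑ j, Ind.tmul φ (τ.dual j) (τ.basis j • y • m) =
      ∑ j, Ind.tmul φ (y * τ.dual j) (τ.basis j • m) := by
  have h1 : ∀ j, Ind.tmul φ (τ.dual j) (τ.basis j • y • m) = ∑ l,
      Ind.tmul φ (τ.dual j * φ (τ.form (τ.basis j * (y * τ.dual l)))) (τ.basis l • m) := fun j => by
    have h2 := τ.sum_left (τ.basis j * y)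
    conv_lhs => rw [← mul_smul, ← h2, Finset.sum_smul]
    change Ind.mk φ N (_ ⊗ₜ _) = _
    rw [TensorProduct.tmul_sum, map_sum]
    refine Finset.sum_congr rfl fun l _ => ?_
    rw [Ind.tmul_mul, h, ← mul_smul, mul_assoc (τ.basis j)]
    rfl
  rw [Finset.sum_congr rfl fun j _ => h1 j, Finset.sum_comm]
  refine Finset.sum_congr rfl fun l _ => ?_
  conv_rhs => rw [← τ.sum_right (y * τ.dual l)]
  change _ = Ind.mk φ N (_ ⊗ₜ _)
  rw [TensorProduct.sum_tmul, map_sum]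
  rfl

/-- The map `m ↦ ∑ z_j ⊗ b_j m`. -/
def unit : N →ₗ[S] Ind φ N where
  toFun m := ∑ j, Ind.tmul φ (τ.dual j) (τ.basis j • m)
  map_add' m m' := by
    rw [← Finset.sum_add_distrib]
    exact Finset.sum_congr rfl fun j _ => by rw [smul_add, Ind.tmul_add]
  map_smul' y m := by
    rw [τ.tmul_dual_smul N h, RingHom.id_apply, Finset.smul_sum]
    exact Finset.sum_congr rfl fun j _ => by rw [Ind.smul_tmul]

lemma unit_apply (m : N) :
    τ.unit N h m = ∑ j, Ind.tmul φ (τ.dual j) (τ.basis j • m) := rfl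

lemma counit_unit (m : N) : τ.counit N (τ.unit N h m) = m := by
  rw [unit_apply, map_sum]
  simp only [counit_tmul, h, ← mul_smul]
  rw [← Finset.sum_smul]
  have := τ.sum_left 1
  simp only [one_mul] at this
  rw [this, one_smul]

lemma map_unit {N' : Type u} [AddCommGroup N'] [Module R N'] [Module S N']
    (h' : ∀ (r : R) (m : N'), r • m = φ r • m) (f : N →ₗ[S] N') (f' : N →ₗ[R] N')
    (hf : ∀ m, f' m = f m) (m : N) : Ind.map φ f' (τ.unit N h m) = τ.unit N' h' (f m) := by
  rw [unit_apply, unit_apply, map_sum]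
  exact Finset.sum_congr rfl fun j _ => by rw [Ind.map_tmul, hf, map_smul]

lemma map_counit_unit (M : Type u) [AddCommGroup M] [Module R M] [Module R (Ind φ M)]
    (h : ∀ (r : R) (x : Ind φ M), r • x = φ r • x) (f : Ind φ M →ₗ[R] M)
    (hf : ∀ x, f x = τ.counit M x) (x : Ind φ M) :
    Ind.map φ f (τ.unit (Ind φ M) h x) = x := by
  induction x using Ind.induction_on with
  | h0 => simp
  | ha x y hx hy => rw [map_add, map_add, hx, hy]
  | ht s m =>
    rw [unit_apply, map_sum]
    conv_rhs => rw [← τ.sum_right s]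
    change _ = Ind.mk φ M (_ ⊗ₜ _)
    rw [TensorProduct.sum_tmul, map_sum]
    refine Finset.sum_congr rfl fun j _ => ?_
    rw [Ind.map_tmul, hf, Ind.smul_tmul, counit_tmul, ← Ind.tmul_mul]
    rfl

end Unit

end FrobeniusForm

variable {k : Type u} [Field k] {R S : Type u} [Ring R] [Ring S] [Algebra k R] [Algebra k S]
  [Module.Finite k S] (φ : R →ₐ[k] S) {J : Type*} [Fintype J]

/-- Restriction is left adjoint to induction for a Frobenius extension. -/
def resIndAdj (τ : FrobeniusForm (φ : R →+* S) J) : resFunctor φ ⊣ indFunctor (φ : R →+* S) where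
  unit :=
    { app := fun M =>
        letI : Module R M := Module.compHom M (φ : R →+* S)
        FGModuleCat.ofHom (τ.unit M fun _ _ => rfl)
      naturality := fun M N f =>
        letI : Module R M := Module.compHom M (φ : R →+* S)
        letI : Module R N := Module.compHom N (φ : R →+* S)
        FGModuleCat.hom_ext (LinearMap.ext fun m => (τ.map_unit M (fun _ _ => rfl)
          (fun _ _ => rfl) f.hom.hom ((resFunctor φ).map f).hom.hom (fun _ => rfl) m).symm) }
  counit :=
    { app := fun M => ObjectProperty.homMk (ModuleCat.ofHom
        (X := (ModuleCat.restrictScalars (φ : R →+* S)).obj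
          (ModuleCat.of S (Ind (φ : R →+* S) M)))
        { toFun := τ.counit M
          map_add' := map_add _
          map_smul' := τ.counit_smul M })
      naturality := fun M _ f => FGModuleCat.hom_ext (LinearMap.ext fun x =>
        τ.counit_map M f.hom.hom x) }
  left_triangle_components M :=
    letI : Module R M := Module.compHom M (φ : R →+* S)
    FGModuleCat.hom_ext (LinearMap.ext fun m => τ.counit_unit M (fun _ _ => rfl) m)
  right_triangle_components M :=
    letI : Module R (Ind (φ : R →+* S) M) := Module.compHom _ (φ : R →+* S)
    FGModuleCat.hom_ext (LinearMap.ext fun x => τ.map_counit_unit M (fun _ _ => rfl) _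
      (fun _ => rfl) x)

/-- If all the extensions `B_i → B_{i+1}` are Frobenius, then `F` is left adjoint to `E`. -/
def MinCat.adjOfFrobenius (p : Param k) (n : ℕ) {J : ℕ → Type*} [∀ i, Fintype (J i)]
    (τ : ∀ i, FrobeniusForm (B.incl p n i : B p n i →+* B p n (i + 1)) (J i)) :
    MinCat.F p n ⊣ MinCat.E p n where
  unit :=
    { app := fun M => fun
        | 0 => 0
        | i + 1 => (resIndAdj (B.incl p n i) (τ i)).unit.app (M (i + 1))
      naturality := fun _ _ f => funext fun
        | 0 => FGModuleCat.hom_ext (LinearMap.ext fun _ => rfl)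
        | i + 1 => (resIndAdj (B.incl p n i) (τ i)).unit.naturality (f (i + 1)) }
  counit :=
    { app := fun M i => (resIndAdj (B.incl p n i) (τ i)).counit.app (M i)
      naturality := fun _ _ f => funext fun i =>
        (resIndAdj (B.incl p n i) (τ i)).counit.naturality (f i) }
  left_triangle_components M := funext fun i =>
    (resIndAdj (B.incl p n i) (τ i)).left_triangle_components (M (i + 1))
  right_triangle_components M := funext fun
    | 0 => hom_ext_punit _ _
    | i + 1 => (resIndAdj (B.incl p n i) (τ i)).right_triangle_components (M i)

end FrobeniusAdjunction

end SlTwo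

namespace SlTwo

/-! ### The relations in the minimal categorification -/

section MinimalRelations

variable {k : Type u} [Field k] {p : Param k} {n : ℕ}

namespace B

/-- In degrees at most `n` the relation is inherited from `H̄_n`, and in higher degrees the ring is
zero. The same dichotomy gives the other relations. -/
lemma T_sq (i : ℕ) : T p n i * T p n i = (p.q - 1) • T p n i + p.q • (1 : B p n (i + 2)) := by
  by_cases hi : i + 2 ≤ n
  · apply valHom_injective hi
    rw [map_mul, map_add, map_smul, map_smul, map_one, valHom_T]
    exact (HBar.isHecke p n).quad i hi
  · have := subsingleton (p := p) (n := n) (i := i + 2) (by omega)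
    exact Subsingleton.elim _ _

lemma T_braid (i : ℕ) : incl p n (i + 2) (T p n i) * T p n (i + 1) * incl p n (i + 2) (T p n i) =
    T p n (i + 1) * incl p n (i + 2) (T p n i) * T p n (i + 1) := by
  by_cases hi : i + 3 ≤ n
  · apply valHom_injective hi
    simp only [map_mul, valHom_incl, valHom_T]
    exact (HBar.isHecke p n).braid i hi
  · have := subsingleton (p := p) (n := n) (i := i + 3) (by omega)
    exact Subsingleton.elim _ _

lemma T_X_T (hq : p.q ≠ 1) (i : ℕ) :
    T p n i * incl p n (i + 1) (X p n i) * T p n i = p.q • X p n (i + 1) := by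
  by_cases hi : i + 2 ≤ n
  · apply valHom_injective hi
    simp only [map_mul, map_smul, valHom_incl, valHom_T, valHom_X]
    exact (HBar.isHecke p n).affine hq i hi
  · have := subsingleton (p := p) (n := n) (i := i + 2) (by omega)
    exact Subsingleton.elim _ _

lemma T_X_T_degenerate (hq : p.q = 1) (i : ℕ) :
    T p n i * incl p n (i + 1) (X p n i) * T p n i = X p n (i + 1) - T p n i := by
  have h1 : X p n (i + 1) * T p n i = T p n i * incl p n (i + 1) (X p n i) + 1 := by
    by_cases hi : i + 2 ≤ n
    · apply valHom_injective hi
      simp only [map_mul, map_add, map_one, valHom_incl, valHom_T, valHom_X]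
      exact (HBar.isHecke p n).affine_degenerate hq i hi
    · have := subsingleton (p := p) (n := n) (i := i + 2) (by omega)
      exact Subsingleton.elim _ _
  have h2 := T_sq (p := p) (n := n) i
  rw [hq, sub_self, zero_smul, one_smul, zero_add] at h2
  rw [eq_sub_of_add_eq h1.symm, sub_mul, mul_assoc, h2, mul_one, one_mul]

lemma X_sub_pow (i : ℕ) : (X p n i - p.a • (1 : B p n (i + 1))) ^ n = 0 := by
  by_cases hi : i + 1 ≤ n
  · apply valHom_injective hi
    rw [map_pow, map_sub, map_smul, map_one, map_zero, valHom_X]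
    exact HBar.nilX_pow hi
  · have := subsingleton (p := p) (n := n) (i := i + 1) (by omega)
    exact Subsingleton.elim _ _

end B

lemma min_hom_ext {M N : MinCat p n} {f g : M ⟶ N} (h : ∀ i (m : M i), f i m = g i m) : f = g :=
  funext fun i => FGModuleCat.hom_ext (LinearMap.ext (h i))

lemma min_map_smul {M N : MinCat p n} (f : M ⟶ N) {i : ℕ} (b : B p n i) (m : M i) :
    f i (b • m) = b • f i m := (f i).hom.hom.map_smul b m

lemma min_map_add {M N : MinCat p n} (f : M ⟶ N) {i : ℕ} (m m' : M i) :
    f i (m + m') = f i m + f i m' := (f i).hom.hom.map_add m m'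

lemma min_map_zero {M N : MinCat p n} (f : M ⟶ N) {i : ℕ} : f i (0 : M i) = 0 :=
  (f i).hom.hom.map_zero

lemma min_comp_apply {L M N : MinCat p n} (f : L ⟶ M) (g : M ⟶ N) {i : ℕ} (m : L i) :
    (f ≫ g) i m = g i (f i m) := rfl

lemma min_id_apply {M : MinCat p n} {i : ℕ} (m : M i) : (𝟙 M : M ⟶ M) i m = m := rfl

lemma min_add_apply {M N : MinCat p n} (f g : M ⟶ N) {i : ℕ} (m : M i) :
    (f + g) i m = f i m + g i m := rfl

lemma min_sub_apply {M N : MinCat p n} (f g : M ⟶ N) {i : ℕ} (m : M i) :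
    (f - g) i m = f i m - g i m := rfl

lemma min_zero_apply {M N : MinCat p n} {i : ℕ} (m : M i) : (0 : M ⟶ N) i m = 0 := rfl

lemma min_smul_apply {M N : MinCat p n} (c : k) (f : M ⟶ N) {i : ℕ} (m : M i) :
    (c • f) i m = algebraMap k (B p n i) c • f i m := rfl

lemma oneTmul_zero (M : MinCat p n) (i : ℕ) : M.oneTmul i 0 = 0 :=
  map_zero (Ind.unit (B.incl p n i : B p n i →+* B p n (i + 1)))

/-- The elements `1 ⊗ m` generate `E M`. Together with the versions for `E²` and `E³`, this reduces
the axioms for `X` and `T` to relations in the algebras `B_i`. -/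
lemma E_hom_ext {M Y : MinCat p n} {f g : (minimal p n).E.obj M ⟶ Y}
    (h : ∀ i m, f (i + 1) (M.oneTmul i m) = g (i + 1) (M.oneTmul i m)) : f = g := by
  refine min_hom_ext fun i y => ?_
  cases i with
  | zero =>
    have : y = 0 := Subsingleton.elim (α := PUnit) _ _
    rw [this, min_map_zero, min_map_zero]
  | succ i =>
    induction y using E_induction with
    | one m => exact h i m
    | smul b x hx => rw [min_map_smul, min_map_smul, hx]
    | add x y hx hy => rw [min_map_add, min_map_add, hx, hy]

lemma E_E_hom_ext {M Y : MinCat p n} {f g : (minimal p n).E.obj ((minimal p n).E.obj M) ⟶ Y}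
    (h : ∀ i m, f (i + 2) (((minimal p n).E.obj M).oneTmul (i + 1) (M.oneTmul i m)) =
      g (i + 2) (((minimal p n).E.obj M).oneTmul (i + 1) (M.oneTmul i m))) : f = g := by
  refine E_hom_ext fun i y => ?_
  cases i with
  | zero =>
    have h1 : y = (0 : B p n 0) • y := Subsingleton.elim (α := PUnit) _ _
    rw [h1, oneTmul_smul, map_zero, zero_smul, min_map_zero, min_map_zero]
  | succ i =>
    induction y using E_induction with
    | one m => exact h i m
    | smul b x hx => rw [oneTmul_smul, min_map_smul, min_map_smul, hx]
    | add x y hx hy => rw [oneTmul_add, min_map_add, min_map_add, hx, hy]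

lemma E_E_E_hom_ext {M Y : MinCat p n}
    {f g : (minimal p n).E.obj ((minimal p n).E.obj ((minimal p n).E.obj M)) ⟶ Y}
    (h : ∀ i m, f (i + 3) (((minimal p n).E.obj ((minimal p n).E.obj M)).oneTmul (i + 2)
        (((minimal p n).E.obj M).oneTmul (i + 1) (M.oneTmul i m))) =
      g (i + 3) (((minimal p n).E.obj ((minimal p n).E.obj M)).oneTmul (i + 2)
        (((minimal p n).E.obj M).oneTmul (i + 1) (M.oneTmul i m)))) : f = g := by
  refine E_E_hom_ext fun i y => ?_
  cases i with
  | zero =>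
    have h1 : y = (0 : B p n 0) • y := Subsingleton.elim (α := PUnit) _ _
    rw [h1, oneTmul_smul, map_zero, zero_smul, oneTmul_zero, min_map_zero, min_map_zero]
  | succ i =>
    induction y using E_induction with
    | one m => exact h i m
    | smul b x hx => rw [oneTmul_smul, oneTmul_smul, min_map_smul, min_map_smul, hx]
    | add x y hx hy => rw [oneTmul_add, oneTmul_add, min_map_add, min_map_add, hx, hy]

instance minimal_E_additive : (minimal p n).E.Additive where
  map_add {M N f g} := E_hom_ext fun i m => by
    rw [min_add_apply, E_map_oneTmul, E_map_oneTmul, E_map_oneTmul, min_add_apply, oneTmul_add]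

instance minimal_F_additive : (minimal p n).F.Additive where
  map_add := rfl

instance minimal_E_linear : (minimal p n).E.Linear k where
  map_smul {M N} f c := E_hom_ext fun i m => by
    rw [min_smul_apply, E_map_oneTmul, E_map_oneTmul, min_smul_apply, oneTmul_smul,
      AlgHom.commutes]

instance minimal_F_linear : (minimal p n).F.Linear k where
  map_smul {M N} f c := min_hom_ext fun i m => by
    refine (congrArg (fun b : B p n (i + 1) => b • f (i + 1) m) ?_)
    exact ((B.incl p n i).commutes c).symm

namespace minimal

lemma braid (M : MinCat p n) :
    (minimal p n).E.map ((minimal p n).t M) ≫ (minimal p n).t ((minimal p n).E.obj M) ≫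
        (minimal p n).E.map ((minimal p n).t M) =
      (minimal p n).t ((minimal p n).E.obj M) ≫ (minimal p n).E.map ((minimal p n).t M) ≫
        (minimal p n).t ((minimal p n).E.obj M) := E_E_E_hom_ext fun i m => by
  simp only [min_comp_apply, E_map_oneTmul, t_oneTmul, oneTmul_smul, min_map_smul, ← mul_smul]
  rw [← mul_assoc, B.T_braid, mul_assoc]

lemma quad (M : MinCat p n) : ((minimal p n).t M + 𝟙 _) ≫ ((minimal p n).t M - p.q • 𝟙 _) = 0 :=
  E_E_hom_ext fun i m => by
    simp only [min_comp_apply, min_add_apply, min_sub_apply, min_smul_apply, t_oneTmul,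
      min_map_smul, min_id_apply, min_map_add, min_zero_apply, ← mul_smul, ← add_smul, ← sub_smul]
    have h1 : B.T p n i * (B.T p n i - algebraMap k (B p n (i + 2)) p.q) +
        (B.T p n i - algebraMap k (B p n (i + 2)) p.q) = 0 := by
      rw [mul_sub, B.T_sq, Algebra.algebraMap_eq_smul_one, mul_smul_comm, mul_one]
      module
    rw [h1, zero_smul]

lemma affine (hq : p.q ≠ 1) (M : MinCat p n) :
    (minimal p n).t M ≫ (minimal p n).E.map ((minimal p n).x M) ≫ (minimal p n).t M =
      p.q • (minimal p n).x ((minimal p n).E.obj M) := E_E_hom_ext fun i m => by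
  simp only [min_comp_apply, min_smul_apply, t_oneTmul, E_map_oneTmul, x_oneTmul, oneTmul_smul,
    min_map_smul, ← mul_smul]
  rw [← mul_assoc, B.T_X_T hq, Algebra.smul_def]

lemma affine_degenerate (hq : p.q = 1) (M : MinCat p n) :
    (minimal p n).t M ≫ (minimal p n).E.map ((minimal p n).x M) ≫ (minimal p n).t M =
      (minimal p n).x ((minimal p n).E.obj M) - (minimal p n).t M := E_E_hom_ext fun i m => by
  simp only [min_comp_apply, min_sub_apply, t_oneTmul, E_map_oneTmul, x_oneTmul, oneTmul_smul,
    min_map_smul, ← mul_smul, ← sub_smul]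
  rw [← mul_assoc, B.T_X_T_degenerate hq]

/-- On `1 ⊗ m`, the endomorphism acts through the element `X_{i+1} - a` of `B_{i+1}`, whose `n`-th
power vanishes in every degree. -/
lemma nilpotent (M : MinCat p n) :
    (End.of ((minimal p n).x M - p.a • 𝟙 _)) ^ n = 0 := by
  have key : ∀ N : ℕ, ∃ g : (minimal p n).E.obj M ⟶ (minimal p n).E.obj M,
      (End.of ((minimal p n).x M - p.a • 𝟙 _)) ^ N = End.of g ∧ ∀ i (m : M i),
        g (i + 1) (M.oneTmul i m) =
          (B.X p n i - p.a • (1 : B p n (i + 1))) ^ N • M.oneTmul i m := fun N => by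
    induction N with
    | zero => exact ⟨𝟙 _, pow_zero _, fun i m => by rw [pow_zero, one_smul]; rfl⟩
    | succ N ih =>
      obtain ⟨g, h1, h2⟩ := ih
      refine ⟨g ≫ ((minimal p n).x M - p.a • 𝟙 _), by rw [pow_succ', h1]; rfl, fun i m => ?_⟩
      rw [min_comp_apply, h2, min_map_smul, min_sub_apply, min_smul_apply, x_oneTmul,
        min_id_apply, ← sub_smul, pow_succ, mul_smul, Algebra.algebraMap_eq_smul_one]
  obtain ⟨g, h1, h2⟩ := key n
  rw [h1]
  refine E_hom_ext fun i m => (h2 i m).trans ?_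
  rw [B.X_sub_pow, zero_smul]
  rfl

end minimal

end MinimalRelations

end SlTwo

namespace SlTwo

/-! ### Dimensions -/

section Dimension

variable (k : Type u) [Field k] (A : Type u) [Ring A] [Algebra k A]

/-- The vector space underlying a module over a `k`-algebra. -/
abbrev scalarModule (M : Type*) [AddCommGroup M] [Module A M] : Module k M :=
  Module.compHom M (algebraMap k A)

lemma scalarModule_isScalarTower (M : Type*) [AddCommGroup M] [Module A M] :
    letI := scalarModule k A M
    IsScalarTower k A M :=
  letI := scalarModule k A M
  ⟨fun c a m => by rw [Algebra.smul_def, mul_smul]; rfl⟩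

lemma scalarModule_finite [Module.Finite k A] (M : Type*) [AddCommGroup M] [Module A M]
    [Module.Finite A M] :
    letI := scalarModule k A M
    Module.Finite k M :=
  letI := scalarModule k A M
  have := scalarModule_isScalarTower k A M
  Module.Finite.trans A M

/-- The dimension of a module over a `k`-algebra. -/
def fdim (M : Type*) [AddCommGroup M] [Module A M] : ℕ :=
  letI := scalarModule k A M
  Module.finrank k M

variable {k A}

lemma fdim_eq_add [Module.Finite k A] {N M Q : Type*} [AddCommGroup N] [Module A N]
    [AddCommGroup M] [Module A M] [Module.Finite A M] [AddCommGroup Q] [Module A Q]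
    {f : N →ₗ[A] M} {g : M →ₗ[A] Q} (hf : Function.Injective f) (hg : Function.Surjective g)
    (hfg : ∀ x, g x = 0 ↔ ∃ y, f y = x) : fdim k A M = fdim k A N + fdim k A Q := by
  let _ := scalarModule k A M
  let _ := scalarModule k A N
  let _ := scalarModule k A Q
  have := scalarModule_isScalarTower k A M
  have := scalarModule_isScalarTower k A N
  have := scalarModule_isScalarTower k A Q
  have := scalarModule_finite k A M
  have h1 := (g.restrictScalars k).finrank_range_add_finrank_ker
  have h2 : LinearMap.ker (g.restrictScalars k) = LinearMap.range (f.restrictScalars k) := by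
    ext x
    exact hfg x
  have h3 : LinearMap.range (g.restrictScalars k) = ⊤ := LinearMap.range_eq_top.2 hg
  rw [h3, finrank_top, h2, LinearMap.finrank_range_of_inj (f := f.restrictScalars k) hf] at h1
  change Module.finrank k M = Module.finrank k N + Module.finrank k Q
  omega

lemma fdim_eq_zero_iff [Module.Finite k A] {M : Type*} [AddCommGroup M] [Module A M]
    [Module.Finite A M] : fdim k A M = 0 ↔ Subsingleton M := by
  let _ := scalarModule k A M
  have := scalarModule_finite k A M
  exact Module.finrank_zero_iff

end Dimension

/-! ### Exactness for finitely generated modules -/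

section FG

variable {A : Type u} [Ring A]

lemma FG_hom_ext_one {M : FGModuleCat.{u} A} {f g : FGModuleCat.of A A ⟶ M} (h : f (1 : A) = g (1 : A)) :
    f = g := FGModuleCat.hom_ext (LinearMap.ext_ring h)

/-- The morphism `A → M` given by an element of `M`. -/
def elemHom (M : FGModuleCat.{u} A) (m : M) : FGModuleCat.of A A ⟶ M :=
  FGModuleCat.ofHom (LinearMap.toSpanSingleton A M m)

lemma elemHom_one (M : FGModuleCat.{u} A) (m : M) : elemHom M m (1 : A) = m := one_smul A m

lemma FG_injective_of_mono {M N : FGModuleCat.{u} A} (f : M ⟶ N) [Mono f] :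
    Function.Injective f := fun x y h => by
  have h1 : elemHom M x ≫ f = elemHom M y ≫ f := FG_hom_ext_one (by
    change f (elemHom M x (1 : A)) = f (elemHom M y (1 : A))
    rw [elemHom_one, elemHom_one, h])
  have h2 := (cancel_mono f).1 h1
  rw [← elemHom_one M x, h2, elemHom_one]

lemma FG_surjective_of_epi {M N : FGModuleCat.{u} A} (f : M ⟶ N) [Epi f] :
    Function.Surjective f := by
  let q : N ⟶ FGModuleCat.of A (N ⧸ LinearMap.range f.hom.hom) :=
    FGModuleCat.ofHom (LinearMap.range f.hom.hom).mkQ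
  let z : N ⟶ FGModuleCat.of A (N ⧸ LinearMap.range f.hom.hom) := FGModuleCat.ofHom 0
  have h1 : f ≫ q = f ≫ z := FGModuleCat.hom_ext (LinearMap.ext fun x =>
    (Submodule.Quotient.mk_eq_zero _).2 ⟨x, rfl⟩)
  have h2 := (cancel_epi f).1 h1
  intro y
  have h3 : q y = z y := by rw [h2]
  exact (Submodule.Quotient.mk_eq_zero _).1 h3

/-- Elements of a module are morphisms from the regular module, so exactness in the category can be
tested on elements. -/
lemma IsSES.exact_FG [IsNoetherianRing A] {L M N : FGModuleCat.{u} A} {f : L ⟶ M} {g : M ⟶ N}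
    (h : IsSES f g) : Function.Injective f ∧ Function.Surjective g ∧
      ∀ x, g x = 0 ↔ ∃ y, f y = x := by
  have := h.mono
  have := h.epi
  refine ⟨FG_injective_of_mono f, FG_surjective_of_epi g, fun x => ⟨fun hx => ?_, ?_⟩⟩
  · have h1 : elemHom M x ≫ g = 0 := FG_hom_ext_one (by
      change g (elemHom M x (1 : A)) = 0
      rw [elemHom_one, hx])
    obtain ⟨w, hw⟩ := h.lift _ h1
    refine ⟨w (1 : A), ?_⟩
    rw [← elemHom_one M x, ← hw]
    rfl
  · rintro ⟨y, rfl⟩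
    have := congrArg (fun t => t.hom.hom y) h.zero
    exact this

end FG

/-! ### Dimension vectors and finite length in `𝒜(n)` -/

section MinDim

variable {k : Type u} [Field k] {p : Param k} {n : ℕ}

/-- The componentwise kernels of `g` form an object of the product category, and by exactness there
this object lifts through `f`. Its component in degree `i` gives exactness in that degree. -/
lemma isSES_pi {L M N : MinCat p n} {f : L ⟶ M} {g : M ⟶ N} (h : IsSES f g) (i : ℕ) :
    IsSES (f i) (g i) := by
  have := h.mono
  have := h.epi
  have := pi_mono f i
  have := pi_epi g i
  refine IsSES.of_refinements (congrFun h.zero i) fun Z y hy => ?_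
  let κ : (fun j => kernel (g j)) ⟶ M := fun j => kernel.ι (g j)
  obtain ⟨w, hw⟩ := h.lift κ (funext fun j => kernel.condition (g j))
  refine ⟨Z, 𝟙 Z, inferInstance, kernel.lift (g i) y hy ≫ w i, ?_⟩
  have h1 : w i ≫ f i = kernel.ι (g i) := congrFun hw i
  rw [Category.assoc, h1, kernel.lift_ι, Category.id_comp]

/-- The dimension of the component of degree `i`. -/
def mdim (M : MinCat p n) (i : ℕ) : ℕ := fdim k (B p n i) (M i)

lemma mdim_eq_add {L M N : MinCat p n} {f : L ⟶ M} {g : M ⟶ N} (h : IsSES f g) (i : ℕ) :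
    mdim M i = mdim L i + mdim N i := by
  obtain ⟨h1, h2, h3⟩ := (isSES_pi h i).exact_FG
  exact fdim_eq_add (k := k) (f := (f i).hom.hom) (g := (g i).hom.hom) h1 h2 h3

lemma mdim_of_lt (M : MinCat p n) {i : ℕ} (hi : n < i) : mdim M i = 0 :=
  fdim_eq_zero_iff.2 ⟨fun x y => by rw [subsingleton_of_lt M hi x, subsingleton_of_lt M hi y]⟩

lemma min_isZero_iff {M : MinCat p n} : IsZero M ↔ ∀ i, Subsingleton (M i) := by
  rw [IsZero.iff_id_eq_zero]
  constructor
  · intro h i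
    refine ⟨fun x y => ?_⟩
    have h1 : ∀ z : M i, z = 0 := fun z => by
      have := congrArg (fun t : M ⟶ M => t i z) h
      exact this
    rw [h1 x, h1 y]
  · intro h
    exact min_hom_ext fun i m => Subsingleton.elim _ _

lemma min_isZero_iff_mdim {M : MinCat p n} : IsZero M ↔ ∀ i ≤ n, mdim M i = 0 := by
  rw [min_isZero_iff]
  refine ⟨fun h i _ => fdim_eq_zero_iff.2 (h i), fun h i => ?_⟩
  by_cases hi : i ≤ n
  · exact fdim_eq_zero_iff.1 (h i hi)
  · exact fdim_eq_zero_iff.1 (mdim_of_lt M (by omega))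

/-- The dimension of an object of `𝒜(n)`. -/
def tdim (M : MinCat p n) : ℕ := ∑ i ∈ Finset.range (n + 1), mdim M i

lemma tdim_eq_add {L M N : MinCat p n} {f : L ⟶ M} {g : M ⟶ N} (h : IsSES f g) :
    tdim M = tdim L + tdim N := by
  rw [tdim, tdim, tdim, ← Finset.sum_add_distrib]
  exact Finset.sum_congr rfl fun i _ => mdim_eq_add h i

lemma isIso_of_tdim_le {M N : MinCat p n} (f : M ⟶ N) [Mono f] (h : tdim N ≤ tdim M) :
    IsIso f := by
  have h1 := tdim_eq_add (IsSES.cokernel f)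
  have h2 : tdim (cokernel f) = 0 := by omega
  have h3 : IsZero (cokernel f) := min_isZero_iff_mdim.2 fun i hi =>
    Finset.sum_eq_zero_iff.1 h2 i (Finset.mem_range.2 (by omega))
  have : Epi f := Preadditive.epi_of_cokernel_zero (h3.eq_of_tgt _ _)
  exact isIso_of_mono_of_epi f

/-- An inclusion of subobjects of equal total dimension is an isomorphism. Both chain conditions
then come from the natural numbers. -/
lemma tdim_strictMono (M : MinCat p n) : StrictMono fun K : Subobject M => tdim (K : MinCat p n) := by
  intro K L hKL
  by_contra! hle
  have := isIso_of_tdim_le (Subobject.ofLE K L hKL.le) hle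
  have h1 : L ≤ K := by
    refine Subobject.le_of_comm (inv (Subobject.ofLE K L hKL.le)) ?_
    rw [IsIso.inv_comp_eq, Subobject.ofLE_arrow]
  exact absurd (le_antisymm hKL.le h1) hKL.ne

lemma tdim_subobject_le {M : MinCat p n} (K : Subobject M) : tdim (K : MinCat p n) ≤ tdim M := by
  have := tdim_eq_add (IsSES.cokernel K.arrow)
  omega

instance min_finiteLength : FiniteLength (MinCat p n) where
  artinian M := by
    rw [isArtinianObject_iff_not_strictAnti]
    intro f hf
    exact not_strictAnti_of_wellFoundedLT _ ((tdim_strictMono M).comp_strictAnti hf)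
  noetherian M := by
    rw [isNoetherianObject_iff_not_strictMono]
    intro f hf
    have h1 := ((tdim_strictMono M).comp hf).le_apply (x := tdim M + 1)
    have h2 := tdim_subobject_le (f (tdim M + 1))
    simp only [Function.comp_apply] at h1
    omega

end MinDim

end SlTwo

namespace SlTwo

/-! ### Simple objects of the minimal categorification -/

section MinSimple

variable {k : Type u} [Field k] {p : Param k} {n : ℕ}

/-- The subobject given by a family of submodules. -/
def subObj (M : MinCat p n) (W : ∀ i, Submodule (B p n i) (M i)) : MinCat p n := fun i =>
  FGModuleCat.of (B p n i) (W i)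

/-- The inclusion of a subobject given by a family of submodules. -/
def subObjι (M : MinCat p n) (W : ∀ i, Submodule (B p n i) (M i)) : subObj M W ⟶ M := fun i =>
  FGModuleCat.ofHom (W i).subtype

instance (M : MinCat p n) (W : ∀ i, Submodule (B p n i) (M i)) : Mono (subObjι M W) :=
  ⟨fun _ _ e => min_hom_ext fun i m => Subtype.ext (by
    have := congrArg (fun t => t i m) e
    exact this)⟩

lemma min_simple_sub {S : MinCat p n} (hS : Simple S) (W : ∀ i, Submodule (B p n i) (S i)) :
    (∀ i, W i = ⊥) ∨ ∀ i, W i = ⊤ := by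
  by_cases h : subObjι S W = 0
  · refine Or.inl fun i => (Submodule.eq_bot_iff _).2 fun x hx => ?_
    have := congrArg (fun t => t i (⟨x, hx⟩ : W i)) h
    exact this
  · refine Or.inr fun i => ?_
    have := isIso_of_mono_of_nonzero h
    rw [eq_top_iff]
    intro x _
    have h1 := congrArg (fun t => t i x) (IsIso.inv_hom_id (subObjι S W))
    obtain ⟨y, hy⟩ : ∃ y : W i, (y : S i) = x := ⟨inv (subObjι S W) i x, h1⟩
    rw [← hy]
    exact y.2

/-- A simple object is concentrated in one degree, and is a simple module there. -/
lemma min_simple_structure {S : MinCat p n} (hS : Simple S) :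
    ∃ j ≤ n, IsSimpleModule (B p n j) (S j) ∧ ∀ i, i ≠ j → Subsingleton (S i) := by
  obtain ⟨j, hj⟩ : ∃ j, ¬ Subsingleton (S j) := by
    by_contra! h
    exact Simple.not_isZero S (min_isZero_iff.2 h)
  have hn : j ≤ n := by
    by_contra! hlt
    exact hj ⟨fun x y => by rw [subsingleton_of_lt S hlt x, subsingleton_of_lt S hlt y]⟩
  have : Nontrivial (S j) := not_subsingleton_iff_nontrivial.1 hj
  refine ⟨j, hn, ?_, fun i hi => ?_⟩
  · refine (isSimpleModule_iff _ _).2 { eq_bot_or_eq_top := fun W => ?_ }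
    rcases min_simple_sub hS (Function.update (fun _ => ⊥) j W) with h | h
    · exact Or.inl (by simpa using h j)
    · exact Or.inr (by simpa using h j)
  -- The component of degree `j` is a nonzero subobject, hence everything.
  · rcases min_simple_sub hS (Function.update (fun _ => ⊥) j ⊤) with h | h
    · have := h j
      rw [Function.update_self] at this
      exact absurd this top_ne_bot
    · have := h i
      rw [Function.update_of_ne hi] at this
      exact (Submodule.subsingleton_iff (B p n i)).1 (subsingleton_of_bot_eq_top this)

lemma mdim_simple {S : MinCat p n} {j : ℕ} (hj : j ≤ n) [IsSimpleModule (B p n j) (S j)] :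
    mdim S j = j.factorial := by
  let _ := scalarModule k (B p n j) (S j)
  have := scalarModule_isScalarTower k (B p n j) (S j)
  have := scalarModule_finite k (B p n j) (S j)
  exact (B.isNilHecke (p := p) hj).finrank_simple (k := k) (N := S j) (B.nilSub_eq_top hj)
    fun l hl => B.nilX_pow hj hl

lemma min_end_simple {S : MinCat p n} (hS : Simple S) :
    Function.Bijective fun c : k => c • 𝟙 S := by
  obtain ⟨j, hj, hs, h0⟩ := min_simple_structure hS
  let _ := scalarModule k (B p n j) (S j)
  have := scalarModule_isScalarTower k (B p n j) (S j)
  have := scalarModule_finite k (B p n j) (S j)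
  refine ⟨fun c c' h => ?_, fun φ => ?_⟩
  · have h1 : (c - c') • 𝟙 S = 0 := by rw [sub_smul]; exact sub_eq_zero.2 h
    by_contra hne
    have h2 : 𝟙 S = 0 := by
      rw [← inv_smul_smul₀ (sub_ne_zero.2 hne) (𝟙 S), h1, smul_zero]
    exact Simple.not_isZero S ((IsZero.iff_id_eq_zero S).2 h2)
  · obtain ⟨c, hc⟩ := (B.isNilHecke (p := p) hj).end_simple (k := k) (N := S j) (B.nilSub_eq_top hj)
      (fun l hl => B.nilX_pow hj hl) (φ j).hom.hom
    refine ⟨c, min_hom_ext fun i m => ?_⟩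
    by_cases hi : i = j
    · subst hi
      exact (hc m).symm
    · have := h0 i hi
      exact Subsingleton.elim _ _

/-- Simple objects in the same degree are isomorphic. -/
lemma min_simple_iso {S S' : MinCat p n} {j : ℕ} (hj : j ≤ n)
    (hs : IsSimpleModule (B p n j) (S j)) (h0 : ∀ i, i ≠ j → Subsingleton (S i))
    (hs' : IsSimpleModule (B p n j) (S' j)) (h0' : ∀ i, i ≠ j → Subsingleton (S' i)) :
    Nonempty (S ≅ S') := by
  let _ := scalarModule k (B p n j) (S j)
  have := scalarModule_isScalarTower k (B p n j) (S j)
  have := scalarModule_finite k (B p n j) (S j)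
  let _ := scalarModule k (B p n j) (S' j)
  have := scalarModule_isScalarTower k (B p n j) (S' j)
  have := scalarModule_finite k (B p n j) (S' j)
  obtain ⟨e⟩ := (B.isNilHecke (p := p) hj).nonempty_linearEquiv_simple (k := k) (N := S j) (N' := S' j)
    (B.nilSub_eq_top hj) (fun l hl => B.nilX_pow hj hl)
  have hex : ∀ i, Nonempty (S i ≃ₗ[B p n i] S' i) := fun i => by
    by_cases hi : i = j
    · subst hi
      exact ⟨e⟩
    · have := h0 i hi
      have := h0' i hi
      exact ⟨0⟩
  let w : ∀ i, S i ≃ₗ[B p n i] S' i := fun i => (hex i).some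
  exact ⟨{  hom := fun i => FGModuleCat.ofHom (w i).toLinearMap
            inv := fun i => FGModuleCat.ofHom (w i).symm.toLinearMap
            hom_inv_id := min_hom_ext fun i m => (w i).symm_apply_apply m
            inv_hom_id := min_hom_ext fun i m => (w i).apply_symm_apply m }⟩

/-- The functional on `ℚ ⊗ K₀` given by the dimension of a component. -/
lemma exists_mdim_hom (p : Param k) (n : ℕ) (j : ℕ) :
    ∃ d : K0Q (MinCat p n) →ₗ[ℚ] ℚ, ∀ M, d (cls M) = mdim M j :=
  ⟨K0Q.lift (fun M => (mdim M j : ℚ)) fun h => by rw [mdim_eq_add h j]; push_cast; rfl,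
    fun M => K0Q.lift_cls _ _ M⟩

/-- Elements of `ℚ ⊗ K₀` are determined by the dimensions of the components. -/
lemma K0Q_min_eq_zero {d : ℕ → K0Q (MinCat p n) →ₗ[ℚ] ℚ} (hd : ∀ j M, d j (cls M) = mdim M j)
    {v : K0Q (MinCat p n)} (hv : ∀ j ≤ n, d j v = 0) : v = 0 := by
  classical
  -- Up to the factor `1 / j!`, the inverse of its dimension, this is the class of the simple object
  -- of degree `j`. The claim becomes `[M] = ∑ (dim M_j) t_j`, which only has to be checked on
  -- simple objects. The default `0` occurs only if no simple object has degree `j`.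
  let t : ℕ → K0Q (MinCat p n) := fun j =>
    if h : ∃ S : MinCat p n, IsSimpleModule (B p n j) (S j) ∧ ∀ i, i ≠ j → Subsingleton (S i)
    then (j.factorial : ℚ)⁻¹ • cls h.choose else 0
  let Φ : K0Q (MinCat p n) →ₗ[ℚ] K0Q (MinCat p n) :=
    ∑ j ∈ Finset.range (n + 1), (d j).smulRight (t j)
  have hΦ : ∀ v, Φ v = ∑ j ∈ Finset.range (n + 1), d j v • t j := fun v => by
    simp [Φ]
  have key : Φ = LinearMap.id := K0Q.hom_ext fun M => by
    induction M using finite_length_induction with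
    | h0 M hM => rw [cls_of_isZero hM, map_zero, map_zero]
    | h M hM ih =>
      obtain ⟨S, hS, f, hf⟩ := exists_simple_mono hM
      rw [cls_eq_add (IsSES.cokernel f), map_add, map_add, ih f _ hS (IsSES.cokernel f)]
      congr 1
      obtain ⟨j, hj, hs, h0⟩ := min_simple_structure hS
      have hex : ∃ S : MinCat p n, IsSimpleModule (B p n j) (S j) ∧
        ∀ i, i ≠ j → Subsingleton (S i) := ⟨S, hs, h0⟩
      obtain ⟨e⟩ := min_simple_iso hj hs h0 hex.choose_spec.1 hex.choose_spec.2
      rw [hΦ, Finset.sum_eq_single j]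
      · rw [hd, mdim_simple hj, LinearMap.id_apply, cls_eq_of_iso e]
        change _ • (if h : _ then _ else _) = _
        rw [dif_pos hex, smul_smul, mul_inv_cancel₀ (by positivity), one_smul]
      · intro i _ hi
        have := h0 i hi
        rw [hd, mdim, fdim_eq_zero_iff.2 this, Nat.cast_zero, zero_smul]
      · intro h
        exact absurd (Finset.mem_range.2 (by omega)) h
  have h1 := hΦ v
  rw [key, LinearMap.id_apply] at h1
  rw [h1]
  exact Finset.sum_eq_zero fun j hj => by
    rw [hv j (by have := Finset.mem_range.1 hj; omega), zero_smul]

end MinSimple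

end SlTwo

namespace SlTwo

/-! ### Dimensions of induced and restricted modules -/

section FdimInd

variable {k : Type u} [Field k] {R S : Type u} [Ring R] [Ring S] [Algebra k R] [Algebra k S]
  [Module.Finite k R] (φ : R →ₐ[k] S) {J : Type*} [Fintype J]

/-- A basis of `S` as a right `R`-module splits `S ⊗_R M` into copies of `M`. The coordinates are
right `R`-linear, so evaluation at them shows that the copies are independent. -/
lemma fdim_ind {b : J → S} (hb : ∀ y, ∃! c : J → R, ∑ j, b j * φ (c j) = y)
    (M : Type u) [AddCommGroup M] [Module R M] [Module.Finite R M] :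
    fdim k S (Ind (φ : R →+* S) M) = Fintype.card J * fdim k R M := by
  classical
  choose c hc hcu using hb
  have hcu' : ∀ y c', ∑ j, b j * φ (c' j) = y → c' = c y := fun y c' h => hcu y c' h
  have hadd : ∀ y z, c (y + z) = c y + c z := fun y z => (hcu' _ _ (by
    simp only [Pi.add_apply, map_add, mul_add, Finset.sum_add_distrib]
    exact congrArg₂ (· + ·) (hc y) (hc z))).symm
  let χ : J → S →+ R := fun j => AddMonoidHom.mk' (fun y => c y j) fun y z => by rw [hadd]; rfl
  have hχ : ∀ j s r, χ j (s * (φ : R →+* S) r) = χ j s * r := fun j s r => by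
    have h1 : (fun l => c s l * r) = c (s * φ r) := hcu' _ _ (by
      simp only [map_mul, ← mul_assoc]
      rw [← Finset.sum_mul]
      exact congrArg (· * φ r) (hc s))
    exact (congrFun h1 j).symm
  have hχb : ∀ j l, χ j (b l) = if j = l then 1 else 0 := fun j l => by
    have h1 : (fun j => if j = l then (1 : R) else 0) = c (b l) := hcu' _ _ (by
      rw [Finset.sum_eq_single l]
      · simp
      · intro i _ hi
        simp [hi]
      · simp)
    exact (congrFun h1 j).symm
  let _ := scalarModule k R M
  let _ := scalarModule k S (Ind (φ : R →+* S) M)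
  have := scalarModule_finite k R M
  let Φ : (J → M) →ₗ[k] Ind (φ : R →+* S) M :=
    { toFun := fun m => ∑ j, Ind.tmul (φ : R →+* S) (b j) (m j)
      map_add' := fun m m' => by
        simp only [Pi.add_apply, Ind.tmul_add, Finset.sum_add_distrib]
      map_smul' := fun r m => by
        change _ = algebraMap k S r • (∑ j, Ind.tmul (φ : R →+* S) (b j) (m j))
        rw [Finset.smul_sum]
        refine Finset.sum_congr rfl fun j _ => ?_
        change Ind.tmul (φ : R →+* S) (b j) (algebraMap k R r • m j) = _
        rw [← Ind.tmul_mul, Ind.smul_tmul, Algebra.commutes]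
        exact congrArg (fun t => Ind.tmul (φ : R →+* S) (b j * t) (m j)) (φ.commutes r) }
  have hΦ : ∀ m, Φ m = ∑ j, Ind.tmul (φ : R →+* S) (b j) (m j) := fun _ => rfl
  have hbij : Function.Bijective Φ := by
    constructor
    · rw [injective_iff_map_eq_zero]
      intro m hm
      funext j
      have h1 := congrArg (Ind.eval (χ j) (hχ j) M) hm
      rw [hΦ, map_sum, map_zero] at h1
      simp only [Ind.eval_tmul, hχb, ite_smul, one_smul, zero_smul, Finset.sum_ite_eq,
        Finset.mem_univ, if_true] at h1
      exact h1
    · intro x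
      induction x using Ind.induction_on with
      | h0 => exact ⟨0, map_zero _⟩
      | ht s m =>
        refine ⟨fun j => c s j • m, ?_⟩
        rw [hΦ]
        simp only [← Ind.tmul_mul]
        conv_rhs => rw [← hc s]
        change _ = Ind.mk (φ : R →+* S) M (_ ⊗ₜ _)
        rw [TensorProduct.sum_tmul, map_sum]
        rfl
      | ha x y hx hy =>
        obtain ⟨m, rfl⟩ := hx
        obtain ⟨m', rfl⟩ := hy
        exact ⟨m + m', map_add _ _ _⟩
  have h1 := (LinearEquiv.ofBijective Φ hbij).finrank_eq
  rw [Module.finrank_pi_fintype, Finset.sum_const, Finset.card_univ, smul_eq_mul] at h1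
  exact h1.symm

end FdimInd

section MinIndRes

variable {k : Type u} [Field k] {p : Param k} {n : ℕ}

lemma mdim_E_zero (M : MinCat p n) : mdim ((MinCat.E p n).obj M) 0 = 0 :=
  fdim_eq_zero_iff.2 (inferInstanceAs (Subsingleton PUnit))

lemma mdim_E_succ [Nontrivial (HBar p n)] (M : MinCat p n) {i : ℕ} (hi : i < n) :
    mdim ((MinCat.E p n).obj M) (i + 1) = (i + 1) * (n - i) * mdim M i := by
  obtain ⟨b, hb⟩ := B.exists_right_basis (p := p) hi
  have := fdim_ind (B.incl p n i) hb (M i)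
  rw [Fintype.card_prod, Fintype.card_fin, Fintype.card_fin] at this
  exact this

lemma mdim_F (M : MinCat p n) (i : ℕ) : mdim ((MinCat.F p n).obj M) i = mdim M (i + 1) := by
  have h : ∀ (c : k) (m : M (i + 1)),
      B.incl p n i (algebraMap k _ c) • m = algebraMap k (B p n (i + 1)) c • m := fun c m => by
    rw [AlgHom.commutes]
  let N := ((MinCat.F p n).obj M) i
  let _ := scalarModule k (B p n i) N
  let _ := scalarModule k (B p n (i + 1)) (M (i + 1))
  exact LinearEquiv.finrank_eq (R := k) (M := N) (N := M (i + 1))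
    { toFun := fun m => m
      invFun := fun m => m
      left_inv := fun _ => rfl
      right_inv := fun _ => rfl
      map_add' := fun _ _ => rfl
      map_smul' := fun c m => h c m }

end MinIndRes

end SlTwo

namespace SlTwo

/-! ### The minimal categorification is an `sl₂`-categorification -/

lemma IsSES.map {C : Type u} [Category.{v} C] [Abelian C] {C' : Type u'} [Category.{v'} C']
    [Abelian C'] (R : C ⥤ C') [R.Additive] [PreservesFiniteLimits R] [PreservesFiniteColimits R]
    {A M Q : C} {f : A ⟶ M} {g : M ⟶ Q} (h : IsSES f g) : IsSES (R.map f) (R.map g) :=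
  ⟨by rw [← R.map_comp, h.zero, R.map_zero], h.shortExact.map_of_exact R⟩

/-- The endomorphism of `ℚ ⊗ K₀` given by an exact functor. -/
lemma exists_class_hom {C : Type u} [Category.{v} C] [Abelian C] (R : C ⥤ C) [R.Additive]
    [PreservesFiniteLimits R] [PreservesFiniteColimits R] :
    ∃ e : K0Q C →ₗ[ℚ] K0Q C, ∀ M, e (cls M) = cls (R.obj M) :=
  ⟨K0Q.lift (fun M => cls (R.obj M)) fun h => cls_eq_add (h.map R), fun M => K0Q.lift_cls _ _ M⟩

section MinimalAction

variable {k : Type u} [Field k] {p : Param k} {n : ℕ}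

/-- An element of `ℚ ⊗ K₀` is determined by the dimensions of its components. On these `f` is a
shift, `e` is the opposite shift with the factors `(i + 1)(n - i)`, and `h` acts by `2 j - n` in
degree `j`. The space is finite-dimensional, so it serves as the only summand. -/
lemma minimal.sl2_action [Nontrivial (HBar p n)]
    [PreservesFiniteLimits (MinCat.E p n)] [PreservesFiniteColimits (MinCat.E p n)]
    [PreservesFiniteLimits (MinCat.F p n)] [PreservesFiniteColimits (MinCat.F p n)] :
    ∃ e f h : K0Q (MinCat p n) →ₗ[ℚ] K0Q (MinCat p n),
      (∀ M, e (cls M) = cls ((MinCat.E p n).obj M)) ∧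
      (∀ M, f (cls M) = cls ((MinCat.F p n).obj M)) ∧
      e ∘ₗ f - f ∘ₗ e = h ∧
      h ∘ₗ e - e ∘ₗ h = (2 : ℚ) • e ∧
      h ∘ₗ f - f ∘ₗ h = -((2 : ℚ) • f) ∧
      (∃ S : Set (Submodule ℚ (K0Q (MinCat p n))),
        (∀ W ∈ S, FiniteDimensional ℚ W ∧ W ≤ W.comap e ∧ W ≤ W.comap f) ∧
        sSupIndep S ∧ sSup S = ⊤) ∧
      ∀ S : MinCat p n, Simple S → ∃ c : ℤ, h (cls S) = (c : ℚ) • cls S := by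
  have : (MinCat.E p n).Additive := minimal_E_additive
  have : (MinCat.F p n).Additive := minimal_F_additive
  obtain ⟨e, he⟩ := exists_class_hom (MinCat.E p n)
  obtain ⟨f, hf⟩ := exists_class_hom (MinCat.F p n)
  choose d hd using exists_mdim_hom p n
  have hde0 : ∀ v, d 0 (e v) = 0 := fun v => by
    have : d 0 ∘ₗ e = 0 := K0Q.hom_ext fun M => by
      rw [LinearMap.comp_apply, he, hd, mdim_E_zero, Nat.cast_zero, LinearMap.zero_apply]
    exact LinearMap.congr_fun this v
  have hde : ∀ i < n, ∀ v, d (i + 1) (e v) = (i + 1) * (n - i) * d i v := fun i hi v => by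
    have : d (i + 1) ∘ₗ e = ((i + 1) * (n - i) : ℚ) • d i := K0Q.hom_ext fun M => by
      rw [LinearMap.comp_apply, he, hd, mdim_E_succ M hi, LinearMap.smul_apply, hd]
      push_cast [Nat.cast_sub hi.le]
      rfl
    exact LinearMap.congr_fun this v
  have hdf : ∀ i v, d i (f v) = d (i + 1) v := fun i v => by
    have : d i ∘ₗ f = d (i + 1) := K0Q.hom_ext fun M => by
      rw [LinearMap.comp_apply, hf, hd, mdim_F, hd]
    exact LinearMap.congr_fun this v
  have hdn : ∀ v, d (n + 1) v = 0 := fun v => by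
    have : d (n + 1) = 0 := K0Q.hom_ext fun M => by
      rw [hd, mdim_of_lt M (Nat.lt_succ_self n), Nat.cast_zero, LinearMap.zero_apply]
    exact LinearMap.congr_fun this v
  have hef : ∀ j ≤ n, ∀ v, d j (e (f v)) = j * (n - j + 1) * d j v := fun j hj v => by
    cases j with
    | zero => rw [hde0]; simp
    | succ i => rw [hde i (by omega), hdf]; push_cast; ring
  have hfe : ∀ j ≤ n, ∀ v, d j (f (e v)) = (j + 1) * (n - j) * d j v := fun j hj v => by
    rw [hdf]
    rcases hj.eq_or_lt with rfl | hj
    · rw [hdn]; ring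
    · rw [hde j hj]
  have hdh : ∀ j ≤ n, ∀ v, d j ((e ∘ₗ f - f ∘ₗ e) v) = (2 * j - n) * d j v := fun j hj v => by
    rw [LinearMap.sub_apply, map_sub, LinearMap.comp_apply, LinearMap.comp_apply, hef j hj,
      hfe j hj]
    ring
  generalize hh : e ∘ₗ f - f ∘ₗ e = h at hdh
  have hfin : FiniteDimensional ℚ (K0Q (MinCat p n)) := by
    refine FiniteDimensional.of_injective
      (LinearMap.pi fun j : Fin (n + 1) => d j : _ →ₗ[ℚ] (Fin (n + 1) → ℚ)) ?_
    rw [injective_iff_map_eq_zero]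
    exact fun v hv => K0Q_min_eq_zero hd fun j hj => congrFun hv ⟨j, Nat.lt_succ_of_le hj⟩
  refine ⟨e, f, h, he, hf, hh, ?_, ?_, ⟨{⊤}, ?_, sSupIndep_singleton _, sSup_singleton⟩, ?_⟩
  · refine LinearMap.ext fun v => sub_eq_zero.1 (K0Q_min_eq_zero hd fun j hj => ?_)
    rw [LinearMap.sub_apply, LinearMap.comp_apply, LinearMap.comp_apply, LinearMap.smul_apply,
      map_sub, map_sub, map_smul, hdh j hj, smul_eq_mul]
    cases j with
    | zero => rw [hde0, hde0]; ring
    | succ i =>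
      rw [hde i (by omega), hde i (by omega), hdh i (by omega)]
      push_cast
      ring
  · refine LinearMap.ext fun v => sub_eq_zero.1 (K0Q_min_eq_zero hd fun j hj => ?_)
    rw [LinearMap.sub_apply, LinearMap.comp_apply, LinearMap.comp_apply, LinearMap.neg_apply,
      LinearMap.smul_apply, map_sub, map_sub, map_neg, map_smul, hdh j hj, smul_eq_mul, hdf, hdf]
    rcases hj.eq_or_lt with rfl | hj
    · rw [hdn, hdn]; ring
    · rw [hdh (j + 1) hj]
      push_cast
      ring
  · rintro W rfl
    exact ⟨inferInstance, fun _ _ => trivial, fun _ _ => trivial⟩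
  · intro S hS
    obtain ⟨j, hj, -, h0⟩ := min_simple_structure hS
    refine ⟨2 * j - n, sub_eq_zero.1 (K0Q_min_eq_zero hd fun i hi => ?_)⟩
    rw [map_sub, map_smul, hdh i hi, smul_eq_mul]
    by_cases hij : i = j
    · subst hij
      push_cast
      ring
    · have := h0 i hij
      rw [hd, mdim, fdim_eq_zero_iff.2 this, Nat.cast_zero]
      ring

/-- `𝒜(n)` is an `sl₂`-categorification if `H̄_n ≠ 0` and `F` is left adjoint to `E`. -/
theorem minimal.isSl2Categorification [Nontrivial (HBar p n)]
    (adj : MinCat.F p n ⊣ MinCat.E p n) : (minimal p n).IsSl2Categorification := by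
  -- Both functors have adjoints on both sides, which gives exactness.
  have : PreservesFiniteLimits (MinCat.E p n) :=
    have := adj.rightAdjoint_preservesLimits
    inferInstance
  have : PreservesFiniteColimits (MinCat.E p n) :=
    have := (MinCat.adj p n).leftAdjoint_preservesColimits
    inferInstance
  have : PreservesFiniteLimits (MinCat.F p n) :=
    have := (MinCat.adj p n).rightAdjoint_preservesLimits
    inferInstance
  have : PreservesFiniteColimits (MinCat.F p n) :=
    have := adj.leftAdjoint_preservesColimits
    inferInstance
  exact
    { noetherian := min_finiteLength.noetherian
      artinian := min_finiteLength.artinian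
      end_simple := fun _ hS => min_end_simple hS
      additive_E := inferInstance
      additive_F := inferInstance
      linear_E := inferInstance
      linear_F := inferInstance
      left_exact_E := ‹PreservesFiniteLimits (MinCat.E p n)›
      right_exact_E := ‹PreservesFiniteColimits (MinCat.E p n)›
      left_exact_F := ‹PreservesFiniteLimits (MinCat.F p n)›
      right_exact_F := ‹PreservesFiniteColimits (MinCat.F p n)›
      left_adj := ⟨adj⟩
      sl2_action := minimal.sl2_action
      braid := minimal.braid
      quad := minimal.quad
      affine := minimal.affine
      affine_degenerate := minimal.affine_degenerate
      nilpotent := fun M => ⟨n, minimal.nilpotent M⟩ }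

end MinimalAction

end SlTwo

end

theorem theorem4p3p4 {k : Type u} [Field k] {C : Type u'} [Category.{v} C] [Abelian C]
    [Linear k C] (D : Sl2Data k C) (hD : D.IsSl2Categorification)
    (U : C) (hU : Simple U) (hFU : IsZero (D.F.obj U)) (n : ℕ) (hn : D.HPlus U n) :
    (minimal D.param n).IsSl2Categorification ∧
    ∃ ρ : ∀ i : ℕ, B D.param n i →ₐ[k] (End (D.iter U i))ᵐᵒᵖ,
      D.IsHeckeAction U n ρ ∧
      ∃ G : ∀ i : ℕ, TensorFunctor (ρ i),
        (∀ i < n, ∃ φ : (G i).functor.obj (B.res D.param n i) ≅ D.F.obj (D.iter U (i + 1)),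
          ∀ b : B D.param n (i + 1), (G i).ι (B.res D.param n i) b.toRes ≫ φ.hom =
            D.η (D.iter U i) ≫ D.F.map (ρ (i + 1) b).unop.asHom) ∧
        ∃ (ζp : (minimal D.param n).E ⋙ sumFunctor G ≅ sumFunctor G ⋙ D.E)
          (ζm : (minimal D.param n).F ⋙ sumFunctor G ≅ sumFunctor G ⋙ D.F),
          (∀ (M : MinCat D.param n) (i : ℕ) (hi : i < n) (m : M i),
            sumι G ((minimal D.param n).E.obj M) (i + 1) hi (M.oneTmul i m) ≫ ζp.hom.app M =
              D.E.map (sumι G M i hi.le m)) ∧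
          (∀ (M : MinCat D.param n) (i : ℕ) (hi : i < n) (m : M (i + 1)),
            sumι G ((minimal D.param n).F.obj M) i hi.le (M.toRes i m) ≫ ζm.hom.app M =
              D.η (D.iter U i) ≫ D.F.map (sumι G M (i + 1) hi m)) ∧
          (minimal D.param n).IsMorphism D (sumFunctor G) ζp ζm := by
  have hL : D.IsLowest U n := ⟨hD.toIsWeak, hU, hFU, hn⟩
  have := hD.additive_E
  have := hD.linear_E
  have := hL.nontrivial_hBar hD
  obtain ⟨ρ, hρ, hb⟩ := hL.exists_heckeAction hD
  -- For `i ≥ n` the ring `B_{i+1}` is zero and so is the form. For `i < n` the form comes from the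
  -- given category, so `𝒜(n)` inherits its second adjunction from that of `𝒜`.
  let τ : ∀ i, FrobeniusForm (B.incl D.param n i : B D.param n i →+* B D.param n (i + 1))
      (Fin (i + 1) × Fin (n - i)) := fun i =>
    if hi : i < n then (hL.exists_frobeniusForm hD hρ hb hi).some
    else
      have : Subsingleton (B D.param n (i + 1)) := B.subsingleton (by omega)
      FrobeniusForm.ofSubsingleton _
  refine ⟨minimal.isSl2Categorification (MinCat.adjOfFrobenius D.param n τ), ρ, hρ, ?_⟩
  let G : ∀ i, TensorFunctor (ρ i) := fun i => (exists_tensorFunctor (ρ i)).some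
  have hG : Sl2Data.CanonicalIso G := fun i hi => hL.exists_canonical_iso hD hρ hb G hi
  obtain ⟨ζp, hp⟩ := hL.exists_zetaPlus G hρ
  obtain ⟨ζm, hm⟩ := Sl2Data.IsLowest.exists_zetaMinus hG hL hρ
  exact ⟨G, hG, ζp, ζm, hp, hm, hρ.isMorphism ζp ζm hp hm⟩
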